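/- Let $T>0$, let $\mathrm g\in\mathbb R$, and let $z(\alpha,t)$, $\alpha\in\mathbb R$, $t\in[0,T)$, be a family of simple regular curves in $\mathbb R^2$ ($\partial_\alpha z\neq 0$) which are either closed contours, $z(\alpha+2\pi,t)=z(\alpha,t)$, or periodic in the horizontal variable, $z(\alpha+2\pi,t)=z(\alpha,t)+(2\pi,0)$. In both cases no point is repeated except as forced by the closed case: $z(\alpha,t)=z(\beta,t)$ only if $\alpha-\beta\in2\pi\mathbb Z$. Suppose that the curve separates the plane into two disjoint open sets, $\mathbb R^2\setminus z(\mathbb R,t)=\Omega^1(t)\cup\Omega^2(t)$, with the normal $\partial_\alpha^\perp z=(-\partial_\alpha z_2,\partial_\alpha z_1)$ pointing into $\Omega^1(t)$, so that $z+s\,\partial_\alpha^\perp z\in\Omega^1(t)$ and $z-s\,\partial_\alpha^\perp z\in\Omega^2(t)$ for small $s>0$. Let $\varpi(\alpha,t)$ be real-valued and $2\pi$-periodic in $\alpha$. Assume $z\in C^1([0,T);C^3)$ and $\varpi\in C^1([0,T);C^2)$. Let $(\rho,v,p)$ be a weak solution in the whole plane of $$\rho_t+v\cdot\nabla\rho=0,\qquad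 \rho(v_t+v\cdot\nabla v)=-\nabla p-(0,\mathrm g\rho),\qquad \nabla\cdot v=0,$$ with initial data $\rho_0,v_0$; that is, $\rho$, $v$, $\rho v$, $\rho v_iv_j$, $p$ are locally integrable on $\mathbb R^2\times[0,T)$, $\rho_0$ and $\rho_0v_0$ are locally integrable on $\mathbb R^2$, and for all $\zeta,\chi\in C_c^\infty([0,T)\times\mathbb R^2)$ and all $\eta\in C_c^\infty([0,T)\times\mathbb R^2;\mathbb R^2)$ $$\int_0^T\!\!\int_{\mathbb R^2}\rho(\zeta_t+v\cdot\nabla\zeta)\,dx\,dt+\int_{\mathbb R^2}\rho_0(x)\zeta(x,0)\,dx=0,$$ $$\int_0^T\!\!\int_{\mathbb R^2}\big(\rho v\cdot(\eta_t+v\cdot\nabla\eta)+p\,\nabla\cdot\eta-(0,\mathrm g\rho)\cdot\eta\big)\,dx\,dt+\int_{\mathbb R^2}\rho_0(x)v_0(x)\cdot\eta(x,0)\,dx=0,$$ $$\int_0^T\!\!\int_{\mathbb R^2}v\cdot\nabla\chi\,dx\,dt=0.$$ Assume that $\rho=\rho^j$ in $\Omega^j(t)$, $j=1,2$, with constants $\rho^1\neq\rho^2$,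 and that the vorticity is concentrated on the curve, $\operatorname{curl}v=\varpi(\alpha,t)\,\delta(x-z(\alpha,t))$, in the sense of distributions: for all $\chi\in C_c^\infty([0,T)\times\mathbb R^2)$, $$\int_0^T\!\!\int_{\mathbb R^2}(v_1\partial_{x_2}\chi-v_2\partial_{x_1}\chi)\,dx\,dt=\int_0^T\!\!\int\varpi(\alpha,t)\,\chi(z(\alpha,t),t)\,d\alpha\,dt,$$ where $\alpha$ runs over $(-\pi,\pi]$ for a closed contour and over $\mathbb R$ for a periodic curve. Assume finally the condition at infinity under which $v$ is given by the Biot–Savart law, for almost every $t\in(0,T)$ (with limits taken outside null sets): for a closed contour, $v(x,t)\to0$ as $|x|\to\infty$; for a periodic curve, $v(\cdot,t)$ is $2\pi$-periodic in $x_1$ (almost everywhere) and there is a vector $V(t)$ with $v(x,t)\to V(t)$ as $x_2\to+\infty$ and $v(x,t)\to-V(t)$ as $x_2\to-\infty$, uniformly in $x_1$. Then the limit pressures from the two sides of the interface exist and agree: $$p^1(z(\alpha,t),t)=p^2(z(\alpha,t),t),$$ where $p^1(z(\alpha,t),t)=\lim_{s\to0^+}p(z+s\,\partial_\alpha^\perp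 z,t)$ and $p^2(z(\alpha,t),t)=\lim_{s\to0^+}p(z-s\,\partial_\alpha^\perp z,t)$ are the limits approaching the curve in the normal direction inside $\Omega^1(t)$ and $\Omega^2(t)$. Precisely: (a) $p$ coincides almost everywhere in $\mathbb R^2\times(0,T)$ with a function $q$ such that, for every $t\in(0,T)$, $q(\cdot,t)$ is continuous in $\Omega^1(t)$ and in $\Omega^2(t)$, and for every $\alpha$ its two normal limits at $z(\alpha,t)$ exist and are equal; (b) if $p$ itself is continuous in each of the regions $\{(x,t):0\le t<T,\ x\in\Omega^j(t)\}$, $j=1,2$, then for every $t\in[0,T)$ and every $\alpha$ the two normal limits of $p(\cdot,t)$ at $z(\alpha,t)$ exist and are equal. -/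

import Mathlib

open Set Filter MeasureTheory
open scoped Topology ContDiff

namespace TwoFluid

noncomputable section

/-- The plane, with coordinates `x = (x.1, x.2)`. Only its topology, its Lebesgue measure and
its coordinates are used below. -/
abbrev Plane := ℝ × ℝ

/-- Points `(x, t)` of space-time. -/
abbrev SpaceTime := Plane × ℝ

/-- `ℝ² × (0, T)`, the domain of integration of the weak formulation. -/
def slab (T : ℝ) : Set SpaceTime := univ ×ˢ Ioo 0 T

/-- `ℝ² × [0, T)`. -/
def slab₀ (T : ℝ) : Set SpaceTime := univ ×ˢ Ico 0 T

/-! ### Test functions and partial derivatives -/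

/-- Test functions in `C_c^∞([0,T) × ℝ²)`, as restrictions of smooth compactly supported functions
on `ℝ² × (-∞, T)`. They need not vanish at time `0`. -/
structure IsTest (T : ℝ) (ζ : SpaceTime → ℝ) : Prop where
  smooth : ContDiff ℝ ∞ ζ
  compact : HasCompactSupport ζ
  support : tsupport ζ ⊆ {q | q.2 < T}

/-- `∂ζ/∂x₁`. -/
def d₁ (ζ : SpaceTime → ℝ) (q : SpaceTime) : ℝ := fderiv ℝ ζ q ((1, 0), 0)

/-- `∂ζ/∂x₂`. -/
def d₂ (ζ : SpaceTime → ℝ) (q : SpaceTime) : ℝ := fderiv ℝ ζ q ((0, 1), 0)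

/-- `∂ζ/∂t`. -/
def dt (ζ : SpaceTime → ℝ) (q : SpaceTime) : ℝ := fderiv ℝ ζ q ((0, 0), 1)

/-! ### Weak solutions of the inhomogeneous incompressible Euler system -/

/-- `(ρ, v, p)` is a weak solution on `ℝ² × [0, T)`, with gravity constant `g` and initial data
`ρ₀`, `v₀`, of
`ρ_t + v·∇ρ = 0`, `ρ (v_t + v·∇v) = -∇p - (0, g ρ)`, `∇·v = 0`.
The local integrability conditions say that all the integrals make sense. -/
structure IsWeakSolution (g T : ℝ) (ρ : SpaceTime → ℝ) (v : SpaceTime → Plane)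
    (p : SpaceTime → ℝ) (ρ₀ : Plane → ℝ) (v₀ : Plane → Plane) : Prop where
  int_ρ : LocallyIntegrableOn ρ (slab₀ T)
  int_v : LocallyIntegrableOn v (slab₀ T)
  int_ρv : LocallyIntegrableOn (fun q => ρ q • v q) (slab₀ T)
  int_ρvv₁₁ : LocallyIntegrableOn (fun q => ρ q * ((v q).1 * (v q).1)) (slab₀ T)
  int_ρvv₁₂ : LocallyIntegrableOn (fun q => ρ q * ((v q).1 * (v q).2)) (slab₀ T)
  int_ρvv₂₂ : LocallyIntegrableOn (fun q => ρ q * ((v q).2 * (v q).2)) (slab₀ T)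
  int_p : LocallyIntegrableOn p (slab₀ T)
  int_ρ₀ : LocallyIntegrable ρ₀
  int_ρ₀v₀ : LocallyIntegrable (fun x => ρ₀ x • v₀ x)
  /-- Conservation of mass. -/
  mass : ∀ ζ : SpaceTime → ℝ, IsTest T ζ →
    (∫ q in slab T, ρ q * (dt ζ q + ((v q).1 * d₁ ζ q + (v q).2 * d₂ ζ q)))
      + ∫ x, ρ₀ x * ζ (x, 0) = 0
  /-- Balance of momentum, with the vector test function `η = (η₁, η₂)`. -/
  momentum : ∀ η₁ η₂ : SpaceTime → ℝ, IsTest T η₁ → IsTest T η₂ →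
    (∫ q in slab T,
        (ρ q * ((v q).1 * (dt η₁ q + ((v q).1 * d₁ η₁ q + (v q).2 * d₂ η₁ q))
              + (v q).2 * (dt η₂ q + ((v q).1 * d₁ η₂ q + (v q).2 * d₂ η₂ q)))
          + p q * (d₁ η₁ q + d₂ η₂ q) - g * ρ q * η₂ q))
      + ∫ x, ρ₀ x * ((v₀ x).1 * η₁ (x, 0) + (v₀ x).2 * η₂ (x, 0)) = 0
  /-- Incompressibility. -/
  div_free : ∀ χ : SpaceTime → ℝ, IsTest T χ →
    ∫ q in slab T, ((v q).1 * d₁ χ q + (v q).2 * d₂ χ q) = 0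

/-! ### The interface -/

/-- The two kinds of interface: a closed contour, `z(α + 2π, t) = z(α, t)`, and a curve that is
periodic in the horizontal variable, `z(α + 2π, t) = z(α, t) + (2π, 0)`. -/
inductive Geometry
  | closed
  | periodic

/-- Displacement of the curve when its parameter grows by `2π`. -/
def Geometry.shift : Geometry → Plane
  | .closed => 0
  | .periodic => (2 * Real.pi, 0)

/-- A set of parameters that runs through the whole curve exactly once. -/
def Geometry.params : Geometry → Set ℝ
  | .closed => Ioc (-Real.pi) Real.pi
  | .periodic => univ

/-- `f(α, t)` is of class `C¹([0, T); C^k)`: for `f` and for its time derivative `f'` (one-sided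
at `t = 0`), the `α`-derivatives of order at most `k` exist and are jointly continuous. -/
def IsC1Ck {E : Type*} [NormedAddCommGroup E] [NormedSpace ℝ E] (k : ℕ) (T : ℝ)
    (f : ℝ → ℝ → E) : Prop :=
  ∃ f' : ℝ → ℝ → E,
    (∀ α, ∀ t ∈ Ico 0 T, HasDerivWithinAt (fun s => f α s) (f' α t) (Ico 0 T) t) ∧
    (∀ t ∈ Ico 0 T, ContDiff ℝ k (fun α => f α t) ∧ ContDiff ℝ k (fun α => f' α t)) ∧
    ∀ i ≤ k,
      ContinuousOn (fun q : ℝ × ℝ => iteratedDeriv i (fun α => f α q.2) q.1)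
        (univ ×ˢ Ico 0 T) ∧
      ContinuousOn (fun q : ℝ × ℝ => iteratedDeriv i (fun α => f' α q.2) q.1)
        (univ ×ˢ Ico 0 T)

/-- The tangent vector `∂_α z(α, t)`. -/
def tangent (z : ℝ → ℝ → Plane) (α t : ℝ) : Plane := deriv (fun a => z a t) α

/-- The normal vector `∂_α^⊥ z = (-∂_α z₂, ∂_α z₁)`. -/
def normal (z : ℝ → ℝ → Plane) (α t : ℝ) : Plane := (-(tangent z α t).2, (tangent z α t).1)

/-- For each `t ∈ [0, T)`, `z(·, t)` is a simple regular curve of the given geometry, and it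
separates the plane into the open sets `Ω₁ t` and `Ω₂ t`; the normal `∂_α^⊥ z` points
into `Ω₁ t`. -/
structure IsInterface (G : Geometry) (T : ℝ) (z : ℝ → ℝ → Plane) (Ω₁ Ω₂ : ℝ → Set Plane) :
    Prop where
  period : ∀ t ∈ Ico 0 T, ∀ α, z (α + 2 * Real.pi) t = z α t + G.shift
  simple : ∀ t ∈ Ico 0 T, ∀ α β, z α t = z β t → ∃ k : ℤ, α = β + k * (2 * Real.pi)
  regular : ∀ t ∈ Ico 0 T, ∀ α, tangent z α t ≠ 0
  isOpen₁ : ∀ t ∈ Ico 0 T, IsOpen (Ω₁ t)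
  isOpen₂ : ∀ t ∈ Ico 0 T, IsOpen (Ω₂ t)
  disjoint : ∀ t ∈ Ico 0 T, Disjoint (Ω₁ t) (Ω₂ t)
  union : ∀ t ∈ Ico 0 T, Ω₁ t ∪ Ω₂ t = (range fun α => z α t)ᶜ
  side₁ : ∀ t ∈ Ico 0 T, ∀ α, ∀ᶠ s : ℝ in 𝓝[>] 0, z α t + s • normal z α t ∈ Ω₁ t
  side₂ : ∀ t ∈ Ico 0 T, ∀ α, ∀ᶠ s : ℝ in 𝓝[>] 0, z α t - s • normal z α t ∈ Ω₂ t

/-- The region of space-time, over `[0, T)`, that is filled by one of the fluids. -/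
def fluidRegion (T : ℝ) (Ω : ℝ → Set Plane) : Set SpaceTime := {q | q.2 ∈ Ico 0 T ∧ q.1 ∈ Ω q.2}

/-! ### The vorticity -/

/-- `curl v = ∂₁ v₂ - ∂₂ v₁` is, in the sense of distributions on `ℝ² × (0, T)`, the measure
`ϖ(α, t) δ(x - z(α, t))`. -/
def HasSheetVorticity (G : Geometry) (T : ℝ) (z : ℝ → ℝ → Plane) (ϖ : ℝ → ℝ → ℝ)
    (v : SpaceTime → Plane) : Prop :=
  ∀ χ : SpaceTime → ℝ, IsTest T χ →
    ∫ q in slab T, ((v q).1 * d₂ χ q - (v q).2 * d₁ χ q)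
      = ∫ t in Ioo 0 T, ∫ α in G.params, ϖ α t * χ (z α t, t)

/-- The condition at infinity under which the velocity is recovered from its vorticity by the
Biot-Savart law. For a closed contour: `v → 0` at infinity. For a periodic interface: `v` is
`2π`-periodic in `x₁` and has opposite limits for `x₂ → +∞` and `x₂ → -∞` (the contribution of the
mean of `ϖ`; both limits vanish if the mean does). As `v` is only defined almost everywhere, limits
are taken outside null sets, and at almost every time. -/
def FarField (T : ℝ) (v : SpaceTime → Plane) : Geometry → Prop
  | .closed => ∀ᵐ t ∂(volume.restrict (Ioo 0 T)),
      Tendsto (fun x : Plane => v (x, t)) (cocompact Plane ⊓ ae volume) (𝓝 0)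
  | .periodic => ∀ᵐ t ∂(volume.restrict (Ioo 0 T)),
      (∀ᵐ x : Plane, v (x + (2 * Real.pi, 0), t) = v (x, t)) ∧
      ∃ V : Plane,
        Tendsto (fun x : Plane => v (x, t)) (comap Prod.snd atTop ⊓ ae volume) (𝓝 V) ∧
        Tendsto (fun x : Plane => v (x, t)) (comap Prod.snd atBot ⊓ ae volume) (𝓝 (-V))

/-! ### Limits at the interface -/

/-- At the point `z(α, t)`, the limits `p¹` and `p²` of `p(·, t)` along the normal, from inside
`Ω₁ t` and from inside `Ω₂ t`, exist and are equal. -/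
def PressuresAgree (z : ℝ → ℝ → Plane) (p : SpaceTime → ℝ) (α t : ℝ) : Prop :=
  ∃ p₁ p₂ : ℝ,
    Tendsto (fun s : ℝ => p (z α t + s • normal z α t, t)) (𝓝[>] 0) (𝓝 p₁) ∧
    Tendsto (fun s : ℝ => p (z α t - s • normal z α t, t)) (𝓝[>] 0) (𝓝 p₂) ∧
    p₁ = p₂

end

end TwoFluid

open TwoFluid

/-!
The plane is identified with `ℂ`, so that away from the interface a divergence-free and curl-free
velocity is the conjugate of a holomorphic function `v₁ - i v₂`.

The velocity. For almost every time, the difference of `v₁ - i v₂` and of the Biot-Savart integral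
`Sheet.vel` of the sheet is weakly holomorphic in the whole plane. Its mollifications are entire, and
the condition at infinity forces them to vanish by Liouville's theorem. Hence the velocity is the
Biot-Savart integral almost everywhere (`Sheet.ae_cvel_eq`). Such an integral is smooth off the curve
and has one-sided limits at it (`Sheet.exists_limit`): near the singularity the density is compared
with a multiple of `∂_α z`, for which the integral is a logarithm.

The pressure in each fluid. The time derivative of `v₁ - i v₂` has a complex potential
`Sheet.accPot`, which comes from an integration by parts of `∂_t ϖ` along the curve and is again a
Cauchy integral over the sheet, up to a logarithm. The momentum equation then says that the sum of
the pressure and of the Bernoulli function `Sheet.bern` has no spatial gradient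
(`Sheet.weak_gradient`), so that locally in each fluid it is a function of time
(`exists_time_function`, `ae_eq_time_function`). Since the Bernoulli function has one-sided limits at
the curve, so has the pressure, up to the choice of that function of time at single instants. This is
what a `PressureChart` records.

The jump. The one-sided limits of the pressure agree (`Sheet.pressure_eq`). Around a point of the
interface space-time is dilated, in the frame of the tangent and the normal, and the equations are
tested with functions that concentrate at the point. In the limit, mass and incompressibility give
two linear equations for the fluxes of volume into the two fluids through the interface; since
`ρ₁ ≠ ρ₂`, they imply that both vanish. No mass crosses the interface, hence no momentum is carried
through it, gravity is of lower order, and the balance of momentum becomes `(p₁ - p₂) X = 0` with a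
vector `X` whose normal component is not zero. Only limits in the mean over cylinders at later times
are needed, which makes the argument work at Lebesgue points, and at time `0`.

For the version of the pressure, countably many charts cover space-time. At almost all times they are
compatible and the times are Lebesgue points of all functions of time involved
(`Sheet.exists_version`). If the pressure itself is continuous inside the fluids, then in a chart the
function of time is continuous up to time `0`, and every time can be treated
(`Sheet.exists_common_limit`).
-/

open Set Filter MeasureTheory
open scoped Topology ContDiff Interval Convolution

namespace TwoFluid

noncomputable section

/-! ### The Biot-Savart kernel -/

/-- The entire function whose logarithmic derivative is the Biot-Savart kernel: `w` for a closed
contour and `2 sin (w / 2)` for a periodic curve. It vanishes exactly on the lattice of periods. -/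
def sig : Geometry → ℂ → ℂ
  | .closed => fun w => w
  | .periodic => fun w => 2 * Complex.sin (w / 2)

/-- The (complex, conjugated) Biot-Savart kernel `1 / w`, respectively `cot (w / 2) / 2`, without its
factor `1 / (2πi)`. -/
def bsKer (G : Geometry) (w : ℂ) : ℂ := deriv (sig G) w / sig G w

/-- The entire function `sig w / w`. -/
def esig (G : Geometry) : ℂ → ℂ := dslope (sig G) 0

/-- The holomorphic part `esig' / esig` of the kernel at the origin. -/
def hker (G : Geometry) (w : ℂ) : ℂ := deriv (esig G) w / esig G w

theorem hasDerivAt_sig_periodic (w : ℂ) :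
    HasDerivAt (sig .periodic) (Complex.cos (w / 2)) w := by
  have h := ((Complex.hasDerivAt_sin (w / 2)).comp w ((hasDerivAt_id w).div_const 2)).const_mul 2
  refine (h.congr_deriv (by ring)).congr_of_eventuallyEq ?_
  exact Eventually.of_forall fun x => rfl

theorem deriv_sig_closed (w : ℂ) : deriv (sig .closed) w = 1 := (hasDerivAt_id w).deriv

theorem deriv_sig_periodic (w : ℂ) : deriv (sig .periodic) w = Complex.cos (w / 2) :=
  (hasDerivAt_sig_periodic w).deriv

theorem differentiable_sig (G : Geometry) : Differentiable ℂ (sig G) := by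
  cases G with
  | closed => exact differentiable_id
  | periodic => exact fun w => (hasDerivAt_sig_periodic w).differentiableAt

theorem hasDerivAt_sig (G : Geometry) (w : ℂ) : HasDerivAt (sig G) (deriv (sig G) w) w :=
  (differentiable_sig G w).hasDerivAt

theorem continuous_sig (G : Geometry) : Continuous (sig G) := (differentiable_sig G).continuous

theorem continuous_deriv_sig (G : Geometry) : Continuous (deriv (sig G)) := by
  have : ContDiff ℂ 1 (sig G) := (differentiable_sig G).contDiff
  exact this.continuous_deriv le_rfl

@[simp] theorem sig_zero (G : Geometry) : sig G 0 = 0 := by cases G <;> simp [sig]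

theorem deriv_sig_zero (G : Geometry) : deriv (sig G) 0 = 1 := by
  cases G
  · exact deriv_sig_closed 0
  · simp [deriv_sig_periodic]

theorem differentiable_esig (G : Geometry) : Differentiable ℂ (esig G) := by
  have h := (Complex.differentiableOn_dslope (s := univ) (c := 0) (f := sig G) univ_mem).2
    (differentiable_sig G).differentiableOn
  exact differentiableOn_univ.1 h

theorem sig_eq_mul_esig (G : Geometry) (w : ℂ) : sig G w = w * esig G w := by
  have := sub_smul_dslope (sig G) 0 w
  simpa [esig] using this.symm

theorem esig_zero (G : Geometry) : esig G 0 = 1 := by simp [esig, deriv_sig_zero]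

theorem continuous_esig (G : Geometry) : Continuous (esig G) := (differentiable_esig G).continuous

theorem continuousAt_hker {G : Geometry} {w : ℂ} (h : esig G w ≠ 0) : ContinuousAt (hker G) w := by
  have h1 : ContDiff ℂ 1 (esig G) := (differentiable_esig G).contDiff
  exact (h1.continuous_deriv le_rfl).continuousAt.div (continuous_esig G).continuousAt h

theorem differentiableAt_hker {G : Geometry} {w : ℂ} (h : esig G w ≠ 0) :
    DifferentiableAt ℂ (hker G) w := by
  have h1 : ContDiff ℂ 2 (esig G) := (differentiable_esig G).contDiff
  have h2 : Differentiable ℂ (deriv (esig G)) := h1.differentiable_deriv_two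
  exact (h2 w).div (differentiable_esig G w) h

/-- Off the other poles, the kernel is the Cauchy kernel plus a holomorphic function. -/
theorem bsKer_eq {G : Geometry} {w : ℂ} (h : sig G w ≠ 0) : bsKer G w = 1 / w + hker G w := by
  have hw : w ≠ 0 := fun h0 => h (by simp [h0])
  have he : esig G w ≠ 0 := fun h0 => h (by simp [sig_eq_mul_esig, h0])
  have hd : deriv (sig G) w = esig G w + w * deriv (esig G) w := by
    have h1 : sig G = fun w => w * esig G w := funext (sig_eq_mul_esig G)
    rw [h1]
    have h2 := (hasDerivAt_id w).fun_mul (differentiable_esig G w).hasDerivAt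
    simpa using h2.deriv
  rw [bsKer, hd, sig_eq_mul_esig, hker]
  field_simp

theorem differentiableAt_bsKer {G : Geometry} {w : ℂ} (h : sig G w ≠ 0) :
    DifferentiableAt ℂ (bsKer G) w := by
  have h1 : ContDiff ℂ 2 (sig G) := (differentiable_sig G).contDiff
  exact (h1.differentiable_deriv_two w).div (differentiable_sig G w) h

theorem isOpen_sig_ne (G : Geometry) : IsOpen {w | sig G w ≠ 0} :=
  isOpen_ne_fun (continuous_sig G) continuous_const

theorem continuousAt_bsKer {G : Geometry} {w : ℂ} (h : sig G w ≠ 0) : ContinuousAt (bsKer G) w :=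
  (differentiableAt_bsKer h).continuousAt

theorem continuousOn_deriv_bsKer (G : Geometry) : ContinuousOn (deriv (bsKer G)) {w | sig G w ≠ 0} :=
  (DifferentiableOn.deriv (fun _ hw => (differentiableAt_bsKer hw).differentiableWithinAt)
    (isOpen_sig_ne G)).continuousOn

theorem measurable_bsKer (G : Geometry) : Measurable (bsKer G) :=
  (continuous_deriv_sig G).measurable.div (continuous_sig G).measurable

theorem bsKer_closed (w : ℂ) : bsKer .closed w = 1 / w := by
  simp [bsKer, sig]

theorem bsKer_periodic (w : ℂ) :
    bsKer .periodic w = Complex.cos (w / 2) / (2 * Complex.sin (w / 2)) := by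
  rw [bsKer, deriv_sig_periodic]; rfl

/-- The displacement of the curve over a period, as a complex number. -/
def cshift : Geometry → ℂ
  | .closed => 0
  | .periodic => 2 * Real.pi

theorem sig_add_shift (G : Geometry) (w : ℂ) : sig G (w + cshift G) = sig G w ∨
    sig G (w + cshift G) = - sig G w := by
  cases G with
  | closed => simp [sig, cshift]
  | periodic =>
    right
    have : (w + 2 * Real.pi) / 2 = w / 2 + Real.pi := by ring
    simp [sig, cshift, this, Complex.sin_add_pi]

theorem bsKer_add_shift (G : Geometry) (w : ℂ) : bsKer G (w + cshift G) = bsKer G w := by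
  cases G with
  | closed => simp [cshift]
  | periodic =>
    have : (w + 2 * Real.pi) / 2 = w / 2 + Real.pi := by ring
    simp only [bsKer_periodic, cshift, this, Complex.sin_add_pi, Complex.cos_add_pi]
    rw [mul_neg, neg_div_neg_eq]

theorem bsKer_add_int_shift (G : Geometry) (w : ℂ) (n : ℤ) : bsKer G (w + n * cshift G) = bsKer G w := by
  have hp : Function.Periodic (bsKer G) (cshift G) := bsKer_add_shift G
  exact hp.int_mul n w

/-- Up to sign, `sig` is periodic, so that its zero set is. -/
theorem sig_add_int_shift_eq_zero (G : Geometry) (w : ℂ) (n : ℤ) :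
    sig G (w + n * cshift G) = 0 ↔ sig G w = 0 := by
  have hp : Function.Periodic (fun w => sig G w = 0) (cshift G) := fun w => by
    rcases sig_add_shift G w with h | h <;> simp [h]
  exact iff_of_eq (hp.int_mul n w)

theorem sig_eq_zero {G : Geometry} {w : ℂ} : sig G w = 0 ↔ ∃ n : ℤ, w = n * cshift G := by
  cases G with
  | closed => simp [sig, cshift]
  | periodic =>
    simp only [sig, cshift, mul_eq_zero, OfNat.ofNat_ne_zero, false_or, Complex.sin_eq_zero_iff]
    refine exists_congr fun n => ?_
    constructor <;> intro h
    · rw [div_eq_iff two_ne_zero] at h; rw [h]; ring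
    · rw [h]; ring

theorem esig_ne_zero_closed (w : ℂ) : esig .closed w ≠ 0 := by
  by_cases hw : w = 0
  · simp [hw, esig_zero]
  · have := sig_eq_mul_esig .closed w
    intro h
    rw [h, mul_zero] at this
    exact hw this

theorem esig_ne_zero {G : Geometry} {w : ℂ} (hw : |w.re| < 2 * Real.pi) : esig G w ≠ 0 := by
  by_cases h0 : w = 0
  · simp [h0, esig_zero]
  intro h
  have h1 : sig G w = 0 := by rw [sig_eq_mul_esig, h, mul_zero]
  cases G with
  | closed => exact h0 h1
  | periodic =>
    obtain ⟨n, hn⟩ := sig_eq_zero.1 h1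
    have hre : w.re = n * (2 * Real.pi) := by
      rw [hn]; simp [cshift]
    have hn0 : n ≠ 0 := by rintro rfl; apply h0; simpa using hn
    rw [hre, abs_mul, abs_of_pos Real.two_pi_pos] at hw
    have : (1 : ℝ) ≤ |(n : ℝ)| := by exact_mod_cast Int.one_le_abs hn0
    nlinarith [Real.two_pi_pos]

/-- The conjugate kernel in terms of the exponential: `cot (w / 2) / 2` tends to `-i / 2` in the
upper half plane. -/
theorem bsKer_periodic_eq (w : ℂ) : bsKer .periodic w =
    Complex.I / 2 * ((Complex.exp (Complex.I * w) + 1) / (Complex.exp (Complex.I * w) - 1)) := by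
  have h1 : Complex.exp (Complex.I * w) = Complex.exp (Complex.I * w / 2) * Complex.exp (Complex.I * w / 2) := by
    rw [← Complex.exp_add]; ring_nf
  have e0 := Complex.exp_ne_zero (Complex.I * w / 2)
  have hc : Complex.cos (w / 2) = (Complex.exp (Complex.I * w / 2) + (Complex.exp (Complex.I * w / 2))⁻¹) / 2 := by
    rw [Complex.cos, ← Complex.exp_neg]; ring_nf
  have hs : Complex.sin (w / 2) = ((Complex.exp (Complex.I * w / 2))⁻¹ - Complex.exp (Complex.I * w / 2)) * Complex.I / 2 := by
    rw [Complex.sin, ← Complex.exp_neg]; ring_nf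
  rw [bsKer_periodic, hc, hs, h1]
  set E := Complex.exp (Complex.I * w / 2)
  by_cases hE : E * E - 1 = 0
  · have : E⁻¹ - E = 0 := by
      field_simp
      linear_combination -hE
    simp [hE, this]
  · have h2 : E⁻¹ - E ≠ 0 := by
      intro h; apply hE; field_simp at h; linear_combination -h
    have hI := Complex.I_ne_zero
    have h3 : 1 - E ^ 2 ≠ 0 := fun h => hE (by linear_combination -h)
    have h4 : E ^ 2 - 1 ≠ 0 := fun h => hE (by linear_combination h)
    field_simp
    rw [Complex.I_sq]
    ring

theorem tendsto_bsKer_periodic_atTop :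
    Tendsto (bsKer .periodic) (comap Complex.im atTop) (𝓝 (-(Complex.I / 2))) := by
  have h : Tendsto (fun w : ℂ => Complex.exp (Complex.I * w)) (comap Complex.im atTop) (𝓝 0) := by
    rw [tendsto_zero_iff_norm_tendsto_zero]
    have : (fun w : ℂ => ‖Complex.exp (Complex.I * w)‖) = fun w => Real.exp (-w.im) := by
      funext w; simp [Complex.norm_exp]
    rw [this]
    exact Real.tendsto_exp_neg_atTop_nhds_zero.comp tendsto_comap
  have h2 := ((h.add_const 1).div (h.sub_const 1) (by norm_num)).const_mul (Complex.I / 2)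
  have h3 : Complex.I / 2 * ((0 + 1) / (0 - 1)) = -(Complex.I / 2) := by norm_num
  rw [h3] at h2
  exact h2.congr fun w => (bsKer_periodic_eq w).symm

theorem bsKer_neg (G : Geometry) (w : ℂ) : bsKer G (-w) = - bsKer G w := by
  cases G with
  | closed => rw [bsKer_closed, bsKer_closed, div_neg]
  | periodic => simp [bsKer_periodic, neg_div, div_neg]

theorem tendsto_bsKer_periodic_atBot :
    Tendsto (bsKer .periodic) (comap Complex.im atBot) (𝓝 (Complex.I / 2)) := by
  have h : Tendsto (fun w : ℂ => -w) (comap Complex.im atBot) (comap Complex.im atTop) := by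
    rw [tendsto_comap_iff]
    exact tendsto_neg_atBot_atTop.comp tendsto_comap
  have := (tendsto_bsKer_periodic_atTop.comp h).neg
  rw [neg_neg] at this
  exact this.congr fun w => by simp [bsKer_neg]

/-! ### The sheet in complex notation -/

/-- The plane as the complex plane. -/
def cx : Plane ≃L[ℝ] ℂ := Complex.equivRealProdCLM.symm

@[simp] theorem cx_re (x : Plane) : (cx x).re = x.1 := rfl

@[simp] theorem cx_im (x : Plane) : (cx x).im = x.2 := rfl

@[simp] theorem cx_symm_fst (w : ℂ) : (cx.symm w).1 = w.re := rfl

@[simp] theorem cx_symm_snd (w : ℂ) : (cx.symm w).2 = w.im := rfl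

theorem cx_mk (a b : ℝ) : cx (a, b) = a + b * Complex.I := by
  apply Complex.ext <;> simp

theorem cx_shift (G : Geometry) : cx G.shift = cshift G := by
  cases G
  · simp [Geometry.shift, cshift]
  · simp [Geometry.shift, cshift, cx_mk]

/-- A moving vortex sheet in complex notation, `z` being the curve and `w` its strength, together
with the derivatives that the argument uses: `zα`, `zαα`, `zt`, `ztα`, `wα`, `wt` stand for `∂_α z`,
`∂_α² z`, `∂_t z`, `∂_α ∂_t z`, `∂_α w`, `∂_t w`. Time derivatives are one-sided at `t = 0`. -/
structure Sheet (G : Geometry) (T : ℝ) where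
  z : ℝ → ℝ → ℂ
  zα : ℝ → ℝ → ℂ
  zαα : ℝ → ℝ → ℂ
  zt : ℝ → ℝ → ℂ
  ztα : ℝ → ℝ → ℂ
  w : ℝ → ℝ → ℝ
  wα : ℝ → ℝ → ℝ
  wt : ℝ → ℝ → ℝ
  hasDeriv_z : ∀ t ∈ Ico 0 T, ∀ α, HasDerivAt (fun a => z a t) (zα α t) α
  hasDeriv_zα : ∀ t ∈ Ico 0 T, ∀ α, HasDerivAt (fun a => zα a t) (zαα α t) α
  hasDeriv_zt : ∀ t ∈ Ico 0 T, ∀ α, HasDerivAt (fun a => zt a t) (ztα α t) α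
  hasDeriv_w : ∀ t ∈ Ico 0 T, ∀ α, HasDerivAt (fun a => w a t) (wα α t) α
  hasDerivT_z : ∀ t ∈ Ico 0 T, ∀ α, HasDerivWithinAt (fun s => z α s) (zt α t) (Ico 0 T) t
  hasDerivT_w : ∀ t ∈ Ico 0 T, ∀ α, HasDerivWithinAt (fun s => w α s) (wt α t) (Ico 0 T) t
  cont_z : ContinuousOn (fun q : ℝ × ℝ => z q.1 q.2) (univ ×ˢ Ico 0 T)
  cont_zα : ContinuousOn (fun q : ℝ × ℝ => zα q.1 q.2) (univ ×ˢ Ico 0 T)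
  cont_zαα : ContinuousOn (fun q : ℝ × ℝ => zαα q.1 q.2) (univ ×ˢ Ico 0 T)
  cont_zt : ContinuousOn (fun q : ℝ × ℝ => zt q.1 q.2) (univ ×ˢ Ico 0 T)
  cont_ztα : ContinuousOn (fun q : ℝ × ℝ => ztα q.1 q.2) (univ ×ˢ Ico 0 T)
  cont_w : ContinuousOn (fun q : ℝ × ℝ => w q.1 q.2) (univ ×ˢ Ico 0 T)
  cont_wα : ContinuousOn (fun q : ℝ × ℝ => wα q.1 q.2) (univ ×ˢ Ico 0 T)
  cont_wt : ContinuousOn (fun q : ℝ × ℝ => wt q.1 q.2) (univ ×ˢ Ico 0 T)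
  period : ∀ t ∈ Ico 0 T, ∀ α, z (α + 2 * Real.pi) t = z α t + cshift G
  simple : ∀ t ∈ Ico 0 T, ∀ α β, z α t = z β t → ∃ k : ℤ, α = β + k * (2 * Real.pi)
  regular : ∀ t ∈ Ico 0 T, ∀ α, zα α t ≠ 0
  w_period : ∀ t ∈ Ico 0 T, ∀ α, w (α + 2 * Real.pi) t = w α t

/-- The sign of a side of the interface: `true` is the side the normal points into. -/
def sg (b : Bool) : ℝ := if b then 1 else -1

theorem sg_mul_self (b : Bool) : sg b * sg b = 1 := by cases b <;> norm_num [sg]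

theorem abs_sg (b : Bool) : |sg b| = 1 := by cases b <;> norm_num [sg]

theorem sg_ne_zero (b : Bool) : sg b ≠ 0 := by cases b <;> norm_num [sg]

/-- The two sides `Ω true`, `Ω false` of a sheet, which carry the signs `1` and `-1` with respect
to the normal `i ∂_α z`. -/
structure Sides {G : Geometry} {T : ℝ} (S : Sheet G T) (Ω : Bool → ℝ → Set Plane) : Prop where
  isOpen : ∀ b, ∀ t ∈ Ico 0 T, IsOpen (Ω b t)
  disjoint : ∀ t ∈ Ico 0 T, Disjoint (Ω true t) (Ω false t)
  union : ∀ t ∈ Ico 0 T, ∀ x, (x ∈ Ω true t ∨ x ∈ Ω false t) ↔ ∀ α, cx x ≠ S.z α t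
  side : ∀ b, ∀ t ∈ Ico 0 T, ∀ α, ∀ᶠ s : ℝ in 𝓝[>] 0,
    cx.symm (S.z α t + (sg b * s : ℝ) * (Complex.I * S.zα α t)) ∈ Ω b t

theorem cx_normal (z : ℝ → ℝ → Plane) (α t : ℝ) :
    cx (normal z α t) = Complex.I * cx (tangent z α t) := by
  apply Complex.ext <;> simp [normal]

/-- The complex form of the data of the theorem. -/
theorem exists_sheet {G : Geometry} {T : ℝ} {z : ℝ → ℝ → Plane} {Ω₁ Ω₂ : ℝ → Set Plane}
    {ϖ : ℝ → ℝ → ℝ} (hz : IsC1Ck 3 T z) (hΩ : IsInterface G T z Ω₁ Ω₂)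
    (hϖ : IsC1Ck 2 T ϖ) (hϖ_per : ∀ t ∈ Ico 0 T, ∀ α, ϖ (α + 2 * Real.pi) t = ϖ α t) :
    ∃ S : Sheet G T, (∀ α t, S.z α t = cx (z α t)) ∧ (∀ α t, S.zα α t = cx (tangent z α t)) ∧
      (∀ α t, S.w α t = ϖ α t) ∧ Sides S (fun b => if b then Ω₁ else Ω₂) := by
  obtain ⟨z', hzt, hzs, hzc⟩ := hz
  obtain ⟨w', hwt, hws, hwc⟩ := hϖ
  have hcx : ∀ (f : ℝ → Plane) (f' : Plane) (a : ℝ), HasDerivAt f f' a →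
      HasDerivAt (fun s => cx (f s)) (cx f') a := fun f f' a h =>
    (cx.toContinuousLinearMap.hasFDerivAt.comp_hasDerivAt a h)
  have hcc : ∀ (f : ℝ × ℝ → Plane), ContinuousOn f (univ ×ˢ Ico 0 T) →
      ContinuousOn (fun q => cx (f q)) (univ ×ˢ Ico 0 T) := fun f h =>
    cx.continuous.comp_continuousOn h
  let S : Sheet G T :=
    { z := fun α t => cx (z α t)
      zα := fun α t => cx (tangent z α t)
      zαα := fun α t => cx (iteratedDeriv 2 (fun a => z a t) α)
      zt := fun α t => cx (z' α t)
      ztα := fun α t => cx (deriv (fun a => z' a t) α)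
      w := ϖ
      wα := fun α t => deriv (fun a => ϖ a t) α
      wt := w'
      hasDeriv_z := fun t ht α => hcx _ _ _
        ((hzs t ht).1.differentiable (by norm_num) α).hasDerivAt
      hasDeriv_zα := fun t ht α => by
        refine hcx _ _ _ ?_
        have h := (hzs t ht).1
        have h2 : Differentiable ℝ (iteratedDeriv 1 (fun a => z a t)) :=
          h.differentiable_iteratedDeriv 1 (by norm_num)
        rw [iteratedDeriv_succ]
        simp only [iteratedDeriv_one] at h2 ⊢
        exact (h2 α).hasDerivAt
      hasDeriv_zt := fun t ht α => hcx _ _ _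
        ((hzs t ht).2.differentiable (by norm_num) α).hasDerivAt
      hasDeriv_w := fun t ht α => ((hws t ht).1.differentiable (by norm_num) α).hasDerivAt
      hasDerivT_z := fun t ht α =>
        (cx.toContinuousLinearMap.hasFDerivAt.comp_hasDerivWithinAt t (hzt α t ht))
      hasDerivT_w := fun t ht α => hwt α t ht
      cont_z := hcc _ (by simpa [iteratedDeriv_zero] using (hzc 0 (by norm_num)).1)
      cont_zα := hcc _ (by simpa [iteratedDeriv_one, tangent] using (hzc 1 (by norm_num)).1)
      cont_zαα := hcc _ (hzc 2 (by norm_num)).1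
      cont_zt := hcc _ (by simpa [iteratedDeriv_zero] using (hzc 0 (by norm_num)).2)
      cont_ztα := hcc _ (by simpa [iteratedDeriv_one] using (hzc 1 (by norm_num)).2)
      cont_w := by simpa [iteratedDeriv_zero] using (hwc 0 (by norm_num)).1
      cont_wα := by simpa [iteratedDeriv_one] using (hwc 1 (by norm_num)).1
      cont_wt := by simpa [iteratedDeriv_zero] using (hwc 0 (by norm_num)).2
      period := fun t ht α => by rw [hΩ.period t ht, map_add, cx_shift]
      simple := fun t ht α β h => hΩ.simple t ht α β (cx.injective h)
      regular := fun t ht α h => hΩ.regular t ht α (cx.injective (by rw [h, map_zero]))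
      w_period := hϖ_per }
  refine ⟨S, fun _ _ => rfl, fun _ _ => rfl, fun _ _ => rfl, ?_, ?_, ?_, ?_⟩
  · intro b t ht
    cases b
    · exact hΩ.isOpen₂ t ht
    · exact hΩ.isOpen₁ t ht
  · intro t ht
    exact hΩ.disjoint t ht
  · intro t ht x
    have h := Set.ext_iff.1 (hΩ.union t ht) x
    simp only [mem_union, mem_compl_iff, mem_range, not_exists] at h
    simp only [if_true]
    refine h.trans (forall_congr' fun α => ?_)
    refine not_congr ⟨fun h => by rw [← h], fun h => (cx.injective h).symm⟩
  · intro b t ht α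
    have key : ∀ s : ℝ, cx.symm (S.z α t + (s : ℝ) * (Complex.I * S.zα α t))
        = z α t + s • normal z α t := by
      intro s
      apply cx.injective
      rw [cx.apply_symm_apply, map_add, map_smul, cx_normal]
      simp [S]
    cases b
    · filter_upwards [hΩ.side₂ t ht α] with s hs
      rw [key]
      simpa [sg, sub_eq_add_neg] using hs
    · filter_upwards [hΩ.side₁ t ht α] with s hs
      rw [key]
      simpa [sg] using hs

namespace Sheet

variable {G : Geometry} {T : ℝ} (S : Sheet G T)

theorem z_add_int {t : ℝ} (ht : t ∈ Ico 0 T) (α : ℝ) (n : ℤ) :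
    S.z (α + n * (2 * Real.pi)) t = S.z α t + n * cshift G := by
  induction n using Int.induction_on with
  | zero => simp
  | succ n ih =>
    have h := S.period t ht (α + (n : ℤ) * (2 * Real.pi))
    rw [ih] at h
    have e : α + ((n : ℤ) + 1 : ℤ) * (2 * Real.pi) = α + (n : ℤ) * (2 * Real.pi) + 2 * Real.pi := by
      push_cast; ring
    rw [e, h]; push_cast; ring
  | pred n ih =>
    have h := S.period t ht (α + (-(n : ℤ) - 1 : ℤ) * (2 * Real.pi))
    have e : α + (-(n : ℤ) - 1 : ℤ) * (2 * Real.pi) + 2 * Real.pi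
        = α + (-(n : ℤ) : ℤ) * (2 * Real.pi) := by
      push_cast; ring
    rw [e, ih] at h
    rw [← sub_eq_iff_eq_add.2 h]; push_cast; ring

theorem sig_sub_add_int {t : ℝ} (ht : t ∈ Ico 0 T) (x : ℂ) (α : ℝ) (n : ℤ) :
    sig G (x - S.z (α + n * (2 * Real.pi)) t) = 0 ↔ sig G (x - S.z α t) = 0 := by
  rw [S.z_add_int ht, ← sig_add_int_shift_eq_zero G (x - S.z α t) (-n)]
  have : x - (S.z α t + n * cshift G) = x - S.z α t + (-n : ℤ) * cshift G := by push_cast; ring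
  rw [this]

theorem exists_eq_of_sig_eq_zero {t : ℝ} (ht : t ∈ Ico 0 T) {x : ℂ} {α : ℝ}
    (h : sig G (x - S.z α t) = 0) : ∃ n : ℤ, x = S.z (α + n * (2 * Real.pi)) t := by
  obtain ⟨n, hn⟩ := sig_eq_zero.1 h
  exact ⟨n, by rw [S.z_add_int ht, ← hn]; ring⟩

theorem sig_z_sub {t : ℝ} (ht : t ∈ Ico 0 T) {α β : ℝ} (h : sig G (S.z α t - S.z β t) = 0) :
    ∃ k : ℤ, α = β + k * (2 * Real.pi) := by
  obtain ⟨n, hn⟩ := S.exists_eq_of_sig_eq_zero ht h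
  obtain ⟨k, hk⟩ := S.simple t ht _ _ hn
  exact ⟨n + k, by rw [hk]; push_cast; ring⟩

theorem sig_z_sub_ne {t : ℝ} (ht : t ∈ Ico 0 T) {α β : ℝ} (hne : α ≠ β)
    (h : |α - β| < 2 * Real.pi) : sig G (S.z α t - S.z β t) ≠ 0 := by
  intro h0
  obtain ⟨k, hk⟩ := S.sig_z_sub ht h0
  have e : α - β = k * (2 * Real.pi) := by linarith
  rw [e, abs_mul, abs_of_pos Real.two_pi_pos] at h
  have hk0 : k ≠ 0 := by
    rintro rfl; apply hne; simpa using hk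
  have : (1 : ℝ) ≤ |(k : ℝ)| := by exact_mod_cast Int.one_le_abs hk0
  nlinarith [Real.two_pi_pos]

/-- `x` is off the curve at time `t` -- in the periodic geometry, off all its translates, which is
the same. -/
def Off (t : ℝ) (x : ℂ) : Prop := ∀ α, sig G (x - S.z α t) ≠ 0

theorem off_iff {t : ℝ} (ht : t ∈ Ico 0 T) (x : ℂ) : S.Off t x ↔ ∀ α, x ≠ S.z α t := by
  constructor
  · intro h α hx
    exact h α (by simp [hx])
  · intro h α h0
    obtain ⟨n, hn⟩ := S.exists_eq_of_sig_eq_zero ht h0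
    exact h _ hn

/-- Every parameter is congruent to one in a given window of length `2π`. -/
theorem exists_window (c β : ℝ) : ∃ n : ℤ, β + n * (2 * Real.pi) ∈ Ico c (c + 2 * Real.pi) := by
  obtain ⟨n, hn, -⟩ := existsUnique_add_zsmul_mem_Ico Real.two_pi_pos β c
  exact ⟨n, by simpa [zsmul_eq_mul] using hn⟩

theorem off_iff_window {t : ℝ} (ht : t ∈ Ico 0 T) (x : ℂ) (c : ℝ) :
    S.Off t x ↔ ∀ α ∈ Icc c (c + 2 * Real.pi), sig G (x - S.z α t) ≠ 0 := by
  refine ⟨fun h α _ => h α, fun h α h0 => ?_⟩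
  obtain ⟨n, hn⟩ := exists_window c α
  exact h _ ⟨hn.1, hn.2.le⟩ ((S.sig_sub_add_int ht x α n).2 h0)

theorem continuousOn_sub : ContinuousOn (fun y : SpaceTime × ℝ => cx y.1.1 - S.z y.2 y.1.2)
    (slab₀ T ×ˢ univ) := by
  refine ContinuousOn.sub (cx.continuous.comp (by fun_prop)).continuousOn ?_
  refine S.cont_z.comp (f := fun y : SpaceTime × ℝ => (y.2, y.1.2)) (by fun_prop) ?_
  rintro ⟨⟨x, t⟩, α⟩ ⟨h1, -⟩
  exact ⟨mem_univ _, h1.2⟩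

/-- An open condition on `x - z(α, t)` is stable, uniformly for `α` in a compact set. -/
theorem eventually_forall_sub {K : Set ℝ} (hK : IsCompact K) {V : Set ℂ} (hV : IsOpen V)
    {q₀ : SpaceTime} (hq₀ : q₀ ∈ slab₀ T) (h : ∀ α ∈ K, cx q₀.1 - S.z α q₀.2 ∈ V) :
    ∀ᶠ q in 𝓝[slab₀ T] q₀, ∀ α ∈ K, cx q.1 - S.z α q.2 ∈ V := by
  have := hK.eventually_forall_of_forall_eventually (x₀ := q₀)
    (P := fun q α => q ∈ slab₀ T → cx q.1 - S.z α q.2 ∈ V) ?_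
  · rw [eventually_nhdsWithin_iff]
    filter_upwards [this] with q hq hqs α hα using hq α hα hqs
  · intro α hα
    have h1 := S.continuousOn_sub (q₀, α) ⟨hq₀, mem_univ _⟩
    have h2 := h1.eventually (hV.mem_nhds (h α hα))
    rw [eventually_nhdsWithin_iff] at h2
    filter_upwards [h2] with y hy hs using hy ⟨hs, mem_univ _⟩

theorem eventually_off {q₀ : SpaceTime} (hq₀ : q₀ ∈ slab₀ T) (h : S.Off q₀.2 (cx q₀.1)) :
    ∀ᶠ q in 𝓝[slab₀ T] q₀, S.Off q.2 (cx q.1) := by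
  have h1 := S.eventually_forall_sub (isCompact_Icc (a := (0 : ℝ)) (b := 0 + 2 * Real.pi))
    (isOpen_sig_ne G) hq₀ ((S.off_iff_window hq₀.2 _ 0).1 h)
  filter_upwards [h1, self_mem_nhdsWithin] with q hq hqs
  exact (S.off_iff_window hqs.2 _ 0).2 hq

/-- The tangent vector is almost constant near a point of the curve. -/
theorem exists_cone (α₀ : ℝ) {t₀ : ℝ} (ht₀ : t₀ ∈ Ico 0 T) : ∃ δ > 0, ∀ t ∈ Ico 0 T, |t - t₀| < δ →
    ∀ a b, |a - α₀| < δ → |b - α₀| < δ →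
      ‖S.zα a t / S.zα α₀ t₀ - 1‖ ≤ 1 / 4 ∧
      ‖(S.z a t - S.z b t) / S.zα α₀ t₀ - ((a - b : ℝ) : ℂ)‖ ≤ |a - b| / 4 := by
  set τ := S.zα α₀ t₀
  have hτ : τ ≠ 0 := S.regular t₀ ht₀ α₀
  have h1 : Tendsto (fun q : ℝ × ℝ => S.zα q.1 q.2 / τ - 1) (𝓝[univ ×ˢ Ico 0 T] (α₀, t₀))
      (𝓝 (τ / τ - 1)) :=
    ((S.cont_zα.div_const τ).sub continuousOn_const) _ ⟨mem_univ _, ht₀⟩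
  rw [div_self hτ, sub_self, Metric.tendsto_nhdsWithin_nhds] at h1
  obtain ⟨δ, hδ, h⟩ := h1 (1 / 4) (by norm_num)
  have key : ∀ t ∈ Ico 0 T, |t - t₀| < δ → ∀ a, |a - α₀| < δ → ‖S.zα a t / τ - 1‖ ≤ 1 / 4 := by
    intro t ht htd a ha
    have := @h (a, t) ⟨mem_univ _, ht⟩ (by rw [Prod.dist_eq]; exact max_lt ha htd)
    rw [dist_zero_right] at this
    exact this.le
  refine ⟨δ, hδ, fun t ht htd a b ha hb => ⟨key t ht htd a ha, ?_⟩⟩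
  have hconv : Convex ℝ (Metric.ball α₀ δ) := convex_ball _ _
  have h3 := hconv.norm_image_sub_le_of_norm_hasDerivWithin_le
    (f := fun a => S.z a t / τ - ((a : ℝ) : ℂ)) (f' := fun a => S.zα a t / τ - 1) (C := 1 / 4)
    (fun a _ => (((S.hasDeriv_z t ht a).div_const τ).sub
      (Complex.ofRealCLM.hasDerivAt (x := a))).hasDerivWithinAt)
    (fun a ha => key t ht htd a ha) hb ha
  have e : (S.z a t / τ - (a : ℂ)) - (S.z b t / τ - (b : ℂ))
      = (S.z a t - S.z b t) / τ - ((a - b : ℝ) : ℂ) := by push_cast; ring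
  rw [e, Real.norm_eq_abs] at h3
  linarith

/-- A moving point of the curve has finite speed. -/
theorem exists_speed (α₀ : ℝ) {t₀ : ℝ} (ht₀ : t₀ ∈ Ico 0 T) : ∃ M > 0, ∃ δ > 0, ∀ t ∈ Ico 0 T,
    |t - t₀| < δ → ‖(S.z α₀ t - S.z α₀ t₀) / S.zα α₀ t₀‖ ≤ M * |t - t₀| := by
  have h := ((S.hasDerivT_z t₀ ht₀ α₀).div_const (S.zα α₀ t₀)).isBigO_sub
  obtain ⟨M, hM, h⟩ := h.exists_pos
  rw [Asymptotics.IsBigOWith, Filter.prod_pure, eventually_map, eventually_nhdsWithin_iff,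
    Metric.eventually_nhds_iff] at h
  obtain ⟨δ, hδ, h⟩ := h
  refine ⟨M, hM, δ, hδ, fun t ht htd => ?_⟩
  have := h (y := t) htd ht
  dsimp only at this
  rwa [← sub_div, Real.norm_eq_abs] at this

/-- Near one of its points, the curve consists of a single arc. -/
theorem eventually_arc (α₀ : ℝ) {t₀ : ℝ} (ht₀ : t₀ ∈ Ico 0 T) {δ : ℝ} (hδ : 0 < δ) :
    ∀ᶠ q in 𝓝[slab₀ T] (cx.symm (S.z α₀ t₀), t₀), ∀ α, cx q.1 = S.z α q.2 →
      ∃ β, |β - α₀| < δ ∧ cx q.1 = S.z β q.2 := by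
  set q₀ : SpaceTime := (cx.symm (S.z α₀ t₀), t₀)
  have hq₀ : q₀ ∈ slab₀ T := ⟨mem_univ _, ht₀⟩
  have hx₀ : cx q₀.1 = S.z α₀ t₀ := by simp [q₀]
  set K : Set ℝ := Icc (α₀ - Real.pi) (α₀ + Real.pi)
  have hK : IsCompact K := isCompact_Icc
  -- far from `α₀` the kernel argument is not a pole, nearby it is in the strip free of other poles
  have h1 := S.eventually_forall_sub (hK.diff (Metric.isOpen_ball (x := α₀) (ε := δ)))
    (isOpen_sig_ne G) hq₀ (by
      rintro α ⟨hα, hα2⟩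
      rw [hx₀]
      refine S.sig_z_sub_ne ht₀ ?_ ?_
      · rintro rfl; exact hα2 (Metric.mem_ball_self hδ)
      · rw [abs_lt]; constructor <;> linarith [hα.1, hα.2, Real.pi_pos])
  have h2 := S.eventually_forall_sub (hK)
    (isOpen_ne_fun (continuous_esig G) (continuous_const (y := (0 : ℂ)))) hq₀ (by
      intro α hα
      rw [hx₀]
      show esig G (S.z α₀ t₀ - S.z α t₀) ≠ 0
      by_cases hαα : α₀ = α
      · simp [hαα, esig_zero]
      · have := S.sig_z_sub_ne ht₀ hαα (by
          rw [abs_lt]; constructor <;> linarith [hα.1, hα.2, Real.pi_pos])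
        intro h
        rw [sig_eq_mul_esig, h, mul_zero] at this
        exact this rfl)
  filter_upwards [h1, h2, self_mem_nhdsWithin] with q hq1 hq2 hqs α hα
  obtain ⟨n, hn⟩ := exists_window (α₀ - Real.pi) α
  have hβ : α + n * (2 * Real.pi) ∈ K := ⟨hn.1, by linarith [hn.2]⟩
  have h0 : sig G (cx q.1 - S.z (α + n * (2 * Real.pi)) q.2) = 0 := by
    rw [S.sig_sub_add_int hqs.2, hα, sub_self, sig_zero]
  refine ⟨α + n * (2 * Real.pi), ?_, ?_⟩
  · by_contra hc
    exact hq1 _ ⟨hβ, hc⟩ h0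
  · rw [sig_eq_mul_esig] at h0
    exact sub_eq_zero.1 ((mul_eq_zero.1 h0).resolve_right (hq2 _ hβ))

end Sheet

/-! ### Local charts of the interface -/

/-- The open square with center `x₀`, half-side `r ‖τ‖` and sides parallel to `τ` and `iτ`. -/
def box (x₀ τ : ℂ) (r : ℝ) : Set Plane :=
  {x | |((cx x - x₀) / τ).re| < r ∧ |((cx x - x₀) / τ).im| < r}

theorem isOpen_box (x₀ τ : ℂ) (r : ℝ) : IsOpen (box x₀ τ r) := by
  have h : Continuous fun x : Plane => (cx x - x₀) / τ :=
    (cx.continuous.sub continuous_const).div_const τ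
  exact (isOpen_lt (Complex.continuous_re.comp h).abs continuous_const).inter
    (isOpen_lt (Complex.continuous_im.comp h).abs continuous_const)

theorem norm_sub_lt_of_mem_box {x₀ τ : ℂ} {r : ℝ} (hτ : τ ≠ 0) {x : Plane} (hx : x ∈ box x₀ τ r) :
    ‖cx x - x₀‖ < 2 * r * ‖τ‖ := by
  have h := Complex.norm_le_abs_re_add_abs_im ((cx x - x₀) / τ)
  rw [norm_div, div_le_iff₀ (norm_pos_iff.2 hτ)] at h
  have : 0 < ‖τ‖ := norm_pos_iff.2 hτ
  nlinarith [hx.1, hx.2]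

theorem dist_lt_of_mem_box {x₀ τ : ℂ} {r : ℝ} (hτ : τ ≠ 0) {x : Plane} (hx : x ∈ box x₀ τ r) :
    dist x (cx.symm x₀) < 2 * r * ‖τ‖ := by
  refine lt_of_le_of_lt ?_ (norm_sub_lt_of_mem_box hτ hx)
  rw [Prod.dist_eq]
  refine max_le ?_ ?_
  · exact Complex.abs_re_le_norm (cx x - x₀)
  · exact Complex.abs_im_le_norm (cx x - x₀)

/-- The part of a square above (`b = true`) or below (`b = false`) a flat enough graph is
connected. -/
theorem isPreconnected_above (x₀ : ℂ) {τ : ℂ} (hτ : τ ≠ 0) {r : ℝ} (hr : 0 < r) {H : ℝ → ℝ}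
    (hH : ∀ u, |u| < r → |H u| < r / 2) (b : Bool) :
    IsPreconnected {x | x ∈ box x₀ τ r ∧
      0 < sg b * (((cx x - x₀) / τ).im - H ((cx x - x₀) / τ).re)} := by
  set φ : Plane → ℂ := fun x => (cx x - x₀) / τ with hφ
  have hφs : ∀ w, φ (cx.symm (x₀ + w * τ)) = w := fun w => by
    simp [hφ, hτ]
  have hcomb : ∀ x y : Plane, ∀ c d : ℝ, c + d = 1 → φ (c • x + d • y) = c * φ x + d * φ y := by
    intro x y c d hcd
    have : x₀ = c * x₀ + d * x₀ := by rw [← add_mul, ← Complex.ofReal_add, hcd]; simp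
    simp only [hφ, map_add, map_smul, Complex.real_smul]
    nth_rewrite 1 [this]
    ring
  set N := {x | x ∈ box x₀ τ r ∧ 0 < sg b * ((φ x).im - H (φ x).re)}
  have hb1 : ∀ a : ℝ, |sg b * a| = |a| := fun a => by rw [abs_mul, abs_sg, one_mul]
  -- a segment in the box whose points are, after reflection, high enough
  refine isPreconnected_of_forall (cx.symm (x₀ + ((sg b * (3 / 4 * r) : ℝ) * Complex.I) * τ)) ?_
  intro y hy
  obtain ⟨⟨hy1, hy2⟩, hy3⟩ := hy
  change |(φ y).re| < r at hy1
  change |(φ y).im| < r at hy2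
  set m := cx.symm (x₀ + (((φ y).re : ℝ) + (sg b * (3 / 4 * r) : ℝ) * Complex.I) * τ) with hm
  set p := cx.symm (x₀ + ((sg b * (3 / 4 * r) : ℝ) * Complex.I) * τ) with hp
  have hφm : φ m = ((φ y).re : ℝ) + (sg b * (3 / 4 * r) : ℝ) * Complex.I := hφs _
  have hφp : φ p = (sg b * (3 / 4 * r) : ℝ) * Complex.I := hφs _
  have hmre : (φ m).re = (φ y).re := by rw [hφm]; simp
  have hmim : (φ m).im = sg b * (3 / 4 * r) := by rw [hφm]; simp
  have hpre : (φ p).re = 0 := by rw [hφp]; simp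
  have hpim : (φ p).im = sg b * (3 / 4 * r) := by rw [hφp]; simp
  have hre : ∀ x y : Plane, ∀ c d : ℝ, c + d = 1 →
      (φ (c • x + d • y)).re = c * (φ x).re + d * (φ y).re := fun x y c d h => by
    rw [hcomb x y c d h]; simp
  have him : ∀ x y : Plane, ∀ c d : ℝ, c + d = 1 →
      (φ (c • x + d • y)).im = c * (φ x).im + d * (φ y).im := fun x y c d h => by
    rw [hcomb x y c d h]; simp
  have hss := sg_mul_self b
  have hHy := hH _ hy1
  refine ⟨segment ℝ y m ∪ segment ℝ m p, ?_, ?_, ?_, ?_⟩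
  · rintro x (⟨c, d, hc, hd, hcd, rfl⟩ | ⟨c, d, hc, hd, hcd, rfl⟩)
    · have e1 := hre y m c d hcd
      have e2 := him y m c d hcd
      rw [hmre, ← add_mul, hcd, one_mul] at e1
      rw [hmim] at e2
      have hq : sg b * (φ (c • y + d • m)).im = c * (sg b * (φ y).im) + d * (3 / 4 * r) := by
        rw [e2]; linear_combination d * (3 / 4 * r) * hss
      have k1 : |sg b * (φ y).im| < r := by rw [hb1]; exact hy2
      have k2 : |sg b * H (φ y).re| < r / 2 := by rw [hb1]; exact hHy
      rw [abs_lt] at k1 k2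
      have hd1 : d = 1 - c := by linarith
      refine ⟨⟨?_, ?_⟩, ?_⟩
      · change |(φ _).re| < r
        rw [e1]; exact hy1
      · change |(φ _).im| < r
        rw [← hb1, hq, abs_lt]
        subst hd1
        constructor <;> nlinarith
      · rw [e1, mul_sub, hq]
        rw [mul_sub] at hy3
        subst hd1
        rcases hc.eq_or_lt with h | h
        · subst h; linarith
        · nlinarith
    · have e1 := hre m p c d hcd
      have e2 := him m p c d hcd
      rw [hmre, hpre, mul_zero, add_zero] at e1
      rw [hmim, hpim, ← add_mul, hcd, one_mul] at e2
      have hc1 : c ≤ 1 := by linarith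
      have hlt : |(φ (c • m + d • p)).re| < r := by
        rw [e1, abs_mul, abs_of_nonneg hc]
        nlinarith [abs_nonneg (φ y).re]
      have k2 : |sg b * H (φ (c • m + d • p)).re| < r / 2 := by rw [hb1]; exact hH _ hlt
      rw [abs_lt] at k2
      refine ⟨⟨hlt, ?_⟩, ?_⟩
      · change |(φ _).im| < r
        rw [e2, hb1, abs_of_pos (by linarith)]; linarith
      · rw [mul_sub, e2, ← mul_assoc, hss, one_mul]; linarith [k2.2]
  · exact Or.inr (right_mem_segment ℝ m p)
  · exact Or.inl (left_mem_segment ℝ y m)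
  · exact IsPreconnected.union m (right_mem_segment ℝ y m) (left_mem_segment ℝ m p)
      (convex_segment y m).isPreconnected (convex_segment m p).isPreconnected

namespace Sheet

variable {G : Geometry} {T : ℝ} (S : Sheet G T) {Ω : Bool → ℝ → Set Plane}

set_option maxHeartbeats 1000000 in
/-- Near a point of the curve, in the frame formed by its tangent and its normal, the curve is a
graph `y = h(u)`, and the two fluids lie above and below it. The square of half-side `r` may be
used during a time proportional to `r`. -/
theorem exists_chart (hΩ : Sides S Ω) (α₀ : ℝ) {t₀ : ℝ} (ht₀ : t₀ ∈ Ico 0 T) :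
    ∃ κ > 0, ∃ r₀ > 0, ∀ r, 0 < r → r < r₀ → ∀ t ∈ Ico 0 T, |t - t₀| < κ * r →
      (∀ u : ℝ, |u| < r → ∃ α h : ℝ, |α - α₀| < 2 * r ∧ |h| < r / 2 ∧
        S.z α t = S.z α₀ t₀ + (u + h * Complex.I) * S.zα α₀ t₀ ∧
        ∀ y : ℝ, |y| < r → ∀ b,
          cx.symm (S.z α₀ t₀ + (u + y * Complex.I) * S.zα α₀ t₀) ∈ Ω b t ↔ 0 < sg b * (y - h)) ∧
      ∀ b, IsPreconnected (box (S.z α₀ t₀) (S.zα α₀ t₀) r ∩ Ω b t) := by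
  obtain ⟨δ₁, hδ₁, hcone⟩ := S.exists_cone α₀ ht₀
  obtain ⟨M, hM, δ₂, hδ₂, hspeed⟩ := S.exists_speed α₀ ht₀
  have harc := S.eventually_arc α₀ ht₀ hδ₁
  rw [eventually_nhdsWithin_iff, Metric.eventually_nhds_iff] at harc
  obtain ⟨δ₃, hδ₃, harc⟩ := harc
  set x₀ := S.z α₀ t₀
  set τ := S.zα α₀ t₀
  have hτ : τ ≠ 0 := S.regular t₀ ht₀ α₀
  have hτn : 0 < ‖τ‖ := norm_pos_iff.2 hτ
  set κ : ℝ := 1 / (20 * (M + 1)) with hκdef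
  have hκ : 0 < κ := by positivity
  have hκM : M * κ < 1 / 20 := by
    rw [hκdef, mul_one_div, div_lt_div_iff₀ (by positivity) (by norm_num)]; linarith
  have hκ1 : κ < 1 := by
    rw [hκdef, div_lt_one (by positivity)]; linarith
  refine ⟨κ, hκ, min (δ₁ / 4) (min δ₂ (δ₃ / (2 * ‖τ‖ + 1))), by positivity, ?_⟩
  intro r hr hr0 t ht htd
  rw [lt_min_iff, lt_min_iff] at hr0
  obtain ⟨hr1, hr2, hr3⟩ := hr0
  rw [lt_div_iff₀ (by positivity)] at hr3
  have htr : |t - t₀| < r := htd.trans (by nlinarith)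
  have hconet := hcone t ht (by linarith)
  set v₀ : ℂ := (S.z α₀ t - x₀) / τ with hv₀
  have hv : ‖v₀‖ < r / 20 := by
    refine (hspeed t ht (by linarith)).trans_lt ?_
    nlinarith
  have hvre : |v₀.re| < r / 20 := (Complex.abs_re_le_norm _).trans_lt hv
  have hvim : |v₀.im| < r / 20 := (Complex.abs_im_le_norm _).trans_lt hv
  -- the cone condition in coordinates
  have hre : ∀ a b, |a - α₀| < δ₁ → |b - α₀| < δ₁ →
      |((S.z a t - S.z b t) / τ).re - (a - b)| ≤ |a - b| / 4 := fun a b ha hb => by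
    have := (Complex.abs_re_le_norm _).trans (hconet a b ha hb).2
    simpa using this
  have him : ∀ a b, |a - α₀| < δ₁ → |b - α₀| < δ₁ →
      |((S.z a t - S.z b t) / τ).im| ≤ |a - b| / 4 := fun a b ha hb => by
    have := (Complex.abs_im_le_norm _).trans (hconet a b ha hb).2
    simpa using this
  have hsplit : ∀ a, (S.z a t - x₀) / τ = (S.z a t - S.z α₀ t) / τ + v₀ := fun a => by
    rw [hv₀]; ring
  have h00 : |α₀ - α₀| < δ₁ := by simpa using hδ₁
  have hgraph : ∀ u : ℝ, ∃ α h : ℝ, |u| < r → |α - α₀| < 2 * r ∧ |h| < r / 2 ∧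
      S.z α t = x₀ + (u + h * Complex.I) * τ := by
    intro u
    by_cases hu : |u| < r
    swap
    · exact ⟨0, 0, fun h => absurd h hu⟩
    have hcont : ContinuousOn (fun a => ((S.z a t - x₀) / τ).re)
        (Icc (α₀ - 3 / 2 * r) (α₀ + 3 / 2 * r)) := fun a _ =>
      (Complex.continuous_re.continuousAt.comp
        (((S.hasDeriv_z t ht a).continuousAt.sub continuousAt_const).div_const τ)).continuousWithinAt
    rw [abs_lt] at hu hvre hvim
    obtain ⟨α, hα, hαu⟩ := intermediate_value_Icc (by linarith) hcont (show u ∈ Icc _ _ by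
      constructor
      · have h1 := hre (α₀ - 3 / 2 * r) α₀
          (by rw [abs_lt]; constructor <;> linarith) h00
        rw [show α₀ - 3 / 2 * r - α₀ = -(3 / 2 * r) by ring, abs_neg,
          abs_of_pos (show 0 < 3 / 2 * r by linarith), abs_le] at h1
        simp only [hsplit, Complex.add_re]
        linarith [h1.2]
      · have h1 := hre (α₀ + 3 / 2 * r) α₀
          (by rw [abs_lt]; constructor <;> linarith) h00
        rw [show α₀ + 3 / 2 * r - α₀ = 3 / 2 * r by ring,
          abs_of_pos (show 0 < 3 / 2 * r by linarith), abs_le] at h1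
        simp only [hsplit, Complex.add_re]
        linarith [h1.1])
    have hαr : |α - α₀| ≤ 3 / 2 * r := by rw [abs_le]; constructor <;> linarith [hα.1, hα.2]
    refine ⟨α, ((S.z α t - x₀) / τ).im, fun _ => ⟨by linarith, ?_, ?_⟩⟩
    · have h1 := him α α₀ (by linarith) h00
      have h2 : |((S.z α t - S.z α₀ t) / τ).im| ≤ 3 / 8 * r := by linarith
      rw [hsplit, Complex.add_im, abs_lt]
      rw [abs_le] at h2
      constructor <;> linarith [h2.1, h2.2]
    · have : (u : ℂ) + ((S.z α t - x₀) / τ).im * Complex.I = (S.z α t - x₀) / τ := by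
        rw [← hαu]; exact Complex.re_add_im _
      rw [this]; field_simp; ring
  choose A H hAH using hgraph
  have hH : ∀ u, |u| < r → |H u| < r / 2 := fun u hu => (hAH u hu).2.1
  set N : Bool → Set Plane := fun b => {x | x ∈ box x₀ τ r ∧
      0 < sg b * (((cx x - x₀) / τ).im - H ((cx x - x₀) / τ).re)} with hN
  have hNpre : ∀ b, IsPreconnected (N b) := fun b => isPreconnected_above x₀ hτ hr hH b
  have hωA : ∀ u, |u| < r → (S.z (A u) t - x₀) / τ = u + H u * Complex.I := fun u hu => by
    rw [(hAH u hu).2.2]; field_simp; ring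
  -- points off the graph are off the curve
  have hoff : ∀ x ∈ box x₀ τ r, (∃ α, cx x = S.z α t) →
      ((cx x - x₀) / τ).im = H ((cx x - x₀) / τ).re := by
    rintro x hx ⟨α, hα⟩
    have hdist : dist ((x, t) : SpaceTime) (cx.symm x₀, t₀) < δ₃ := by
      rw [Prod.dist_eq]
      refine max_lt ?_ ?_
      · refine (dist_lt_of_mem_box hτ hx).trans ?_
        nlinarith
      · change |t - t₀| < δ₃
        nlinarith
    obtain ⟨β, hβ, hxβ⟩ := harc hdist ⟨mem_univ _, ht⟩ α hα
    simp only at hxβ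
    set u := ((cx x - x₀) / τ).re with hu
    have hur : |u| < r := hx.1
    have h1 := hωA u hur
    have h2 : ((S.z (A u) t - S.z β t) / τ).re = 0 := by
      have : (S.z (A u) t - S.z β t) / τ = (S.z (A u) t - x₀) / τ - (cx x - x₀) / τ := by
        rw [hxβ]; ring
      rw [this, h1, Complex.sub_re, ← hu]; simp
    have h3 := hre (A u) β (by linarith [(hAH u hur).1]) hβ
    rw [h2, zero_sub, abs_neg] at h3
    have h4 : A u = β := by
      have : |A u - β| = 0 := le_antisymm (by linarith [abs_nonneg (A u - β)]) (abs_nonneg _)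
      exact sub_eq_zero.1 (abs_eq_zero.1 this)
    rw [hxβ, ← h4, h1]; simp
  have hNsub : ∀ b, N b ⊆ Ω true t ∪ Ω false t := by
    intro b x hx
    refine (hΩ.union t ht x).2 fun α hα => ?_
    have h1 := hoff x hx.1 ⟨α, hα⟩
    have h2 := hx.2
    rw [h1, sub_self, mul_zero] at h2
    exact lt_irrefl _ h2
  -- the normal at `α₀` reaches into the region on its side of the graph
  have hmeet : ∀ b, (N b ∩ Ω b t).Nonempty := by
    intro b
    have hlt : ∀ᶠ s : ℝ in 𝓝[>] 0, s ∈ Ioo 0 (r / 2) :=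
      Ioo_mem_nhdsGT (by linarith)
    obtain ⟨s, hs, hs1, hs2⟩ := ((hΩ.side b t ht α₀).and hlt).exists
    refine ⟨_, ?_, hs⟩
    set ξ := S.zα α₀ t / τ with hξ
    have hξ1 : ‖ξ - 1‖ ≤ 1 / 4 := (hconet α₀ α₀ h00 h00).1
    have hξre : |ξ.re - 1| ≤ 1 / 4 := by
      simpa using (Complex.abs_re_le_norm (ξ - 1)).trans hξ1
    have hξim : |ξ.im| ≤ 1 / 4 := by
      simpa using (Complex.abs_im_le_norm (ξ - 1)).trans hξ1
    have hω : (cx (cx.symm (S.z α₀ t + (sg b * s : ℝ) * (Complex.I * S.zα α₀ t))) - x₀) / τ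
        = v₀ + (sg b * s : ℝ) * (Complex.I * ξ) := by
      rw [cx.apply_symm_apply, hv₀, hξ]; ring
    have hωre : (v₀ + (sg b * s : ℝ) * (Complex.I * ξ)).re = v₀.re - sg b * s * ξ.im := by
      simp; ring
    have hωim : (v₀ + (sg b * s : ℝ) * (Complex.I * ξ)).im = v₀.im + sg b * s * ξ.re := by
      simp
    have hbs : |sg b * s * ξ.im| ≤ s / 4 := by
      rw [abs_mul, abs_mul, abs_sg, abs_of_pos hs1]; nlinarith
    have hbs2 : |sg b * s * ξ.re| ≤ 5 / 4 * s := by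
      rw [abs_mul, abs_mul, abs_sg, abs_of_pos hs1]
      have : |ξ.re| ≤ 5 / 4 := by
        rw [abs_le] at hξre ⊢; constructor <;> linarith [hξre.1, hξre.2]
      nlinarith
    have hur : |v₀.re - sg b * s * ξ.im| < r := by
      refine (abs_sub _ _).trans_lt ?_
      linarith
    show _ ∧ 0 < _
    rw [hω]
    refine ⟨⟨?_, ?_⟩, ?_⟩
    · rw [hω, hωre]; exact hur
    · rw [hω, hωim]
      refine (abs_add_le _ _).trans_lt ?_
      linarith
    · rw [hωim, hωre]
      set u := v₀.re - sg b * s * ξ.im with hu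
      have h1 := hωA u hur
      rw [hsplit] at h1
      have h1re := congrArg Complex.re h1
      have h1im := congrArg Complex.im h1
      simp only [Complex.add_re, Complex.add_im, Complex.ofReal_re, Complex.ofReal_im,
        Complex.mul_re, Complex.mul_im, Complex.I_re, Complex.I_im] at h1re h1im
      have hA : |A u - α₀| < δ₁ := by linarith [(hAH u hur).1]
      have h2 := hre (A u) α₀ hA h00
      have h3 := him (A u) α₀ hA h00
      have h4 : ((S.z (A u) t - S.z α₀ t) / τ).re = - (sg b * s * ξ.im) := by linarith
      have h5 : |A u - α₀| ≤ s / 3 := by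
        rw [h4] at h2
        have : |A u - α₀| ≤ |-(sg b * s * ξ.im) - (A u - α₀)| + |sg b * s * ξ.im| := by
          have := abs_sub (-(sg b * s * ξ.im) - (A u - α₀)) (-(sg b * s * ξ.im))
          rw [abs_neg] at this
          rw [show -(sg b * s * ξ.im) - (A u - α₀) - -(sg b * s * ξ.im) = -(A u - α₀) by ring,
            abs_neg] at this
          exact this
        linarith
      have h6 : H u = ((S.z (A u) t - S.z α₀ t) / τ).im + v₀.im := by linarith
      have h7 : |sg b * ((S.z (A u) t - S.z α₀ t) / τ).im| ≤ s / 12 := by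
        rw [abs_mul, abs_sg]; linarith
      rw [h6]
      have h8 : sg b * (v₀.im + sg b * s * ξ.re - (((S.z (A u) t - S.z α₀ t) / τ).im + v₀.im))
          = s * ξ.re - sg b * ((S.z (A u) t - S.z α₀ t) / τ).im := by
        linear_combination s * ξ.re * sg_mul_self b
      rw [h8]
      rw [abs_le] at h7 hξre
      nlinarith [h7.2, hξre.1]
  have hNΩ : ∀ b, N b ⊆ Ω b t := by
    intro b
    cases b
    · exact (hNpre false).subset_right_of_subset_union (hΩ.isOpen true t ht)
        (hΩ.isOpen false t ht) (hΩ.disjoint t ht) (hNsub false) (hmeet false)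
    · exact (hNpre true).subset_left_of_subset_union (hΩ.isOpen true t ht)
        (hΩ.isOpen false t ht) (hΩ.disjoint t ht) (hNsub true) (hmeet true)
  have hiff : ∀ x ∈ box x₀ τ r, ∀ b, x ∈ Ω b t ↔
      0 < sg b * (((cx x - x₀) / τ).im - H ((cx x - x₀) / τ).re) := by
    intro x hx b
    refine ⟨fun hxb => ?_, fun h => hNΩ b ⟨hx, h⟩⟩
    by_contra hneg
    rw [not_lt] at hneg
    have hun : x ∈ Ω true t ∨ x ∈ Ω false t := by
      cases b
      · exact Or.inr hxb
      · exact Or.inl hxb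
    have hne := (hΩ.union t ht x).1 hun
    rcases hneg.eq_or_lt with h | h
    · -- on the graph, hence on the curve
      have h1 := (mul_eq_zero.1 h).resolve_left (sg_ne_zero b)
      have h2 := hωA _ hx.1
      rw [← sub_eq_zero.1 h1, Complex.re_add_im] at h2
      have h3 := (div_left_inj' hτ).1 h2
      exact hne _ (sub_left_inj.1 h3).symm
    · have h2 : x ∈ Ω (!b) t := hNΩ (!b) ⟨hx, by
        cases b <;> simp only [sg, Bool.not_true, Bool.not_false] at h ⊢ <;> simp at h ⊢ <;> linarith⟩
      have hd := hΩ.disjoint t ht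
      cases b
      · exact disjoint_left.1 hd h2 hxb
      · exact disjoint_left.1 hd hxb h2
  refine ⟨fun u hu => ⟨A u, H u, (hAH u hu).1, (hAH u hu).2.1, (hAH u hu).2.2, ?_⟩, ?_⟩
  · intro y hy b
    have e : (cx (cx.symm (x₀ + (u + y * Complex.I) * τ)) - x₀) / τ = u + y * Complex.I := by
      simp [hτ]
    have hbox : cx.symm (x₀ + (u + y * Complex.I) * τ) ∈ box x₀ τ r := by
      constructor
      · rw [e]; simpa using hu
      · rw [e]; simpa using hy
    rw [hiff _ hbox b, e]
    simp
  · intro b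
    have : box x₀ τ r ∩ Ω b t = N b := by
      ext x
      exact ⟨fun hx => ⟨hx.1, (hiff x hx.1 b).1 hx.2⟩, fun hx => ⟨hx.1, hNΩ b hx⟩⟩
    rw [this]
    exact hNpre b

end Sheet

/-! ### The fluid regions in space-time -/

/-- The part of a fluid region that lies over the open time interval `(0, T)`. -/
def openRegion (T : ℝ) (O : ℝ → Set Plane) : Set SpaceTime := {q | q.2 ∈ Ioo 0 T ∧ q.1 ∈ O q.2}

namespace Sides

variable {G : Geometry} {T : ℝ} {S : Sheet G T} {Ω : Bool → ℝ → Set Plane}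

theorem mem_or (hΩ : Sides S Ω) {t : ℝ} (ht : t ∈ Ico 0 T) {x : Plane} :
    (x ∈ Ω true t ∨ x ∈ Ω false t) ↔ S.Off t (cx x) :=
  (hΩ.union t ht x).trans (S.off_iff ht _).symm

theorem off (hΩ : Sides S Ω) {t : ℝ} (ht : t ∈ Ico 0 T) {b : Bool} {x : Plane} (hx : x ∈ Ω b t) :
    S.Off t (cx x) := by
  refine (hΩ.mem_or ht).1 ?_
  cases b
  · exact Or.inr hx
  · exact Or.inl hx

theorem not_mem_of_mem (hΩ : Sides S Ω) {t : ℝ} (ht : t ∈ Ico 0 T) {b : Bool} {x : Plane}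
    (hx : x ∈ Ω b t) : x ∉ Ω (!b) t := by
  have hd := hΩ.disjoint t ht
  cases b
  · exact fun h => disjoint_left.1 hd h hx
  · exact fun h => disjoint_left.1 hd hx h

/-- A connected set off the curve lies on one side. -/
theorem subset_of_isPreconnected (hΩ : Sides S Ω) {t : ℝ} (ht : t ∈ Ico 0 T) {N : Set Plane}
    (hN : IsPreconnected N) (hoff : ∀ x ∈ N, S.Off t (cx x)) {b : Bool} (hb : (N ∩ Ω b t).Nonempty) :
    N ⊆ Ω b t := by
  have hsub : N ⊆ Ω true t ∪ Ω false t := fun x hx => (hΩ.mem_or ht).2 (hoff x hx)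
  cases b
  · exact hN.subset_right_of_subset_union (hΩ.isOpen true t ht)
        (hΩ.isOpen false t ht) (hΩ.disjoint t ht) hsub hb
  · exact hN.subset_left_of_subset_union (hΩ.isOpen true t ht)
        (hΩ.isOpen false t ht) (hΩ.disjoint t ht) hsub hb

theorem isClosed_curve (hΩ : Sides S Ω) {t : ℝ} (ht : t ∈ Ico 0 T) :
    IsClosed (range fun α => S.z α t) := by
  have : (range fun α => S.z α t)ᶜ = cx.symm ⁻¹' (Ω true t ∪ Ω false t) := by
    ext x
    have := hΩ.union t ht (cx.symm x)
    rw [cx.apply_symm_apply] at this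
    rw [mem_preimage, mem_union, this]
    simp [eq_comm]
  rw [← isOpen_compl_iff, this]
  exact ((hΩ.isOpen true t ht).union (hΩ.isOpen false t ht)).preimage cx.symm.continuous

/-- A point of a fluid lies on the normal through the closest point of the curve, and the
segment that joins both stays in the fluid. -/
theorem exists_normal_segment (hΩ : Sides S Ω) {t : ℝ} (ht : t ∈ Ico 0 T) {b : Bool} {x : Plane}
    (hx : x ∈ Ω b t) : ∃ α s : ℝ, 0 < s ∧ cx x = S.z α t + (sg b * s : ℝ) * (Complex.I * S.zα α t) ∧
      ∀ s' ∈ Ioc 0 s, cx.symm (S.z α t + (sg b * s' : ℝ) * (Complex.I * S.zα α t)) ∈ Ω b t := by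
  obtain ⟨y, ⟨α, rfl⟩, hy⟩ := (hΩ.isClosed_curve ht).exists_infDist_eq_dist
    (range_nonempty _) (cx x)
  have hmin : ∀ β, dist (cx x) (S.z α t) ≤ dist (cx x) (S.z β t) := fun β => by
    rw [← hy]; exact Metric.infDist_le_dist_of_mem ⟨β, rfl⟩
  have hxoff := (S.off_iff ht _).1 (hΩ.off ht hx)
  set D := cx x - S.z α t with hD
  have hD0 : D ≠ 0 := sub_ne_zero.2 (hxoff α)
  set τ := S.zα α t
  have hτ : τ ≠ 0 := S.regular t ht α
  have hperp : D.re * τ.re + D.im * τ.im = 0 := by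
    have h1 : HasDerivAt (fun β => (cx x - S.z β t).re) (-τ.re) α := by
      exact (Complex.reCLM.hasFDerivAt.comp_hasDerivAt α
        ((S.hasDeriv_z t ht α).const_sub (cx x))).congr_deriv (by simp [τ])
    have h2 : HasDerivAt (fun β => (cx x - S.z β t).im) (-τ.im) α := by
      exact (Complex.imCLM.hasFDerivAt.comp_hasDerivAt α
        ((S.hasDeriv_z t ht α).const_sub (cx x))).congr_deriv (by simp [τ])
    have h3 := (h1.fun_pow 2).fun_add (h2.fun_pow 2)
    have h4 : IsLocalMin (fun β => (cx x - S.z β t).re ^ 2 + (cx x - S.z β t).im ^ 2) α := by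
      refine Eventually.of_forall fun β => ?_
      have := hmin β
      rw [dist_eq_norm, dist_eq_norm] at this
      have h5 := pow_le_pow_left₀ (norm_nonneg _) this 2
      rw [← Complex.normSq_eq_norm_sq, ← Complex.normSq_eq_norm_sq, Complex.normSq_apply,
        Complex.normSq_apply] at h5
      simp only [pow_two]
      exact h5
    have h5 := h4.hasDerivAt_eq_zero h3
    simp only [hD]
    norm_num at h5 ⊢
    linarith
  set q := D / (Complex.I * τ) with hq
  have hqD : D = q * (Complex.I * τ) := by
    rw [hq]; field_simp
  have hqim : q.im = 0 := by
    have h1 : (q * (Complex.I * τ)).re = -(q.re * τ.im) - q.im * τ.re := by simp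
    have h2 : (q * (Complex.I * τ)).im = q.re * τ.re - q.im * τ.im := by simp; ring
    rw [hqD, h1, h2] at hperp
    have h3 : q.im * (τ.re * τ.re + τ.im * τ.im) = 0 := by linarith
    refine (mul_eq_zero.1 h3).resolve_right ?_
    rw [← Complex.normSq_apply]
    exact fun h => hτ (Complex.normSq_eq_zero.1 h)
  have hqr : q = (q.re : ℂ) := by apply Complex.ext <;> simp [hqim]
  have hq0 : q.re ≠ 0 := by
    intro h; apply hD0; rw [hqD, hqr, h]; simp
  -- no point of the curve is closer to `x` than the foot, so the segment meets the curve there only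
  have hseg : ∀ θ ∈ Ioc (0 : ℝ) 1, S.Off t (S.z α t + θ * D) := by
    rintro θ ⟨h0, h1⟩
    rw [S.off_iff ht]
    intro β hβ
    have h2 := hmin β
    rw [← hβ, dist_eq_norm, dist_eq_norm] at h2
    have e : cx x - (S.z α t + θ * D) = ((1 - θ : ℝ) : ℂ) * D := by
      push_cast; rw [hD]; ring
    rw [e, norm_mul, Complex.norm_real, Real.norm_of_nonneg (by linarith), ← hD] at h2
    nlinarith [norm_pos_iff.2 hD0]
  have hsegpre : IsPreconnected ((fun θ : ℝ => cx.symm (S.z α t + θ * D)) '' Ioc 0 1) := by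
    refine isPreconnected_Ioc.image _ (Continuous.continuousOn ?_)
    exact cx.symm.continuous.comp (by fun_prop)
  have hsegΩ : ∀ b', ((fun θ : ℝ => cx.symm (S.z α t + θ * D)) '' Ioc 0 1 ∩ Ω b' t).Nonempty →
      ∀ θ ∈ Ioc (0 : ℝ) 1, cx.symm (S.z α t + θ * D) ∈ Ω b' t := by
    intro b' hne θ hθ
    refine hΩ.subset_of_isPreconnected ht hsegpre ?_ hne ⟨θ, hθ, rfl⟩
    rintro _ ⟨θ, hθ, rfl⟩
    simpa using hseg θ hθ
  have h1 : cx.symm (S.z α t + (1 : ℝ) * D) = x := by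
    simp [hD]
  have hb := hsegΩ b ⟨x, ⟨1, by norm_num, h1⟩, hx⟩
  -- the segment starts on the side `b'` of the foot, and it lies in `Ω b`: the two sides agree
  obtain ⟨b', hb'⟩ : ∃ b', 0 < sg b' * q.re := by
    rcases lt_or_gt_of_ne hq0 with h | h
    · exact ⟨false, by simp [sg, h]⟩
    · exact ⟨true, by simp [sg, h]⟩
  have hqb : q.re = sg b' * (sg b' * q.re) := by rw [← mul_assoc, sg_mul_self, one_mul]
  have hscale : ∀ s : ℝ, ((s / (sg b' * q.re) : ℝ) : ℂ) * q = (sg b' * s : ℝ) := by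
    intro s
    have h : s / (sg b' * q.re) * q.re = sg b' * s := by
      rw [div_mul_eq_mul_div, div_eq_iff (mul_ne_zero (sg_ne_zero b') hq0)]
      linear_combination (-(s * q.re)) * sg_mul_self b'
    rw [← h, Complex.ofReal_mul, ← hqr]
  have hbb : b' = b := by
    by_contra hne
    have hne' : b = !b' := Bool.eq_not.2 fun h => hne h.symm
    have hlt : ∀ᶠ s : ℝ in 𝓝[>] 0, s ∈ Ioo 0 (sg b' * q.re) := Ioo_mem_nhdsGT hb'
    obtain ⟨s, hs, hs1, hs2⟩ := ((hΩ.side b' t ht α).and hlt).exists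
    have h2 := hb (s / (sg b' * q.re)) ⟨div_pos hs1 hb', (div_le_one hb').2 hs2.le⟩
    have e : S.z α t + ((s / (sg b' * q.re) : ℝ) : ℂ) * D
        = S.z α t + (sg b' * s : ℝ) * (Complex.I * τ) := by
      rw [hqD, ← mul_assoc, hscale]
    rw [e, hne'] at h2
    exact hΩ.not_mem_of_mem ht hs h2
  subst hbb
  refine ⟨α, sg b' * q.re, hb', ?_, ?_⟩
  · rw [← hqb, ← hqr, ← hqD, hD]; ring
  · rintro s' ⟨hs1, hs2⟩
    have h2 := hb (s' / (sg b' * q.re)) ⟨div_pos hs1 hb', (div_le_one hb').2 hs2⟩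
    have e : S.z α t + ((s' / (sg b' * q.re) : ℝ) : ℂ) * D
        = S.z α t + (sg b' * s' : ℝ) * (Complex.I * τ) := by
      rw [hqD, ← mul_assoc, hscale]
    rwa [e] at h2

/-- The fluid regions are open in space-time. -/
theorem eventually_mem (hΩ : Sides S Ω) {b : Bool} {q₀ : SpaceTime}
    (hq₀ : q₀ ∈ fluidRegion T (Ω b)) : ∀ᶠ q in 𝓝[slab₀ T] q₀, q ∈ fluidRegion T (Ω b) := by
  obtain ⟨x, t₀⟩ := q₀
  obtain ⟨ht₀, hx⟩ := hq₀
  simp only at ht₀ hx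
  obtain ⟨α, s, hs, hxs, hseg⟩ := hΩ.exists_normal_segment ht₀ hx
  obtain ⟨κ, hκ, r₀, hr₀, hchart⟩ := S.exists_chart hΩ α ht₀
  set τ := S.zα α t₀
  set s₁ := min s (r₀ / 2) with hs₁
  have hs₁0 : 0 < s₁ := lt_min hs (by linarith)
  set y : Plane := cx.symm (S.z α t₀ + (sg b * s₁ : ℝ) * (Complex.I * τ)) with hy
  -- a point near the curve stays in the fluid for some time
  have hyΩ : ∀ t ∈ Ico 0 T, |t - t₀| < κ * (4 / 3 * s₁) → y ∈ Ω b t := by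
    intro t ht htd
    have h1 := hchart (4 / 3 * s₁) (by positivity)
      (by have := min_le_right s (r₀ / 2); rw [← hs₁] at this; linarith) t ht htd
    obtain ⟨_, h, -, hh, -, hiff⟩ := h1.1 0 (by simpa using hs₁0)
    have h2 := hiff (sg b * s₁) (by rw [abs_mul, abs_sg, abs_of_pos hs₁0]; linarith) b
    have e : S.z α t₀ + (((0 : ℝ) : ℂ) + ((sg b * s₁ : ℝ) : ℂ) * Complex.I) * τ
        = S.z α t₀ + (sg b * s₁ : ℝ) * (Complex.I * τ) := by push_cast; ring
    rw [e] at h2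
    refine h2.2 ?_
    have h3 : |sg b * h| < 4 / 3 * s₁ / 2 := by rwa [abs_mul, abs_sg, one_mul]
    rw [abs_lt] at h3
    have h4 : sg b * (sg b * s₁ - h) = s₁ - sg b * h := by
      linear_combination s₁ * sg_mul_self b
    rw [h4]; linarith [h3.2]
  have hev1 : ∀ᶠ q : SpaceTime in 𝓝[slab₀ T] (x, t₀), |q.2 - t₀| < κ * (4 / 3 * s₁) := by
    refine nhdsWithin_le_nhds ?_
    refine (isOpen_lt (by fun_prop) continuous_const).mem_nhds ?_
    simp only [mem_ofPred_eq, sub_self, abs_zero]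
    positivity
  -- and it is joined to the points near `(x, t₀)`
  have hev2 : ∀ᶠ q : SpaceTime in 𝓝[slab₀ T] (x, t₀), ∀ θ ∈ Icc (0 : ℝ) 1,
      S.Off q.2 (cx (y + θ • (q.1 - y))) := by
    have := (isCompact_Icc (a := (0 : ℝ)) (b := 1)).eventually_forall_of_forall_eventually
      (x₀ := ((x, t₀) : SpaceTime))
      (P := fun q θ => q ∈ slab₀ T → S.Off q.2 (cx (y + θ • (q.1 - y)))) ?_
    · rw [eventually_nhdsWithin_iff]
      filter_upwards [this] with q hq hqs θ hθ using hq θ hθ hqs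
    · intro θ hθ
      have hoff : S.Off t₀ (cx (y + θ • (x - y))) := by
        have hs1s : s₁ ≤ s := min_le_left _ _
        have e : y + θ • (x - y)
            = cx.symm (S.z α t₀ + (sg b * (s₁ + θ * (s - s₁)) : ℝ) * (Complex.I * τ)) := by
          apply cx.injective
          rw [map_add, map_smul, map_sub, hxs, hy, cx.apply_symm_apply, cx.apply_symm_apply,
            Complex.real_smul]
          push_cast; ring
        rw [e]
        refine hΩ.off ht₀ (hseg _ ⟨?_, ?_⟩)
        · nlinarith [mul_nonneg hθ.1 (sub_nonneg.2 hs1s)]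
        · nlinarith [mul_le_mul_of_nonneg_right hθ.2 (sub_nonneg.2 hs1s)]
      have h1 := S.eventually_off (q₀ := (y + θ • (x - y), t₀)) ⟨mem_univ _, ht₀⟩ hoff
      rw [eventually_nhdsWithin_iff] at h1
      have hc : Continuous fun p : SpaceTime × ℝ =>
          ((y + p.2 • (p.1.1 - y), p.1.2) : SpaceTime) := by fun_prop
      have h2 := hc.continuousAt (x := (((x, t₀) : SpaceTime), θ)) |>.eventually h1
      filter_upwards [h2] with p hp hps
      exact hp ⟨mem_univ _, hps.2⟩
  filter_upwards [hev1, hev2, self_mem_nhdsWithin] with q hq1 hq2 hqs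
  refine ⟨hqs.2, ?_⟩
  have hpre : IsPreconnected ((fun θ : ℝ => y + θ • (q.1 - y)) '' Icc 0 1) :=
    isPreconnected_Icc.image _ (Continuous.continuousOn (by fun_prop))
  refine hΩ.subset_of_isPreconnected hqs.2 hpre ?_ (b := b) ⟨y, ⟨0, by simp, by simp⟩,
    hyΩ q.2 hqs.2 hq1⟩ ⟨1, by simp, by simp⟩
  rintro _ ⟨θ, hθ, rfl⟩
  exact hq2 θ hθ

theorem isOpen_openRegion (hΩ : Sides S Ω) (b : Bool) : IsOpen (openRegion T (Ω b)) := by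
  rw [isOpen_iff_mem_nhds]
  rintro q ⟨hq1, hq2⟩
  have h1 := hΩ.eventually_mem (b := b) (q₀ := q) ⟨⟨hq1.1.le, hq1.2⟩, hq2⟩
  have hT : ∀ᶠ p : SpaceTime in 𝓝 q, p.2 ∈ Ioo 0 T :=
    continuous_snd.continuousAt.eventually (isOpen_Ioo.mem_nhds hq1)
  rw [eventually_nhdsWithin_iff] at h1
  filter_upwards [h1, hT] with p hp hpT
  exact ⟨hpT, (hp ⟨mem_univ _, hpT.1.le, hpT.2⟩).2⟩

end Sides

theorem isOpen_slab (T : ℝ) : IsOpen (slab T) := isOpen_univ.prod isOpen_Ioo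

namespace Sheet

variable {G : Geometry} {T : ℝ} (S : Sheet G T)

/-- A regular curve has Hausdorff dimension at most one, hence no area. -/
theorem volume_curve {t : ℝ} (ht : t ∈ Ico 0 T) :
    volume {x : Plane | ¬ S.Off t (cx x)} = 0 := by
  have hd : ContDiff ℝ 1 (fun α => cx.symm (S.z α t)) := by
    refine cx.symm.contDiff.comp ?_
    rw [contDiff_one_iff_deriv]
    refine ⟨fun α => (S.hasDeriv_z t ht α).differentiableAt, ?_⟩
    have : deriv (fun α => S.z α t) = fun α => S.zα α t :=
      funext fun α => (S.hasDeriv_z t ht α).deriv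
    rw [this, continuous_iff_continuousAt]
    exact fun α => (S.hasDeriv_zα t ht α).continuousAt
  have h1 : dimH (range fun α => cx.symm (S.z α t)) < (2 : NNReal) := by
    refine hd.dimH_range_le.trans_lt ?_
    simp
  have h2 := hausdorffMeasure_of_dimH_lt h1
  rw [NNReal.coe_ofNat, hausdorffMeasure_prod_real] at h2
  refine measure_mono_null ?_ h2
  intro x hx
  rw [mem_ofPred_eq, S.off_iff ht] at hx
  push Not at hx
  obtain ⟨α, hα⟩ := hx
  exact ⟨α, by simp [← hα]⟩

end Sheet

namespace Sides

variable {G : Geometry} {T : ℝ} {S : Sheet G T} {Ω : Bool → ℝ → Set Plane}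

theorem volume_slab_diff (hΩ : Sides S Ω) :
    volume (slab T \ (openRegion T (Ω true) ∪ openRegion T (Ω false))) = 0 := by
  have hm : MeasurableSet (slab T \ (openRegion T (Ω true) ∪ openRegion T (Ω false))) :=
    (isOpen_slab T).measurableSet.diff
      ((hΩ.isOpen_openRegion true).union (hΩ.isOpen_openRegion false)).measurableSet
  rw [Measure.volume_eq_prod, Measure.prod_apply_symm hm, lintegral_eq_zero_iff']
  · refine Eventually.of_forall fun t => ?_
    by_cases ht : t ∈ Ioo 0 T
    · have ht' : t ∈ Ico 0 T := ⟨ht.1.le, ht.2⟩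
      refine measure_mono_null ?_ (S.volume_curve ht')
      rintro x ⟨hx1, hx2⟩ hoff
      refine hx2 ?_
      rcases (hΩ.mem_or ht').2 hoff with h | h
      · exact Or.inl ⟨ht, h⟩
      · exact Or.inr ⟨ht, h⟩
    · have h : (fun x : Plane => (x, t)) ⁻¹'
          (slab T \ (openRegion T (Ω true) ∪ openRegion T (Ω false))) = ∅ := by
        ext x
        simp [slab, ht]
      exact (congrArg volume h).trans measure_empty
  · exact (measurable_measure_prodMk_right hm).aemeasurable

theorem ae_mem (hΩ : Sides S Ω) :
    ∀ᵐ q ∂(volume.restrict (slab T)), q ∈ openRegion T (Ω true) ∪ openRegion T (Ω false) := by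
  rw [ae_restrict_iff' (isOpen_slab T).measurableSet, ae_iff]
  refine measure_mono_null ?_ hΩ.volume_slab_diff
  intro q hq
  simp only [mem_ofPred_eq, Classical.not_imp] at hq
  exact hq

theorem disjoint_openRegion (hΩ : Sides S Ω) :
    Disjoint (openRegion T (Ω true)) (openRegion T (Ω false)) := by
  rw [disjoint_left]
  rintro q ⟨h1, h2⟩ ⟨-, h3⟩
  exact disjoint_left.1 (hΩ.disjoint q.2 ⟨h1.1.le, h1.2⟩) h2 h3

theorem openRegion_subset (b : Bool) : openRegion T (Ω b) ⊆ slab T := fun _ h => ⟨mem_univ _, h.1⟩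

end Sides

/-! ### One-sided limits of potentials of the sheet -/

/-- A parameter may be moved inside an integral over a compact interval if the integrand is jointly
continuous at the limit value of the parameter. -/
theorem tendsto_integral_of_continuousWithinAt {X E : Type*} [TopologicalSpace X]
    [FirstCountableTopology X] [NormedAddCommGroup E] [NormedSpace ℝ E] {s : Set X} {x₀ : X}
    (hx₀ : x₀ ∈ s) {F : X → ℝ → E} {a b : ℝ} (hab : a ≤ b)
    (h : ∀ α ∈ Icc a b, ContinuousWithinAt (fun y : X × ℝ => F y.1 y.2) (s ×ˢ univ) (x₀, α))
    (hm : ∀ᶠ x in 𝓝[s] x₀, ContinuousOn (F x) (Icc a b)) :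
    Tendsto (fun x => ∫ α in a..b, F x α) (𝓝[s] x₀) (𝓝 (∫ α in a..b, F x₀ α)) := by
  have h0 : ContinuousOn (F x₀) (Icc a b) := hm.self_of_nhdsWithin hx₀
  obtain ⟨K, hK⟩ := isCompact_Icc.exists_bound_of_continuousOn h0
  have hb : ∀ᶠ x in 𝓝[s] x₀, ∀ α ∈ Icc a b, ‖F x α‖ < K + 1 := by
    have := (isCompact_Icc (a := a) (b := b)).eventually_forall_of_forall_eventually (x₀ := x₀)
      (P := fun x α => x ∈ s → ‖F x α‖ < K + 1) ?_
    · rw [eventually_nhdsWithin_iff]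
      filter_upwards [this] with q hq hqs α hα using hq α hα hqs
    · intro α hα
      have h1 := (h α hα).norm.eventually (Iio_mem_nhds
        (show ‖F x₀ α‖ < K + 1 from (hK α hα).trans_lt (lt_add_one K)))
      rw [eventually_nhdsWithin_iff] at h1
      filter_upwards [h1] with y hy hs using hy ⟨hs, mem_univ _⟩
  have hsub : Ι a b ⊆ Icc a b := by
    rw [uIoc_of_le hab]; exact Ioc_subset_Icc_self
  refine intervalIntegral.tendsto_integral_filter_of_dominated_convergence (fun _ => K + 1) ?_ ?_
    intervalIntegrable_const ?_
  · filter_upwards [hm] with x hx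
    exact (hx.mono hsub).aestronglyMeasurable measurableSet_uIoc
  · filter_upwards [hb] with x hx
    exact Eventually.of_forall fun α hα => (hx α (hsub hα)).le
  · refine Eventually.of_forall fun α hα => ?_
    have h1 := h α (hsub hα)
    refine h1.tendsto.comp (f := fun x => (x, α)) (tendsto_nhdsWithin_iff.2 ⟨?_, ?_⟩)
    · exact ((continuous_id.prodMk continuous_const).tendsto x₀).mono_left nhdsWithin_le_nhds
    · filter_upwards [self_mem_nhdsWithin] with x hx using ⟨hx, mem_univ _⟩

namespace Sheet

variable {G : Geometry} {T : ℝ} (S : Sheet G T) {Ω : Bool → ℝ → Set Plane}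

theorem continuous_slice {F : ℝ → ℝ → ℂ}
    (hF : ContinuousOn (fun q : ℝ × ℝ => F q.1 q.2) (univ ×ˢ Ico 0 T)) {t : ℝ} (ht : t ∈ Ico 0 T) :
    Continuous fun α => F α t := by
  have := hF.comp (f := fun α : ℝ => (α, t)) (s := univ) (by fun_prop)
    (fun α _ => ⟨mem_univ _, ht⟩)
  exact continuousOn_univ.1 this

/-- Potentials of the sheet are continuous in all variables, as long as the kernel is. -/
theorem tendsto_integral_kernel {F : ℝ → ℝ → ℂ}
    (hF : ContinuousOn (fun q : ℝ × ℝ => F q.1 q.2) (univ ×ˢ Ico 0 T)) {φ : ℂ → ℂ} {V : Set ℂ}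
    (hV : IsOpen V) (hφ : ContinuousOn φ V) {a b : ℝ} (hab : a ≤ b) {q₀ : SpaceTime}
    (hq₀ : q₀ ∈ slab₀ T) (h : ∀ α ∈ Icc a b, cx q₀.1 - S.z α q₀.2 ∈ V) :
    Tendsto (fun q : SpaceTime => ∫ α in a..b, F α q.2 * φ (cx q.1 - S.z α q.2)) (𝓝[slab₀ T] q₀)
      (𝓝 (∫ α in a..b, F α q₀.2 * φ (cx q₀.1 - S.z α q₀.2))) := by
  refine tendsto_integral_of_continuousWithinAt hq₀ hab ?_ ?_
  · intro α hα
    refine ContinuousWithinAt.mul ?_ ?_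
    · have h1 : ContinuousOn (fun y : SpaceTime × ℝ => F y.2 y.1.2) (slab₀ T ×ˢ univ) :=
        hF.comp (f := fun y : SpaceTime × ℝ => (y.2, y.1.2)) (by fun_prop)
          (fun y hy => ⟨mem_univ _, hy.1.2⟩)
      exact h1 (q₀, α) ⟨hq₀, mem_univ _⟩
    · exact ContinuousAt.comp_continuousWithinAt (g := φ)
        (hφ.continuousAt (hV.mem_nhds (h α hα))) (S.continuousOn_sub (q₀, α) ⟨hq₀, mem_univ _⟩)
  · filter_upwards [S.eventually_forall_sub isCompact_Icc hV hq₀ h, self_mem_nhdsWithin]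
      with q hq hqs
    refine ContinuousOn.mul (continuous_slice hF hqs.2).continuousOn ?_
    exact hφ.comp (continuous_const.sub (continuous_slice S.cont_z hqs.2)).continuousOn hq

/-- A continuous density is bounded on a compact set of parameters, locally uniformly in time. -/
theorem exists_bound {F : ℝ → ℝ → ℂ}
    (hF : ContinuousOn (fun q : ℝ × ℝ => F q.1 q.2) (univ ×ˢ Ico 0 T)) (a b : ℝ) {t₀ : ℝ}
    (ht₀ : t₀ ∈ Ico 0 T) : ∃ K > 0, ∀ᶠ t in 𝓝[Ico 0 T] t₀, ∀ α ∈ Icc a b, ‖F α t‖ ≤ K := by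
  obtain ⟨K, hK⟩ := isCompact_Icc.exists_bound_of_continuousOn
    (continuous_slice hF ht₀).continuousOn (s := Icc a b)
  refine ⟨|K| + 1, by positivity, ?_⟩
  have := (isCompact_Icc (a := a) (b := b)).eventually_forall_of_forall_eventually (x₀ := t₀)
    (P := fun t α => t ∈ Ico 0 T → ‖F α t‖ ≤ |K| + 1) ?_
  · rw [eventually_nhdsWithin_iff]
    filter_upwards [this] with q hq hqs α hα using hq α hα hqs
  · intro α hα
    have h1 : ContinuousOn (fun y : ℝ × ℝ => F y.2 y.1) (Ico 0 T ×ˢ univ) :=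
      hF.comp (f := fun y : ℝ × ℝ => (y.2, y.1)) (by fun_prop) (fun y hy => ⟨mem_univ _, hy.1⟩)
    have h2 := (h1 (t₀, α) ⟨ht₀, mem_univ _⟩).norm.eventually (Iio_mem_nhds
        (show ‖F α t₀‖ < |K| + 1 from
          ((hK α hα).trans (le_abs_self K)).trans_lt (lt_add_one _)))
    rw [eventually_nhdsWithin_iff] at h2
    filter_upwards [h2] with y hy hs using (hy ⟨hs, mem_univ _⟩).le

/-- Near a point of the curve, the points of a fluid are `z(A, t) + s n` with a fixed direction `n`
and with `A` close to the parameter of the point. -/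
theorem exists_foot (hΩ : Sides S Ω) (α₀ : ℝ) {t₀ : ℝ} (ht₀ : t₀ ∈ Ico 0 T) (b : Bool) :
    ∃ A s : SpaceTime → ℝ,
      Tendsto A (𝓝[fluidRegion T (Ω b)] (cx.symm (S.z α₀ t₀), t₀)) (𝓝 α₀) ∧
      ∀ᶠ q in 𝓝[fluidRegion T (Ω b)] (cx.symm (S.z α₀ t₀), t₀), 0 < s q ∧
        cx q.1 = S.z (A q) q.2 + s q * (sg b * (Complex.I * S.zα α₀ t₀)) := by
  obtain ⟨κ, hκ, r₀, hr₀, hchart⟩ := S.exists_chart hΩ α₀ ht₀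
  set x₀ := S.z α₀ t₀
  set τ := S.zα α₀ t₀
  have hτ : τ ≠ 0 := S.regular t₀ ht₀ α₀
  set l := 𝓝[fluidRegion T (Ω b)] ((cx.symm x₀, t₀) : SpaceTime)
  have hev : ∀ r, 0 < r → r < r₀ → ∀ᶠ q in l, ∃ α s : ℝ, |α - α₀| < 2 * r ∧ 0 < s ∧
      cx q.1 = S.z α q.2 + s * (sg b * (Complex.I * τ)) := by
    intro r hr hrr
    have h1 : ∀ᶠ q : SpaceTime in l, |q.2 - t₀| < κ * r := by
      refine nhdsWithin_le_nhds ((isOpen_lt (by fun_prop) continuous_const).mem_nhds ?_)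
      simp only [mem_ofPred_eq, sub_self, abs_zero]
      positivity
    have h2 : ∀ᶠ q : SpaceTime in l, q.1 ∈ box x₀ τ r := by
      refine nhdsWithin_le_nhds (continuous_fst.continuousAt.eventually
        ((isOpen_box x₀ τ r).mem_nhds ?_))
      simp [box, hr]
    filter_upwards [h1, h2, self_mem_nhdsWithin] with q hq1 hq2 hq3
    obtain ⟨α, h, hα, hh, hz, hiff⟩ := (hchart r hr hrr q.2 hq3.1 hq1).1 _ hq2.1
    have h3 := hiff _ hq2.2 b
    rw [Complex.re_add_im, div_mul_cancel₀ _ hτ, add_sub_cancel, cx.symm_apply_apply] at h3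
    refine ⟨α, _, hα, h3.1 hq3.2, ?_⟩
    rw [hz]
    have e : ((cx q.1 - x₀) / τ) * τ = cx q.1 - x₀ := div_mul_cancel₀ _ hτ
    rw [← Complex.re_add_im ((cx q.1 - x₀) / τ)] at e
    have hs2 : ((sg b : ℝ) : ℂ) * sg b = 1 := by exact_mod_cast sg_mul_self b
    push_cast
    linear_combination -e - ((((cx q.1 - x₀) / τ).im : ℂ) - h) * Complex.I * τ * hs2
  obtain ⟨δ, hδ, hcone⟩ := S.exists_cone α₀ ht₀
  set r₁ := min (r₀ / 2) (δ / 4)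
  have hr₁ : 0 < r₁ := by positivity
  have hr₁' : r₁ < r₀ := (min_le_left _ _).trans_lt (by linarith)
  have hr₁δ : 2 * r₁ < δ := by linarith [min_le_right (r₀ / 2) (δ / 4)]
  have hex : ∀ q : SpaceTime, ∃ α s : ℝ, (∃ α s : ℝ, |α - α₀| < 2 * r₁ ∧ 0 < s ∧
      cx q.1 = S.z α q.2 + s * (sg b * (Complex.I * τ))) → (|α - α₀| < 2 * r₁ ∧ 0 < s ∧
      cx q.1 = S.z α q.2 + s * (sg b * (Complex.I * τ))) := by
    intro q
    by_cases h : ∃ α s : ℝ, |α - α₀| < 2 * r₁ ∧ 0 < s ∧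
      cx q.1 = S.z α q.2 + s * (sg b * (Complex.I * τ))
    · obtain ⟨α, s, h⟩ := h
      exact ⟨α, s, fun _ => h⟩
    · exact ⟨0, 0, fun h' => absurd h' h⟩
  choose A s hAs using hex
  have hev₁ : ∀ᶠ q in l, |A q - α₀| < 2 * r₁ ∧ 0 < s q ∧
      cx q.1 = S.z (A q) q.2 + s q * (sg b * (Complex.I * τ)) := by
    filter_upwards [hev r₁ hr₁ hr₁'] with q hq using hAs q hq
  have hl : l ≤ 𝓝[slab₀ T] (cx.symm x₀, t₀) :=
    nhdsWithin_mono _ fun q hq => ⟨mem_univ _, hq.1⟩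
  refine ⟨A, s, ?_, hev₁.mono fun q hq => hq.2⟩
  have hlim : Tendsto (fun q : SpaceTime => 4 / 3 * ‖(cx q.1 - S.z α₀ q.2) / τ‖) l (𝓝 0) := by
    have h1 : ContinuousOn (fun q : SpaceTime => cx q.1 - S.z α₀ q.2) (slab₀ T) :=
      S.continuousOn_sub.comp (f := fun q : SpaceTime => (q, α₀)) (by fun_prop)
        (fun q hq => ⟨hq, mem_univ _⟩)
    have h2 := ((continuousOn_const (c := (4 / 3 : ℝ))).mul (h1.div_const τ).norm) (cx.symm x₀, t₀) ⟨mem_univ _, ht₀⟩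
    have h3 : Tendsto (fun q : SpaceTime => 4 / 3 * ‖(cx q.1 - S.z α₀ q.2) / τ‖) l
        (𝓝 (4 / 3 * ‖(cx (cx.symm x₀) - S.z α₀ t₀) / τ‖)) := h2.tendsto.mono_left hl
    simpa [x₀] using h3
  rw [tendsto_iff_norm_sub_tendsto_zero]
  refine squeeze_zero' (Eventually.of_forall fun _ => norm_nonneg _) ?_ hlim
  have h1 : ∀ᶠ q : SpaceTime in l, |q.2 - t₀| < δ := by
    refine nhdsWithin_le_nhds ((isOpen_lt (by fun_prop) continuous_const).mem_nhds ?_)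
    simpa using hδ
  filter_upwards [hev₁, h1, self_mem_nhdsWithin] with q hq hqt hqs
  have h2 := (hcone q.2 hqs.1 hqt (A q) α₀ (by linarith [hq.1]) (by simpa using hδ)).2
  have h3 := (Complex.abs_re_le_norm _).trans h2
  have h4 : ((cx q.1 - S.z α₀ q.2) / τ).re = ((S.z (A q) q.2 - S.z α₀ q.2) / τ).re := by
    have : (cx q.1 - S.z α₀ q.2) / τ
        = (S.z (A q) q.2 - S.z α₀ q.2) / τ + ((s q * sg b : ℝ) : ℂ) * Complex.I := by
      rw [hq.2.2]; push_cast; field_simp; ring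
    rw [this, Complex.add_re]; simp
  have h5 := Complex.abs_re_le_norm ((cx q.1 - S.z α₀ q.2) / τ)
  rw [h4] at h5
  rw [Complex.sub_re, Complex.ofReal_re] at h3
  rw [Real.norm_eq_abs]
  have h6 := abs_sub_abs_le_abs_sub (A q - α₀) (((S.z (A q) q.2 - S.z α₀ q.2) / τ).re)
  rw [abs_sub_comm] at h3
  linarith

/-- Jump relation for the Cauchy integral, in qualitative form: a potential of the sheet with
differentiable density has limits at the sheet from both sides, even if the time varies. Near the
singularity the density is compared with a multiple of `∂_α z`, for which the integral is a
logarithm. -/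
theorem exists_limit (hΩ : Sides S Ω) {f fα : ℝ → ℝ → ℂ}
    (hf : ∀ t ∈ Ico 0 T, ∀ α, HasDerivAt (fun a => f a t) (fα α t) α)
    (hfc : ContinuousOn (fun q : ℝ × ℝ => f q.1 q.2) (univ ×ˢ Ico 0 T))
    (hfαc : ContinuousOn (fun q : ℝ × ℝ => fα q.1 q.2) (univ ×ˢ Ico 0 T))
    {c α₀ : ℝ} (hα₀ : α₀ ∈ Ioo c (c + 2 * Real.pi)) {t₀ : ℝ} (ht₀ : t₀ ∈ Ico 0 T) (b : Bool) :
    ∃ L : ℂ, Tendsto (fun q : SpaceTime => ∫ α in c..c + 2 * Real.pi,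
        f α q.2 * bsKer G (cx q.1 - S.z α q.2))
      (𝓝[fluidRegion T (Ω b)] (cx.symm (S.z α₀ t₀), t₀)) (𝓝 L) := by
  obtain ⟨A, s, hA, hAs⟩ := S.exists_foot hΩ α₀ ht₀ b
  obtain ⟨δ₁, hδ₁, hcone⟩ := S.exists_cone α₀ ht₀
  set x₀ := S.z α₀ t₀ with hx₀
  set τ := S.zα α₀ t₀ with hτdef
  have hτ : τ ≠ 0 := S.regular t₀ ht₀ α₀
  have hτn : 0 < ‖τ‖ := norm_pos_iff.2 hτ
  set q₀ : SpaceTime := (cx.symm x₀, t₀) with hq₀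
  set l := 𝓝[fluidRegion T (Ω b)] q₀ with hl
  have hq₀s : q₀ ∈ slab₀ T := ⟨mem_univ _, ht₀⟩
  have hq₀x : cx q₀.1 = x₀ := by simp [q₀]
  have hls : l ≤ 𝓝[slab₀ T] q₀ := nhdsWithin_mono _ fun q hq => ⟨mem_univ _, hq.1⟩
  have hlt : Tendsto (fun q : SpaceTime => q.2) l (𝓝[Ico 0 T] t₀) := by
    refine tendsto_nhdsWithin_iff.2 ⟨?_, ?_⟩
    · exact (continuous_snd.tendsto q₀).mono_left nhdsWithin_le_nhds
    · filter_upwards [self_mem_nhdsWithin] with q hq using hq.1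
  set d : ℂ := sg b * (Complex.I * τ) with hd
  have hsgc : ((sg b : ℝ) : ℂ) ≠ 0 := by exact_mod_cast sg_ne_zero b
  have hd0 : d ≠ 0 := mul_ne_zero hsgc (mul_ne_zero Complex.I_ne_zero hτ)
  -- the arc `[a₁, a₂]` around `α₀` is short enough for the cone condition
  set δ := min (δ₁ / 2) (min ((α₀ - c) / 2) ((c + 2 * Real.pi - α₀) / 2)) with hδdef
  have hδ : 0 < δ := by
    refine lt_min (by linarith) (lt_min ?_ ?_) <;> linarith [hα₀.1, hα₀.2]
  have hδ1 : δ < δ₁ := (min_le_left _ _).trans_lt (by linarith)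
  have hδ2 : c < α₀ - δ := by
    have := (min_le_right (δ₁ / 2) _).trans (min_le_left ((α₀ - c) / 2) ((c + 2 * Real.pi - α₀) / 2))
    rw [← hδdef] at this
    linarith [hα₀.1]
  have hδ3 : α₀ + δ < c + 2 * Real.pi := by
    have := (min_le_right (δ₁ / 2) _).trans (min_le_right ((α₀ - c) / 2) ((c + 2 * Real.pi - α₀) / 2))
    rw [← hδdef] at this
    linarith [hα₀.2]
  set a₁ := α₀ - δ with ha₁
  set a₂ := α₀ + δ with ha₂
  have hnear : ∀ α ∈ Icc a₁ a₂, |α - α₀| < δ₁ := fun α hα => by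
    rw [abs_lt]; constructor <;> linarith [hα.1, hα.2]
  have hsig : ∀ α ∈ Icc c (c + 2 * Real.pi), α ≠ α₀ → sig G (x₀ - S.z α t₀) ≠ 0 := by
    intro α hα hne
    refine S.sig_z_sub_ne ht₀ hne.symm ?_
    rw [abs_lt]; constructor <;> linarith [hα.1, hα.2, hα₀.1, hα₀.2]
  have hesig : ∀ α ∈ Icc a₁ a₂, cx q₀.1 - S.z α q₀.2 ∈ {w | esig G w ≠ 0} := by
    intro α hα
    rw [hq₀x]
    show esig G (x₀ - S.z α t₀) ≠ 0
    by_cases h : α = α₀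
    · rw [h, sub_self, esig_zero]; exact one_ne_zero
    · intro h0
      refine hsig α ⟨by linarith [hα.1], by linarith [hα.2]⟩ h ?_
      rw [sig_eq_mul_esig, h0, mul_zero]
  have hesigo : IsOpen {w | esig G w ≠ 0} :=
    isOpen_ne_fun (continuous_esig G) continuous_const
  have hkerc : ContinuousOn (bsKer G) {w | sig G w ≠ 0} := fun w hw =>
    (continuousAt_bsKer hw).continuousWithinAt
  have hhkerc : ContinuousOn (hker G) {w | esig G w ≠ 0} := fun w hw =>
    (continuousAt_hker hw).continuousWithinAt
  -- the rest of the curve, and the holomorphic part `hker` of the kernel, contribute continuously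
  have hfar₁ := (S.tendsto_integral_kernel hfc (isOpen_sig_ne G) hkerc hδ2.le hq₀s (by
    intro α hα
    rw [hq₀x]
    exact hsig α ⟨hα.1, by linarith [hα.2]⟩ (by rintro rfl; linarith [hα.2]))).mono_left hls
  have hfar₂ := (S.tendsto_integral_kernel hfc (isOpen_sig_ne G) hkerc hδ3.le hq₀s (by
    intro α hα
    rw [hq₀x]
    exact hsig α ⟨by linarith [hα.1], hα.2⟩ (by rintro rfl; linarith [hα.1]))).mono_left hls
  have hreg := (S.tendsto_integral_kernel hfc hesigo hhkerc (show a₁ ≤ a₂ by linarith) hq₀s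
    hesig).mono_left hls
  -- conditions that hold for all points of the fluid close to `q₀`
  have hesigev := (S.eventually_forall_sub isCompact_Icc hesigo hq₀s hesig).filter_mono hls
  have hmem : ∀ᶠ q in l, q ∈ fluidRegion T (Ω b) := self_mem_nhdsWithin
  have htev : ∀ᶠ q : SpaceTime in l, |q.2 - t₀| < δ₁ := by
    refine nhdsWithin_le_nhds ((isOpen_lt (by fun_prop) continuous_const).mem_nhds ?_)
    simpa [q₀] using hδ₁
  have hAev : ∀ᶠ q in l, A q ∈ Icc a₁ a₂ := hA (Icc_mem_nhds (by linarith) (by linarith))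
  have hre : ∀ t ∈ Ico 0 T, |t - t₀| < δ₁ → ∀ a b', a ∈ Icc a₁ a₂ → b' ∈ Icc a₁ a₂ →
      |((S.z a t - S.z b' t) / τ).re - (a - b')| ≤ |a - b'| / 4 := fun t ht htd a b' ha hb => by
    have := (Complex.abs_re_le_norm _).trans (hcone t ht htd a b' (hnear a ha) (hnear b' hb)).2
    simpa using this
  have hre2 : ∀ t ∈ Ico 0 T, |t - t₀| < δ₁ → ∀ a b', a ∈ Icc a₁ a₂ → b' ∈ Icc a₁ a₂ →
      3 / 4 * |a - b'| ≤ |((S.z a t - S.z b' t) / τ).re| := fun t ht htd a b' ha hb => by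
    have h1 := hre t ht htd a b' ha hb
    have h2 := abs_sub_abs_le_abs_sub (a - b') (((S.z a t - S.z b' t) / τ).re)
    rw [abs_sub_comm] at h1
    linarith
  have hquot : ∀ᶠ q in l, ∀ α ∈ Icc a₁ a₂,
      (cx q.1 - S.z α q.2) / τ = (S.z (A q) q.2 - S.z α q.2) / τ + (s q * sg b : ℝ) * Complex.I := by
    filter_upwards [hAs] with q hq α hα
    rw [hq.2, hd]; push_cast; field_simp; ring
  have hoff : ∀ᶠ q in l, S.Off q.2 (cx q.1) := by
    filter_upwards [hmem] with q hq using hΩ.off hq.1 hq.2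
  -- the multiple `g ∂_α z` of the tangent that agrees with the density at the foot `A q`
  set g : SpaceTime → ℂ := fun q => f (A q) q.2 / S.zα (A q) q.2 with hg
  have hcomp : ∀ {F : ℝ → ℝ → ℂ}, ContinuousOn (fun q : ℝ × ℝ => F q.1 q.2) (univ ×ˢ Ico 0 T) →
      Tendsto (fun q => F (A q) q.2) l (𝓝 (F α₀ t₀)) := by
    intro F hF
    have h1 : Tendsto (fun q : SpaceTime => (A q, q.2)) l (𝓝[univ ×ˢ Ico 0 T] (α₀, t₀)) := by
      rw [nhdsWithin_prod_eq, nhdsWithin_univ]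
      exact hA.prodMk hlt
    exact (hF (α₀, t₀) ⟨mem_univ _, ht₀⟩).tendsto.comp h1
  have hcompα : ∀ {F : ℝ → ℝ → ℂ}, ContinuousOn (fun q : ℝ × ℝ => F q.1 q.2) (univ ×ˢ Ico 0 T) →
      ∀ α, Tendsto (fun q : SpaceTime => F α q.2) l (𝓝 (F α t₀)) := by
    intro F hF α
    have h1 : Tendsto (fun q : SpaceTime => (α, q.2)) l (𝓝[univ ×ˢ Ico 0 T] (α, t₀)) := by
      rw [nhdsWithin_prod_eq, nhdsWithin_univ]
      exact tendsto_const_nhds.prodMk hlt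
    exact (hF (α, t₀) ⟨mem_univ _, ht₀⟩).tendsto.comp h1
  have hglim : Tendsto g l (𝓝 (f α₀ t₀ / τ)) := (hcomp hfc).div (hcomp S.cont_zα) hτ
  have hzlim : ∀ α, Tendsto (fun q : SpaceTime => cx q.1 - S.z α q.2) l (𝓝 (x₀ - S.z α t₀)) := by
    intro α
    refine Tendsto.sub ?_ (hcompα S.cont_z α)
    have := ((cx.continuous.comp continuous_fst).tendsto q₀).mono_left
      (nhdsWithin_le_nhds (s := fluidRegion T (Ω b)))
    rwa [Function.comp_apply, hq₀x] at this
  -- on the side `b`, the short arc seen from `x` and divided by `d` stays in the slit plane, so that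
  -- the integral of `∂_α z / (x - z)` is a difference of values of the principal logarithm
  have hslit : ∀ᶠ q in l, ∀ α ∈ Icc a₁ a₂, (cx q.1 - S.z α q.2) / d ∈ Complex.slitPlane := by
    filter_upwards [hAs, hmem, htev, hAev] with q hq1 hq2 hq3 hq4 α hα
    have e : (cx q.1 - S.z α q.2) / d
        = (s q : ℂ) + (((-sg b : ℝ) : ℂ) * Complex.I) * ((S.z (A q) q.2 - S.z α q.2) / τ) := by
      have hs2 : ((sg b : ℝ) : ℂ) * sg b = 1 := by exact_mod_cast sg_mul_self b
      rw [hq1.2, div_eq_iff hd0, hd]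
      push_cast
      field_simp
      linear_combination ((S.z (A q) q.2 - S.z α q.2) * Complex.I ^ 2) * hs2
        + (S.z (A q) q.2 - S.z α q.2) * Complex.I_sq
    rw [e, Complex.mem_slitPlane_iff]
    by_cases h : α = A q
    · left; rw [h]; simpa using hq1.1
    · right
      have h1 := hre2 q.2 hq2.1 hq3 (A q) α hq4 hα
      have h2 : 0 < |A q - α| := abs_pos.2 (sub_ne_zero.2 (Ne.symm h))
      have h3 : ((S.z (A q) q.2 - S.z α q.2) / τ).re ≠ 0 := by
        intro h0; rw [h0, abs_zero] at h1; linarith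
      rw [Complex.add_im, Complex.ofReal_im, zero_add, mul_assoc, Complex.im_ofReal_mul,
        Complex.I_mul_im]
      exact mul_ne_zero (neg_ne_zero.2 (sg_ne_zero b)) h3
  have hslit₀ : ∀ α ∈ Icc a₁ a₂, α ≠ α₀ → (x₀ - S.z α t₀) / d ∈ Complex.slitPlane := by
    intro α hα hne
    have e : (x₀ - S.z α t₀) / d = ((-sg b : ℝ) : ℂ) * Complex.I * ((S.z α₀ t₀ - S.z α t₀) / τ) := by
      have hs2 : ((sg b : ℝ) : ℂ) * sg b = 1 := by exact_mod_cast sg_mul_self b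
      rw [div_eq_iff hd0, hd, ← hx₀]
      push_cast
      field_simp
      linear_combination ((x₀ - S.z α t₀) * Complex.I ^ 2) * hs2
        + (x₀ - S.z α t₀) * Complex.I_sq
    rw [e, Complex.mem_slitPlane_iff]
    right
    have h1 := hre2 t₀ ht₀ (by simpa using hδ₁) α₀ α ⟨by linarith, by linarith⟩ hα
    have h2 : 0 < |α₀ - α| := abs_pos.2 (sub_ne_zero.2 (Ne.symm hne))
    have h3 : ((S.z α₀ t₀ - S.z α t₀) / τ).re ≠ 0 := by
      intro h0; rw [h0, abs_zero] at h1; linarith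
    rw [mul_assoc, Complex.im_ofReal_mul, Complex.I_mul_im]
    exact mul_ne_zero (neg_ne_zero.2 (sg_ne_zero b)) h3
  have hloglim : ∀ α ∈ Icc a₁ a₂, α ≠ α₀ →
      Tendsto (fun q : SpaceTime => Complex.log ((cx q.1 - S.z α q.2) / d)) l
        (𝓝 (Complex.log ((x₀ - S.z α t₀) / d))) := fun α hα hne =>
    ((hzlim α).div_const d).clog (hslit₀ α hα hne)
  have hlog : ∀ᶠ q in l, ∫ α in a₁..a₂, S.zα α q.2 / (cx q.1 - S.z α q.2)
      = -Complex.log ((cx q.1 - S.z a₂ q.2) / d) + Complex.log ((cx q.1 - S.z a₁ q.2) / d) := by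
    filter_upwards [hslit, hmem, hoff] with q hq1 hq2 hq3
    have hne : ∀ α, cx q.1 - S.z α q.2 ≠ 0 := fun α h => hq3 α (by rw [h, sig_zero])
    have h1 : ∀ α ∈ uIcc a₁ a₂, HasDerivAt (fun α => -Complex.log ((cx q.1 - S.z α q.2) / d))
        (S.zα α q.2 / (cx q.1 - S.z α q.2)) α := by
      intro α hα
      rw [uIcc_of_le (by linarith)] at hα
      have h2 := ((((S.hasDeriv_z q.2 hq2.1 α).const_sub (cx q.1)).div_const d).clog_real
        (hq1 α hα)).neg
      refine h2.congr_deriv ?_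
      have := hne α
      field_simp
    rw [intervalIntegral.integral_eq_sub_of_hasDerivAt h1]
    · ring
    · refine Continuous.intervalIntegrable ?_ _ _
      exact (continuous_slice S.cont_zα hq2.1).div
        (continuous_const.sub (continuous_slice S.cont_z hq2.1)) hne
  -- `f - g ∂_α z` vanishes at the foot, so the quotient by `x - z` is bounded, and dominated
  -- convergence applies
  have hdiff : Tendsto (fun q : SpaceTime => ∫ α in a₁..a₂,
      (f α q.2 - g q * S.zα α q.2) / (cx q.1 - S.z α q.2)) l
      (𝓝 (∫ α in a₁..a₂, (f α t₀ - f α₀ t₀ / τ * S.zα α t₀) / (x₀ - S.z α t₀))) := by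
    obtain ⟨K₁, hK₁, hK₁b⟩ := exists_bound hfαc a₁ a₂ ht₀
    obtain ⟨K₂, hK₂, hK₂b⟩ := exists_bound S.cont_zαα a₁ a₂ ht₀
    have hgb : ∀ᶠ q in l, ‖g q‖ < ‖f α₀ t₀ / τ‖ + 1 :=
      hglim.norm.eventually (Iio_mem_nhds (lt_add_one _))
    set K₃ := ‖f α₀ t₀ / τ‖ + 1
    have hsub : Ι a₁ a₂ ⊆ Icc a₁ a₂ := by
      rw [uIoc_of_le (by linarith)]; exact Ioc_subset_Icc_self
    refine intervalIntegral.tendsto_integral_filter_of_dominated_convergence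
      (fun _ => (K₁ + K₃ * K₂) / (3 / 4 * ‖τ‖)) ?_ ?_ intervalIntegrable_const ?_
    · filter_upwards [hmem, hoff] with q hq1 hq2
      refine Continuous.aestronglyMeasurable ?_
      exact ((continuous_slice hfc hq1.1).sub (continuous_const.mul
        (continuous_slice S.cont_zα hq1.1))).div
        (continuous_const.sub (continuous_slice S.cont_z hq1.1))
        (fun α h => hq2 α (by rw [h, sig_zero]))
    · filter_upwards [hmem, hoff, htev, hAev, hquot, hgb, hlt.eventually hK₁b,
        hlt.eventually hK₂b] with q hq1 hq2 hq3 hq4 hq5 hq6 hq7 hq8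
      refine Eventually.of_forall fun α hα => ?_
      have hα' := hsub hα
      have hconv : Convex ℝ (Icc a₁ a₂) := convex_Icc _ _
      have h1 := hconv.norm_image_sub_le_of_norm_hasDerivWithin_le
        (f := fun a => f a q.2 - g q * S.zα a q.2) (f' := fun a => fα a q.2 - g q * S.zαα a q.2)
        (C := K₁ + K₃ * K₂)
        (fun a _ => ((hf q.2 hq1.1 a).sub
          ((S.hasDeriv_zα q.2 hq1.1 a).const_mul (g q))).hasDerivWithinAt)
        (fun a ha => by
          refine (norm_sub_le _ _).trans (add_le_add (hq7 a ha) ?_)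
          rw [norm_mul]
          exact mul_le_mul hq6.le (hq8 a ha) (norm_nonneg _) (by positivity)) hq4 hα'
      have h2 : f (A q) q.2 - g q * S.zα (A q) q.2 = 0 := by
        rw [hg]
        simp only
        rw [div_mul_cancel₀ _ (S.regular q.2 hq1.1 _), sub_self]
      simp only [h2, sub_zero] at h1
      have h3 : 3 / 4 * |α - A q| * ‖τ‖ ≤ ‖cx q.1 - S.z α q.2‖ := by
        have h4 := Complex.abs_re_le_norm ((cx q.1 - S.z α q.2) / τ)
        have h5 : ((cx q.1 - S.z α q.2) / τ).re = ((S.z (A q) q.2 - S.z α q.2) / τ).re := by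
          rw [hq5 α hα', Complex.add_re]; simp
        rw [h5, norm_div, le_div_iff₀ hτn] at h4
        refine le_trans ?_ h4
        rw [abs_sub_comm]
        exact mul_le_mul_of_nonneg_right (hre2 q.2 hq1.1 hq3 (A q) α hq4 hα') hτn.le
      have h6 : 0 < ‖cx q.1 - S.z α q.2‖ :=
        norm_pos_iff.2 fun h => hq2 α (by rw [h, sig_zero])
      rw [norm_div, div_le_div_iff₀ h6 (by positivity)]
      rw [Real.norm_eq_abs] at h1
      have hKK : 0 ≤ K₁ + K₃ * K₂ := by positivity
      calc ‖f α q.2 - g q * S.zα α q.2‖ * (3 / 4 * ‖τ‖)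
          ≤ ((K₁ + K₃ * K₂) * |α - A q|) * (3 / 4 * ‖τ‖) := by gcongr
        _ = (K₁ + K₃ * K₂) * (3 / 4 * |α - A q| * ‖τ‖) := by ring
        _ ≤ _ := by gcongr
    · have hae : ∀ᵐ α : ℝ, α ≠ α₀ := by simp [ae_iff]
      filter_upwards [hae] with α hne hα
      have hα' := hsub hα
      refine Tendsto.div ((hcompα hfc α).sub (hglim.mul (hcompα S.cont_zα α))) (hzlim α) ?_
      intro h
      exact hsig α ⟨by linarith [hα'.1], by linarith [hα'.2]⟩ hne (by rw [h, sig_zero])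
  have hnear_a₁ : a₁ ∈ Icc a₁ a₂ := ⟨le_rfl, by linarith⟩
  have hnear_a₂ : a₂ ∈ Icc a₁ a₂ := ⟨by linarith, le_rfl⟩
  have hall := ((hfar₁.add (hdiff.add (hglim.mul ((hloglim a₂ hnear_a₂ (by linarith)).neg.add
    (hloglim a₁ hnear_a₁ (by linarith)))))).add hreg).add hfar₂
  refine ⟨_, hall.congr' ?_⟩
  filter_upwards [hmem, hoff, hlog, hesigev] with q hq1 hq2 hq3 hq4
  have hne : ∀ α, cx q.1 - S.z α q.2 ≠ 0 := fun α h => hq2 α (by rw [h, sig_zero])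
  have hzc : Continuous fun α => cx q.1 - S.z α q.2 :=
    continuous_const.sub (continuous_slice S.cont_z hq1.1)
  have hfcq := continuous_slice hfc hq1.1
  have hzαq := continuous_slice S.cont_zα hq1.1
  have hkc : Continuous fun α => f α q.2 * bsKer G (cx q.1 - S.z α q.2) := by
    refine hfcq.mul ?_
    rw [continuous_iff_continuousAt]
    exact fun α => ContinuousAt.comp (f := fun α => cx q.1 - S.z α q.2) (x := α)
      (continuousAt_bsKer (hq2 α)) hzc.continuousAt
  have hi₁ : IntervalIntegrable (fun α => (f α q.2 - g q * S.zα α q.2) / (cx q.1 - S.z α q.2))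
      volume a₁ a₂ :=
    ((hfcq.sub (continuous_const.mul hzαq)).div hzc hne).intervalIntegrable _ _
  have hi₂ : IntervalIntegrable (fun α => S.zα α q.2 / (cx q.1 - S.z α q.2)) volume a₁ a₂ :=
    (hzαq.div hzc hne).intervalIntegrable _ _
  have hi₃ : IntervalIntegrable (fun α => f α q.2 * hker G (cx q.1 - S.z α q.2)) volume a₁ a₂ := by
    refine ContinuousOn.intervalIntegrable ?_
    rw [uIcc_of_le (by linarith)]
    exact hfcq.continuousOn.mul (hhkerc.comp hzc.continuousOn hq4)
  rw [← hq3, ← intervalIntegral.integral_const_mul,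
    ← intervalIntegral.integral_add hi₁ (hi₂.const_mul _)]
  rw [add_assoc (∫ α in c..a₁, _), ← intervalIntegral.integral_add (hi₁.add (hi₂.const_mul _)) hi₃,
    ← intervalIntegral.integral_add_adjacent_intervals (hkc.intervalIntegrable c a₁)
      (hkc.intervalIntegrable a₁ (c + 2 * Real.pi)),
    ← intervalIntegral.integral_add_adjacent_intervals (hkc.intervalIntegrable a₁ a₂)
      (hkc.intervalIntegrable a₂ (c + 2 * Real.pi)), add_assoc]
  congr 2
  refine intervalIntegral.integral_congr fun α _ => ?_
  rw [bsKer_eq (hq2 α)]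
  have := hne α
  field_simp
  ring

end Sheet

/-! ### Derivatives of potentials of the sheet -/

/-- Differentiation under the integral sign, for a derivative that is jointly continuous. -/
theorem hasDerivAt_integral_of_continuousOn {𝕜 : Type*} [RCLike 𝕜] [NormedSpace 𝕜 ℂ]
    {F F' : 𝕜 → ℝ → ℂ}
    {x₀ : 𝕜} {a b : ℝ} (hab : a ≤ b) {U : Set 𝕜} (hU : U ∈ 𝓝 x₀)
    (hF : ∀ x ∈ U, ContinuousOn (F x) (Icc a b))
    (hF' : ContinuousOn (fun y : 𝕜 × ℝ => F' y.1 y.2) (U ×ˢ Icc a b))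
    (hd : ∀ x ∈ U, ∀ α ∈ Icc a b, HasDerivAt (fun x => F x α) (F' x α) x) :
    HasDerivAt (fun x => ∫ α in a..b, F x α) (∫ α in a..b, F' x₀ α) x₀ := by
  obtain ⟨ε, hε, hεU⟩ := Metric.nhds_basis_closedBall.mem_iff.1 hU
  have hcomp : IsCompact (Metric.closedBall x₀ ε ×ˢ Icc a b) :=
    (isCompact_closedBall x₀ ε).prod isCompact_Icc
  obtain ⟨K, hK⟩ := hcomp.exists_bound_of_continuousOn (hF'.mono (prod_mono hεU Subset.rfl))
  have hsub : Ι a b ⊆ Icc a b := by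
    rw [uIoc_of_le hab]; exact Ioc_subset_Icc_self
  have hx₀ : x₀ ∈ U := mem_of_mem_nhds hU
  refine (intervalIntegral.hasDerivAt_integral_of_dominated_loc_of_deriv_le (F := F) (F' := F')
    (bound := fun _ => K) (Metric.closedBall_mem_nhds x₀ hε) ?_ ?_ ?_ ?_ intervalIntegrable_const ?_).2
  · filter_upwards [hU] with x hx
    exact ((hF x hx).mono hsub).aestronglyMeasurable measurableSet_uIoc
  · refine ContinuousOn.intervalIntegrable ?_
    rw [uIcc_of_le hab]; exact hF x₀ hx₀
  · refine ContinuousOn.aestronglyMeasurable (ContinuousOn.mono ?_ hsub) measurableSet_uIoc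
    exact hF'.comp (f := fun α : ℝ => (x₀, α)) (by fun_prop) (fun α hα => ⟨hx₀, hα⟩)
  · exact Eventually.of_forall fun α hα x hx => hK (x, α) ⟨hx, hsub hα⟩
  · exact Eventually.of_forall fun α hα x hx => hd x (hεU hx) α (hsub hα)

namespace Sheet

variable {G : Geometry} {T : ℝ} (S : Sheet G T) {Ω : Bool → ℝ → Set Plane}

theorem two_pi_window (c : ℝ) : c ≤ c + 2 * Real.pi := by linarith [Real.two_pi_pos]

/-- The potential `∫ f(α, t) k(x - z(α, t)) dα` of the sheet, over one period. -/
def cauchy (k : ℂ → ℂ) (f : ℝ → ℝ → ℂ) (c : ℝ) (x : ℂ) (t : ℝ) : ℂ :=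
  ∫ α in c..c + 2 * Real.pi, f α t * k (x - S.z α t)

theorem continuousOn_kernel {F : ℝ → ℝ → ℂ}
    (hF : ContinuousOn (fun q : ℝ × ℝ => F q.1 q.2) (univ ×ˢ Ico 0 T)) {φ : ℂ → ℂ}
    (hφ : ContinuousOn φ {w | sig G w ≠ 0}) :
    ContinuousOn (fun y : (ℂ × ℝ) × ℝ => F y.2 y.1.2 * φ (y.1.1 - S.z y.2 y.1.2))
      {y | y.1.2 ∈ Ico 0 T ∧ S.Off y.1.2 y.1.1} := by
  have h1 : ∀ {F : ℝ → ℝ → ℂ}, ContinuousOn (fun q : ℝ × ℝ => F q.1 q.2) (univ ×ˢ Ico 0 T) →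
      ContinuousOn (fun y : (ℂ × ℝ) × ℝ => F y.2 y.1.2) {y | y.1.2 ∈ Ico 0 T ∧ S.Off y.1.2 y.1.1} :=
    fun {F} hF => hF.comp (f := fun y : (ℂ × ℝ) × ℝ => (y.2, y.1.2)) (by fun_prop)
      (fun y hy => ⟨mem_univ _, hy.1⟩)
  refine (h1 hF).mul (hφ.comp (ContinuousOn.sub (by fun_prop) (h1 S.cont_z)) ?_)
  exact fun y hy => hy.2 _

theorem continuousOn_bsKer (G : Geometry) : ContinuousOn (bsKer G) {w | sig G w ≠ 0} := fun _ hw =>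
  (continuousAt_bsKer hw).continuousWithinAt

theorem isOpen_off {t : ℝ} (ht : t ∈ Ico 0 T) : IsOpen {x : ℂ | S.Off t x} := by
  rw [isOpen_iff_mem_nhds]
  intro x hx
  have h1 := S.eventually_off (q₀ := (cx.symm x, t)) ⟨mem_univ _, ht⟩ (by simpa using hx)
  rw [eventually_nhdsWithin_iff] at h1
  have hc : ContinuousAt (fun x : ℂ => ((cx.symm x, t) : SpaceTime)) x :=
    (cx.symm.continuous.prodMk continuous_const).continuousAt
  filter_upwards [hc.eventually h1] with y hy
  simpa using hy ⟨mem_univ _, ht⟩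

theorem eventually_off_time {t : ℝ} (ht : t ∈ Ioo 0 T) {x : ℂ} (hx : S.Off t x) :
    ∀ᶠ s in 𝓝 t, s ∈ Ioo 0 T ∧ S.Off s x := by
  have h1 := S.eventually_off (q₀ := (cx.symm x, t)) ⟨mem_univ _, ht.1.le, ht.2⟩ (by simpa using hx)
  rw [eventually_nhdsWithin_iff] at h1
  have hc : ContinuousAt (fun s : ℝ => ((cx.symm x, s) : SpaceTime)) t :=
    (continuous_const.prodMk continuous_id).continuousAt
  filter_upwards [hc.eventually h1, isOpen_Ioo.mem_nhds ht] with s hs hs2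
  exact ⟨hs2, by simpa using hs ⟨mem_univ _, hs2.1.le, hs2.2⟩⟩

theorem continuousWithinAt_cauchy {F : ℝ → ℝ → ℂ}
    (hF : ContinuousOn (fun q : ℝ × ℝ => F q.1 q.2) (univ ×ˢ Ico 0 T)) {φ : ℂ → ℂ}
    (hφ : ContinuousOn φ {w | sig G w ≠ 0}) (c : ℝ) {q : SpaceTime} (hq : q ∈ slab₀ T)
    (hoff : S.Off q.2 (cx q.1)) :
    ContinuousWithinAt (fun q : SpaceTime => S.cauchy φ F c (cx q.1) q.2) (slab₀ T) q :=
  S.tendsto_integral_kernel hF (isOpen_sig_ne G) hφ (two_pi_window c) hq fun _ _ => hoff _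

theorem hasDerivAt_cauchy {F : ℝ → ℝ → ℂ}
    (hF : ContinuousOn (fun q : ℝ × ℝ => F q.1 q.2) (univ ×ˢ Ico 0 T)) (c : ℝ) {t : ℝ}
    (ht : t ∈ Ico 0 T) {x : ℂ} (hx : S.Off t x) :
    HasDerivAt (fun x => S.cauchy (bsKer G) F c x t) (S.cauchy (deriv (bsKer G)) F c x t) x := by
  have hk : ∀ {φ : ℂ → ℂ}, ContinuousOn φ {w | sig G w ≠ 0} →
      ContinuousOn (fun y : ℂ × ℝ => F y.2 t * φ (y.1 - S.z y.2 t))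
        ({x | S.Off t x} ×ˢ Icc c (c + 2 * Real.pi)) := fun {φ} hφ =>
    (S.continuousOn_kernel hF hφ).comp (f := fun y : ℂ × ℝ => ((y.1, t), y.2)) (by fun_prop)
      (fun y hy => ⟨ht, hy.1⟩)
  refine hasDerivAt_integral_of_continuousOn (two_pi_window c)
    (F := fun x α => F α t * bsKer G (x - S.z α t))
    (F' := fun x α => F α t * deriv (bsKer G) (x - S.z α t))
    ((S.isOpen_off ht).mem_nhds hx) ?_ (hk (continuousOn_deriv_bsKer G)) ?_
  · intro x hx
    exact (hk (continuousOn_bsKer G)).comp (f := fun α : ℝ => (x, α)) (by fun_prop)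
      (fun α hα => ⟨hx, hα⟩)
  · intro x hx α _
    have h1 := (differentiableAt_bsKer (hx α)).hasDerivAt.comp_sub_const x (S.z α t)
    exact h1.const_mul _

theorem hasDerivAt_cauchy_time {F Ft : ℝ → ℝ → ℂ}
    (hF : ContinuousOn (fun q : ℝ × ℝ => F q.1 q.2) (univ ×ˢ Ico 0 T))
    (hFt : ContinuousOn (fun q : ℝ × ℝ => Ft q.1 q.2) (univ ×ˢ Ico 0 T))
    (hd : ∀ t ∈ Ico 0 T, ∀ α, HasDerivWithinAt (fun s => F α s) (Ft α t) (Ico 0 T) t) (c : ℝ) {t : ℝ}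
    (ht : t ∈ Ioo 0 T) {x : ℂ} (hx : S.Off t x) :
    HasDerivAt (fun t => S.cauchy (bsKer G) F c x t) (S.cauchy (bsKer G) Ft c x t
      - S.cauchy (deriv (bsKer G)) (fun α t => F α t * S.zt α t) c x t) t := by
  have hU := S.eventually_off_time ht hx
  set U := {s | s ∈ Ioo 0 T ∧ S.Off s x}
  have hUI : ∀ s ∈ U, s ∈ Ico 0 T := fun s hs => ⟨hs.1.1.le, hs.1.2⟩
  have hk : ∀ {F : ℝ → ℝ → ℂ}, ContinuousOn (fun q : ℝ × ℝ => F q.1 q.2) (univ ×ˢ Ico 0 T) →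
      ∀ {φ : ℂ → ℂ}, ContinuousOn φ {w | sig G w ≠ 0} →
      ContinuousOn (fun y : ℝ × ℝ => F y.2 y.1 * φ (x - S.z y.2 y.1))
        (U ×ˢ Icc c (c + 2 * Real.pi)) := fun {F} hF {φ} hφ =>
    (S.continuousOn_kernel hF hφ).comp (f := fun y : ℝ × ℝ => ((x, y.1), y.2)) (by fun_prop)
      (fun y hy => ⟨hUI _ hy.1, hy.1.2⟩)
  have hFz : ContinuousOn (fun q : ℝ × ℝ => F q.1 q.2 * S.zt q.1 q.2) (univ ×ˢ Ico 0 T) :=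
    hF.mul S.cont_zt
  have hs : ∀ {F : ℝ → ℝ → ℂ}, ContinuousOn (fun q : ℝ × ℝ => F q.1 q.2) (univ ×ˢ Ico 0 T) →
      ∀ {φ : ℂ → ℂ}, ContinuousOn φ {w | sig G w ≠ 0} → ∀ s ∈ U,
      ContinuousOn (fun α => F α s * φ (x - S.z α s)) (Icc c (c + 2 * Real.pi)) :=
    fun {F} hF {φ} hφ s hs => (hk hF hφ).comp (f := fun α : ℝ => (s, α)) (by fun_prop)
      (fun α hα => ⟨hs, hα⟩)
  have hmem : t ∈ U := ⟨ht, hx⟩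
  have h := hasDerivAt_integral_of_continuousOn (two_pi_window c)
    (F := fun s α => F α s * bsKer G (x - S.z α s))
    (F' := fun s α => Ft α s * bsKer G (x - S.z α s)
      - F α s * S.zt α s * deriv (bsKer G) (x - S.z α s)) hU
    (fun s hsU => hs hF (continuousOn_bsKer G) s hsU)
    ((hk hFt (continuousOn_bsKer G)).sub (hk (F := fun α t => F α t * S.zt α t) hFz (continuousOn_deriv_bsKer G))) ?_
  · rw [intervalIntegral.integral_sub] at h
    · exact h
    · refine ContinuousOn.intervalIntegrable ?_
      rw [uIcc_of_le (two_pi_window c)]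
      exact hs hFt (continuousOn_bsKer G) t hmem
    · refine ContinuousOn.intervalIntegrable ?_
      rw [uIcc_of_le (two_pi_window c)]
      exact hs (F := fun α t => F α t * S.zt α t) hFz (continuousOn_deriv_bsKer G) t hmem
  · intro s hsU α _
    have hn : Ico 0 T ∈ 𝓝 s := Ico_mem_nhds hsU.1.1 hsU.1.2
    have h1 := (hd s (hUI s hsU) α).hasDerivAt hn
    have h2 := ((S.hasDerivT_z s (hUI s hsU) α).hasDerivAt hn).const_sub x
    have h3 := (differentiableAt_bsKer (hsU.2 α)).hasDerivAt.comp s h2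
    refine (h1.mul h3).congr_deriv ?_
    simp only [Function.comp_apply]
    ring

/-! ### The velocity and its time derivative -/

/-- The strength of the sheet, as a complex function. -/
def wc (α t : ℝ) : ℂ := S.w α t

theorem cont_wc : ContinuousOn (fun q : ℝ × ℝ => S.wc q.1 q.2) (univ ×ˢ Ico 0 T) :=
  Complex.continuous_ofReal.comp_continuousOn S.cont_w

theorem cont_wtc : ContinuousOn (fun q : ℝ × ℝ => (S.wt q.1 q.2 : ℂ)) (univ ×ˢ Ico 0 T) :=
  Complex.continuous_ofReal.comp_continuousOn S.cont_wt

/-- The conjugate `v₁ - i v₂` of the velocity that the Biot-Savart law assigns to the sheet. -/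
def vel (x : ℂ) (t : ℝ) : ℂ := (2 * Real.pi * Complex.I)⁻¹ * S.cauchy (bsKer G) S.wc (-Real.pi) x t

theorem vel_eq (c : ℝ) (x : ℂ) {t : ℝ} (ht : t ∈ Ico 0 T) :
    S.vel x t = (2 * Real.pi * Complex.I)⁻¹ * S.cauchy (bsKer G) S.wc c x t := by
  have hp : Function.Periodic (fun α => S.wc α t * bsKer G (x - S.z α t)) (2 * Real.pi) := by
    intro α
    simp only [wc]
    rw [S.w_period t ht, S.period t ht]
    have := bsKer_add_int_shift G (x - S.z α t) (-1)
    rw [← this]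
    congr 2
    push_cast; ring
  rw [vel, cauchy, cauchy, hp.intervalIntegral_add_eq (-Real.pi) c]

/-- The complex derivative of the velocity. -/
def velDeriv (x : ℂ) (t : ℝ) : ℂ :=
  (2 * Real.pi * Complex.I)⁻¹ * S.cauchy (deriv (bsKer G)) S.wc (-Real.pi) x t

/-- The time derivative of the velocity, computed on the period that starts at `c`. -/
def velTime (c : ℝ) (x : ℂ) (t : ℝ) : ℂ :=
  (2 * Real.pi * Complex.I)⁻¹ * (S.cauchy (bsKer G) (fun α t => (S.wt α t : ℂ)) c x t
      - S.cauchy (deriv (bsKer G)) (fun α t => S.wc α t * S.zt α t) c x t)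

theorem hasDerivAt_vel {t : ℝ} (ht : t ∈ Ico 0 T) {x : ℂ} (hx : S.Off t x) :
    HasDerivAt (fun x => S.vel x t) (S.velDeriv x t) x :=
  (S.hasDerivAt_cauchy S.cont_wc (-Real.pi) ht hx).const_mul _

theorem hasDerivAt_vel_time (c : ℝ) {t : ℝ} (ht : t ∈ Ioo 0 T) {x : ℂ} (hx : S.Off t x) :
    HasDerivAt (fun t => S.vel x t) (S.velTime c x t) t := by
  have h := (S.hasDerivAt_cauchy_time (F := S.wc) (Ft := fun α t => (S.wt α t : ℂ)) S.cont_wc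
    S.cont_wtc (fun t ht α => by
      have := Complex.ofRealCLM.hasFDerivAt.comp_hasDerivWithinAt t (S.hasDerivT_w t ht α)
      exact this) c ht hx).const_mul (2 * Real.pi * Complex.I)⁻¹
  refine h.congr_of_eventuallyEq ?_
  filter_upwards [isOpen_Ioo.mem_nhds ht] with s hs
  exact S.vel_eq c x ⟨hs.1.le, hs.2⟩

theorem continuousWithinAt_vel {q : SpaceTime} (hq : q ∈ slab₀ T) (hoff : S.Off q.2 (cx q.1)) :
    ContinuousWithinAt (fun q : SpaceTime => S.vel (cx q.1) q.2) (slab₀ T) q :=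
  continuousWithinAt_const.mul
    (S.continuousWithinAt_cauchy S.cont_wc (continuousOn_bsKer G) _ hq hoff)

theorem continuousWithinAt_velDeriv {q : SpaceTime} (hq : q ∈ slab₀ T)
    (hoff : S.Off q.2 (cx q.1)) :
    ContinuousWithinAt (fun q : SpaceTime => S.velDeriv (cx q.1) q.2) (slab₀ T) q :=
  continuousWithinAt_const.mul
    (S.continuousWithinAt_cauchy S.cont_wc (continuousOn_deriv_bsKer G) _ hq hoff)

theorem continuousWithinAt_velTime (c : ℝ) {q : SpaceTime} (hq : q ∈ slab₀ T)
    (hoff : S.Off q.2 (cx q.1)) :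
    ContinuousWithinAt (fun q : SpaceTime => S.velTime c (cx q.1) q.2) (slab₀ T) q :=
  continuousWithinAt_const.mul
    ((S.continuousWithinAt_cauchy S.cont_wtc (continuousOn_bsKer G) _ hq hoff).sub
      (S.continuousWithinAt_cauchy (F := fun α t => S.wc α t * S.zt α t)
        (S.cont_wc.mul S.cont_zt) (continuousOn_deriv_bsKer G) _ hq hoff))

/-! ### A potential of the acceleration -/

/-- The primitive of `∂_t ϖ` along the curve that vanishes at `α = c`. It need not be periodic. -/
def prim (c α t : ℝ) : ℂ := ∫ a in c..α, (S.wt a t : ℂ)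

theorem hasDerivAt_prim (c : ℝ) {t : ℝ} (ht : t ∈ Ico 0 T) (α : ℝ) :
    HasDerivAt (fun α => S.prim c α t) (S.wt α t : ℂ) α :=
  ((continuous_slice (F := fun α t => (S.wt α t : ℂ)) S.cont_wtc ht).integral_hasStrictDerivAt c α).hasDerivAt

theorem cont_prim (c : ℝ) : ContinuousOn (fun q : ℝ × ℝ => S.prim c q.1 q.2) (univ ×ˢ Ico 0 T) := by
  have e : (fun q : ℝ × ℝ => S.prim c q.1 q.2) = fun q : ℝ × ℝ =>
      ∫ s in (0 : ℝ)..1, ((q.1 - c : ℝ) : ℂ) * (S.wt (c + (q.1 - c) * s) q.2 : ℂ) := by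
    funext q
    have := intervalIntegral.smul_integral_comp_add_mul (a := 0) (b := 1)
      (fun a => (S.wt a q.2 : ℂ)) (q.1 - c) c
    rw [intervalIntegral.integral_const_mul, ← Complex.real_smul, this, prim]
    congr 1 <;> ring
  rw [e]
  intro q hq
  have hc : ContinuousOn (fun y : (ℝ × ℝ) × ℝ =>
      ((y.1.1 - c : ℝ) : ℂ) * (S.wt (c + (y.1.1 - c) * y.2) y.1.2 : ℂ))
      ((univ ×ˢ Ico 0 T) ×ˢ univ) := by
    refine ContinuousOn.mul (Continuous.continuousOn (by fun_prop)) ?_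
    exact S.cont_wtc.comp (f := fun y : (ℝ × ℝ) × ℝ => (c + (y.1.1 - c) * y.2, y.1.2))
      (by fun_prop) (fun y hy => ⟨mem_univ _, hy.1.2⟩)
  refine tendsto_integral_of_continuousWithinAt
    (F := fun (q : ℝ × ℝ) s => ((q.1 - c : ℝ) : ℂ) * (S.wt (c + (q.1 - c) * s) q.2 : ℂ))
    hq zero_le_one (fun s _ => hc (q, s) ⟨hq, mem_univ _⟩) ?_
  filter_upwards [self_mem_nhdsWithin] with q' hq'
  exact hc.comp (f := fun s : ℝ => (q', s)) (by fun_prop) (fun s _ => ⟨hq', mem_univ _⟩)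

/-- The density of the potential of the acceleration. -/
def accDensity (c α t : ℝ) : ℂ := S.prim c α t * S.zα α t - S.wc α t * S.zt α t

theorem cont_accDensity (c : ℝ) :
    ContinuousOn (fun q : ℝ × ℝ => S.accDensity c q.1 q.2) (univ ×ˢ Ico 0 T) :=
  ((S.cont_prim c).mul S.cont_zα).sub (S.cont_wc.mul S.cont_zt)

/-- A complex potential of `∂_t (v₁ - i v₂)`, on both sides of the sheet. It is obtained from
the logarithmic potential of `∂_t ϖ` by integration by parts on the period that starts at `c`; the
boundary term is a logarithm, for which `σ₀` selects a branch. -/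
def accPot (c : ℝ) (σ₀ x : ℂ) (t : ℝ) : ℂ :=
  (2 * Real.pi * Complex.I)⁻¹ * (S.cauchy (bsKer G) (S.accDensity c) c x t
    + S.prim c (c + 2 * Real.pi) t * Complex.log (sig G (x - S.z c t) / σ₀))

theorem hasDerivAt_accPot (c : ℝ) {σ₀ : ℂ} (hσ₀ : σ₀ ≠ 0) {t : ℝ} (ht : t ∈ Ico 0 T) {x : ℂ}
    (hx : S.Off t x) (hs : sig G (x - S.z c t) / σ₀ ∈ Complex.slitPlane) :
    HasDerivAt (fun x => S.accPot c σ₀ x t) (S.velTime c x t) x := by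
  have h1 := S.hasDerivAt_cauchy (S.cont_accDensity c) c ht hx
  have h2 : HasDerivAt (fun x => Complex.log (sig G (x - S.z c t) / σ₀)) (bsKer G (x - S.z c t)) x := by
    have h3 := (((hasDerivAt_sig G (x - S.z c t)).comp_sub_const x (S.z c t)).div_const σ₀).clog hs
    refine h3.congr_deriv ?_
    rw [bsKer]
    have := hx c
    field_simp
  refine ((h1.add (h2.const_mul (S.prim c (c + 2 * Real.pi) t))).const_mul _).congr_deriv ?_
  rw [velTime]
  congr 1
  have hzc : Continuous fun α => x - S.z α t :=
    continuous_const.sub (continuous_slice S.cont_z ht)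
  have hk : ∀ {φ : ℂ → ℂ}, ContinuousOn φ {w | sig G w ≠ 0} →
      Continuous fun α => φ (x - S.z α t) := fun {φ} hφ =>
    continuousOn_univ.1 (hφ.comp hzc.continuousOn fun α _ => hx α)
  have hpr := continuous_slice (S.cont_prim c) ht
  have hzα := continuous_slice S.cont_zα ht
  have hwt := continuous_slice (F := fun α t => (S.wt α t : ℂ)) S.cont_wtc ht
  have hwz := (continuous_slice S.cont_wc ht).mul (continuous_slice S.cont_zt ht)
  have hk0 := hk (continuousOn_bsKer G)
  have hk1 := hk (continuousOn_deriv_bsKer G)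
  -- integration by parts along the curve; the kernel takes the same value at both ends, where the
  -- primitive is `0` and the total of `∂_t ϖ`
  have hparts : ∫ α in c..c + 2 * Real.pi, ((S.wt α t : ℂ) * bsKer G (x - S.z α t)
      - S.prim c α t * S.zα α t * deriv (bsKer G) (x - S.z α t))
      = S.prim c (c + 2 * Real.pi) t * bsKer G (x - S.z c t) := by
    rw [intervalIntegral.integral_eq_sub_of_hasDerivAt
      (f := fun α => S.prim c α t * bsKer G (x - S.z α t))]
    · have h4 : S.prim c c t = 0 := intervalIntegral.integral_same
      rw [h4, zero_mul, sub_zero, S.period t ht]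
      congr 1
      have := bsKer_add_int_shift G (x - S.z c t) (-1)
      rw [← this]
      congr 1
      push_cast; ring
    · intro α _
      have h5 := (differentiableAt_bsKer (hx α)).hasDerivAt.comp α
        ((S.hasDeriv_z t ht α).const_sub x)
      refine ((S.hasDerivAt_prim c ht α).mul h5).congr_deriv ?_
      simp only [Function.comp_apply]
      ring
    · exact ((hwt.mul hk0).sub ((hpr.mul hzα).mul hk1)).intervalIntegrable _ _
  rw [← hparts, cauchy, cauchy, cauchy, ← intervalIntegral.integral_add, ← intervalIntegral.integral_sub]
  · refine intervalIntegral.integral_congr fun α _ => ?_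
    simp only [accDensity]
    ring
  · exact (hwt.mul hk0).intervalIntegrable _ _
  · exact (hwz.mul hk1).intervalIntegrable _ _
  · exact ((continuous_slice (S.cont_accDensity c) ht).mul hk1).intervalIntegrable _ _
  · exact ((hwt.mul hk0).sub ((hpr.mul hzα).mul hk1)).intervalIntegrable _ _

/-- The points of space-time at which the branch of the logarithm in `accPot` is holomorphic. -/
def Branch (c : ℝ) (σ₀ : ℂ) (q : SpaceTime) : Prop :=
  sig G (cx q.1 - S.z c q.2) / σ₀ ∈ Complex.slitPlane

theorem continuousWithinAt_sig (c : ℝ) (σ₀ : ℂ) {q : SpaceTime} (hq : q ∈ slab₀ T) :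
    ContinuousWithinAt (fun q : SpaceTime => sig G (cx q.1 - S.z c q.2) / σ₀) (slab₀ T) q := by
  have h1 : ContinuousOn (fun q : SpaceTime => cx q.1 - S.z c q.2) (slab₀ T) :=
    S.continuousOn_sub.comp (f := fun q : SpaceTime => (q, c)) (by fun_prop)
      (fun q hq => ⟨hq, mem_univ _⟩)
  exact (((continuous_sig G).comp_continuousOn h1).div_const σ₀) q hq

theorem eventually_branch {c : ℝ} {σ₀ : ℂ} {q : SpaceTime} (hq : q ∈ slab₀ T)
    (h : S.Branch c σ₀ q) : ∀ᶠ q' in 𝓝[slab₀ T] q, S.Branch c σ₀ q' :=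
  (S.continuousWithinAt_sig c σ₀ hq).eventually (Complex.isOpen_slitPlane.mem_nhds h)

theorem continuousWithinAt_accLog {c : ℝ} {σ₀ : ℂ} {q : SpaceTime} (hq : q ∈ slab₀ T)
    (h : S.Branch c σ₀ q) :
    ContinuousWithinAt (fun q : SpaceTime => S.prim c (c + 2 * Real.pi) q.2 *
      Complex.log (sig G (cx q.1 - S.z c q.2) / σ₀)) (slab₀ T) q := by
  have h1 : ContinuousOn (fun q : SpaceTime => S.prim c (c + 2 * Real.pi) q.2) (slab₀ T) :=
    (S.cont_prim c).comp (f := fun q : SpaceTime => (c + 2 * Real.pi, q.2)) (by fun_prop)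
      (fun q hq => ⟨mem_univ _, hq.2⟩)
  exact (h1 q hq).mul ((S.continuousWithinAt_sig c σ₀ hq).clog h)

theorem continuousWithinAt_accPot {c : ℝ} {σ₀ : ℂ} {q : SpaceTime} (hq : q ∈ slab₀ T)
    (hoff : S.Off q.2 (cx q.1)) (h : S.Branch c σ₀ q) :
    ContinuousWithinAt (fun q : SpaceTime => S.accPot c σ₀ (cx q.1) q.2) (slab₀ T) q :=
  continuousWithinAt_const.mul ((S.continuousWithinAt_cauchy (S.cont_accDensity c)
    (continuousOn_bsKer G) _ hq hoff).add (S.continuousWithinAt_accLog hq h))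

/-- The velocity has one-sided limits at the sheet. -/
theorem exists_limit_vel (hΩ : Sides S Ω) (α₀ : ℝ) {t₀ : ℝ} (ht₀ : t₀ ∈ Ico 0 T) (b : Bool) :
    ∃ L : ℂ, Tendsto (fun q : SpaceTime => S.vel (cx q.1) q.2)
      (𝓝[fluidRegion T (Ω b)] (cx.symm (S.z α₀ t₀), t₀)) (𝓝 L) := by
  obtain ⟨L, hL⟩ := S.exists_limit hΩ (f := S.wc) (fα := fun α t => (S.wα α t : ℂ))
    (fun t ht α => Complex.ofRealCLM.hasFDerivAt.comp_hasDerivAt α (S.hasDeriv_w t ht α))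
    S.cont_wc (Complex.continuous_ofReal.comp_continuousOn S.cont_wα)
    (c := α₀ - Real.pi) (α₀ := α₀) ⟨by linarith [Real.pi_pos], by linarith [Real.pi_pos]⟩ ht₀ b
  refine ⟨_, (hL.const_mul (2 * Real.pi * Complex.I)⁻¹).congr' ?_⟩
  filter_upwards [self_mem_nhdsWithin] with q hq
  exact (S.vel_eq _ _ hq.1).symm

/-- The potential of the acceleration has one-sided limits at the sheet. -/
theorem exists_limit_accPot (hΩ : Sides S Ω) {c α₀ : ℝ} (hα₀ : α₀ ∈ Ioo c (c + 2 * Real.pi))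
    {σ₀ : ℂ} {t₀ : ℝ} (ht₀ : t₀ ∈ Ico 0 T)
    (h : S.Branch c σ₀ (cx.symm (S.z α₀ t₀), t₀)) (b : Bool) :
    ∃ L : ℂ, Tendsto (fun q : SpaceTime => S.accPot c σ₀ (cx q.1) q.2)
      (𝓝[fluidRegion T (Ω b)] (cx.symm (S.z α₀ t₀), t₀)) (𝓝 L) := by
  have hq₀ : ((cx.symm (S.z α₀ t₀), t₀) : SpaceTime) ∈ slab₀ T := ⟨mem_univ _, ht₀⟩
  obtain ⟨L, hL⟩ := S.exists_limit hΩ (f := S.accDensity c)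
    (fα := fun α t => ((S.wt α t : ℂ) * S.zα α t + S.prim c α t * S.zαα α t)
      - ((S.wα α t : ℂ) * S.zt α t + S.wc α t * S.ztα α t))
    (fun t ht α => by
      have h1 : HasDerivAt (fun α => S.wc α t) (S.wα α t : ℂ) α :=
        Complex.ofRealCLM.hasFDerivAt.comp_hasDerivAt α (S.hasDeriv_w t ht α)
      exact ((S.hasDerivAt_prim c ht α).mul (S.hasDeriv_zα t ht α)).sub
        (h1.mul (S.hasDeriv_zt t ht α)))
    (S.cont_accDensity c)
    (((S.cont_wtc.mul S.cont_zα).add ((S.cont_prim c).mul S.cont_zαα)).sub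
      (((Complex.continuous_ofReal.comp_continuousOn S.cont_wα).mul S.cont_zt).add
        (S.cont_wc.mul S.cont_ztα))) hα₀ ht₀ b
  have hl : 𝓝[fluidRegion T (Ω b)] ((cx.symm (S.z α₀ t₀), t₀) : SpaceTime)
      ≤ 𝓝[slab₀ T] (cx.symm (S.z α₀ t₀), t₀) :=
    nhdsWithin_mono _ fun q hq => ⟨mem_univ _, hq.1⟩
  exact ⟨_, (hL.add ((S.continuousWithinAt_accLog hq₀ h).tendsto.mono_left hl)).const_mul _⟩

end Sheet

/-! ### Integration by parts and the Cauchy-Pompeiu formula -/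

theorem integrable_mul_of_continuousOn {E A : Type*} [TopologicalSpace E] [T2Space E]
    [MeasurableSpace E] [OpensMeasurableSpace E]
    [RCLike A] {μ : Measure E} [IsFiniteMeasureOnCompacts μ] {f g : E → A} {K : Set E}
    (hK : IsCompact K)
    (hf : ContinuousOn f K) (hg : ContinuousOn g K) (hgK : ∀ x, x ∉ K → g x = 0) :
    Integrable (fun x => f x * g x) μ := by
  have h : IntegrableOn (fun x => f x * g x) K μ := (hf.mul hg).integrableOn_compact hK
  refine (integrableOn_iff_integrable_of_support_subset fun x hx => ?_).1 h
  by_contra hn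
  exact hx (by simp [hgK x hn])

theorem fderiv_eq_zero_of_notMem_tsupport {E A : Type*} [NormedAddCommGroup E] [NormedSpace ℝ E]
    [NormedAddCommGroup A] [NormedSpace ℝ A] {g : E → A} {x : E} (hx : x ∉ tsupport g) :
    fderiv ℝ g x = 0 :=
  image_eq_zero_of_notMem_tsupport fun h => hx (tsupport_fderiv_subset ℝ h)

/-- Integration by parts against a compactly supported function; the other factor need only be
differentiable on the support. -/
theorem integral_mul_fderiv {E A : Type*} [NormedAddCommGroup E] [NormedSpace ℝ E]
    [FiniteDimensional ℝ E] [MeasurableSpace E] [BorelSpace E] [RCLike A]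
    {μ : Measure E} [μ.IsAddHaarMeasure]
    {f f' g : E → A} {v : E} (hg : ContDiff ℝ 1 g) (hgc : HasCompactSupport g)
    (hf : ContinuousOn f (tsupport g)) (hf' : ContinuousOn f' (tsupport g))
    (hd : ∀ x ∈ tsupport g, HasLineDerivAt ℝ f (f' x) x v) :
    ∫ x, f x * fderiv ℝ g x v ∂μ = -∫ x, f' x * g x ∂μ := by
  have hg' : Continuous fun x => fderiv ℝ g x v :=
    (hg.continuous_fderiv one_ne_zero).clm_apply continuous_const
  refine integral_bilinear_hasLineDerivAt_right_eq_neg_left_of_integrable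
    (B := ContinuousLinearMap.mul ℝ A) ?_ ?_ ?_ hd ?_
  · exact integrable_mul_of_continuousOn hgc hf' hg.continuous.continuousOn
      fun x hx => image_eq_zero_of_notMem_tsupport hx
  · exact integrable_mul_of_continuousOn hgc hf hg'.continuousOn fun x hx => by
      rw [fderiv_eq_zero_of_notMem_tsupport hx]; rfl
  · exact integrable_mul_of_continuousOn hgc hf hg.continuous.continuousOn
      fun x hx => image_eq_zero_of_notMem_tsupport hx
  · exact fun x _ => ((hg.differentiable one_ne_zero x).hasFDerivAt.hasLineDerivAt v)

/-- The operator `∂₁ + i ∂₂`. -/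
def dbar (g : Plane → ℂ) (x : Plane) : ℂ :=
  fderiv ℝ g x (1, 0) + Complex.I * fderiv ℝ g x (0, 1)

theorem continuous_dbar {g : Plane → ℂ} (hg : ContDiff ℝ 1 g) : Continuous (dbar g) :=
  ((hg.continuous_fderiv one_ne_zero).clm_apply continuous_const).add
    (continuous_const.mul ((hg.continuous_fderiv one_ne_zero).clm_apply continuous_const))

theorem dbar_eq_zero {g : Plane → ℂ} {x : Plane} (hx : x ∉ tsupport g) : dbar g x = 0 := by
  simp [dbar, fderiv_eq_zero_of_notMem_tsupport hx]

theorem hasCompactSupport_dbar {g : Plane → ℂ} (hg : HasCompactSupport g) :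
    HasCompactSupport (dbar g) :=
  HasCompactSupport.intro hg fun _ hx => dbar_eq_zero hx

/-- A holomorphic function is annihilated by `∂₁ + i ∂₂`, in the weak sense. -/
theorem integral_holomorphic_mul_dbar {g : Plane → ℂ} (hg : ContDiff ℝ 1 g)
    (hgc : HasCompactSupport g) {f : ℂ → ℂ} {U : Set ℂ} (hU : IsOpen U)
    (hf : DifferentiableOn ℂ f U) (hgU : ∀ x ∈ tsupport g, cx x ∈ U) :
    ∫ x, f (cx x) * dbar g x = 0 := by
  have hfc : ContinuousOn (fun x => f (cx x)) (tsupport g) :=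
    hf.continuousOn.comp (f := fun x : Plane => cx x) cx.continuous.continuousOn hgU
  have hfc' : ContinuousOn (fun x => deriv f (cx x)) (tsupport g) :=
    (hf.deriv hU).continuousOn.comp (f := fun x : Plane => cx x) cx.continuous.continuousOn hgU
  have hd : ∀ x ∈ tsupport g, ∀ v : Plane,
      HasLineDerivAt ℝ (fun x => f (cx x)) (deriv f (cx x) * cx v) x v := by
    intro x hx v
    have h1 := (hf.differentiableAt (hU.mem_nhds (hgU x hx))).hasDerivAt.hasFDerivAt.restrictScalars ℝ
    have h2 := (h1.comp x cx.toContinuousLinearMap.hasFDerivAt).hasLineDerivAt v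
    refine (h2 : HasLineDerivAt ℝ (fun x => f (cx x)) _ x v).congr_deriv ?_
    simp [mul_comm]
  have hi : ∀ v : Plane, Integrable fun x => f (cx x) * fderiv ℝ g x v := fun v =>
    integrable_mul_of_continuousOn hgc hfc
      ((hg.continuous_fderiv one_ne_zero).clm_apply continuous_const).continuousOn fun x hx => by
        rw [fderiv_eq_zero_of_notMem_tsupport hx]; rfl
  have h1 := integral_mul_fderiv (μ := volume) hg hgc hfc
    (hfc'.mul continuousOn_const) (fun x hx => hd x hx (1, 0))
  have h2 := integral_mul_fderiv (μ := volume) hg hgc hfc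
    (hfc'.mul continuousOn_const) (fun x hx => hd x hx (0, 1))
  have e : (fun x => f (cx x) * dbar g x) = fun x => f (cx x) * fderiv ℝ g x (1, 0)
      + Complex.I * (f (cx x) * fderiv ℝ g x (0, 1)) := by
    funext x; rw [dbar]; ring
  rw [e, integral_add (hi _) ((hi _).const_mul _), integral_const_mul, h1, h2,
    ← integral_neg, ← integral_neg, ← integral_const_mul]
  rw [← integral_add]
  · have : ∀ x, -(deriv f (cx x) * cx (1, 0) * g x)
        + Complex.I * -(deriv f (cx x) * cx (0, 1) * g x) = 0 := fun x => by
      have e1 : cx (1, 0) = 1 := by simp [cx_mk]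
      have e2 : cx (0, 1) = Complex.I := by simp [cx_mk]
      rw [e1, e2]
      linear_combination (-(deriv f (cx x)) * g x) * Complex.I_mul_I
    exact (integral_congr_ae (Eventually.of_forall this)).trans (integral_zero _ _)
  all_goals
    first
    | exact (integrable_mul_of_continuousOn hgc (hfc'.mul continuousOn_const)
        hg.continuous.continuousOn fun x hx => image_eq_zero_of_notMem_tsupport hx).neg
    | exact (integrable_mul_of_continuousOn hgc (hfc'.mul continuousOn_const)
        hg.continuous.continuousOn fun x hx => image_eq_zero_of_notMem_tsupport hx).neg.const_mul _

/-- The unit vector of angle `θ`. -/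
def ray (θ : ℝ) : Plane := (Real.cos θ, Real.sin θ)

theorem cx_ray (θ : ℝ) : cx (ray θ) = Complex.exp (θ * Complex.I) := by
  rw [ray, cx_mk, Complex.exp_mul_I]; simp

theorem norm_smul_ray {r θ R : ℝ} (hR : R < |r|) {K : Set Plane}
    (hK : ∀ x ∈ K, ‖cx x‖ ≤ R) : r • ray θ ∉ K := by
  intro h
  have := hK _ h
  rw [map_smul, cx_ray, norm_smul, Complex.norm_exp_ofReal_mul_I, mul_one, Real.norm_eq_abs] at this
  linarith

/-- The Cauchy-Pompeiu formula, at the origin. -/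
theorem integral_dbar_div {g : Plane → ℂ} (hg : ContDiff ℝ 1 g) (hgc : HasCompactSupport g) :
    ∫ x, dbar g x * (1 / cx x) = -(2 * Real.pi) * g 0 := by
  obtain ⟨R, hR0, hR⟩ : ∃ R : ℝ, 0 ≤ R ∧ ∀ x ∈ tsupport g, ‖cx x‖ ≤ R := by
    obtain ⟨R, hR⟩ := (hgc.isCompact.image cx.continuous).isBounded.exists_norm_le
    exact ⟨max R 0, le_max_right _ _, fun x hx => (hR _ ⟨x, hx, rfl⟩).trans (le_max_left _ _)⟩
  have hg' := hg.continuous_fderiv one_ne_zero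
  have hray : Continuous ray := by unfold ray; fun_prop
  set A : ℝ × ℝ → ℂ := fun p => fderiv ℝ g (p.1 • ray p.2) (ray p.2) with hA
  set B : ℝ × ℝ → ℂ := fun p => fderiv ℝ g (p.1 • ray p.2) (-(Real.sin p.2), Real.cos p.2) with hB
  have hAc : Continuous A := (hg'.comp (by fun_prop)).clm_apply (by fun_prop)
  have hBc : Continuous B := (hg'.comp (by fun_prop)).clm_apply (by fun_prop)
  have hz : ∀ p : ℝ × ℝ, R < |p.1| → A p = 0 ∧ B p = 0 := fun p hp => by
    have := fderiv_eq_zero_of_notMem_tsupport (norm_smul_ray (θ := p.2) hp hR)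
    simp [hA, hB, this]
  have hint : ∀ F : ℝ × ℝ → ℂ, Continuous F → (∀ p : ℝ × ℝ, R < |p.1| → F p = 0) →
      IntegrableOn F (Ioi 0 ×ˢ Ioo (-Real.pi) Real.pi) := by
    intro F hF h0
    have h1 : IntegrableOn F (Icc 0 R ×ˢ Icc (-Real.pi) Real.pi) :=
      hF.continuousOn.integrableOn_compact (isCompact_Icc.prod isCompact_Icc)
    refine h1.of_forall_sdiff_eq_zero (measurableSet_Ioi.prod measurableSet_Ioo) ?_
    rintro ⟨r, θ⟩ ⟨⟨hr, hθ⟩, hn⟩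
    refine h0 _ ?_
    by_contra hle
    have hr' : 0 < r := hr
    exact hn ⟨⟨hr'.le, by rwa [not_lt, abs_of_pos hr'] at hle⟩, hθ.1.le, hθ.2.le⟩
  have hiA := hint A hAc fun p hp => (hz p hp).1
  have hiB := hint B hBc fun p hp => (hz p hp).2
  have hpol : ∫ x, dbar g x * (1 / cx x)
      = ∫ p in Ioi 0 ×ˢ Ioo (-Real.pi) Real.pi, (A p + Complex.I * B p) := by
    rw [← integral_comp_polarCoord_symm]
    refine setIntegral_congr_fun (measurableSet_Ioi.prod measurableSet_Ioo) ?_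
    rintro ⟨r, θ⟩ ⟨hr, -⟩
    have hr' : 0 < r := hr
    have e : polarCoord.symm (r, θ) = r • ray θ := by simp [ray]
    have hlin : ∀ a b : ℝ, fderiv ℝ g (r • ray θ) (a, b)
        = a * fderiv ℝ g (r • ray θ) (1, 0) + b * fderiv ℝ g (r • ray θ) (0, 1) := fun a b => by
      have : ((a, b) : Plane) = a • (1, 0) + b • (0, 1) := by simp
      rw [this, map_add, map_smul, map_smul, Complex.real_smul, Complex.real_smul]
    simp only [e, hA, hB]
    rw [show fderiv ℝ g (r • ray θ) (ray θ) = _ from hlin _ _,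
      hlin (-Real.sin θ) (Real.cos θ), dbar, map_smul, cx_ray,
      Complex.real_smul, Complex.real_smul]
    set X := fderiv ℝ g (r • ray θ) (1, 0)
    set Y := fderiv ℝ g (r • ray θ) (0, 1)
    have hr0 : (r : ℂ) ≠ 0 := by exact_mod_cast hr'.ne'
    have h1 : (1 : ℂ) / (r * Complex.exp (θ * Complex.I)) = Complex.exp (-(θ : ℂ) * Complex.I) / r := by
      rw [neg_mul, Complex.exp_neg]; field_simp
    rw [h1, Complex.exp_mul_I, Complex.cos_neg, Complex.sin_neg]
    push_cast
    field_simp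
    linear_combination (-(Complex.sin θ) * Y) * Complex.I_mul_I
  have h1 : ∫ p in Ioi 0 ×ˢ Ioo (-Real.pi) Real.pi, A p = -(2 * Real.pi) * g 0 := by
    rw [Measure.volume_eq_prod, ← setIntegral_prod_swap, setIntegral_prod]
    · have : ∀ θ, ∫ r in Ioi (0 : ℝ), A (r, θ) = - g 0 := by
        intro θ
        have hd : ∀ r : ℝ, HasDerivAt (fun r : ℝ => g (r • ray θ)) (A (r, θ)) r := fun r => by
          have := (hg.differentiable one_ne_zero (r • ray θ)).hasFDerivAt.comp_hasDerivAt r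
            ((hasDerivAt_id r).smul_const (ray θ))
          rw [one_smul] at this
          exact this
        have hcd : ContDiff ℝ 1 (fun r : ℝ => g (r • ray θ)) :=
          hg.comp (contDiff_id.smul contDiff_const)
        have hcs : HasCompactSupport (fun r : ℝ => g (r • ray θ)) := by
          refine HasCompactSupport.intro (isCompact_closedBall (0 : ℝ) R) fun r hr => ?_
          rw [mem_closedBall_zero_iff, not_le] at hr
          exact image_eq_zero_of_notMem_tsupport (norm_smul_ray hr hR)
        have h3 := hcs.integral_Ioi_deriv_eq hcd 0
        rw [show deriv (fun r : ℝ => g (r • ray θ)) = fun r => A (r, θ) from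
          funext fun r => (hd r).deriv] at h3
        simpa using h3
      simp only [Prod.swap_prod_mk, this, integral_const]
      rw [measureReal_restrict_apply_univ, Real.volume_real_Ioo_of_le (by linarith [Real.pi_pos]),
        Complex.real_smul]
      push_cast; ring
    · exact hiA.swap
  have h2 : ∫ p in Ioi 0 ×ˢ Ioo (-Real.pi) Real.pi, B p = 0 := by
    rw [Measure.volume_eq_prod, setIntegral_prod _ hiB]
    refine setIntegral_eq_zero_of_forall_eq_zero fun r hr => ?_
    have hr' : (0 : ℝ) < r := hr
    have hd : ∀ θ : ℝ, HasDerivAt (fun θ : ℝ => g (r • ray θ)) (r • B (r, θ)) θ := fun θ => by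
      have h0 : HasDerivAt ray (-(Real.sin θ), Real.cos θ) θ :=
        (Real.hasDerivAt_cos θ).prodMk (Real.hasDerivAt_sin θ)
      have := (hg.differentiable one_ne_zero (r • ray θ)).hasFDerivAt.comp_hasDerivAt θ
        (h0.const_smul r)
      rw [map_smul] at this
      exact this
    have h3 : ∫ θ in (-Real.pi)..Real.pi, r • B (r, θ) = 0 := by
      rw [intervalIntegral.integral_eq_sub_of_hasDerivAt (fun θ _ => hd θ)
        ((hBc.comp (by fun_prop : Continuous fun θ : ℝ => (r, θ))).const_smul r
          |>.intervalIntegrable _ _)]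
      simp [ray]
    rw [intervalIntegral.integral_smul, smul_eq_zero_iff_right hr'.ne',
      intervalIntegral.integral_of_le (by linarith [Real.pi_pos])] at h3
    rw [← integral_Ioc_eq_integral_Ioo, h3]
  rw [hpol, integral_add hiA (hiB.const_mul _), integral_const_mul, h1, h2, mul_zero, add_zero]

/-! ### The Biot-Savart kernel as a fundamental solution -/

/-- `1 / |x|` is integrable near the origin of the plane. -/
theorem integrable_indicator_inv_norm :
    Integrable (fun x : Plane => (Iic (1 : ℝ)).indicator (fun r => 1 / r) ‖x‖) := by
  rw [integrable_fun_norm_addHaar volume (f := (Iic (1 : ℝ)).indicator (fun r => 1 / r))]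
  have hd : Module.finrank ℝ Plane - 1 = 1 := by simp [Plane]
  rw [hd]
  have h1 : IntegrableOn (fun _ : ℝ => (1 : ℝ)) (Ioc 0 1) := by
    simp
  have h2 : IntegrableOn (fun y : ℝ => y ^ 1 • (Iic (1 : ℝ)).indicator (fun r => 1 / r) y) (Ioc 0 1) := by
    refine h1.congr_fun (fun y hy => ?_) measurableSet_Ioc
    have := hy.1.ne'
    simp [indicator_of_mem (show y ∈ Iic (1 : ℝ) from hy.2), this]
  refine h2.of_forall_sdiff_eq_zero measurableSet_Ioi fun y hy => ?_
  have : y ∉ Iic (1 : ℝ) := fun h => hy.2 ⟨hy.1, h⟩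
  simp [indicator_of_notMem this]

/-- The Cauchy transform of a test function converges absolutely, uniformly with respect to the
position of the pole. -/
theorem exists_integral_div_le {h : Plane → ℂ} (hc : Continuous h) (hs : HasCompactSupport h) :
    ∃ M, ∀ b : ℂ, Integrable (fun x => h x * (1 / (cx x - b))) ∧
      ∫ x, ‖h x * (1 / (cx x - b))‖ ≤ M := by
  obtain ⟨K, hK⟩ := hc.bounded_above_of_compact_support hs
  have hK0 : 0 ≤ K := (norm_nonneg _).trans (hK 0)
  set N : Plane → ℝ := fun x => (Iic (1 : ℝ)).indicator (fun r => 1 / r) ‖x‖ with hN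
  have hNi : Integrable N := integrable_indicator_inv_norm
  have hhi : Integrable fun x => ‖h x‖ := (hc.integrable_of_hasCompactSupport hs).norm
  refine ⟨(∫ x, K * N x) + ∫ x, ‖h x‖, fun b => ?_⟩
  have hbound : ∀ x, ‖h x * (1 / (cx x - b))‖ ≤ K * N (x - cx.symm b) + ‖h x‖ := by
    intro x
    have hle : ‖x - cx.symm b‖ ≤ ‖cx x - b‖ := by
      rw [Prod.norm_def]
      exact max_le (by simpa using Complex.abs_re_le_norm (cx x - b))
        (by simpa using Complex.abs_im_le_norm (cx x - b))
    rw [norm_mul, norm_div, norm_one]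
    by_cases h1 : ‖x - cx.symm b‖ ≤ 1
    · have e : N (x - cx.symm b) = 1 / ‖x - cx.symm b‖ :=
        indicator_of_mem (show ‖x - cx.symm b‖ ∈ Iic (1 : ℝ) from h1) _
      rw [e]
      by_cases h0 : x - cx.symm b = 0
      · have : cx x - b = 0 := by
          have := congrArg cx h0; simpa using this
        simp [this]; positivity
      · have hpos := norm_pos_iff.2 h0
        have : ‖h x‖ * (1 / ‖cx x - b‖) ≤ K * (1 / ‖x - cx.symm b‖) :=
          mul_le_mul (hK x) (one_div_le_one_div_of_le hpos hle) (by positivity) hK0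
        linarith [norm_nonneg (h x)]
    · have e : N (x - cx.symm b) = 0 :=
        indicator_of_notMem (show ‖x - cx.symm b‖ ∉ Iic (1 : ℝ) from h1) _
      rw [e, mul_zero, zero_add]
      have : 1 ≤ ‖cx x - b‖ := by linarith
      have h2 : 1 / ‖cx x - b‖ ≤ 1 := by rw [div_le_one (by linarith)]; exact this
      exact mul_le_of_le_one_right (norm_nonneg _) h2
  have hi : Integrable fun x => K * N (x - cx.symm b) + ‖h x‖ :=
    ((hNi.comp_sub_right (cx.symm b)).const_mul K).add hhi
  have hm : AEStronglyMeasurable (fun x => h x * (1 / (cx x - b))) volume := by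
    refine hc.aestronglyMeasurable.mul (Measurable.aestronglyMeasurable ?_)
    exact measurable_const.div (cx.continuous.measurable.sub_const b)
  refine ⟨hi.mono' hm (Eventually.of_forall hbound), ?_⟩
  refine (integral_mono_of_nonneg (Eventually.of_forall fun _ => norm_nonneg _) hi
    (Eventually.of_forall hbound)).trans ?_
  rw [integral_add ((hNi.comp_sub_right (cx.symm b)).const_mul K) hhi,
    integral_sub_right_eq_self (fun x => K * N x)]

/-- The Cauchy-Pompeiu formula. -/
theorem integral_dbar_div_sub {g : Plane → ℂ} (hg : ContDiff ℝ 1 g) (hgc : HasCompactSupport g)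
    (a : ℂ) : ∫ x, dbar g x * (1 / (cx x - a)) = -(2 * Real.pi) * g (cx.symm a) := by
  set b := cx.symm a
  have hg' : ContDiff ℝ 1 fun x => g (x + b) := hg.comp (contDiff_id.add contDiff_const)
  have hgc' : HasCompactSupport fun x => g (x + b) := hgc.comp_homeomorph (Homeomorph.addRight b)
  have h := integral_dbar_div hg' hgc'
  rw [zero_add] at h
  rw [← h, ← integral_add_right_eq_self _ b]
  refine integral_congr_ae (Eventually.of_forall fun x => ?_)
  simp only [dbar, fderiv_comp_add_right, map_add, b, ContinuousLinearEquiv.apply_symm_apply,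
    add_sub_cancel_right]

/-- Modulo the periods of the kernel, a bounded set of differences avoids all poles but one. -/
theorem exists_reduce (G : Geometry) (R : ℝ) : ∃ W : Set ℂ, IsCompact W ∧ (∀ w ∈ W, esig G w ≠ 0) ∧
    ∀ a y : ℂ, ‖y - a‖ ≤ R → ∃ n : ℤ, ∀ x, ‖x - y‖ ≤ 1 → x - (a + n * cshift G) ∈ W := by
  cases G with
  | closed =>
    refine ⟨Metric.closedBall 0 (R + 1), isCompact_closedBall _ _, fun w _ =>
      esig_ne_zero_closed w, fun a y h => ⟨0, fun x hx => ?_⟩⟩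
    rw [mem_closedBall_zero_iff]
    have : x - (a + ((0 : ℤ) : ℂ) * cshift .closed) = (x - y) + (y - a) := by simp
    rw [this]
    linarith [norm_add_le (x - y) (y - a)]
  | periodic =>
    refine ⟨(Icc (-(Real.pi + 1)) (Real.pi + 1)) ×ℂ Icc (-(R + 1)) (R + 1),
      isCompact_Icc.reProdIm isCompact_Icc, fun w hw => esig_ne_zero ?_, fun a y h => ?_⟩
    · have := abs_le.2 hw.1
      linarith [Real.pi_gt_three]
    · refine ⟨round ((y - a).re / (2 * Real.pi)), fun x hx => ?_⟩
      set n := round ((y - a).re / (2 * Real.pi))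
      have hn := abs_sub_round ((y - a).re / (2 * Real.pi))
      have hre : (x - (a + n * cshift .periodic)).re
          = (x - y).re + (2 * Real.pi) * ((y - a).re / (2 * Real.pi) - n) := by
        have : 2 * Real.pi * ((y - a).re / (2 * Real.pi)) = (y - a).re := by
          field_simp
        rw [mul_sub, this]
        simp [cshift]; ring
      have him : (x - (a + n * cshift .periodic)).im = (x - y).im + (y - a).im := by
        simp [cshift]
      have h1 := (Complex.abs_re_le_norm (x - y)).trans hx
      have h2 := (Complex.abs_im_le_norm (x - y)).trans hx
      have h3 := (Complex.abs_im_le_norm (y - a)).trans h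
      refine ⟨abs_le.1 ?_, abs_le.1 ?_⟩
      · rw [hre]
        refine (abs_add_le _ _).trans ?_
        rw [abs_mul, abs_of_pos Real.two_pi_pos]
        nlinarith [Real.pi_pos]
      · rw [him]
        refine (abs_add_le _ _).trans ?_
        linarith

/-- The Biot-Savart kernel is a fundamental solution of `∂₁ + i ∂₂`, up to the factor `2π`. The test
function has a support too small to see two poles of the kernel: the integer `n` selects the only
one at which it may be nonzero. The bound `M`, uniform with respect to the pole `a`, is what Fubini's
theorem requires along the sheet. -/
theorem exists_integral_dbar_bsKer (G : Geometry) {g : Plane → ℂ} (hg : ContDiff ℝ 1 g)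
    {y : ℂ} (hy : ∀ x ∈ tsupport g, ‖cx x - y‖ ≤ 1) (hgc : HasCompactSupport g) (R : ℝ) :
    ∃ M, ∀ a : ℂ, ‖y - a‖ ≤ R → Integrable (fun x => dbar g x * bsKer G (cx x - a)) ∧
      (∫ x, ‖dbar g x * bsKer G (cx x - a)‖) ≤ M ∧
      ∃ n : ℤ, ∫ x, dbar g x * bsKer G (cx x - a) = -(2 * Real.pi) * g (cx.symm (a + n * cshift G)) ∧
        (G = .periodic → ∀ m ≠ n, g (cx.symm (a + m * cshift G)) = 0) := by
  obtain ⟨W, hW, hWe, hred⟩ := exists_reduce G R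
  obtain ⟨M₀, hM₀⟩ := exists_integral_div_le (continuous_dbar hg) (hasCompactSupport_dbar hgc)
  have hhc : ContinuousOn (hker G) W := fun w hw => (continuousAt_hker (hWe w hw)).continuousWithinAt
  obtain ⟨C, hC⟩ := hW.exists_bound_of_continuousOn hhc
  have hdi : Integrable (dbar g) :=
    (continuous_dbar hg).integrable_of_hasCompactSupport (hasCompactSupport_dbar hgc)
  refine ⟨M₀ + ∫ x, C * ‖dbar g x‖, fun a ha => ?_⟩
  obtain ⟨n, hn⟩ := hred a y ha
  set a' := a + n * cshift G with ha'
  obtain ⟨hi1, hle1⟩ := hM₀ a'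
  have hsupp : ∀ x ∈ tsupport g, cx x - a' ∈ W := fun x hx => hn _ (hy x hx)
  have hU : IsOpen {w : ℂ | esig G (w - a') ≠ 0} :=
    isOpen_ne_fun ((continuous_esig G).comp (continuous_id.sub continuous_const)) continuous_const
  have hhd : DifferentiableOn ℂ (fun w => hker G (w - a')) {w : ℂ | esig G (w - a') ≠ 0} :=
    fun w hw => ((differentiableAt_hker hw).comp w
      (differentiableAt_id.sub_const a')).differentiableWithinAt
  have hi2 : Integrable fun x => dbar g x * hker G (cx x - a') := by
    have := integrable_mul_of_continuousOn (μ := volume) hgc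
      (f := fun x : Plane => hker G (cx x - a')) (g := dbar g)
      (hhd.continuousOn.comp (f := fun x : Plane => cx x) cx.continuous.continuousOn
        fun x hx => hWe _ (hsupp x hx)) (continuous_dbar hg).continuousOn
      (fun x hx => dbar_eq_zero hx)
    simpa only [mul_comm] using this
  have hz : ∫ x, dbar g x * hker G (cx x - a') = 0 := by
    simpa only [mul_comm] using integral_holomorphic_mul_dbar hg hgc hU hhd
      fun x hx => hWe _ (hsupp x hx)
  have hle2 : ∀ x, ‖dbar g x * hker G (cx x - a')‖ ≤ C * ‖dbar g x‖ := fun x => by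
    by_cases hx : x ∈ tsupport g
    · rw [norm_mul, mul_comm]
      exact mul_le_mul_of_nonneg_right (hC _ (hsupp x hx)) (norm_nonneg _)
    · simp [dbar_eq_zero hx]
  have hae : (fun x => dbar g x * bsKer G (cx x - a)) =ᵐ[volume]
      fun x => dbar g x * (1 / (cx x - a')) + dbar g x * hker G (cx x - a') := by
    have hne : ∀ᵐ x : Plane, x ≠ cx.symm a' := by
      rw [ae_iff]; simp
    filter_upwards [hne] with x hx
    by_cases hxs : x ∈ tsupport g
    · have h0 : cx x - a' ≠ 0 := fun h0 => hx (by rw [← sub_eq_zero.1 h0]; simp)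
      have hs : sig G (cx x - a') ≠ 0 := by
        rw [sig_eq_mul_esig]; exact mul_ne_zero h0 (hWe _ (hsupp x hxs))
      have : cx x - a = cx x - a' + n * cshift G := by rw [ha']; ring
      rw [this, bsKer_add_int_shift, bsKer_eq hs, mul_add]
    · simp [dbar_eq_zero hxs]
  refine ⟨(hi1.add hi2).congr hae.symm, ?_, n, ?_, ?_⟩
  · have h1 : ∫ x, ‖dbar g x * bsKer G (cx x - a)‖
        ≤ ∫ x, (‖dbar g x * (1 / (cx x - a'))‖ + C * ‖dbar g x‖) := by
      refine integral_mono_ae ((hi1.add hi2).congr hae.symm).norm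
        (hi1.norm.add (hdi.norm.const_mul C)) ?_
      filter_upwards [hae] with x hx
      rw [hx]
      exact (norm_add_le _ _).trans (by gcongr; exact hle2 x)
    rw [integral_add hi1.norm (hdi.norm.const_mul C)] at h1
    linarith
  · rw [integral_congr_ae hae, integral_add hi1 hi2, hz, add_zero, integral_dbar_div_sub hg hgc]
  · rintro hG m hm
    by_contra hne
    have hmem : cx.symm (a + m * cshift G) ∈ tsupport g := subset_tsupport _ hne
    have h1 := hWe _ (hsupp _ hmem)
    have h2 : cx (cx.symm (a + m * cshift G)) - a' = (m - n : ℤ) * cshift G := by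
      rw [ha']; simp; ring
    rw [h2] at h1
    have h3 : sig G ((m - n : ℤ) * cshift G) = 0 := sig_eq_zero.2 ⟨_, rfl⟩
    rw [sig_eq_mul_esig] at h3
    rcases mul_eq_zero.1 h3 with h4 | h4
    · subst hG
      have hmn : ((m - n : ℤ) : ℂ) ≠ 0 := Int.cast_ne_zero.2 (sub_ne_zero.2 hm)
      exact mul_ne_zero hmn (by simp [cshift, Real.pi_ne_zero]) h4
    · exact h1 h4

/-! ### Curl and divergence of the Biot-Savart velocity -/

/-- An integral over the line is the sum of the integrals over all periods. -/
theorem hasSum_integral_period {F : ℝ → ℂ} (hF : Integrable F) :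
    HasSum (fun n : ℤ => ∫ α in (-Real.pi)..Real.pi, F (α + n * (2 * Real.pi))) (∫ α, F α) := by
  have hpi := Real.two_pi_pos
  set H : ℝ → ℂ := fun s => (2 * Real.pi : ℝ) • F (2 * Real.pi * s - Real.pi) with hH
  have hHi : Integrable H :=
    ((hF.comp_sub_right Real.pi).comp_mul_left' hpi.ne').smul (2 * Real.pi : ℝ)
  have h := hHi.hasSum_intervalIntegral_comp_add_int
  have e1 : ∫ s, H s = ∫ α, F α := by
    rw [hH, integral_smul, Measure.integral_comp_mul_left (fun a => F (a - Real.pi)),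
      integral_sub_right_eq_self, abs_of_pos (by positivity), smul_smul, mul_inv_cancel₀ hpi.ne',
      one_smul]
  rw [e1] at h
  have key : ∀ n : ℤ, ∫ s in (0 : ℝ)..1, H (s + n)
      = ∫ α in (-Real.pi)..Real.pi, F (α + n * (2 * Real.pi)) := fun n => by
    have := intervalIntegral.smul_integral_comp_mul_add (a := 0) (b := 1)
      (fun a => F (a + n * (2 * Real.pi))) (2 * Real.pi) (-Real.pi)
    rw [← intervalIntegral.integral_smul] at this
    rw [show (2 * Real.pi) * 0 + -Real.pi = -Real.pi by ring,
      show (2 * Real.pi) * 1 + -Real.pi = Real.pi by ring] at this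
    rw [← this]
    refine intervalIntegral.integral_congr fun s _ => ?_
    simp only [hH]
    congr 2
    ring
  simpa only [key] using h

namespace Sheet

variable {G : Geometry} {T : ℝ} (S : Sheet G T)

/-- The pairing of a test function with the vorticity at a fixed time. -/
def strength (g : Plane → ℂ) (t : ℝ) : ℂ :=
  ∫ α in G.params, (S.w α t : ℂ) * g (cx.symm (S.z α t))

/-- Locally uniformly in time, only finitely many translates of a period of a periodic sheet meet a
given compact set. -/
theorem exists_shift_bound (S : Sheet .periodic T) {K : Set Plane} (hK : IsCompact K) {T' : ℝ}
    (hT' : T' < T) : ∃ M : ℕ, ∀ t ∈ Icc 0 T', ∀ β ∈ Icc (-Real.pi) Real.pi, ∀ n : ℤ,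
      cx.symm (S.z β t + n * cshift .periodic) ∈ K → n ∈ Finset.Icc (-(M : ℤ)) M := by
  have hc : IsCompact (Icc (-Real.pi) Real.pi ×ˢ Icc 0 T') := isCompact_Icc.prod isCompact_Icc
  obtain ⟨A, hA⟩ := hc.exists_bound_of_continuousOn
    (S.cont_z.mono (prod_mono (subset_univ _) fun t ht => ⟨ht.1, ht.2.trans_lt hT'⟩))
  obtain ⟨B, hB⟩ := (hK.image cx.continuous).isBounded.exists_norm_le
  obtain ⟨M, hM⟩ := exists_nat_ge (A + B)
  refine ⟨M, fun t ht β hβ n hn => ?_⟩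
  have h1 := hA (β, t) ⟨hβ, ht⟩
  have h2 := hB _ ⟨_, hn, rfl⟩
  rw [ContinuousLinearEquiv.apply_symm_apply] at h2
  have h3 : ‖(n : ℂ) * cshift .periodic‖ ≤ A + B := by
    have : (n : ℂ) * cshift .periodic = (S.z β t + n * cshift .periodic) - S.z β t := by ring
    rw [this]
    exact (norm_sub_le _ _).trans (by linarith)
  have h4 : ‖(n : ℂ) * cshift .periodic‖ = |(n : ℝ)| * (2 * Real.pi) := by
    rw [norm_mul, Complex.norm_intCast, cshift]
    simp [abs_of_pos Real.pi_pos]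
  have h5 : |(n : ℝ)| ≤ M := by
    nlinarith [abs_nonneg (n : ℝ), Real.pi_gt_three]
  rw [Finset.mem_Icc]
  have h6 := abs_le.1 h5
  exact ⟨by exact_mod_cast h6.1, by exact_mod_cast h6.2⟩

/-- For a periodic sheet, the pairing is a finite sum of integrals over one period. -/
theorem strength_eq_sum (S : Sheet .periodic T) {g : Plane → ℂ} (hg : Continuous g) {M : ℕ}
    {t : ℝ} (ht : t ∈ Ico 0 T) (hM : ∀ β ∈ Icc (-Real.pi) Real.pi, ∀ n : ℤ,
      cx.symm (S.z β t + n * cshift .periodic) ∈ tsupport g → n ∈ Finset.Icc (-(M : ℤ)) M) :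
    S.strength g t = ∑ n ∈ Finset.Icc (-(M : ℤ)) M, ∫ α in (-Real.pi)..Real.pi,
      (S.w α t : ℂ) * g (cx.symm (S.z α t + n * cshift .periodic)) := by
  set F : ℝ → ℂ := fun α => (S.w α t : ℂ) * g (cx.symm (S.z α t)) with hF
  have hFn : ∀ α (n : ℤ), F (α + n * (2 * Real.pi))
      = (S.w α t : ℂ) * g (cx.symm (S.z α t + n * cshift .periodic)) := fun α n => by
    have hp : Function.Periodic (fun α => S.w α t) (2 * Real.pi) := S.w_period t ht
    have : S.w (α + n * (2 * Real.pi)) t = S.w α t := hp.int_mul n α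
    simp only [hF]
    rw [this, S.z_add_int ht]
  have hFc : Continuous F := (continuous_slice S.cont_wc ht).mul
    (hg.comp (cx.symm.continuous.comp (continuous_slice S.cont_z ht)))
  have hFs : HasCompactSupport F := by
    refine HasCompactSupport.intro (isCompact_Icc (a := -(Real.pi + M * (2 * Real.pi)))
      (b := Real.pi + M * (2 * Real.pi))) fun α hα => ?_
    by_contra hne
    apply hα
    obtain ⟨n, hn⟩ := exists_window (-Real.pi) α
    have hz : S.z α t = S.z (α + n * (2 * Real.pi)) t + (-n : ℤ) * cshift .periodic := by
      rw [S.z_add_int ht]; push_cast; ring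
    have hmem : cx.symm (S.z (α + n * (2 * Real.pi)) t + (-n : ℤ) * cshift .periodic) ∈ tsupport g := by
      rw [← hz]
      exact subset_tsupport _ fun h0 => hne (by simp [hF, h0])
    have h1 := Finset.mem_Icc.1 (hM _ ⟨hn.1, by linarith [hn.2]⟩ _ hmem)
    have h2 : -(M : ℝ) ≤ -n := by exact_mod_cast h1.1
    have h3 : -(n : ℝ) ≤ M := by exact_mod_cast h1.2
    constructor <;> nlinarith [hn.1, hn.2, Real.pi_pos]
  have h := hasSum_integral_period (hFc.integrable_of_hasCompactSupport hFs)
  simp only [hFn] at h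
  have h2 := hasSum_sum_of_ne_finset_zero (L := SummationFilter.unconditional ℤ) (s := Finset.Icc (-(M : ℤ)) M)
    (f := fun n : ℤ => ∫ α in (-Real.pi)..Real.pi,
      (S.w α t : ℂ) * g (cx.symm (S.z α t + n * cshift .periodic))) (fun n hn => by
    refine (intervalIntegral.integral_congr fun α hα => ?_).trans intervalIntegral.integral_zero
    rw [uIcc_of_le (by linarith [Real.pi_pos])] at hα
    have : g (cx.symm (S.z α t + n * cshift .periodic)) = 0 := by
      by_contra hne
      exact hn (hM α hα n (subset_tsupport _ hne))
    exact mul_eq_zero_of_right _ this)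
  rw [strength, Geometry.params, setIntegral_univ]
  exact h.unique h2

theorem continuousWithinAt_window {g : Plane → ℂ} (hg : Continuous g) (b : ℂ) {t : ℝ}
    (ht : t ∈ Ico 0 T) :
    ContinuousWithinAt (fun t => ∫ α in (-Real.pi)..Real.pi, (S.w α t : ℂ) * g (cx.symm (S.z α t + b)))
      (Ico 0 T) t := by
  have hpi : -Real.pi ≤ Real.pi := by linarith [Real.pi_pos]
  refine tendsto_integral_of_continuousWithinAt (s := Ico 0 T) (x₀ := t)
    (F := fun t α => (S.w α t : ℂ) * g (cx.symm (S.z α t + b))) ht hpi ?_ ?_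
  · intro α _
    have h1 : ∀ {F : ℝ → ℝ → ℂ}, ContinuousOn (fun q : ℝ × ℝ => F q.1 q.2) (univ ×ˢ Ico 0 T) →
        ContinuousOn (fun y : ℝ × ℝ => F y.2 y.1) (Ico 0 T ×ˢ univ) := fun {F} hF =>
      hF.comp (f := fun y : ℝ × ℝ => (y.2, y.1)) (by fun_prop) (fun y hy => ⟨mem_univ _, hy.1⟩)
    exact ((h1 S.cont_wc).mul (hg.comp_continuousOn (cx.symm.continuous.comp_continuousOn
      ((h1 S.cont_z).add continuousOn_const)))) _ ⟨ht, mem_univ _⟩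
  · filter_upwards [self_mem_nhdsWithin] with s hs
    exact ((continuous_slice S.cont_wc hs).mul (hg.comp (cx.symm.continuous.comp
      ((continuous_slice S.cont_z hs).add continuous_const)))).continuousOn

theorem strength_closed (S : Sheet .closed T) (g : Plane → ℂ) (t : ℝ) : S.strength g t =
    ∫ α in (-Real.pi)..Real.pi, (S.w α t : ℂ) * g (cx.symm (S.z α t + 0)) := by
  rw [strength, intervalIntegral.integral_of_le (by linarith [Real.pi_pos])]
  simp [Geometry.params]

theorem continuousOn_strength {g : Plane → ℂ} (hg : Continuous g) (hgc : HasCompactSupport g) :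
    ContinuousOn (S.strength g) (Ico 0 T) := by
  intro t ht
  cases G with
  | closed =>
    exact (S.continuousWithinAt_window hg 0 ht).congr (fun s _ => S.strength_closed g s)
      (S.strength_closed g t)
  | periodic =>
    obtain ⟨M, hM⟩ := S.exists_shift_bound hgc (T' := (t + T) / 2) (by linarith [ht.2])
    have e : ∀ s ∈ Ico 0 T, s ≤ (t + T) / 2 → S.strength g s
        = ∑ n ∈ Finset.Icc (-(M : ℤ)) M, ∫ α in (-Real.pi)..Real.pi,
          (S.w α s : ℂ) * g (cx.symm (S.z α s + n * cshift .periodic)) := fun s hs hst =>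
      S.strength_eq_sum hg hs fun β hβ n hn => hM s ⟨hs.1, hst⟩ β hβ n hn
    refine ContinuousWithinAt.congr_of_eventuallyEq (f := fun s =>
      ∑ n ∈ Finset.Icc (-(M : ℤ)) M, ∫ α in (-Real.pi)..Real.pi,
          (S.w α s : ℂ) * g (cx.symm (S.z α s + n * cshift .periodic))) ?_ ?_
      (e t ht (by linarith [ht.2]))
    · exact tendsto_finsetSum _ fun n _ => S.continuousWithinAt_window hg _ ht
    · filter_upwards [self_mem_nhdsWithin,
        mem_nhdsWithin_of_mem_nhds (Iio_mem_nhds (show t < (t + T) / 2 by linarith [ht.2]))]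
        with s hs hs2
      exact e s hs (le_of_lt hs2)

/-- The Biot-Savart velocity of the sheet is divergence free, and its curl is the measure
`ϖ δ(x - z)`, at each time. -/
theorem integral_vel_mul_dbar {t : ℝ} (ht : t ∈ Ico 0 T) {g : Plane → ℂ} (hg : ContDiff ℝ 1 g)
    {y : ℂ} (hy : ∀ x ∈ tsupport g, ‖cx x - y‖ ≤ 1) (hgc : HasCompactSupport g) :
    Integrable (fun x => S.vel (cx x) t * dbar g x) ∧
    ∫ x, S.vel (cx x) t * dbar g x = Complex.I * S.strength g t := by
  have hpi : -Real.pi ≤ Real.pi := by linarith [Real.pi_pos]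
  have hzc := continuous_slice S.cont_z ht
  have hwc := continuous_slice S.cont_wc ht
  obtain ⟨R, hR⟩ := (isCompact_Icc (a := -Real.pi) (b := Real.pi)).exists_bound_of_continuousOn
    (continuous_const.sub hzc : Continuous fun α => y - S.z α t).continuousOn
  obtain ⟨C, hC⟩ := (isCompact_Icc (a := -Real.pi) (b := Real.pi)).exists_bound_of_continuousOn
    hwc.continuousOn
  obtain ⟨M, hM⟩ := exists_integral_dbar_bsKer G hg hy hgc R
  set μ : Measure ℝ := volume.restrict (Ioc (-Real.pi) Real.pi)
  have hμ : ∀ᵐ α ∂μ, α ∈ Icc (-Real.pi) Real.pi :=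
    (ae_restrict_mem measurableSet_Ioc).mono fun α hα => Ioc_subset_Icc_self hα
  set f : Plane → ℝ → ℂ := fun x α => S.wc α t * (dbar g x * bsKer G (cx x - S.z α t)) with hf
  have hmeas : AEStronglyMeasurable (Function.uncurry f) ((volume : Measure Plane).prod μ) := by
    refine Measurable.aestronglyMeasurable ?_
    refine (hwc.measurable.comp measurable_snd).mul
      (((continuous_dbar hg).measurable.comp measurable_fst).mul ((measurable_bsKer G).comp ?_))
    exact (cx.continuous.measurable.comp measurable_fst).sub (hzc.measurable.comp measurable_snd)
  have hint : Integrable (Function.uncurry f) ((volume : Measure Plane).prod μ) := by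
    rw [integrable_prod_iff' hmeas]
    constructor
    · filter_upwards [hμ] with α hα
      exact (hM (S.z α t) (hR α hα)).1.const_mul (S.wc α t)
    · refine Integrable.mono' (g := fun _ => C * M) (integrable_const _) ?_ ?_
      · exact hmeas.norm.prod_swap.integral_prod_right'
      · filter_upwards [hμ] with α hα
        rw [Real.norm_of_nonneg (integral_nonneg fun _ => norm_nonneg _)]
        have e : ∀ x, ‖Function.uncurry f (x, α)‖
            = ‖S.wc α t‖ * ‖dbar g x * bsKer G (cx x - S.z α t)‖ := fun x => by
          rw [← norm_mul]; rfl
        simp only [e]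
        rw [integral_const_mul]
        exact mul_le_mul (hC α hα) (hM _ (hR α hα)).2.1 (integral_nonneg fun _ => norm_nonneg _)
          ((norm_nonneg _).trans (hC α hα))
  have evel : ∀ x, S.vel (cx x) t * dbar g x
      = (2 * Real.pi * Complex.I)⁻¹ * ∫ α, f x α ∂μ := fun x => by
    rw [vel, cauchy, intervalIntegral.integral_of_le (two_pi_window _)]
    rw [show -Real.pi + 2 * Real.pi = Real.pi by ring, mul_assoc, ← integral_mul_const]
    congr 1
    refine integral_congr_ae (Eventually.of_forall fun α => ?_)
    simp only [hf]; ring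
  simp only [evel]
  refine ⟨hint.integral_prod_left.const_mul _, ?_⟩
  rw [integral_const_mul, integral_integral_swap hint]
  have key : ∫ α, (∫ x, f x α) ∂μ = -(2 * Real.pi) * S.strength g t := by
    cases G with
    | closed =>
      rw [S.strength_closed, intervalIntegral.integral_of_le hpi, ← integral_const_mul]
      refine integral_congr_ae ?_
      filter_upwards [hμ] with α hα
      obtain ⟨n, hn, -⟩ := (hM _ (hR α hα)).2.2
      simp only [hf]
      rw [integral_const_mul, hn]
      simp only [cshift, mul_zero]
      rw [wc]; ring
    | periodic =>
      obtain ⟨N, hN⟩ := S.exists_shift_bound hgc (T' := t) ht.2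
      rw [S.strength_eq_sum hg.continuous ht fun β hβ n hn => hN t ⟨ht.1, le_rfl⟩ β hβ n hn]
      rw [← intervalIntegral.integral_finsetSum]
      swap
      · intro n _
        exact (hwc.mul (hg.continuous.comp (cx.symm.continuous.comp
          (hzc.add continuous_const)))).intervalIntegrable _ _
      rw [intervalIntegral.integral_of_le hpi, ← integral_const_mul]
      refine integral_congr_ae ?_
      filter_upwards [hμ] with α hα
      obtain ⟨n, hn, hn0⟩ := (hM _ (hR α hα)).2.2
      simp only [hf]
      rw [integral_const_mul, hn, ← Finset.mul_sum, Finset.sum_eq_single n]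
      · rw [wc]; ring
      · exact fun m _ hm => hn0 rfl m hm
      · intro hmem
        by_contra hne
        exact hmem (hN t ⟨ht.1, le_rfl⟩ α hα n (subset_tsupport _ hne))
  rw [key]
  have : (Real.pi : ℂ) ≠ 0 := by exact_mod_cast Real.pi_ne_zero
  field_simp
  rw [Complex.I_sq]; ring

end Sheet

/-! ### Mollification and Liouville's theorem -/

/-- A sequence of bumps whose supports shrink to the origin. -/
def bump (n : ℕ) : ContDiffBump (0 : Plane) where
  rIn := 1 / (4 * (n + 1))
  rOut := 1 / (2 * (n + 1))
  rIn_pos := by positivity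
  rIn_lt_rOut := by
    apply one_div_lt_one_div_of_lt (by positivity)
    have : (0 : ℝ) < n + 1 := by positivity
    linarith

/-- The mollifier of index `n`. -/
def moll (n : ℕ) : Plane → ℝ := (bump n).normed volume

theorem contDiff_moll (n : ℕ) {k : ℕ∞} : ContDiff ℝ k (moll n) := (bump n).contDiff_normed

theorem hasCompactSupport_moll (n : ℕ) : HasCompactSupport (moll n) :=
  (bump n).hasCompactSupport_normed

theorem moll_nonneg (n : ℕ) (x : Plane) : 0 ≤ moll n x := (bump n).nonneg_normed x

theorem norm_le_of_mem_tsupport_moll {n : ℕ} {x : Plane} (hx : x ∈ tsupport (moll n)) :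
    ‖x‖ ≤ 1 / 2 := by
  rw [moll, (bump n).tsupport_normed_eq, mem_closedBall_zero_iff] at hx
  refine hx.trans ?_
  apply one_div_le_one_div_of_le (by norm_num)
  have : (0 : ℝ) ≤ n := by positivity
  linarith

theorem moll_eq_zero {n : ℕ} {x : Plane} (hx : 1 / 2 < ‖x‖) : moll n x = 0 :=
  image_eq_zero_of_notMem_tsupport fun h => (norm_le_of_mem_tsupport_moll h).not_gt hx

/-- The mollification of a function. -/
def mollify (n : ℕ) (w : Plane → ℂ) (y : Plane) : ℂ := ∫ x, moll n (y - x) • w x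

/-- The mollifier centred at `y`, as a complex test function. -/
def mollAt (n : ℕ) (y x : Plane) : ℂ := (moll n (y - x) : ℂ)

theorem mollify_eq (n : ℕ) (w : Plane → ℂ) :
    mollify n w = (moll n ⋆[ContinuousLinearMap.lsmul ℝ ℝ, volume] w) := by
  funext y
  rw [convolution_eq_swap]; rfl

theorem contDiff_moll_sub (n : ℕ) (y : Plane) {k : ℕ∞} : ContDiff ℝ k fun x => moll n (y - x) :=
  (contDiff_moll n).comp (contDiff_const.sub contDiff_id)

theorem hasCompactSupport_moll_sub (n : ℕ) (y : Plane) :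
    HasCompactSupport fun x => moll n (y - x) :=
  (hasCompactSupport_moll n).comp_homeomorph (Homeomorph.subLeft y)

theorem contDiff_mollAt (n : ℕ) (y : Plane) {k : ℕ∞} : ContDiff ℝ k (mollAt n y) :=
  Complex.ofRealCLM.contDiff.comp (contDiff_moll_sub n y)

theorem hasCompactSupport_mollAt (n : ℕ) (y : Plane) : HasCompactSupport (mollAt n y) :=
  (hasCompactSupport_moll_sub n y).comp_left (g := fun r : ℝ => (r : ℂ)) Complex.ofReal_zero

theorem norm_sub_le_of_mem_tsupport_mollAt {n : ℕ} {y x : Plane} (hx : x ∈ tsupport (mollAt n y)) :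
    ‖cx x - cx y‖ ≤ 1 := by
  have h1 : tsupport (mollAt n y) ⊆ {x | ‖y - x‖ ≤ 1 / 2} := by
    refine closure_minimal (fun x hx => ?_) (isClosed_le (by fun_prop) continuous_const)
    by_contra hn
    exact hx (by simp [mollAt, moll_eq_zero (not_le.1 hn)])
  have h2 : ‖y - x‖ ≤ 1 / 2 := h1 hx
  rw [Prod.norm_def] at h2
  have h3 := (le_max_left _ _).trans h2
  have h4 := (le_max_right _ _).trans h2
  have h5 := Complex.norm_le_abs_re_add_abs_im (cx x - cx y)
  simp only [Complex.sub_re, Complex.sub_im, cx_re, cx_im, Prod.fst_sub, Prod.snd_sub,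
    Real.norm_eq_abs] at h3 h4 h5
  rw [abs_sub_comm] at h3 h4
  linarith

theorem dbar_mollAt (n : ℕ) (y x : Plane) : dbar (mollAt n y) x =
    -((fderiv ℝ (moll n) (y - x) (1, 0) : ℝ) + Complex.I * (fderiv ℝ (moll n) (y - x) (0, 1) : ℝ)) := by
  have h1 : HasFDerivAt (moll n) (fderiv ℝ (moll n) (y - x)) (y - x) :=
    ((contDiff_moll n (k := 1)).differentiable one_ne_zero _).hasFDerivAt
  have h2 := h1.comp x ((hasFDerivAt_id x).const_sub y)
  have h3 := (Complex.ofRealCLM.hasFDerivAt.comp x h2).fderiv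
  have h4 : fderiv ℝ (mollAt n y) x = _ := h3
  rw [dbar, h4]
  simp only [ContinuousLinearMap.comp_apply, neg_apply,
    ContinuousLinearMap.id_apply, map_neg, Complex.ofRealCLM_apply]
  ring

theorem integrable_moll_sub_smul {w : Plane → ℂ} (hw : LocallyIntegrable w) (n : ℕ) (y : Plane) :
    Integrable fun x => moll n (y - x) • w x :=
  hw.integrable_smul_left_of_hasCompactSupport (contDiff_moll_sub n y (k := 0)).continuous
    (hasCompactSupport_moll_sub n y)

theorem fderiv_mollify {w : Plane → ℂ} (hw : LocallyIntegrable w) (n : ℕ) (y e : Plane) :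
    HasFDerivAt (mollify n w) (fderiv ℝ (mollify n w) y) y ∧
    fderiv ℝ (mollify n w) y e = ∫ x, fderiv ℝ (moll n) (y - x) e • w x := by
  have h := (hasCompactSupport_moll n).hasFDerivAt_convolution_left
    (ContinuousLinearMap.lsmul ℝ ℝ) (contDiff_moll n (k := 1)) hw y
  rw [← mollify_eq] at h
  refine ⟨h.differentiableAt.hasFDerivAt, ?_⟩
  rw [h.fderiv, convolution_eq_swap]
  have hi : Integrable fun x => (ContinuousLinearMap.precompL Plane
      (ContinuousLinearMap.lsmul ℝ ℝ : ℝ →L[ℝ] ℂ →L[ℝ] ℂ)) (fderiv ℝ (moll n) (y - x)) (w x) := by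
    have hce := (hasCompactSupport_moll n).fderiv (𝕜 := ℝ) |>.convolutionExists_left
      (ContinuousLinearMap.precompL Plane (ContinuousLinearMap.lsmul ℝ ℝ : ℝ →L[ℝ] ℂ →L[ℝ] ℂ))
      ((contDiff_moll n (k := 1)).continuous_fderiv one_ne_zero) hw y
    exact hce.integrable_swap
  rw [ContinuousLinearMap.integral_apply hi]
  rfl

theorem integral_mul_dbar_mollAt {w : Plane → ℂ} (hw : LocallyIntegrable w) (n : ℕ) (y : Plane) :
    ∫ x, w x * dbar (mollAt n y) x
      = -(fderiv ℝ (mollify n w) y (1, 0) + Complex.I * fderiv ℝ (mollify n w) y (0, 1)) := by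
  have hi : ∀ e : Plane, Integrable fun x => fderiv ℝ (moll n) (y - x) e • w x := fun e => by
    refine hw.integrable_smul_left_of_hasCompactSupport ?_ ?_
    · exact (((contDiff_moll n (k := 1)).continuous_fderiv one_ne_zero).comp
        (continuous_const.sub continuous_id)).clm_apply continuous_const
    · have h1 := ((hasCompactSupport_moll n).fderiv (𝕜 := ℝ)).comp_left
        (g := fun A : Plane →L[ℝ] ℝ => A e) rfl
      exact h1.comp_homeomorph (Homeomorph.subLeft y)
  rw [(fderiv_mollify hw n y _).2, (fderiv_mollify hw n y _).2, ← integral_const_mul,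
    ← integral_add (hi _) ((hi _).const_mul _), ← integral_neg]
  refine integral_congr_ae (Eventually.of_forall fun x => ?_)
  simp only [dbar_mollAt, Complex.real_smul]
  ring

/-- If the mollifications are holomorphic in the weak sense, they are entire. -/
theorem differentiable_mollify {w : Plane → ℂ} (hw : LocallyIntegrable w) (n : ℕ) {D : Set Plane}
    (hD : Dense D) (h : ∀ y ∈ D, ∫ x, w x * dbar (mollAt n y) x = 0) :
    Differentiable ℂ fun ζ : ℂ => mollify n w (cx.symm ζ) := by
  have hc : Continuous fun y => fderiv ℝ (mollify n w) y := by
    have : ContDiff ℝ 1 (mollify n w) := by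
      rw [mollify_eq]
      exact (hasCompactSupport_moll n).contDiff_convolution_left _ (contDiff_moll n (k := 1)) hw
    exact this.continuous_fderiv one_ne_zero
  have h0 : ∀ y, fderiv ℝ (mollify n w) y (1, 0)
      + Complex.I * fderiv ℝ (mollify n w) y (0, 1) = 0 := by
    refine fun y => congrFun (Continuous.ext_on hD
      (f := fun y => fderiv ℝ (mollify n w) y (1, 0) + Complex.I * fderiv ℝ (mollify n w) y (0, 1))
      (g := fun _ => 0)
      ((hc.clm_apply continuous_const).add (continuous_const.mul (hc.clm_apply continuous_const)))
      continuous_const fun y hy => ?_) y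
    have := h y hy
    rwa [integral_mul_dbar_mollAt hw, neg_eq_zero] at this
  intro ζ
  rw [differentiableAt_complex_iff_differentiableAt_real]
  have h1 := ((fderiv_mollify hw n (cx.symm ζ) 0).1).comp ζ cx.symm.toContinuousLinearMap.hasFDerivAt
  have h2 : HasFDerivAt (fun ζ : ℂ => mollify n w (cx.symm ζ)) _ ζ := h1
  refine ⟨h2.differentiableAt, ?_⟩
  rw [h2.fderiv]
  have e1 : cx.symm 1 = (1, 0) := by apply Prod.ext <;> simp
  have e2 : cx.symm Complex.I = (0, 1) := by apply Prod.ext <;> simp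
  have := h0 (cx.symm ζ)
  simp only [ContinuousLinearMap.comp_apply, ContinuousLinearEquiv.coe_coe, e1, e2, smul_eq_mul]
  linear_combination (-Complex.I) * this + fderiv ℝ (mollify n w) (cx.symm ζ) (0, 1) * Complex.I_mul_I

/-- A function that is `ε`-close to a constant around a point has mollifications with this property.
The unit distance is enough for all mollifiers. -/
theorem norm_mollify_sub_le {w : Plane → ℂ} (hw : LocallyIntegrable w) (n : ℕ) {A : Set Plane}
    {L : ℂ} {ε : ℝ} (h : ∀ᵐ x, x ∈ A → ‖w x - L‖ ≤ ε) {y : Plane} (hy : ∀ x, ‖x - y‖ ≤ 1 → x ∈ A) :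
    ‖mollify n w y - L‖ ≤ ε := by
  have h1 : ∫ x, moll n (y - x) = 1 := by
    rw [integral_sub_left_eq_self (moll n) volume y]
    exact (bump n).integral_normed
  have hi : Integrable fun x => moll n (y - x) :=
    (contDiff_moll_sub n y (k := 0)).continuous.integrable_of_hasCompactSupport
      (hasCompactSupport_moll_sub n y)
  have e : mollify n w y - L = ∫ x, moll n (y - x) • (w x - L) := by
    simp only [smul_sub]
    rw [integral_sub (integrable_moll_sub_smul hw n y) (hi.smul_const L), integral_smul_const, h1,
      one_smul, mollify]
  have e2 : ∫ x, moll n (y - x) * ε = ε := by rw [integral_mul_const, h1, one_mul]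
  rw [e, ← e2]
  refine norm_integral_le_of_norm_le (hi.mul_const ε) ?_
  filter_upwards [h] with x hx
  rw [norm_smul, Real.norm_of_nonneg (moll_nonneg _ _)]
  by_cases hxy : ‖y - x‖ ≤ 1 / 2
  · refine mul_le_mul_of_nonneg_left (hx (hy x ?_)) (moll_nonneg _ _)
    rw [norm_sub_rev]; linarith
  · simp [moll_eq_zero (not_le.1 hxy)]

theorem exists_mem_ae_imp {l : Filter Plane} {P : Plane → Prop} (h : ∀ᶠ x in l ⊓ ae volume, P x) :
    ∃ s ∈ l, ∀ᵐ x : Plane, x ∈ s → P x := by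
  obtain ⟨s, hs, t, ht, hst⟩ := mem_inf_iff_superset.1 h
  exact ⟨s, hs, mem_of_superset ht fun x hxt hxs => hst ⟨hxs, hxt⟩⟩

/-- Behaviour at infinity that excludes all entire functions but zero: limit zero for a closed
contour; for a periodic curve, periodicity and opposite limits `V` and `-V` at the two ends of the
strip, so that a bounded entire function, being constant, has `V = -V`. -/
def Decays (w : Plane → ℂ) : Geometry → Prop
  | .closed => Tendsto w (cocompact Plane ⊓ ae volume) (𝓝 0)
  | .periodic => (∀ᵐ x : Plane, w (x + (2 * Real.pi, 0)) = w x) ∧ ∃ V : ℂ,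
      Tendsto w (comap Prod.snd atTop ⊓ ae volume) (𝓝 V) ∧
      Tendsto w (comap Prod.snd atBot ⊓ ae volume) (𝓝 (-V))

theorem eventually_norm_sub_le {l : Filter Plane} {w : Plane → ℂ} {L : ℂ} (h : Tendsto w l (𝓝 L))
    {ε : ℝ} (hε : 0 < ε) : ∀ᶠ x in l, ‖w x - L‖ ≤ ε := by
  filter_upwards [h (Metric.closedBall_mem_nhds L hε)] with x hx
  rwa [mem_preimage, mem_closedBall_iff_norm] at hx

theorem exists_top {w : Plane → ℂ} (hw : LocallyIntegrable w) (n : ℕ) {V : ℂ}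
    (h : Tendsto w (comap Prod.snd atTop ⊓ ae volume) (𝓝 V)) {ε : ℝ} (hε : 0 < ε) :
    ∃ M : ℝ, ∀ y : Plane, M ≤ y.2 → ‖mollify n w y - V‖ ≤ ε := by
  obtain ⟨s, hs, h1⟩ := exists_mem_ae_imp (eventually_norm_sub_le h hε)
  obtain ⟨t, ht, hts⟩ := mem_comap.1 hs
  obtain ⟨M, hM⟩ := mem_atTop_sets.1 ht
  refine ⟨M + 1, fun y hy => norm_mollify_sub_le hw n h1 fun x hx => hts (hM _ ?_)⟩
  have := (abs_le.1 ((norm_snd_le (x - y)).trans hx)).1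
  simp only [Prod.snd_sub] at this
  linarith

theorem exists_bot {w : Plane → ℂ} (hw : LocallyIntegrable w) (n : ℕ) {V : ℂ}
    (h : Tendsto w (comap Prod.snd atBot ⊓ ae volume) (𝓝 V)) {ε : ℝ} (hε : 0 < ε) :
    ∃ M : ℝ, ∀ y : Plane, y.2 ≤ M → ‖mollify n w y - V‖ ≤ ε := by
  obtain ⟨s, hs, h1⟩ := exists_mem_ae_imp (eventually_norm_sub_le h hε)
  obtain ⟨t, ht, hts⟩ := mem_comap.1 hs
  obtain ⟨M, hM⟩ := mem_atBot_sets.1 ht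
  refine ⟨M - 1, fun y hy => norm_mollify_sub_le hw n h1 fun x hx => hts (hM _ ?_)⟩
  have := (abs_le.1 ((norm_snd_le (x - y)).trans hx)).2
  simp only [Prod.snd_sub] at this
  linarith

/-- Liouville's theorem for entire mollifications. -/
theorem mollify_eq_zero {w : Plane → ℂ} (hw : LocallyIntegrable w) (n : ℕ) {G : Geometry}
    (hG : Decays w G) (hd : Differentiable ℂ fun ζ : ℂ => mollify n w (cx.symm ζ)) (y : Plane) :
    mollify n w y = 0 := by
  have hcont : Continuous (mollify n w) := by
    have := hd.continuous.comp cx.continuous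
    simpa [Function.comp_def] using this
  cases G with
  | closed =>
    have hG' : Tendsto w (cocompact Plane ⊓ ae volume) (𝓝 0) := hG
    have h1 : Tendsto (mollify n w) (cocompact Plane) (𝓝 0) := by
      rw [Metric.tendsto_nhds]
      intro ε hε
      obtain ⟨s, hs, h1⟩ := exists_mem_ae_imp (eventually_norm_sub_le hG' (half_pos hε))
      obtain ⟨R, hR⟩ := Metric.closedBall_compl_subset_of_mem_cocompact hs 0
      have h2 : (Metric.closedBall (0 : Plane) (R + 1))ᶜ ∈ cocompact Plane :=
        (isCompact_closedBall _ _).compl_mem_cocompact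
      filter_upwards [h2] with y hy
      rw [dist_eq_norm]
      refine (norm_mollify_sub_le hw n h1 fun x hx => hR fun hxR => hy ?_).trans_lt (half_lt_self hε)
      rw [mem_closedBall_zero_iff] at hxR ⊢
      have : y = x - (x - y) := by abel
      rw [this]
      exact (norm_sub_le _ _).trans (by linarith)
    have h2 := h1.comp cx.symm.toHomeomorph.isClosedEmbedding.tendsto_cocompact
    have h3 := hd.apply_eq_of_tendsto_cocompact (cx y) h2
    simpa using h3
  | periodic =>
    obtain ⟨hper, V, hVt, hVb⟩ := hG
    have hperW : ∀ y, mollify n w (y + (2 * Real.pi, 0)) = mollify n w y := fun y => by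
      rw [mollify, ← integral_add_right_eq_self _ ((2 * Real.pi, 0) : Plane), mollify]
      refine integral_congr_ae ?_
      filter_upwards [hper] with x hx
      rw [hx, add_sub_add_right_eq_sub]
    obtain ⟨M₁, hM₁⟩ := exists_top hw n hVt one_pos
    obtain ⟨M₂, hM₂⟩ := exists_bot hw n hVb one_pos
    obtain ⟨C, hC⟩ := (isCompact_Icc (a := (0 : ℝ)) (b := 2 * Real.pi)).prod
      (isCompact_Icc (a := M₂) (b := M₁)) |>.exists_bound_of_continuousOn hcont.continuousOn
    have hb : Bornology.IsBounded (range fun ζ : ℂ => mollify n w (cx.symm ζ)) := by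
      refine isBounded_iff_forall_norm_le.2 ⟨max C (‖V‖ + 1), ?_⟩
      rintro _ ⟨ζ, rfl⟩
      simp only
      set y := cx.symm ζ
      rcases le_total M₁ y.2 with h1 | h1
      · have := norm_sub_norm_le (mollify n w y) V
        have := hM₁ y h1
        exact le_max_of_le_right (by linarith)
      rcases le_total y.2 M₂ with h2 | h2
      · have := norm_sub_norm_le (mollify n w y) (-V)
        have := hM₂ y h2
        rw [norm_neg] at *
        exact le_max_of_le_right (by linarith)
      · obtain ⟨k, hk⟩ := Sheet.exists_window 0 y.1
        have hp : Function.Periodic (mollify n w) (2 * Real.pi, 0) := hperW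
        have h3 := hp.int_mul k y
        have h4 : y + (k : Plane) * (2 * Real.pi, 0) = (y.1 + k * (2 * Real.pi), y.2) := by
          apply Prod.ext <;> simp
        rw [h4] at h3
        rw [← h3]
        refine le_max_of_le_left (hC _ ⟨⟨hk.1, ?_⟩, h2, h1⟩)
        have := hk.2.le
        simpa using this
    have hconst : ∀ y', mollify n w y' = mollify n w y := fun y' => by
      have := hd.apply_eq_apply_of_bounded hb (cx y') (cx y)
      simpa using this
    have h1 : mollify n w y - V = 0 := norm_le_zero_iff.1 (le_of_forall_pos_le_add fun ε hε => by
      obtain ⟨M, hM⟩ := exists_top hw n hVt hε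
      rw [zero_add, ← hconst (0, M)]
      exact hM (0, M) le_rfl)
    have h2 : mollify n w y - -V = 0 := norm_le_zero_iff.1 (le_of_forall_pos_le_add fun ε hε => by
      obtain ⟨M, hM⟩ := exists_bot hw n hVb hε
      rw [zero_add, ← hconst (0, M)]
      exact hM (0, M) le_rfl)
    linear_combination (h1 + h2) / 2

theorem tendsto_rOut : Tendsto (fun n => (bump n).rOut) atTop (𝓝 0) := by
  have h1 : Tendsto (fun n : ℕ => 1 / ((n : ℝ) + 1)) atTop (𝓝 0) :=
    tendsto_one_div_add_atTop_nhds_zero_nat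
  have h2 := h1.const_mul (1 / 2)
  rw [mul_zero] at h2
  refine h2.congr fun n => ?_
  simp only [bump]
  have : (n : ℝ) + 1 ≠ 0 := by positivity
  field_simp

theorem ae_tendsto_mollify {w : Plane → ℂ} (hw : LocallyIntegrable w) :
    ∀ᵐ x, Tendsto (fun n => mollify n w x) atTop (𝓝 (w x)) := by
  have h1 := ContDiffBump.ae_convolution_tendsto_right_of_locallyIntegrable (φ := bump) (K := 2)
    (μ := volume) (g := w) tendsto_rOut (Eventually.of_forall fun n => by
      simp only [bump]
      have : (n : ℝ) + 1 ≠ 0 := by positivity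
      refine le_of_eq ?_
      field_simp
      norm_num) hw
  filter_upwards [h1] with x hx
  refine hx.congr fun n => ?_
  rw [mollify_eq]; rfl

/-- A locally integrable function that is holomorphic in the weak sense and decays vanishes. -/
theorem ae_eq_zero_of_weak_holomorphic {w : Plane → ℂ} (hw : LocallyIntegrable w) {G : Geometry}
    (hG : Decays w G) {D : Set Plane} (hD : Dense D)
    (h : ∀ n, ∀ y ∈ D, ∫ x, w x * dbar (mollAt n y) x = 0) : ∀ᵐ x, w x = 0 := by
  filter_upwards [ae_tendsto_mollify hw] with x hx
  have e : (fun n => mollify n w x) = fun _ => (0 : ℂ) :=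
    funext fun n => mollify_eq_zero hw n hG (differentiable_mollify hw n hD (h n)) x
  rw [e] at hx
  exact tendsto_nhds_unique hx tendsto_const_nhds

/-! ### Slices in time -/

theorem restrict_univ_prod (s : Set ℝ) :
    (volume : Measure SpaceTime).restrict (univ ×ˢ s) = volume.prod (volume.restrict s) := by
  rw [Measure.volume_eq_prod, ← Measure.prod_restrict, Measure.restrict_univ]

/-- A locally integrable function times a test function is integrable. -/
theorem integrableOn_slab_mul {A : Type*} [RCLike A] {T : ℝ} {f g : SpaceTime → A}
    (hf : LocallyIntegrableOn f (slab₀ T)) (hg : Continuous g) {K : Set SpaceTime}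
    (hK : IsCompact K) (hKT : K ⊆ {q | q.2 < T}) (h0 : ∀ q, q ∉ K → g q = 0) :
    IntegrableOn (fun q => f q * g q) (slab T) := by
  have hK' : IsCompact (K ∩ {q | 0 ≤ q.2}) :=
    hK.inter_right (isClosed_le continuous_const continuous_snd)
  have h1 : IntegrableOn f (K ∩ {q | 0 ≤ q.2}) :=
    hf.integrableOn_compact_subset (fun q hq => ⟨mem_univ _, hq.2, hKT hq.1⟩) hK'
  have h2 : IntegrableOn (fun q => f q * g q) (K ∩ {q | 0 ≤ q.2}) :=
    h1.mul_continuousOn hg.continuousOn hK'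
  refine h2.of_forall_sdiff_eq_zero (isOpen_slab T).measurableSet fun q hq => ?_
  rw [h0 q fun hqK => hq.2 ⟨hqK, hq.1.2.1.le⟩, mul_zero]

/-- Almost all time slices of a locally integrable function are locally integrable. -/
theorem ae_locallyIntegrable_slice {E : Type*} [NormedAddCommGroup E] {T : ℝ} {f : SpaceTime → E}
    (hf : LocallyIntegrableOn f (slab₀ T)) :
    ∀ᵐ t ∂(volume.restrict (Ioo 0 T)), LocallyIntegrable fun x => f (x, t) := by
  have h : ∀ m : ℕ, ∀ᵐ t : ℝ, t ∈ Icc 0 (T - 1 / (m + 1)) →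
      IntegrableOn (fun x => f (x, t)) (Metric.closedBall 0 m) := fun m => by
    have h1 : IntegrableOn f (Metric.closedBall 0 m ×ˢ Icc 0 (T - 1 / (m + 1))) := by
      refine hf.integrableOn_compact_subset ?_ ((isCompact_closedBall _ _).prod isCompact_Icc)
      rintro q ⟨-, h2⟩
      have : (0 : ℝ) < 1 / (m + 1) := by positivity
      exact ⟨mem_univ _, h2.1, by linarith [h2.2]⟩
    rw [IntegrableOn, Measure.volume_eq_prod, ← Measure.prod_restrict] at h1
    exact (ae_restrict_iff' measurableSet_Icc).1 h1.prod_left_ae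
  rw [ae_restrict_iff' measurableSet_Ioo]
  filter_upwards [ae_all_iff.2 h] with t ht htT x
  obtain ⟨m₁, h1⟩ := exists_nat_gt ‖x‖
  obtain ⟨m₂, h2⟩ := exists_nat_one_div_lt (sub_pos.2 htT.2)
  set m := max m₁ m₂
  have h3 : t ∈ Icc 0 (T - 1 / ((m : ℝ) + 1)) := by
    refine ⟨htT.1.le, ?_⟩
    have : 1 / ((m : ℝ) + 1) ≤ 1 / (m₂ + 1) := by
      apply one_div_le_one_div_of_le (by positivity)
      have : (m₂ : ℝ) ≤ m := by exact_mod_cast le_max_right _ _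
      linarith
    linarith
  refine ⟨_, ?_, ht m h3⟩
  refine Metric.closedBall_mem_nhds_of_mem ?_
  rw [mem_ball_zero_iff]
  exact h1.trans_le (by exact_mod_cast le_max_left _ _)

/-- The conjugate complex velocity. -/
def cvel (v : SpaceTime → Plane) (q : SpaceTime) : ℂ := ((v q).1 : ℂ) - Complex.I * (v q).2

theorem cvel_eq (v : SpaceTime → Plane) (q : SpaceTime) :
    cvel v q = (starRingEnd ℂ) (cx (v q)) := by
  apply Complex.ext <;> simp [cvel]

theorem locallyIntegrableOn_cvel {v : SpaceTime → Plane} {s : Set SpaceTime}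
    (hv : LocallyIntegrableOn v s) : LocallyIntegrableOn (cvel v) s := by
  intro q hq
  obtain ⟨t, ht, hi⟩ := hv q hq
  refine ⟨t, ht, ?_⟩
  have h1 := ((ContinuousLinearMap.fst ℝ ℝ ℝ).integrable_comp hi)
  have h2 := ((ContinuousLinearMap.snd ℝ ℝ ℝ).integrable_comp hi)
  exact h1.ofReal.sub (h2.ofReal.const_mul Complex.I)

/-- Products `φ(x) θ(t)` are test functions. -/
theorem isTest_mul {T : ℝ} {φ : Plane → ℝ} (hφ : ContDiff ℝ ∞ φ) (hφc : HasCompactSupport φ)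
    {θ : ℝ → ℝ} (hθ : ContDiff ℝ ∞ θ) (hθc : HasCompactSupport θ) (hθT : tsupport θ ⊆ Iio T) :
    IsTest T fun q => φ q.1 * θ q.2 := by
  have hsub : tsupport (fun q : SpaceTime => φ q.1 * θ q.2) ⊆ tsupport φ ×ˢ tsupport θ := by
    refine closure_minimal (fun q hq => ?_) ((isClosed_tsupport φ).prod (isClosed_tsupport θ))
    exact ⟨subset_tsupport _ (left_ne_zero_of_mul hq), subset_tsupport _ (right_ne_zero_of_mul hq)⟩
  exact ⟨(hφ.comp contDiff_fst).mul (hθ.comp contDiff_snd),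
    (hφc.isCompact.prod hθc.isCompact).of_isClosed_subset (isClosed_tsupport _) hsub,
    fun q hq => hθT (hsub hq).2⟩

theorem fderiv_mul_apply {φ : Plane → ℝ} (hφ : Differentiable ℝ φ) {θ : ℝ → ℝ}
    (hθ : Differentiable ℝ θ) (q : SpaceTime) (e : Plane) (s : ℝ) :
    fderiv ℝ (fun q : SpaceTime => φ q.1 * θ q.2) q (e, s)
      = θ q.2 * fderiv ℝ φ q.1 e + φ q.1 * (s * deriv θ q.2) := by
  have h1 := (hφ q.1).hasFDerivAt.comp q (hasFDerivAt_fst (𝕜 := ℝ) (p := q))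
  have h2 := (hθ q.2).hasDerivAt.hasFDerivAt.comp q (hasFDerivAt_snd (𝕜 := ℝ) (p := q))
  have h3 : HasFDerivAt (fun q : SpaceTime => φ q.1 * θ q.2) _ q := h1.mul h2
  rw [h3.fderiv]
  simp
  ring

theorem dbar_ofReal {φ : Plane → ℝ} (hφ : Differentiable ℝ φ) (x : Plane) :
    dbar (fun x => (φ x : ℂ)) x
      = (fderiv ℝ φ x (1, 0) : ℝ) + Complex.I * (fderiv ℝ φ x (0, 1) : ℝ) := by
  have h : HasFDerivAt (fun x => (φ x : ℂ)) _ x :=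
    Complex.ofRealCLM.hasFDerivAt.comp x (hφ x).hasFDerivAt
  rw [dbar, h.fderiv]
  simp

/-- The equations for the divergence and the curl hold at almost every time. -/
theorem ae_slice_dbar {G : Geometry} {T : ℝ} (S : Sheet G T)
    {v : SpaceTime → Plane} (hv : LocallyIntegrableOn v (slab₀ T))
    (hdiv : ∀ χ : SpaceTime → ℝ, IsTest T χ →
      ∫ q in slab T, ((v q).1 * d₁ χ q + (v q).2 * d₂ χ q) = 0)
    (hcurl : ∀ χ : SpaceTime → ℝ, IsTest T χ →
      ∫ q in slab T, ((v q).1 * d₂ χ q - (v q).2 * d₁ χ q)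
        = ∫ t in Ioo 0 T, ∫ α in G.params, S.w α t * χ (cx.symm (S.z α t), t))
    {φ : Plane → ℝ} (hφ : ContDiff ℝ ∞ φ) (hφc : HasCompactSupport φ) :
    ∀ᵐ t ∂(volume.restrict (Ioo 0 T)), ∫ x, cvel v (x, t) * dbar (fun x => (φ x : ℂ)) x
      = Complex.I * S.strength (fun x => (φ x : ℂ)) t := by
  set g : Plane → ℂ := fun x => (φ x : ℂ) with hg
  have hφd : Differentiable ℝ φ := hφ.differentiable (by simp)
  have hgd : ContDiff ℝ 1 g := Complex.ofRealCLM.contDiff.comp (hφ.of_le (by simp))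
  have hgc : HasCompactSupport g := hφc.comp_left (g := fun r : ℝ => (r : ℂ)) Complex.ofReal_zero
  have hu := locallyIntegrableOn_cvel hv
  set F : SpaceTime → ℂ := fun q => cvel v q * dbar g q.1 with hF
  have hFK : ∀ K : Set ℝ, IsCompact K → K ⊆ Ioo 0 T → IntegrableOn F (univ ×ˢ K) := by
    intro K hK hKT
    have hc : IsCompact (tsupport g ×ˢ K) := hgc.isCompact.prod hK
    have h1 : IntegrableOn (cvel v) (tsupport g ×ˢ K) :=
      hu.integrableOn_compact_subset (fun q hq => ⟨mem_univ _, (hKT hq.2).1.le, (hKT hq.2).2⟩) hc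
    have h2 := h1.mul_continuousOn ((continuous_dbar hgd).comp continuous_fst).continuousOn hc
    refine h2.of_forall_sdiff_eq_zero (MeasurableSet.univ.prod hK.measurableSet) fun q hq => ?_
    have : dbar g q.1 = 0 := dbar_eq_zero fun h => hq.2 ⟨h, hq.1.2⟩
    exact mul_eq_zero_of_right _ this
  set J : ℝ → ℂ := fun t => ∫ x, F (x, t) with hJ
  have hJK : LocallyIntegrableOn J (Ioo 0 T) := by
    rw [locallyIntegrableOn_iff isOpen_Ioo.isLocallyClosed]
    intro K hKT hK
    have := hFK K hK hKT
    rw [IntegrableOn, restrict_univ_prod] at this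
    exact this.integral_prod_right
  have hsc : ContinuousOn (S.strength g) (Ioo 0 T) :=
    (S.continuousOn_strength hgd.continuous hgc).mono Ioo_subset_Ico_self
  have hsl : LocallyIntegrableOn (S.strength g) (Ioo 0 T) :=
    hsc.locallyIntegrableOn measurableSet_Ioo
  have hsl' : LocallyIntegrableOn (fun t => Complex.I * S.strength g t) (Ioo 0 T) :=
    (continuousOn_const.mul hsc).locallyIntegrableOn measurableSet_Ioo
  have hae := isOpen_Ioo.ae_eq_zero_of_integral_contDiff_smul_eq_zero (μ := volume)
    (hJK.sub hsl') ?_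
  · rw [ae_restrict_iff' measurableSet_Ioo]
    filter_upwards [hae] with t ht htT
    exact sub_eq_zero.1 (ht htT)
  intro θ hθ hθc hθT
  have hθd : Differentiable ℝ θ := hθ.differentiable (by simp)
  have htest := isTest_mul hφ hφc hθ hθc fun t ht => (hθT ht).2
  set χ : SpaceTime → ℝ := fun q => φ q.1 * θ q.2 with hχ
  have e1 : ∀ q, d₁ χ q = θ q.2 * fderiv ℝ φ q.1 (1, 0) := fun q => by
    rw [d₁, fderiv_mul_apply hφd hθd]; ring
  have e2 : ∀ q, d₂ χ q = θ q.2 * fderiv ℝ φ q.1 (0, 1) := fun q => by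
    rw [d₂, fderiv_mul_apply hφd hθd]; ring
  have hsupp : tsupport χ ⊆ {q | q.2 < T} := htest.support
  have hv1 : LocallyIntegrableOn (fun q => (v q).1) (slab₀ T) := fun q hq => by
    obtain ⟨t, ht, hi⟩ := hv q hq
    exact ⟨t, ht, (ContinuousLinearMap.fst ℝ ℝ ℝ).integrable_comp hi⟩
  have hv2 : LocallyIntegrableOn (fun q => (v q).2) (slab₀ T) := fun q hq => by
    obtain ⟨t, ht, hi⟩ := hv q hq
    exact ⟨t, ht, (ContinuousLinearMap.snd ℝ ℝ ℝ).integrable_comp hi⟩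
  have hi : ∀ {f : SpaceTime → ℝ}, LocallyIntegrableOn f (slab₀ T) → ∀ e : SpaceTime,
      IntegrableOn (fun q => f q * fderiv ℝ χ q e) (slab T) := fun {f} hf e => by
    refine integrableOn_slab_mul hf ?_ htest.compact hsupp fun q hq => by
      rw [fderiv_eq_zero_of_notMem_tsupport hq]; rfl
    exact (htest.smooth.continuous_fderiv (by simp)).clm_apply continuous_const
  have hid : IntegrableOn (fun q => (v q).1 * d₁ χ q + (v q).2 * d₂ χ q) (slab T) :=
    (hi hv1 _).add (hi hv2 _)
  have hic : IntegrableOn (fun q => (v q).1 * d₂ χ q - (v q).2 * d₁ χ q) (slab T) :=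
    (hi hv1 _).sub (hi hv2 _)
  have hcomb : ∀ q, θ q.2 • F q = (((v q).1 * d₁ χ q + (v q).2 * d₂ χ q : ℝ) : ℂ)
      + Complex.I * ((v q).1 * d₂ χ q - (v q).2 * d₁ χ q : ℝ) := fun q => by
    rw [e1, e2, hF, Complex.real_smul]
    simp only [hg]
    rw [dbar_ofReal hφd, cvel]
    push_cast
    linear_combination (-(θ q.2 : ℂ) * (v q).2 * (fderiv ℝ φ q.1 (0, 1) : ℝ)) * Complex.I_mul_I
  have hleft : ∫ q in slab T, θ q.2 • F q
      = Complex.I * ((∫ t in Ioo 0 T, ∫ α in G.params, S.w α t * χ (cx.symm (S.z α t), t) : ℝ) : ℂ) := by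
    rw [← hcurl χ htest, ← integral_complex_ofReal]
    simp only [hcomb]
    rw [integral_add hid.ofReal (hic.ofReal.const_mul _), integral_const_mul, integral_complex_ofReal,
      hdiv χ htest, Complex.ofReal_zero, zero_add]
  have hθF : IntegrableOn (fun q => θ q.2 • F q) (slab T) := by
    have : (fun q => θ q.2 • F q) = fun q => (((v q).1 * d₁ χ q + (v q).2 * d₂ χ q : ℝ) : ℂ)
      + Complex.I * ((v q).1 * d₂ χ q - (v q).2 * d₁ χ q : ℝ) := funext hcomb
    rw [this]
    exact hid.ofReal.add (hic.ofReal.const_mul _)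
  have hleft2 : ∫ q in slab T, θ q.2 • F q = ∫ t in Ioo 0 T, θ t • J t := by
    rw [slab, restrict_univ_prod]
    rw [IntegrableOn, slab, restrict_univ_prod] at hθF
    rw [integral_prod_symm _ hθF]
    simp only [integral_smul, hJ]
  have hright : ((∫ t in Ioo 0 T, ∫ α in G.params, S.w α t * χ (cx.symm (S.z α t), t) : ℝ) : ℂ)
      = ∫ t in Ioo 0 T, θ t • S.strength g t := by
    rw [← integral_complex_ofReal]
    refine integral_congr_ae (Eventually.of_forall fun t => ?_)
    simp only [Sheet.strength, hχ, hg]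
    rw [← integral_complex_ofReal, ← integral_smul]
    refine integral_congr_ae (Eventually.of_forall fun α => ?_)
    simp only [Complex.real_smul]
    push_cast
    ring
  have hset : ∀ f : ℝ → ℂ, ∫ t in Ioo 0 T, θ t • f t = ∫ t, θ t • f t := fun f => by
    refine setIntegral_eq_integral_of_forall_compl_eq_zero fun t ht => ?_
    rw [image_eq_zero_of_notMem_tsupport fun h => ht (hθT h), zero_smul]
  have hloc : ∀ {f : ℝ → ℂ}, LocallyIntegrableOn f (Ioo 0 T) → Integrable fun t => θ t • f t :=
    fun {f} hf => by
      have h1 := (hf.integrableOn_compact_subset hθT hθc).continuousOn_smul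
        hθ.continuous.continuousOn hθc
      refine (integrableOn_iff_integrable_of_support_subset fun t ht => ?_).1 h1
      by_contra hn
      exact ht (by simp [image_eq_zero_of_notMem_tsupport hn])
  simp only [Pi.sub_apply, smul_sub]
  rw [integral_sub (hloc hJK) (hloc hsl'), ← hset, ← hleft2, hleft, hright, hset, sub_eq_zero,
    ← integral_const_mul]
  refine integral_congr_ae (Eventually.of_forall fun t => ?_)
  simp only [Complex.real_smul]
  ring

/-! ### The velocity is given by the Biot-Savart law -/

/-- A measurable function that vanishes almost everywhere at almost every time vanishes almost
everywhere in space-time. -/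
theorem ae_eq_zero_of_slices {E : Type*} [NormedAddCommGroup E] {μ : Measure Plane}
    {ν : Measure ℝ} [SFinite μ] [SFinite ν] {h : SpaceTime → E}
    (hm : AEStronglyMeasurable h (μ.prod ν)) (h0 : ∀ᵐ t ∂ν, ∀ᵐ x ∂μ, h (x, t) = 0) :
    ∀ᵐ q ∂(μ.prod ν), h q = 0 := by
  have h1 : ∫⁻ q, ‖h q‖ₑ ∂(μ.prod ν) = 0 := by
    rw [lintegral_prod_symm _ hm.enorm]
    refine (lintegral_congr_ae (g := fun _ => 0) ?_).trans lintegral_zero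
    filter_upwards [h0] with t ht
    refine (lintegral_congr_ae (g := fun _ => 0) ?_).trans lintegral_zero
    filter_upwards [ht] with x hx
    simp [hx]
  rw [lintegral_eq_zero_iff' hm.enorm] at h1
  filter_upwards [h1] with q hq
  simpa using hq

namespace Sheet

variable {G : Geometry} {T : ℝ} (S : Sheet G T) {Ω : Bool → ℝ → Set Plane}

theorem continuousOn_vel_openRegion (hΩ : Sides S Ω) (b : Bool) :
    ContinuousOn (fun q : SpaceTime => S.vel (cx q.1) q.2) (openRegion T (Ω b)) := fun q hq =>
  (S.continuousWithinAt_vel (q := q) ⟨mem_univ _, hq.1.1.le, hq.1.2⟩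
    (hΩ.off ⟨hq.1.1.le, hq.1.2⟩ hq.2)).mono fun _ h => ⟨mem_univ _, h.1.1.le, h.1.2⟩

theorem aestronglyMeasurable_of_continuousOn (hΩ : Sides S Ω) {E : Type*} [NormedAddCommGroup E]
    {f : SpaceTime → E} (hf : ∀ b, ContinuousOn f (openRegion T (Ω b))) :
    AEStronglyMeasurable f (volume.restrict (slab T)) := by
  have h1 : volume.restrict (slab T)
      = volume.restrict (openRegion T (Ω true) ∪ openRegion T (Ω false)) := by
    refine Measure.restrict_congr_set (ae_eq_set.2 ⟨hΩ.volume_slab_diff, ?_⟩)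
    rw [sdiff_eq_empty.2 (union_subset (Sides.openRegion_subset _) (Sides.openRegion_subset _)),
      measure_empty]
  rw [h1]
  exact (ContinuousOn.union_of_isOpen (hf true) (hf false) (hΩ.isOpen_openRegion _)
    (hΩ.isOpen_openRegion _)).aestronglyMeasurable
    ((hΩ.isOpen_openRegion _).union (hΩ.isOpen_openRegion _)).measurableSet

theorem ae_off {t : ℝ} (ht : t ∈ Ico 0 T) : ∀ᵐ x : Plane, S.Off t (cx x) := by
  rw [ae_iff]; exact S.volume_curve ht

theorem aestronglyMeasurable_vel_slice {t : ℝ} (ht : t ∈ Ico 0 T) :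
    AEStronglyMeasurable (fun x : Plane => S.vel (cx x) t) volume := by
  have ho : IsOpen {x : Plane | S.Off t (cx x)} := (S.isOpen_off ht).preimage cx.continuous
  have h : ContinuousOn (fun x : Plane => S.vel (cx x) t) {x : Plane | S.Off t (cx x)} := fun x hx =>
    ((S.hasDerivAt_vel ht hx).continuousAt.comp cx.continuous.continuousAt).continuousWithinAt
  have h2 := h.aestronglyMeasurable (μ := volume) ho.measurableSet
  have h3 : volume.restrict {x : Plane | S.Off t (cx x)} = volume :=
    Measure.restrict_eq_self_of_ae_mem (S.ae_off ht)
  rwa [h3] at h2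

theorem locallyIntegrable_vel_slice (hΩ : Sides S Ω) {t : ℝ} (ht : t ∈ Ico 0 T) :
    LocallyIntegrable fun x : Plane => S.vel (cx x) t := by
  intro x₀
  have hm : StronglyMeasurableAtFilter (fun x : Plane => S.vel (cx x) t) (𝓝 x₀) :=
    ⟨univ, univ_mem, (S.aestronglyMeasurable_vel_slice ht).restrict⟩
  suffices h : ∃ C : ℝ, ∀ᶠ x in 𝓝 x₀, S.Off t (cx x) → ‖S.vel (cx x) t‖ ≤ C by
    obtain ⟨C, hC⟩ := h
    refine (Measure.FiniteAtFilter.integrableAtFilter (hm.filter_mono inf_le_left)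
      (volume.finiteAt_nhds x₀).inf_of_left ⟨C, ?_⟩).of_inf_ae
    rw [eventually_map, eventually_inf]
    refine ⟨_, hC, _, S.ae_off ht, fun x hx => hx.1 hx.2⟩
  by_cases hoff : S.Off t (cx x₀)
  · refine ⟨‖S.vel (cx x₀) t‖ + 1, ?_⟩
    have hc : ContinuousAt (fun x : Plane => S.vel (cx x) t) x₀ :=
      ContinuousAt.comp (f := fun x : Plane => cx x) (g := fun w : ℂ => S.vel w t)
        (S.hasDerivAt_vel ht hoff).continuousAt cx.continuous.continuousAt
    filter_upwards [hc.norm.eventually_lt_const (lt_add_one _)] with x hx _ using hx.le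
  · rw [S.off_iff ht] at hoff
    push Not at hoff
    obtain ⟨α, hα⟩ := hoff
    have e : cx.symm (S.z α t) = x₀ := by rw [← hα]; simp
    have hb : ∀ b, ∃ C : ℝ, ∀ᶠ x in 𝓝 x₀, x ∈ Ω b t → ‖S.vel (cx x) t‖ ≤ C := fun b => by
      obtain ⟨L, hL⟩ := S.exists_limit_vel hΩ α ht b
      refine ⟨‖L‖ + 1, ?_⟩
      have h1 := hL.norm.eventually_lt_const (lt_add_one _)
      rw [eventually_nhdsWithin_iff, e] at h1
      have hc : ContinuousAt (fun x : Plane => ((x, t) : SpaceTime)) x₀ := by fun_prop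
      filter_upwards [hc.eventually h1] with x hx hxΩ using (hx ⟨ht, hxΩ⟩).le
    obtain ⟨C₁, h1⟩ := hb true
    obtain ⟨C₂, h2⟩ := hb false
    refine ⟨max C₁ C₂, ?_⟩
    filter_upwards [h1, h2] with x hx1 hx2 hxoff
    rcases (hΩ.mem_or ht).2 hxoff with h | h
    · exact le_max_of_le_left (hx1 h)
    · exact le_max_of_le_right (hx2 h)

/-- If the kernel has a limit at infinity, so does the velocity. -/
theorem tendsto_vel {t : ℝ} (ht : t ∈ Ico 0 T) {l : Filter Plane} {κ : ℂ}
    (h : ∀ ε > 0, ∀ᶠ x in l, ∀ α ∈ Icc (-Real.pi) Real.pi, ‖bsKer G (cx x - S.z α t) - κ‖ ≤ ε) :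
    Tendsto (fun x => S.vel (cx x) t) l
      (𝓝 ((2 * Real.pi * Complex.I)⁻¹ * ((∫ α in (-Real.pi)..Real.pi, S.wc α t) * κ))) := by
  have hpi : -Real.pi ≤ Real.pi := by linarith [Real.pi_pos]
  have hwc := continuous_slice S.cont_wc ht
  obtain ⟨C, hC⟩ := (isCompact_Icc (a := -Real.pi) (b := Real.pi)).exists_bound_of_continuousOn
    hwc.continuousOn
  have hC0 : 0 ≤ C := (norm_nonneg _).trans (hC 0 ⟨by linarith [Real.pi_pos], Real.pi_pos.le⟩)
  refine Tendsto.const_mul _ ?_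
  rw [tendsto_iff_norm_sub_tendsto_zero]
  have key : ∀ ε > 0, ∀ᶠ x in l, ‖S.cauchy (bsKer G) S.wc (-Real.pi) (cx x) t
      - (∫ α in (-Real.pi)..Real.pi, S.wc α t) * κ‖ ≤ C * ε * (2 * Real.pi) := by
    intro ε hε
    filter_upwards [h ε hε] with x hx
    have hi2 : IntervalIntegrable (fun α => S.wc α t * κ) volume (-Real.pi) Real.pi :=
      (hwc.mul continuous_const).intervalIntegrable _ _
    have hbd : ∀ α ∈ Icc (-Real.pi) Real.pi,
        ‖S.wc α t * (bsKer G (cx x - S.z α t) - κ)‖ ≤ C * ε := fun α hα => by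
      rw [norm_mul]
      exact mul_le_mul (hC α hα) (hx α hα) (norm_nonneg _) hC0
    have hm : Measurable fun α => S.wc α t * (bsKer G (cx x - S.z α t) - κ) :=
      hwc.measurable.mul (((measurable_bsKer G).comp
        ((continuous_slice S.cont_z ht).measurable.const_sub (cx x))).sub_const κ)
    have hi1 : IntervalIntegrable (fun α => S.wc α t * (bsKer G (cx x - S.z α t) - κ)) volume
        (-Real.pi) Real.pi := by
      rw [intervalIntegrable_iff, uIoc_of_le hpi]
      refine Integrable.mono' (g := fun _ => C * ε) (integrable_const _) hm.aestronglyMeasurable ?_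
      filter_upwards [ae_restrict_mem measurableSet_Ioc] with α hα
      exact hbd α (Ioc_subset_Icc_self hα)
    have e : S.cauchy (bsKer G) S.wc (-Real.pi) (cx x) t
        - (∫ α in (-Real.pi)..Real.pi, S.wc α t) * κ
        = ∫ α in (-Real.pi)..Real.pi, S.wc α t * (bsKer G (cx x - S.z α t) - κ) := by
      rw [cauchy, show -Real.pi + 2 * Real.pi = Real.pi by ring,
        ← intervalIntegral.integral_mul_const, sub_eq_iff_eq_add,
        ← intervalIntegral.integral_add hi1 hi2]
      refine intervalIntegral.integral_congr fun α _ => ?_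
      ring
    rw [e]
    refine (intervalIntegral.norm_integral_le_of_norm_le_const fun α hα => hbd α ?_).trans ?_
    · rw [uIoc_of_le hpi] at hα; exact Ioc_subset_Icc_self hα
    · rw [abs_of_nonneg (by linarith)]
      exact le_of_eq (by ring)
  rw [Metric.tendsto_nhds]
  intro ε hε
  have hpos : 0 < ε / ((C + 1) * (2 * Real.pi + 1)) := by
    have := Real.pi_pos; positivity
  filter_upwards [key _ hpos] with x hx
  rw [dist_zero_right, norm_norm]
  refine hx.trans_lt ?_
  have h1 : C * (ε / ((C + 1) * (2 * Real.pi + 1))) * (2 * Real.pi)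
      = ε * (C / (C + 1) * (2 * Real.pi / (2 * Real.pi + 1))) := by
    have := Real.pi_pos
    field_simp
  rw [h1]
  have h2 : C / (C + 1) < 1 := by rw [div_lt_one (by linarith)]; linarith
  have h3 : 2 * Real.pi / (2 * Real.pi + 1) < 1 := by
    rw [div_lt_one (by linarith [Real.pi_pos])]; linarith
  have h4 : 0 ≤ C / (C + 1) := by positivity
  have h5 : 0 ≤ 2 * Real.pi / (2 * Real.pi + 1) := by have := Real.pi_pos; positivity
  have h6 := mul_lt_one_of_nonneg_of_lt_one_left h4 h2 h3.le
  nlinarith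

theorem exists_bound_z {t : ℝ} (ht : t ∈ Ico 0 T) :
    ∃ A, ∀ α ∈ Icc (-Real.pi) Real.pi, ‖S.z α t‖ ≤ A :=
  isCompact_Icc.exists_bound_of_continuousOn (continuous_slice S.cont_z ht).continuousOn

theorem tendsto_vel_closed (S : Sheet .closed T) {t : ℝ} (ht : t ∈ Ico 0 T) :
    Tendsto (fun x : Plane => S.vel (cx x) t) (cocompact Plane) (𝓝 0) := by
  obtain ⟨A, hA⟩ := S.exists_bound_z ht
  have h := S.tendsto_vel ht (l := cocompact Plane) (κ := 0) fun ε hε => by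
    have h2 : (Metric.closedBall (0 : Plane) (A + 1 / ε))ᶜ ∈ cocompact Plane :=
      (isCompact_closedBall _ _).compl_mem_cocompact
    filter_upwards [h2] with x hx α hα
    rw [mem_compl_iff, mem_closedBall_zero_iff, not_le] at hx
    have h3 : ‖x‖ ≤ ‖cx x‖ := by
      rw [Prod.norm_def]
      exact max_le (Complex.abs_re_le_norm (cx x)) (Complex.abs_im_le_norm (cx x))
    have h4 := norm_sub_norm_le (cx x) (S.z α t)
    have h5 := hA α hα
    rw [bsKer_closed, sub_zero, norm_div, norm_one]
    have h6 : 1 / ε ≤ ‖cx x - S.z α t‖ := by linarith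
    have := one_div_le_one_div_of_le (by positivity) h6
    rwa [one_div_one_div] at this
  simpa using h

theorem tendsto_vel_periodic (S : Sheet .periodic T) {t : ℝ} (ht : t ∈ Ico 0 T) :
    ∃ V : ℂ, Tendsto (fun x : Plane => S.vel (cx x) t) (comap Prod.snd atTop) (𝓝 V) ∧
      Tendsto (fun x : Plane => S.vel (cx x) t) (comap Prod.snd atBot) (𝓝 (-V)) := by
  obtain ⟨A, hA⟩ := S.exists_bound_z ht
  have him : ∀ (x : Plane), ∀ α ∈ Icc (-Real.pi) Real.pi, |(cx x - S.z α t).im - x.2| ≤ A :=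
    fun x α hα => by
      have := (Complex.abs_im_le_norm (S.z α t)).trans (hA α hα)
      rwa [Complex.sub_im, cx_im, sub_sub_cancel_left, abs_neg]
  have h1 := S.tendsto_vel ht (l := comap Prod.snd atTop) (κ := -(Complex.I / 2)) fun ε hε => by
    obtain ⟨s, hs, h⟩ := mem_comap.1
      (tendsto_bsKer_periodic_atTop (Metric.closedBall_mem_nhds _ hε))
    obtain ⟨M, hM⟩ := mem_atTop_sets.1 hs
    filter_upwards [preimage_mem_comap (Ici_mem_atTop (M + A))] with x hx α hα
    have h2 := (abs_le.1 (him x α hα)).1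
    have h3 : M + A ≤ x.2 := hx
    have h4 := h (hM _ (show M ≤ (cx x - S.z α t).im by linarith))
    rwa [mem_preimage, mem_closedBall_iff_norm] at h4
  have h2 := S.tendsto_vel ht (l := comap Prod.snd atBot) (κ := Complex.I / 2) fun ε hε => by
    obtain ⟨s, hs, h⟩ := mem_comap.1
      (tendsto_bsKer_periodic_atBot (Metric.closedBall_mem_nhds _ hε))
    obtain ⟨M, hM⟩ := mem_atBot_sets.1 hs
    filter_upwards [preimage_mem_comap (Iic_mem_atBot (M - A))] with x hx α hα
    have h2 := (abs_le.1 (him x α hα)).2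
    have h3 : x.2 ≤ M - A := hx
    have h4 := h (hM _ (show (cx x - S.z α t).im ≤ M by linarith))
    rwa [mem_preimage, mem_closedBall_iff_norm] at h4
  refine ⟨_, h1, ?_⟩
  convert h2 using 2
  ring

theorem vel_add_shift (x : ℂ) (t : ℝ) : S.vel (x + cshift G) t = S.vel x t := by
  rw [vel, vel, cauchy, cauchy]
  congr 1
  refine intervalIntegral.integral_congr fun α _ => ?_
  rw [show x + cshift G - S.z α t = x - S.z α t + cshift G by ring, bsKer_add_shift]

/-- By the conditions at infinity, Liouville's theorem applies to the difference of the velocity and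
of the Biot-Savart integral. -/
theorem ae_decays {v : SpaceTime → Plane} (hfar : FarField T v G) :
    ∀ᵐ t ∂(volume.restrict (Ioo 0 T)),
      Decays (fun x => cvel v (x, t) - S.vel (cx x) t) G := by
  have hcj : ∀ {l : Filter Plane} {t : ℝ} {V : Plane}, Tendsto (fun x => v (x, t)) l (𝓝 V) →
      Tendsto (fun x => cvel v (x, t)) l (𝓝 ((starRingEnd ℂ) (cx V))) := fun h => by
    simp only [cvel_eq]
    exact (Complex.continuous_conj.tendsto _).comp ((cx.continuous.tendsto _).comp h)
  have hT := ae_restrict_mem (μ := (volume : Measure ℝ)) (measurableSet_Ioo (a := 0) (b := T))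
  cases G with
  | closed =>
    have hfar' : ∀ᵐ t ∂(volume.restrict (Ioo 0 T)),
      Tendsto (fun x : Plane => v (x, t)) (cocompact Plane ⊓ ae volume) (𝓝 0) := hfar
    filter_upwards [hfar', hT] with t ht htT
    have h1 := (hcj ht).sub ((S.tendsto_vel_closed ⟨htT.1.le, htT.2⟩).mono_left
      (inf_le_left (b := ae volume)))
    simpa [Decays] using h1
  | periodic =>
    have hfar' : ∀ᵐ t ∂(volume.restrict (Ioo 0 T)),
      (∀ᵐ x : Plane, v (x + (2 * Real.pi, 0), t) = v (x, t)) ∧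
      ∃ V : Plane,
        Tendsto (fun x : Plane => v (x, t)) (comap Prod.snd atTop ⊓ ae volume) (𝓝 V) ∧
        Tendsto (fun x : Plane => v (x, t)) (comap Prod.snd atBot ⊓ ae volume) (𝓝 (-V)) := hfar
    filter_upwards [hfar', hT] with t ht htT
    obtain ⟨hper, V, hV1, hV2⟩ := ht
    obtain ⟨V', hV1', hV2'⟩ := S.tendsto_vel_periodic ⟨htT.1.le, htT.2⟩
    refine ⟨?_, (starRingEnd ℂ) (cx V) - V', ?_, ?_⟩
    · filter_upwards [hper] with x hx
      have e1 : cx (x + (2 * Real.pi, 0)) = cx x + cshift .periodic := by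
        rw [map_add]; congr 1; apply Complex.ext <;> simp [cshift]
      rw [e1, S.vel_add_shift, cvel_eq, cvel_eq, hx]
    · exact (hcj hV1).sub (hV1'.mono_left inf_le_left)
    · have := (hcj hV2).sub (hV2'.mono_left (inf_le_left (b := ae volume)))
      rw [map_neg, map_neg] at this
      convert this using 2
      ring

/-- The velocity is the Biot-Savart integral of the vorticity. -/
theorem ae_cvel_eq (hΩ : Sides S Ω) {v : SpaceTime → Plane}
    (hv : LocallyIntegrableOn v (slab₀ T))
    (hdiv : ∀ χ : SpaceTime → ℝ, IsTest T χ →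
      ∫ q in slab T, ((v q).1 * d₁ χ q + (v q).2 * d₂ χ q) = 0)
    (hcurl : ∀ χ : SpaceTime → ℝ, IsTest T χ →
      ∫ q in slab T, ((v q).1 * d₂ χ q - (v q).2 * d₁ χ q)
        = ∫ t in Ioo 0 T, ∫ α in G.params, S.w α t * χ (cx.symm (S.z α t), t))
    (hfar : FarField T v G) :
    ∀ᵐ q ∂(volume.restrict (slab T)), cvel v q = S.vel (cx q.1) q.2 := by
  obtain ⟨D, hDc, hD⟩ := TopologicalSpace.exists_countable_dense Plane
  have hu := locallyIntegrableOn_cvel hv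
  have hslice : ∀ᵐ t ∂(volume.restrict (Ioo 0 T)), ∀ n : ℕ, ∀ y ∈ D,
      ∫ x, cvel v (x, t) * dbar (mollAt n y) x = Complex.I * S.strength (mollAt n y) t := by
    rw [ae_all_iff]
    intro n
    rw [ae_ball_iff hDc]
    exact fun y _ => ae_slice_dbar S hv hdiv hcurl (contDiff_moll_sub n y (k := ⊤))
      (hasCompactSupport_moll_sub n y)
  have hT := ae_restrict_mem (μ := (volume : Measure ℝ)) (measurableSet_Ioo (a := 0) (b := T))
  have h := ae_eq_zero_of_slices (μ := volume) (ν := volume.restrict (Ioo 0 T))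
    (h := fun q : SpaceTime => cvel v q - S.vel (cx q.1) q.2) ?_ ?_
  · rw [slab, restrict_univ_prod]
    filter_upwards [h] with q hq using sub_eq_zero.1 hq
  · rw [← restrict_univ_prod]
    refine AEStronglyMeasurable.sub ?_ (S.aestronglyMeasurable_of_continuousOn hΩ
      (S.continuousOn_vel_openRegion hΩ))
    exact (hu.mono_set (prod_mono Subset.rfl Ioo_subset_Ico_self)).aestronglyMeasurable
  · filter_upwards [hslice, ae_locallyIntegrable_slice hu, S.ae_decays hfar, hT] with t h1 h2 h3 htT
    have ht : t ∈ Ico 0 T := ⟨htT.1.le, htT.2⟩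
    have hvl := S.locallyIntegrable_vel_slice hΩ ht
    refine ae_eq_zero_of_weak_holomorphic (h2.sub hvl) h3 hD fun n y hy => ?_
    obtain ⟨hi, he⟩ := S.integral_vel_mul_dbar ht (contDiff_mollAt n y (k := 1)) (y := cx y)
      (fun x hx => norm_sub_le_of_mem_tsupport_mollAt hx) (hasCompactSupport_mollAt n y)
    simp only [sub_mul]
    rw [integral_sub _ hi, he, h1 n y hy, sub_self]
    have := h2.integrable_smul_left_of_hasCompactSupport
      (continuous_dbar (contDiff_mollAt n y (k := 1)))
      (hasCompactSupport_dbar (hasCompactSupport_mollAt n y))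
    simpa only [smul_eq_mul, mul_comm] using this

end Sheet

/-! ### Bernoulli's law in each fluid -/

instance isAddHaarMeasure_spaceTime : (volume : Measure SpaceTime).IsAddHaarMeasure :=
  inferInstanceAs ((volume : Measure Plane).prod (volume : Measure ℝ)).IsAddHaarMeasure

/-- Integration by parts of a space-time divergence against a test function; the fields need only be
differentiable along the axes. -/
theorem integral_div_test {O : Set SpaceTime} {A₀ A₁ A₂ A₀' A₁' A₂' ζ : SpaceTime → ℝ}
    (hζ : ContDiff ℝ 1 ζ) (hζc : HasCompactSupport ζ) (hζO : tsupport ζ ⊆ O)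
    (h₀ : ContinuousOn A₀ O) (h₁ : ContinuousOn A₁ O) (h₂ : ContinuousOn A₂ O)
    (h₀' : ContinuousOn A₀' O) (h₁' : ContinuousOn A₁' O) (h₂' : ContinuousOn A₂' O)
    (hd₀ : ∀ q ∈ O, HasLineDerivAt ℝ A₀ (A₀' q) q ((0, 0), 1))
    (hd₁ : ∀ q ∈ O, HasLineDerivAt ℝ A₁ (A₁' q) q ((1, 0), 0))
    (hd₂ : ∀ q ∈ O, HasLineDerivAt ℝ A₂ (A₂' q) q ((0, 1), 0)) :
    Integrable (fun q => A₀ q * dt ζ q + A₁ q * d₁ ζ q + A₂ q * d₂ ζ q) ∧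
    ∫ q, (A₀ q * dt ζ q + A₁ q * d₁ ζ q + A₂ q * d₂ ζ q)
      = -∫ q, (A₀' q + A₁' q + A₂' q) * ζ q := by
  have hi : ∀ {A : SpaceTime → ℝ}, ContinuousOn A O → ∀ e : SpaceTime,
      Integrable fun q => A q * fderiv ℝ ζ q e := fun hA e =>
    integrable_mul_of_continuousOn hζc (hA.mono hζO)
      ((hζ.continuous_fderiv one_ne_zero).clm_apply continuous_const).continuousOn fun q hq => by
        rw [fderiv_eq_zero_of_notMem_tsupport hq]; rfl
  have hi' : ∀ {A : SpaceTime → ℝ}, ContinuousOn A O → Integrable fun q => A q * ζ q := fun hA =>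
    integrable_mul_of_continuousOn hζc (hA.mono hζO) hζ.continuous.continuousOn fun q hq =>
      image_eq_zero_of_notMem_tsupport hq
  have e0 := integral_mul_fderiv (μ := volume) hζ hζc (h₀.mono hζO) (h₀'.mono hζO)
    fun q hq => hd₀ q (hζO hq)
  have e1 := integral_mul_fderiv (μ := volume) hζ hζc (h₁.mono hζO) (h₁'.mono hζO)
    fun q hq => hd₁ q (hζO hq)
  have e2 := integral_mul_fderiv (μ := volume) hζ hζc (h₂.mono hζO) (h₂'.mono hζO)
    fun q hq => hd₂ q (hζO hq)
  refine ⟨((hi h₀ _).add (hi h₁ _)).add (hi h₂ _), ?_⟩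
  simp only [add_mul]
  have i1 : Integrable fun q => A₀ q * dt ζ q + A₁ q * d₁ ζ q := (hi h₀ _).add (hi h₁ _)
  have i2 : Integrable fun q => A₀' q * ζ q + A₁' q * ζ q := (hi' h₀').add (hi' h₁')
  have j1 : Integrable fun q => A₁ q * d₁ ζ q := hi h₁ _
  have j2 : Integrable fun q => A₂ q * d₂ ζ q := hi h₂ _
  have j0 : Integrable fun q => A₀ q * dt ζ q := hi h₀ _
  rw [integral_add i1 j2, integral_add j0 j1, integral_add i2 (hi' h₂'),
    integral_add (hi' h₀') (hi' h₁'), show ∫ q, A₀ q * dt ζ q = _ from e0,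
    show ∫ q, A₁ q * d₁ ζ q = _ from e1, show ∫ q, A₂ q * d₂ ζ q = _ from e2]
  ring

namespace Sheet

variable {G : Geometry} {T : ℝ} (S : Sheet G T) {Ω : Bool → ℝ → Set Plane}

theorem hasLineDerivAt_space {f f' : ℂ → ℝ → ℂ} {q : SpaceTime}
    (h : HasDerivAt (fun x => f x q.2) (f' (cx q.1) q.2) (cx q.1)) (e : Plane) :
    HasLineDerivAt ℝ (fun q : SpaceTime => f (cx q.1) q.2) (f' (cx q.1) q.2 * cx e) q (e, 0) := by
  have h1 : HasDerivAt (fun s : ℝ => cx q.1 + s • cx e) (cx e) 0 := by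
    simpa using ((hasDerivAt_id (0 : ℝ)).smul_const (cx e)).const_add (cx q.1)
  have h2 : HasDerivAt (fun x => f x q.2) (f' (cx q.1) q.2) (cx q.1 + (0 : ℝ) • cx e) := by
    simpa using h
  have h3 := h2.comp (0 : ℝ) h1
  rw [HasLineDerivAt]
  refine h3.congr_of_eventuallyEq (Eventually.of_forall fun s => ?_)
  simp

theorem hasLineDerivAt_time {f f' : ℂ → ℝ → ℂ} {q : SpaceTime}
    (h : HasDerivAt (fun t => f (cx q.1) t) (f' (cx q.1) q.2) q.2) :
    HasLineDerivAt ℝ (fun q : SpaceTime => f (cx q.1) q.2) (f' (cx q.1) q.2) q ((0, 0), 1) := by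
  have h1 : HasDerivAt (fun s : ℝ => q.2 + s) 1 0 := (hasDerivAt_id (0 : ℝ)).const_add q.2
  have h2 : HasDerivAt (fun t => f (cx q.1) t) (f' (cx q.1) q.2) (q.2 + 0) := by simpa using h
  have h3 := h2.scomp (0 : ℝ) h1
  rw [one_smul] at h3
  rw [HasLineDerivAt]
  refine h3.congr_of_eventuallyEq (Eventually.of_forall fun s => ?_)
  have : ((0, 0) : Plane) = 0 := rfl
  simp [this]

/-- The Bernoulli function, for density `r`: the sum of the pressure and of this function depends on
time only. -/
def bern (c : ℝ) (σ₀ : ℂ) (g r : ℝ) (q : SpaceTime) : ℝ :=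
  r * ((S.accPot c σ₀ (cx q.1) q.2).re
    + ((S.vel (cx q.1) q.2).re ^ 2 + (S.vel (cx q.1) q.2).im ^ 2) / 2 + g * q.1.2)

/-- In a fluid of density `r`, the sum of the pressure and the Bernoulli function has no spatial
gradient in the weak sense: this is the momentum equation, where `v · ∇v` is the gradient of `|v|² / 2`
because `v₁ - i v₂` is holomorphic. -/
theorem weak_gradient (hΩ : Sides S Ω) {b : Bool} {O : Set SpaceTime}
    (hO : O ⊆ openRegion T (Ω b)) {c : ℝ} {σ₀ : ℂ} (hσ₀ : σ₀ ≠ 0) (hbr : ∀ q ∈ O, S.Branch c σ₀ q)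
    {g r : ℝ} {ρ : SpaceTime → ℝ} {v : SpaceTime → Plane} {p : SpaceTime → ℝ} {ρ₀ : Plane → ℝ}
    {v₀ : Plane → Plane} (hsol : IsWeakSolution g T ρ v p ρ₀ v₀)
    (hρ : ∀ q ∈ openRegion T (Ω b), ρ q = r)
    (hvel : ∀ᵐ q ∂(volume.restrict (slab T)), cvel v q = S.vel (cx q.1) q.2)
    {ζ : SpaceTime → ℝ} (hζ : ContDiff ℝ ∞ ζ) (hζc : HasCompactSupport ζ) (hζO : tsupport ζ ⊆ O) :
    (∫ q, (p q + S.bern c σ₀ g r q) * d₁ ζ q = 0) ∧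
      ∫ q, (p q + S.bern c σ₀ g r q) * d₂ ζ q = 0 := by
  have hζ1 : ContDiff ℝ 1 ζ := hζ.of_le (by simp)
  have hOT : ∀ q ∈ O, q.2 ∈ Ioo 0 T := fun q hq => (hO hq).1
  have hOT' : ∀ q ∈ O, q.2 ∈ Ico 0 T := fun q hq => ⟨(hOT q hq).1.le, (hOT q hq).2⟩
  have hOs : O ⊆ slab₀ T := fun q hq => ⟨mem_univ _, hOT' q hq⟩
  have hoff : ∀ q ∈ O, S.Off q.2 (cx q.1) := fun q hq => hΩ.off (hOT' q hq) (hO hq).2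
  have htest : IsTest T ζ := ⟨hζ, hζc, fun q hq => (hOT q (hζO hq)).2⟩
  have hzero : IsTest T fun _ => (0 : ℝ) :=
    ⟨contDiff_const, HasCompactSupport.zero, by simp [tsupport]⟩
  -- the coordinates of the velocity and their derivatives
  set U : SpaceTime → ℂ := fun q => S.vel (cx q.1) q.2 with hU
  set D : SpaceTime → ℂ := fun q => S.velDeriv (cx q.1) q.2 with hD
  set W : SpaceTime → ℂ := fun q => S.velTime c (cx q.1) q.2 with hW
  set P : SpaceTime → ℂ := fun q => S.accPot c σ₀ (cx q.1) q.2 with hP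
  have cU : ContinuousOn U O := fun q hq => (S.continuousWithinAt_vel (hOs hq) (hoff q hq)).mono hOs
  have cD : ContinuousOn D O := fun q hq =>
    (S.continuousWithinAt_velDeriv (hOs hq) (hoff q hq)).mono hOs
  have cW : ContinuousOn W O := fun q hq =>
    (S.continuousWithinAt_velTime c (hOs hq) (hoff q hq)).mono hOs
  have cP : ContinuousOn P O := fun q hq =>
    (S.continuousWithinAt_accPot (hOs hq) (hoff q hq) (hbr q hq)).mono hOs
  have e1 : cx (1, 0) = 1 := by simp [cx_mk]
  have e2 : cx (0, 1) = Complex.I := by simp [cx_mk]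
  have U0 : ∀ q ∈ O, HasLineDerivAt ℝ U (W q) q ((0, 0), 1) := fun q hq =>
    hasLineDerivAt_time (f := S.vel) (f' := S.velTime c) (S.hasDerivAt_vel_time c (hOT q hq) (hoff q hq))
  have U1 : ∀ q ∈ O, HasLineDerivAt ℝ U (D q) q ((1, 0), 0) := fun q hq => by
    have := hasLineDerivAt_space (f := S.vel) (f' := S.velDeriv)
      (S.hasDerivAt_vel (hOT' q hq) (hoff q hq)) (1, 0)
    rwa [e1, mul_one] at this
  have U2 : ∀ q ∈ O, HasLineDerivAt ℝ U (D q * Complex.I) q ((0, 1), 0) := fun q hq => by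
    have := hasLineDerivAt_space (f := S.vel) (f' := S.velDeriv)
      (S.hasDerivAt_vel (hOT' q hq) (hoff q hq)) (0, 1)
    rwa [e2] at this
  have P1 : ∀ q ∈ O, HasLineDerivAt ℝ P (W q) q ((1, 0), 0) := fun q hq => by
    have := hasLineDerivAt_space (f := S.accPot c σ₀) (f' := S.velTime c)
      (S.hasDerivAt_accPot c hσ₀ (hOT' q hq) (hoff q hq) (hbr q hq)) (1, 0)
    rwa [e1, mul_one] at this
  have P2 : ∀ q ∈ O, HasLineDerivAt ℝ P (W q * Complex.I) q ((0, 1), 0) := fun q hq => by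
    have := hasLineDerivAt_space (f := S.accPot c σ₀) (f' := S.velTime c)
      (S.hasDerivAt_accPot c hσ₀ (hOT' q hq) (hoff q hq) (hbr q hq)) (0, 1)
    rwa [e2] at this
  have hre : ∀ {F : SpaceTime → ℂ} {F' : ℂ} {q e : SpaceTime}, HasLineDerivAt ℝ F F' q e →
      HasLineDerivAt ℝ (fun q => (F q).re) F'.re q e := fun h =>
    Complex.reCLM.hasFDerivAt.comp_hasDerivAt (0 : ℝ) h
  have him : ∀ {F : SpaceTime → ℂ} {F' : ℂ} {q e : SpaceTime}, HasLineDerivAt ℝ F F' q e →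
      HasLineDerivAt ℝ (fun q => (F q).im) F'.im q e := fun h =>
    Complex.imCLM.hasFDerivAt.comp_hasDerivAt (0 : ℝ) h
  have hmul : ∀ {f₁ f₂ : SpaceTime → ℝ} {a₁ a₂ : ℝ} {q e : SpaceTime}, HasLineDerivAt ℝ f₁ a₁ q e →
      HasLineDerivAt ℝ f₂ a₂ q e → HasLineDerivAt ℝ (fun q => f₁ q * f₂ q) (a₁ * f₂ q + f₁ q * a₂) q e :=
    fun {f₁ f₂ a₁ a₂ q e} h1 h2 => by
      have := HasDerivAt.mul (𝕜 := ℝ) h1 h2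
      simp only [zero_smul, add_zero] at this
      exact this
  have hx2 : ∀ (q : SpaceTime) (e : Plane), HasLineDerivAt ℝ (fun q : SpaceTime => q.1.2) e.2 q (e, 0) := by
    intro q e
    have h1 : HasDerivAt (fun s : ℝ => q.1.2 + s * e.2) e.2 0 := by
      simpa using ((hasDerivAt_id (0 : ℝ)).mul_const e.2).const_add q.1.2
    exact h1
  have cre : ∀ {F : SpaceTime → ℂ}, ContinuousOn F O → ContinuousOn (fun q => (F q).re) O :=
    fun h => Complex.continuous_re.comp_continuousOn h
  have cim : ∀ {F : SpaceTime → ℂ}, ContinuousOn F O → ContinuousOn (fun q => (F q).im) O :=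
    fun h => Complex.continuous_im.comp_continuousOn h
  have cDI : ContinuousOn (fun q => D q * Complex.I) O := cD.mul continuousOn_const
  have cWI : ContinuousOn (fun q => W q * Complex.I) O := cW.mul continuousOn_const
  have cu := cre cU
  have cv := cim cU
  have cx2 : ContinuousOn (fun q : SpaceTime => q.1.2) O := by fun_prop
  set B : SpaceTime → ℝ := S.bern c σ₀ g r with hB
  have hBeq : ∀ q, B q = r * ((P q).re + ((U q).re * (U q).re + (U q).im * (U q).im) / 2 + g * q.1.2) :=
    fun q => by simp only [hB, bern, hU, hP]; ring
  have cB : ContinuousOn B O := by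
    rw [show B = _ from funext hBeq]
    exact continuousOn_const.mul (((cre cP).add (((cu.mul cu).add (cv.mul cv)).div_const 2)).add
      (continuousOn_const.mul cx2))
  have dB : ∀ {q : SpaceTime} {e : Plane} {P' U' : ℂ}, HasLineDerivAt ℝ P P' q (e, 0) →
      HasLineDerivAt ℝ U U' q (e, 0) → HasLineDerivAt ℝ B
        (r * (P'.re + ((U q).re * U'.re + (U q).im * U'.im) + g * e.2)) q (e, 0) := by
    intro q e P' U' hP' hU'
    rw [show B = _ from funext hBeq]
    have h1 := hmul (hre hU') (hre hU')
    have h2 := hmul (him hU') (him hU')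
    have h3 := (((hre hP' : HasDerivAt _ _ (0 : ℝ)).add
      (((h1 : HasDerivAt _ _ (0 : ℝ)).add (h2 : HasDerivAt _ _ (0 : ℝ))).div_const 2)).add
      ((hx2 q e : HasDerivAt _ _ (0 : ℝ)).const_mul g)).const_mul r
    refine HasDerivAt.congr_deriv (h3 : HasLineDerivAt ℝ (fun q => r * ((P q).re +
      ((U q).re * (U q).re + (U q).im * (U q).im) / 2 + g * q.1.2)) _ q (e, 0)) ?_
    ring
  have hconst : ∀ {f : SpaceTime → ℝ} {a : ℝ} {q e : SpaceTime} (k : ℝ), HasLineDerivAt ℝ f a q e →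
      HasLineDerivAt ℝ (fun q => k * f q) (k * a) q e := fun k h =>
    HasDerivAt.const_mul (𝕜 := ℝ) k h
  have hsub : ∀ {f₁ f₂ : SpaceTime → ℝ} {a₁ a₂ : ℝ} {q e : SpaceTime}, HasLineDerivAt ℝ f₁ a₁ q e →
      HasLineDerivAt ℝ f₂ a₂ q e → HasLineDerivAt ℝ (fun q => f₁ q - f₂ q) (a₁ - a₂) q e :=
    fun h1 h2 => HasDerivAt.sub (𝕜 := ℝ) h1 h2
  have hout : ∀ q, q ∉ O → ∀ e, fderiv ℝ ζ q e = 0 := fun q hq e => by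
    rw [fderiv_eq_zero_of_notMem_tsupport fun h => hq (hζO h)]; rfl
  have hζ0 : ∀ q, q ∉ O → ζ q = 0 := fun q hq => image_eq_zero_of_notMem_tsupport fun h => hq (hζO h)
  have hinit : ∀ x, ζ (x, 0) = 0 := fun x => hζ0 _ fun h => lt_irrefl _ (hOT _ h).1
  have hslab : ∀ {F : SpaceTime → ℝ}, (∀ q, q ∉ O → F q = 0) → ∫ q in slab T, F q = ∫ q, F q :=
    fun hF => setIntegral_eq_integral_of_forall_compl_eq_zero fun q hq =>
      hF q fun h => hq ⟨mem_univ _, hOT q h⟩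
  have hpi : ∀ e : SpaceTime, Integrable fun q => p q * fderiv ℝ ζ q e := fun e => by
    have h1 := integrableOn_slab_mul hsol.int_p
      ((hζ1.continuous_fderiv one_ne_zero).clm_apply (continuous_const (y := e))) hζc htest.support
      fun q hq => by rw [fderiv_eq_zero_of_notMem_tsupport hq]; rfl
    refine (integrableOn_iff_integrable_of_support_subset fun q hq => ?_).1 h1
    by_contra hn
    exact hq (mul_eq_zero_of_right _ (hout q (fun h => hn ⟨mem_univ _, hOT q h⟩) e))
  have hv : ∀ᵐ q ∂(volume.restrict (slab T)), (v q).1 = (U q).re ∧ (v q).2 = -(U q).im := by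
    filter_upwards [hvel] with q hq
    simp only [hU, ← hq]
    simp [cvel]
  have hd0 : ∀ q, d₁ (fun _ => (0 : ℝ)) q = 0 ∧ d₂ (fun _ => (0 : ℝ)) q = 0 ∧
      dt (fun _ => (0 : ℝ)) q = 0 := fun q => by simp [d₁, d₂, dt]
  have hζi : Integrable ζ := hζ.continuous.integrable_of_hasCompactSupport hζc
  constructor
  · -- the first component of the momentum equation, from which a weak divergence that vanishes
    -- pointwise is subtracted
    have hm := hsol.momentum ζ (fun _ => 0) htest hzero
    simp only [hinit, mul_zero, add_zero, integral_zero, (hd0 _).1, (hd0 _).2.1, (hd0 _).2.2,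
      sub_zero] at hm
    have hm2 : ∫ q, (r * ((U q).re * (dt ζ q + ((U q).re * d₁ ζ q + -(U q).im * d₂ ζ q)))
        + p q * d₁ ζ q) = 0 := by
      rw [← hm, ← hslab]
      · refine integral_congr_ae ?_
        filter_upwards [hv] with q hq
        by_cases hqO : q ∈ O
        · rw [hρ q (hO hqO), hq.1, hq.2]
        · simp [d₁, d₂, dt, hout q hqO]
      · intro q hqO
        simp [d₁, d₂, dt, hout q hqO]
    obtain ⟨hAi, hA⟩ := integral_div_test (O := O) hζ1 hζc hζO
      (A₀ := fun q => (-r) * (U q).re) (A₁ := fun q => B q - r * ((U q).re * (U q).re))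
      (A₂ := fun q => r * ((U q).re * (U q).im))
      (A₀' := fun q => (-r) * (W q).re)
      (A₁' := fun q => r * ((W q).re + ((U q).re * (D q).re + (U q).im * (D q).im) + g * 0)
        - r * ((D q).re * (U q).re + (U q).re * (D q).re))
      (A₂' := fun q => r * ((D q * Complex.I).re * (U q).im + (U q).re * (D q * Complex.I).im))
      (continuousOn_const.mul cu) (cB.sub (continuousOn_const.mul (cu.mul cu)))
      (continuousOn_const.mul (cu.mul cv)) (continuousOn_const.mul (cre cW))
      ((continuousOn_const.mul (((cre cW).add ((cu.mul (cre cD)).add (cv.mul (cim cD)))).add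
        continuousOn_const)).sub (continuousOn_const.mul (((cre cD).mul cu).add (cu.mul (cre cD)))))
      (continuousOn_const.mul (((cre cDI).mul cv).add (cu.mul (cim cDI))))
      (fun q hq => hconst _ (hre (U0 q hq)))
      (fun q hq => hsub (dB (P1 q hq) (U1 q hq)) (hconst r (hmul (hre (U1 q hq)) (hre (U1 q hq)))))
      (fun q hq => hconst r (hmul (hre (U2 q hq)) (him (U2 q hq))))
    have hzero' : ∀ q, ((-r) * (W q).re + (r * ((W q).re + ((U q).re * (D q).re
        + (U q).im * (D q).im) + g * 0) - r * ((D q).re * (U q).re + (U q).re * (D q).re))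
        + r * ((D q * Complex.I).re * (U q).im + (U q).re * (D q * Complex.I).im)) * ζ q = 0 :=
      fun q => by simp; left; ring
    simp only [hzero', integral_zero, neg_zero] at hA
    have hBi : Integrable fun q => B q * d₁ ζ q := integrable_mul_of_continuousOn hζc (cB.mono hζO)
      ((hζ1.continuous_fderiv one_ne_zero).clm_apply continuous_const).continuousOn
      fun q hq => by rw [d₁, fderiv_eq_zero_of_notMem_tsupport hq]; rfl
    have hti : Integrable fun q => (p q + B q) * d₁ ζ q := by
      simp only [add_mul]; exact (hpi _).add hBi
    have hsum : ∀ q, r * ((U q).re * (dt ζ q + ((U q).re * d₁ ζ q + -(U q).im * d₂ ζ q)))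
        + p q * d₁ ζ q = (p q + B q) * d₁ ζ q - ((-r) * (U q).re * dt ζ q
        + (B q - r * ((U q).re * (U q).re)) * d₁ ζ q + r * ((U q).re * (U q).im) * d₂ ζ q) :=
      fun q => by ring
    simp only [hsum] at hm2
    rw [integral_sub hti hAi, hA, sub_zero] at hm2
    exact hm2
  · -- the second component; here the divergence equals the gravity term
    have hm := hsol.momentum (fun _ => 0) ζ hzero htest
    simp only [hinit, mul_zero, add_zero, zero_add, integral_zero, (hd0 _).1, (hd0 _).2.1,
      (hd0 _).2.2] at hm
    have hm2 : ∫ q, (r * (-(U q).im * (dt ζ q + ((U q).re * d₁ ζ q + -(U q).im * d₂ ζ q)))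
        + p q * d₂ ζ q - g * r * ζ q) = 0 := by
      rw [← hm, ← hslab]
      · refine integral_congr_ae ?_
        filter_upwards [hv] with q hq
        by_cases hqO : q ∈ O
        · rw [hρ q (hO hqO), hq.1, hq.2]
        · simp [d₁, d₂, dt, hout q hqO, hζ0 q hqO]
      · intro q hqO
        simp [d₁, d₂, dt, hout q hqO, hζ0 q hqO]
    obtain ⟨hAi, hA⟩ := integral_div_test (O := O) hζ1 hζc hζO
      (A₀ := fun q => r * (U q).im) (A₁ := fun q => r * ((U q).re * (U q).im))
      (A₂ := fun q => B q - r * ((U q).im * (U q).im))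
      (A₀' := fun q => r * (W q).im)
      (A₁' := fun q => r * ((D q).re * (U q).im + (U q).re * (D q).im))
      (A₂' := fun q => r * ((W q * Complex.I).re + ((U q).re * (D q * Complex.I).re
          + (U q).im * (D q * Complex.I).im) + g * 1)
        - r * ((D q * Complex.I).im * (U q).im + (U q).im * (D q * Complex.I).im))
      (continuousOn_const.mul cv) (continuousOn_const.mul (cu.mul cv))
      (cB.sub (continuousOn_const.mul (cv.mul cv)))
      (continuousOn_const.mul (cim cW))
      (continuousOn_const.mul (((cre cD).mul cv).add (cu.mul (cim cD))))
      ((continuousOn_const.mul (((cre cWI).add ((cu.mul (cre cDI)).add (cv.mul (cim cDI)))).add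
        continuousOn_const)).sub
        (continuousOn_const.mul (((cim cDI).mul cv).add (cv.mul (cim cDI)))))
      (fun q hq => hconst _ (him (U0 q hq)))
      (fun q hq => hconst r (hmul (hre (U1 q hq)) (him (U1 q hq))))
      (fun q hq => hsub (dB (P2 q hq) (U2 q hq)) (hconst r (hmul (him (U2 q hq)) (him (U2 q hq)))))
    have hzero' : ∀ q, (r * (W q).im + r * ((D q).re * (U q).im + (U q).re * (D q).im)
        + (r * ((W q * Complex.I).re + ((U q).re * (D q * Complex.I).re
          + (U q).im * (D q * Complex.I).im) + g * 1)
        - r * ((D q * Complex.I).im * (U q).im + (U q).im * (D q * Complex.I).im))) * ζ q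
        = g * r * ζ q :=
      fun q => by simp; left; ring
    simp only [hzero'] at hA
    have hBi : Integrable fun q => B q * d₂ ζ q := integrable_mul_of_continuousOn hζc (cB.mono hζO)
      ((hζ1.continuous_fderiv one_ne_zero).clm_apply continuous_const).continuousOn
      fun q hq => by rw [d₂, fderiv_eq_zero_of_notMem_tsupport hq]; rfl
    have hti : Integrable fun q => (p q + B q) * d₂ ζ q := by
      simp only [add_mul]; exact (hpi _).add hBi
    have hsum : ∀ q, r * (-(U q).im * (dt ζ q + ((U q).re * d₁ ζ q + -(U q).im * d₂ ζ q)))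
        + p q * d₂ ζ q - g * r * ζ q = (p q + B q) * d₂ ζ q - (r * (U q).im * dt ζ q
        + r * ((U q).re * (U q).im) * d₁ ζ q + (B q - r * ((U q).im * (U q).im)) * d₂ ζ q)
        - g * r * ζ q :=
      fun q => by ring
    simp only [hsum] at hm2
    have hti2 : Integrable fun q => (p q + B q) * d₂ ζ q - (r * (U q).im * dt ζ q
        + r * ((U q).re * (U q).im) * d₁ ζ q + (B q - r * ((U q).im * (U q).im)) * d₂ ζ q) :=
      hti.sub hAi
    rw [integral_sub hti2 (hζi.const_mul _), integral_sub hti hAi, hA, sub_neg_eq_add,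
      add_sub_cancel_right] at hm2
    exact hm2

end Sheet

/-! ### Functions without spatial gradient -/

theorem tsupport_moll_sub_subset (n : ℕ) (y : Plane) :
    tsupport (fun x => moll n (y - x)) ⊆ Metric.closedBall y (bump n).rOut := by
  refine closure_minimal (fun x hx => ?_) Metric.isClosed_closedBall
  have h1 : y - x ∈ tsupport (moll n) := subset_tsupport _ hx
  rw [moll, (bump n).tsupport_normed_eq, mem_closedBall_zero_iff] at h1
  rwa [mem_closedBall_iff_norm, norm_sub_rev]

/-- If a weak spatial derivative vanishes, it does so at almost every time. -/
theorem ae_slice_fderiv {h : SpaceTime → ℝ} {B : Set Plane} {I : Set ℝ}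
    (hI : IsOpen I) (hi : IntegrableOn h (B ×ˢ I)) {e : Plane}
    (hw : ∀ ζ : SpaceTime → ℝ, ContDiff ℝ ∞ ζ → HasCompactSupport ζ → tsupport ζ ⊆ B ×ˢ I →
      ∫ q, h q * fderiv ℝ ζ q (e, 0) = 0)
    {φ : Plane → ℝ} (hφ : ContDiff ℝ ∞ φ) (hφc : HasCompactSupport φ) (hφB : tsupport φ ⊆ B) :
    ∀ᵐ t ∂(volume.restrict I), ∫ x, h (x, t) * fderiv ℝ φ x e = 0 := by
  have hφ1 : ContDiff ℝ 1 φ := hφ.of_le (by simp)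
  have hφd : Differentiable ℝ φ := hφ.differentiable (by simp)
  have hcont : Continuous fun x => fderiv ℝ φ x e :=
    (hφ1.continuous_fderiv one_ne_zero).clm_apply continuous_const
  have hout : ∀ x, x ∉ B → fderiv ℝ φ x e = 0 := fun x hx => by
    rw [fderiv_eq_zero_of_notMem_tsupport fun h => hx (hφB h)]; rfl
  obtain ⟨C, hC⟩ := hcont.bounded_above_of_compact_support
    ((hφc.fderiv (𝕜 := ℝ)).comp_left (g := fun A : Plane →L[ℝ] ℝ => A e) rfl)
  set F : SpaceTime → ℝ := fun q => h q * fderiv ℝ φ q.1 e with hF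
  have hFi : IntegrableOn F (univ ×ˢ I) := by
    have h1 : IntegrableOn F (B ×ˢ I) := Integrable.mul_bdd (c := C) hi
      (hcont.comp continuous_fst).aestronglyMeasurable (Eventually.of_forall fun q => hC q.1)
    refine h1.of_forall_sdiff_eq_zero (MeasurableSet.univ.prod hI.measurableSet) fun q hq => ?_
    exact mul_eq_zero_of_right _ (hout _ fun hq1 => hq.2 ⟨hq1, hq.1.2⟩)
  have hFi' := hFi
  rw [IntegrableOn, restrict_univ_prod] at hFi'
  have hJ : IntegrableOn (fun t => ∫ x, F (x, t)) I := hFi'.integral_prod_right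
  have hae := hI.ae_eq_zero_of_integral_contDiff_smul_eq_zero (μ := volume)
    hJ.locallyIntegrableOn fun θ hθ hθc hθI => ?_
  · rw [ae_restrict_iff' hI.measurableSet]
    exact hae
  have hθd : Differentiable ℝ θ := hθ.differentiable (by simp)
  have hsub : tsupport (fun q : SpaceTime => φ q.1 * θ q.2) ⊆ tsupport φ ×ˢ tsupport θ := by
    refine closure_minimal (fun q hq => ?_) ((isClosed_tsupport φ).prod (isClosed_tsupport θ))
    exact ⟨subset_tsupport _ (left_ne_zero_of_mul hq), subset_tsupport _ (right_ne_zero_of_mul hq)⟩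
  have h0 := hw (fun q => φ q.1 * θ q.2) ((hφ.comp contDiff_fst).mul (hθ.comp contDiff_snd))
    ((hφc.isCompact.prod hθc.isCompact).of_isClosed_subset (isClosed_tsupport _) hsub)
    (hsub.trans (prod_mono hφB hθI))
  have e1 : ∀ q : SpaceTime, h q * fderiv ℝ (fun q : SpaceTime => φ q.1 * θ q.2) q (e, 0)
      = θ q.2 * F q := fun q => by
    rw [fderiv_mul_apply hφd hθd, hF]; ring
  simp only [e1] at h0
  have hθ0 : ∀ t, t ∉ I → θ t = 0 := fun t ht => image_eq_zero_of_notMem_tsupport fun h => ht (hθI h)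
  rw [← setIntegral_eq_integral_of_forall_compl_eq_zero (s := univ ×ˢ I)
    (fun q hq => by rw [hθ0 q.2 fun h => hq ⟨mem_univ _, h⟩, zero_mul]), restrict_univ_prod] at h0
  obtain ⟨C', hC'⟩ := hθ.continuous.bounded_above_of_compact_support hθc
  have hint : Integrable (fun q : SpaceTime => θ q.2 * F q) (volume.prod (volume.restrict I)) :=
    Integrable.bdd_mul (c := C') hFi' (hθ.continuous.comp continuous_snd).aestronglyMeasurable
      (Eventually.of_forall fun q => hC' q.2)
  rw [integral_prod_symm _ hint] at h0
  rw [← setIntegral_eq_integral_of_forall_compl_eq_zero (s := I)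
    (fun t ht => by rw [hθ0 t ht, zero_smul]), ← h0]
  refine integral_congr_ae (Eventually.of_forall fun t => ?_)
  simp only [smul_eq_mul, integral_const_mul]

/-- A function on a ball whose weak gradient vanishes is almost everywhere constant. -/
theorem exists_ae_eq_const {w : Plane → ℝ} {x₁ : Plane} {R : ℝ} (hR : 0 < R)
    (hw : IntegrableOn w (Metric.ball x₁ R)) {D : Set Plane} (hD : Dense D)
    (h : ∀ n, ∀ y ∈ D, Metric.closedBall y (bump n).rOut ⊆ Metric.ball x₁ R →
      ∀ e ∈ ({(1, 0), (0, 1)} : Set Plane), ∫ x, w x * fderiv ℝ (fun x => moll n (y - x)) x e = 0) :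
    ∃ k, ∀ᵐ x ∂(volume.restrict (Metric.ball x₁ R)), w x = k := by
  set B := Metric.ball x₁ R
  have hBm : MeasurableSet B := Metric.isOpen_ball.measurableSet
  set u : Plane → ℂ := B.indicator fun x => (w x : ℂ) with hu
  have hui : Integrable u := (integrable_indicator_iff hBm).2 hw.ofReal
  have hul : LocallyIntegrable u := hui.locallyIntegrable
  have hcd : ∀ n, ContDiff ℝ 1 (mollify n u) := fun n => by
    rw [mollify_eq]
    exact (hasCompactSupport_moll n).contDiff_convolution_left _ (contDiff_moll n (k := 1)) hul
  have hD0 : ∀ n, ∀ y ∈ D, Metric.closedBall y (bump n).rOut ⊆ B →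
      ∀ e ∈ ({(1, 0), (0, 1)} : Set Plane), fderiv ℝ (mollify n u) y e = 0 := by
    intro n y hy hyB e he
    rw [(fderiv_mollify hul n y e).2]
    have h1 := h n y hy hyB e he
    have h2 : ∀ x, fderiv ℝ (moll n) (y - x) e • u x
        = -((w x * fderiv ℝ (fun x => moll n (y - x)) x e : ℝ) : ℂ) := fun x => by
      have e1 : fderiv ℝ (fun x => moll n (y - x)) x e = -fderiv ℝ (moll n) (y - x) e := by
        have h3 : HasFDerivAt (moll n) (fderiv ℝ (moll n) (y - x)) (y - x) :=
          ((contDiff_moll n (k := 1)).differentiable one_ne_zero _).hasFDerivAt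
        have h4 : HasFDerivAt (fun x => moll n (y - x)) _ x :=
          h3.comp x ((hasFDerivAt_id x).const_sub y)
        rw [h4.fderiv]; simp
      by_cases hx : x ∈ B
      · rw [hu, indicator_of_mem hx, e1, Complex.real_smul]; push_cast; ring
      · have h5 : fderiv ℝ (fun x => moll n (y - x)) x e = 0 := by
          rw [fderiv_eq_zero_of_notMem_tsupport fun h =>
            hx (hyB (tsupport_moll_sub_subset n y h))]; rfl
        rw [h5, hu, indicator_of_notMem hx]; simp
    simp only [h2]
    rw [integral_neg, integral_complex_ofReal, h1]; simp
  have hconst : ∀ n, ∀ x ∈ Metric.ball x₁ (R - (bump n).rOut), ∀ y ∈ Metric.ball x₁ (R - (bump n).rOut),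
      mollify n u x = mollify n u y := by
    intro n x hx y hy
    refine Metric.isOpen_ball.is_const_of_fderiv_eq_zero (𝕜 := ℝ)
      (convex_ball x₁ (R - (bump n).rOut)).isPreconnected
      ((hcd n).differentiable one_ne_zero).differentiableOn ?_ hx hy
    have hsub : ∀ y ∈ Metric.ball x₁ (R - (bump n).rOut), Metric.closedBall y (bump n).rOut ⊆ B := by
      intro y hy z hz
      rw [Metric.mem_ball] at hy ⊢
      rw [Metric.mem_closedBall] at hz
      linarith [dist_triangle z y x₁]
    have hzero : ∀ e ∈ ({(1, 0), (0, 1)} : Set Plane), ∀ y ∈ Metric.ball x₁ (R - (bump n).rOut),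
        fderiv ℝ (mollify n u) y e = 0 := by
      intro e he
      have hcl : Metric.ball x₁ (R - (bump n).rOut) ⊆ closure (Metric.ball x₁ (R - (bump n).rOut) ∩ D) :=
        hD.open_subset_closure_inter Metric.isOpen_ball
      have hclosed : IsClosed {y | fderiv ℝ (mollify n u) y e = 0} :=
        isClosed_eq (((hcd n).continuous_fderiv one_ne_zero).clm_apply continuous_const)
          continuous_const
      exact fun y hy => closure_minimal (fun z hz => hD0 n z hz.2 (hsub z hz.1) e he) hclosed (hcl hy)
    intro y hy
    refine ContinuousLinearMap.ext fun e => ?_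
    have he : e = e.1 • (1, 0) + e.2 • (0, 1) := by apply Prod.ext <;> simp
    rw [he, map_add, map_smul, map_smul, hzero (1, 0) (by simp) y hy, hzero (0, 1) (by simp) y hy]
    simp
  have hlim := ae_restrict_of_ae (s := B) (ae_tendsto_mollify hul)
  have hne : NeZero (volume.restrict B) := by
    refine ⟨fun h0 => ?_⟩
    rw [Measure.restrict_eq_zero] at h0
    exact (Metric.measure_ball_pos volume x₁ hR).ne' h0
  have hmem := ae_restrict_mem (μ := (volume : Measure Plane)) hBm
  obtain ⟨x', hx'⟩ := (hlim.and hmem).exists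
  refine ⟨w x', ?_⟩
  filter_upwards [hlim, hmem] with x hx hxB
  have hev : ∀ x ∈ B, ∀ᶠ n in atTop, x ∈ Metric.ball x₁ (R - (bump n).rOut) := by
    intro x hx
    have h1 : 0 < R - dist x x₁ := sub_pos.2 hx
    filter_upwards [tendsto_rOut.eventually_lt_const h1] with n hn
    rw [Metric.mem_ball]; linarith
  have h1 : Tendsto (fun n => mollify n u x) atTop (𝓝 (u x')) := by
    refine hx'.1.congr' ?_
    filter_upwards [hev x hxB, hev x' hx'.2] with n hn hn'
    exact hconst n _ hn' _ hn
  have h2 := tendsto_nhds_unique hx h1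
  rw [hu, indicator_of_mem hxB, indicator_of_mem hx'.2] at h2
  exact_mod_cast h2

/-- A function on a cylinder without weak spatial gradient depends on time only. -/
theorem exists_time_function {h : SpaceTime → ℝ} {x₁ : Plane} {R : ℝ} (hR : 0 < R) {I : Set ℝ}
    (hI : IsOpen I) (hi : IntegrableOn h (Metric.ball x₁ R ×ˢ I))
    (hw : ∀ ζ : SpaceTime → ℝ, ContDiff ℝ ∞ ζ → HasCompactSupport ζ →
      tsupport ζ ⊆ Metric.ball x₁ R ×ˢ I → (∫ q, h q * d₁ ζ q = 0) ∧ ∫ q, h q * d₂ ζ q = 0) :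
    ∃ κ : ℝ → ℝ, IntegrableOn κ I ∧
      ∀ᵐ q ∂(volume.restrict (Metric.ball x₁ R ×ˢ I)), h q = κ q.2 := by
  obtain ⟨D, hDc, hD⟩ := TopologicalSpace.exists_countable_dense Plane
  set B := Metric.ball x₁ R
  have hvol : volume.real B ≠ 0 :=
    (ENNReal.toReal_pos (Metric.measure_ball_pos volume x₁ hR).ne'
      (measure_ball_lt_top).ne).ne'
  have hi' := hi
  rw [IntegrableOn, Measure.volume_eq_prod, ← Measure.prod_restrict] at hi'
  set κ : ℝ → ℝ := fun t => (volume.real B)⁻¹ * ∫ x in B, h (x, t) with hκ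
  have hκi : IntegrableOn κ I := hi'.integral_prod_right.const_mul _
  refine ⟨κ, hκi, ?_⟩
  have hslice : ∀ᵐ t ∂(volume.restrict I), ∀ n : ℕ, ∀ y ∈ D,
      Metric.closedBall y (bump n).rOut ⊆ B → ∀ e ∈ ({(1, 0), (0, 1)} : Set Plane),
        ∫ x, h (x, t) * fderiv ℝ (fun x => moll n (y - x)) x e = 0 := by
    rw [ae_all_iff]
    intro n
    rw [ae_ball_iff hDc]
    intro y _
    by_cases hy : Metric.closedBall y (bump n).rOut ⊆ B
    · have hs : ∀ e : Plane, (∀ ζ : SpaceTime → ℝ, ContDiff ℝ ∞ ζ → HasCompactSupport ζ →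
          tsupport ζ ⊆ B ×ˢ I → ∫ q, h q * fderiv ℝ ζ q (e, 0) = 0) →
          ∀ᵐ t ∂(volume.restrict I), ∫ x, h (x, t) * fderiv ℝ (fun x => moll n (y - x)) x e = 0 :=
        fun e he => ae_slice_fderiv hI hi he (contDiff_moll_sub n y (k := ⊤))
          (hasCompactSupport_moll_sub n y) ((tsupport_moll_sub_subset n y).trans hy)
      filter_upwards [hs (1, 0) fun ζ h1 h2 h3 => (hw ζ h1 h2 h3).1,
        hs (0, 1) fun ζ h1 h2 h3 => (hw ζ h1 h2 h3).2] with t h1 h2 _ e he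
      rcases he with rfl | rfl
      · exact h1
      · exact h2
    · exact Eventually.of_forall fun t h => absurd h hy
  have h1 : ∀ᵐ t ∂(volume.restrict I), ∀ᵐ x ∂(volume.restrict B), h (x, t) - κ t = 0 := by
    filter_upwards [hslice, hi'.prod_left_ae] with t ht hti
    obtain ⟨k, hk⟩ := exists_ae_eq_const hR hti hD ht
    have : κ t = k := by
      rw [hκ]
      simp only
      rw [integral_congr_ae hk, integral_const, measureReal_restrict_apply_univ, smul_eq_mul,
        inv_mul_cancel_left₀ hvol]
    filter_upwards [hk] with x hx
    rw [hx, this, sub_self]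
  have h2 := ae_eq_zero_of_slices (h := fun q : SpaceTime => h q - κ q.2)
    (hi'.aestronglyMeasurable.sub hκi.aestronglyMeasurable.comp_snd) h1
  rw [Measure.prod_restrict, ← Measure.volume_eq_prod] at h2
  filter_upwards [h2] with q hq using sub_eq_zero.1 hq

/-- The same on an open set with connected time slices that contains a cylinder. -/
theorem ae_eq_time_function {h : SpaceTime → ℝ} {O : Set SpaceTime} (hO : IsOpen O)
    (hloc : LocallyIntegrableOn h O)
    (hw : ∀ ζ : SpaceTime → ℝ, ContDiff ℝ ∞ ζ → HasCompactSupport ζ →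
      tsupport ζ ⊆ O → (∫ q, h q * d₁ ζ q = 0) ∧ ∫ q, h q * d₂ ζ q = 0)
    {x₁ : Plane} {R : ℝ} (hR : 0 < R) {I : Set ℝ}
    (hI : IsOpen I) (hBO : Metric.ball x₁ R ×ˢ I ⊆ O) (hOI : ∀ q ∈ O, q.2 ∈ I)
    (hconn : ∀ t ∈ I, IsPreconnected {x | (x, t) ∈ O}) {κ : ℝ → ℝ}
    (hκ : ∀ᵐ q ∂(volume.restrict (Metric.ball x₁ R ×ˢ I)), h q = κ q.2) :
    ∀ᵐ q ∂(volume.restrict O), h q = κ q.2 := by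
  -- cover `O` by countably many cylinders on which `h` depends on time only
  have hbox : ∀ q ∈ O, ∃ r > 0, Metric.ball q.1 r ×ˢ Metric.ball q.2 r ⊆ O ∧ ∃ k : ℝ → ℝ,
      ∀ᵐ q' ∂(volume.restrict (Metric.ball q.1 r ×ˢ Metric.ball q.2 r)), h q' = k q'.2 := by
    intro q hq
    obtain ⟨ε, hε, hεO⟩ := Metric.nhds_basis_closedBall.mem_iff.1 (hO.mem_nhds hq)
    have hsub : Metric.ball q.1 ε ×ˢ Metric.ball q.2 ε ⊆ Metric.closedBall q ε := by
      rw [ball_prod_same]; exact Metric.ball_subset_closedBall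
    refine ⟨ε, hε, hsub.trans hεO, ?_⟩
    have hi : IntegrableOn h (Metric.ball q.1 ε ×ˢ Metric.ball q.2 ε) :=
      (hloc.integrableOn_compact_subset hεO (isCompact_closedBall _ _)).mono_set hsub
    obtain ⟨k, -, hk⟩ := exists_time_function hε Metric.isOpen_ball hi fun ζ h1 h2 h3 =>
      hw ζ h1 h2 (h3.trans (hsub.trans hεO))
    exact ⟨k, hk⟩
  choose! r hr hrO k hk using hbox
  set N : SpaceTime → Set SpaceTime := fun q => Metric.ball q.1 (r q) ×ˢ Metric.ball q.2 (r q)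
  have hNo : ∀ q, IsOpen (N q) := fun q => Metric.isOpen_ball.prod Metric.isOpen_ball
  have hNmem : ∀ q ∈ O, N q ∈ 𝓝[O] q := fun q hq => mem_nhdsWithin_of_mem_nhds
    ((hNo q).mem_nhds ⟨Metric.mem_ball_self (hr q hq), Metric.mem_ball_self (hr q hq)⟩)
  obtain ⟨s, hsO, hsc, hcov⟩ := TopologicalSpace.countable_cover_nhdsWithin hNmem
  have hslice : ∀ {A : Set Plane} {J : Set ℝ} {k : ℝ → ℝ}, MeasurableSet J →
      (∀ᵐ q ∂(volume.restrict (A ×ˢ J)), h q = k q.2) →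
      ∀ᵐ t : ℝ, t ∈ J → ∀ᵐ x ∂(volume.restrict A), h (x, t) = k t := by
    intro A J k hJ hA
    rw [Measure.volume_eq_prod, ← Measure.prod_restrict] at hA
    exact (ae_restrict_iff' hJ).1 (Measure.ae_ae_of_ae_prod 
      (Measure.measurePreserving_swap.quasiMeasurePreserving.ae hA))
  have heq : ∀ {A A' : Set Plane} {t a a' : ℝ}, IsOpen A → IsOpen A' → (A ∩ A').Nonempty →
      (∀ᵐ x ∂(volume.restrict A), h (x, t) = a) → (∀ᵐ x ∂(volume.restrict A'), h (x, t) = a') →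
      a = a' := by
    intro A A' t a a' hA hA' hne h1 h2
    have hne0 : NeZero (volume.restrict (A ∩ A')) :=
      ⟨fun h0 => ((hA.inter hA').measure_pos volume hne).ne' (Measure.restrict_eq_zero.1 h0)⟩
    have h1' : ∀ᵐ x ∂(volume.restrict (A ∩ A')), h (x, t) = a :=
      ae_restrict_of_ae_restrict_of_subset inter_subset_left h1
    have h2' : ∀ᵐ x ∂(volume.restrict (A ∩ A')), h (x, t) = a' :=
      ae_restrict_of_ae_restrict_of_subset inter_subset_right h2
    obtain ⟨x, hx1, hx2⟩ := (h1'.and h2').exists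
    rw [← hx1, ← hx2]
  have hIo : ∀ᵐ t : ℝ, t ∈ I → ∀ᵐ x ∂(volume.restrict (Metric.ball x₁ R)), h (x, t) = κ t := by
    rw [Measure.volume_eq_prod, ← Measure.prod_restrict] at hκ
    exact (ae_restrict_iff' hI.measurableSet).1
      (Measure.ae_ae_of_ae_prod (Measure.measurePreserving_swap.quasiMeasurePreserving.ae hκ))
  have hall : ∀ᵐ t : ℝ, ∀ q ∈ s, t ∈ Metric.ball q.2 (r q) →
      ∀ᵐ x ∂(volume.restrict (Metric.ball q.1 (r q))), h (x, t) = k q t :=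
    (ae_ball_iff hsc).2 fun q hq => hslice Metric.isOpen_ball.measurableSet (hk q (hsO hq))
  have hkey : ∀ᵐ t : ℝ, t ∈ I → ∀ q ∈ s, t ∈ Metric.ball q.2 (r q) → k q t = κ t := by
    filter_upwards [hIo, hall] with t ht1 ht2 htI
    set U : Set Plane := ⋃ q ∈ {q ∈ s | t ∈ Metric.ball q.2 (r q) ∧ k q t = κ t}, Metric.ball q.1 (r q)
    set V : Set Plane := ⋃ q ∈ {q ∈ s | t ∈ Metric.ball q.2 (r q) ∧ k q t ≠ κ t}, Metric.ball q.1 (r q)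
    have hUV : {x | (x, t) ∈ O} ⊆ U ∪ V := fun x hx => by
      obtain ⟨q, hq, hxq⟩ := mem_iUnion₂.1 (hcov hx)
      by_cases hkq : k q t = κ t
      · exact Or.inl (mem_biUnion (show q ∈ {q ∈ s | _} from ⟨hq, hxq.2, hkq⟩) hxq.1)
      · exact Or.inr (mem_biUnion (show q ∈ {q ∈ s | _} from ⟨hq, hxq.2, hkq⟩) hxq.1)
    have hdisj : Disjoint U V := by
      rw [disjoint_left]
      intro x hxU hxV
      obtain ⟨q, ⟨hq, hqt, hqk⟩, hxq⟩ := mem_iUnion₂.1 hxU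
      obtain ⟨q', ⟨hq', hqt', hqk'⟩, hxq'⟩ := mem_iUnion₂.1 hxV
      exact hqk' ((heq Metric.isOpen_ball Metric.isOpen_ball ⟨x, hxq', hxq⟩ (ht2 q' hq' hqt')
        (ht2 q hq hqt)).trans hqk)
    have hx₁O : (x₁, t) ∈ O := hBO ⟨Metric.mem_ball_self hR, htI⟩
    have hx₁U : x₁ ∈ U := by
      refine (hUV hx₁O).resolve_right fun hV => ?_
      obtain ⟨q', ⟨hq', hqt', hqk'⟩, hxq'⟩ := mem_iUnion₂.1 hV
      exact hqk' (heq Metric.isOpen_ball Metric.isOpen_ball ⟨x₁, hxq', Metric.mem_ball_self hR⟩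
        (ht2 q' hq' hqt') (ht1 htI))
    have hsubU := (hconn t htI).subset_left_of_subset_union
      (isOpen_biUnion fun _ _ => Metric.isOpen_ball) (isOpen_biUnion fun _ _ => Metric.isOpen_ball)
      hdisj hUV ⟨x₁, hx₁O, hx₁U⟩
    intro q hq hqt
    have hqO : (q.1, t) ∈ O := hrO q (hsO hq) ⟨Metric.mem_ball_self (hr q (hsO hq)), hqt⟩
    obtain ⟨q', ⟨hq', hqt', hqk'⟩, hxq'⟩ := mem_iUnion₂.1 (hsubU hqO)
    exact (heq Metric.isOpen_ball Metric.isOpen_ball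
      ⟨q.1, Metric.mem_ball_self (hr q (hsO hq)), hxq'⟩ (ht2 q hq hqt) (ht2 q' hq' hqt')).trans hqk'
  have hkey' : ∀ᵐ q' : SpaceTime, q'.2 ∈ I → ∀ q ∈ s, q'.2 ∈ Metric.ball q.2 (r q) →
      k q q'.2 = κ q'.2 := Measure.quasiMeasurePreserving_snd.ae hkey
  refine ae_restrict_of_ae_restrict_of_subset hcov ?_
  rw [ae_restrict_biUnion_iff _ hsc]
  intro q hq
  filter_upwards [hk q (hsO hq), ae_restrict_of_ae hkey', ae_restrict_mem (hNo q).measurableSet]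
    with q' h1 h2 h3
  rw [h1, h2 (hOI _ (hrO q (hsO hq) h3)) q hq h3.2]

/-! ### Dilations of space-time -/

/-- The dilation with center `q₀` and ratio `r`, in the frame given by `A`. -/
def blow (q₀ : SpaceTime) (A : SpaceTime ≃L[ℝ] SpaceTime) (r : ℝ) (p : SpaceTime) : SpaceTime :=
  q₀ + r • A p

/-- The inverse of `blow q₀ A r`. -/
def unblow (q₀ : SpaceTime) (A : SpaceTime ≃L[ℝ] SpaceTime) (r : ℝ) (q : SpaceTime) : SpaceTime :=
  A.symm (r⁻¹ • (q - q₀))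

theorem unblow_blow (q₀ : SpaceTime) (A : SpaceTime ≃L[ℝ] SpaceTime) {r : ℝ} (hr : r ≠ 0)
    (p : SpaceTime) : unblow q₀ A r (blow q₀ A r p) = p := by
  simp [blow, unblow, smul_smul, hr]

theorem blow_unblow (q₀ : SpaceTime) (A : SpaceTime ≃L[ℝ] SpaceTime) {r : ℝ} (hr : r ≠ 0)
    (q : SpaceTime) : blow q₀ A r (unblow q₀ A r q) = q := by
  simp [blow, unblow, smul_smul, hr]

theorem continuous_blow (q₀ : SpaceTime) (A : SpaceTime ≃L[ℝ] SpaceTime) (r : ℝ) :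
    Continuous (blow q₀ A r) := continuous_const.add (A.continuous.const_smul r)

theorem continuous_unblow (q₀ : SpaceTime) (A : SpaceTime ≃L[ℝ] SpaceTime) (r : ℝ) :
    Continuous (unblow q₀ A r) :=
  A.symm.continuous.comp ((continuous_id.sub continuous_const).const_smul r⁻¹)

/-- A dilation as a homeomorphism. -/
def blowHomeo (q₀ : SpaceTime) (A : SpaceTime ≃L[ℝ] SpaceTime) {r : ℝ} (hr : r ≠ 0) :
    SpaceTime ≃ₜ SpaceTime where
  toFun := blow q₀ A r
  invFun := unblow q₀ A r
  left_inv := unblow_blow q₀ A hr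
  right_inv := blow_unblow q₀ A hr
  continuous_toFun := continuous_blow q₀ A r
  continuous_invFun := continuous_unblow q₀ A r

theorem measurableEmbedding_blow (q₀ : SpaceTime) (A : SpaceTime ≃L[ℝ] SpaceTime) {r : ℝ}
    (hr : r ≠ 0) : MeasurableEmbedding (blow q₀ A r) :=
  (blowHomeo q₀ A hr).measurableEmbedding

/-- A dilation of ratio `r` multiplies volumes by `c r³`, with a constant `c` that depends on the
frame only. -/
theorem exists_map_blow (A : SpaceTime ≃L[ℝ] SpaceTime) : ∃ c > 0, ∀ (q₀ : SpaceTime) (r : ℝ),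
    0 < r → (volume : Measure SpaceTime).map (blow q₀ A r)
      = ENNReal.ofReal (c * r ^ 3)⁻¹ • volume := by
  have hdet : LinearMap.det (A : SpaceTime →ₗ[ℝ] SpaceTime) ≠ 0 :=
    (LinearEquiv.isUnit_det' A.toLinearEquiv).ne_zero
  refine ⟨|LinearMap.det (A : SpaceTime →ₗ[ℝ] SpaceTime)|, abs_pos.2 hdet, fun q₀ r hr => ?_⟩
  have hfr : Module.finrank ℝ SpaceTime = 3 := by simp
  have hd : LinearMap.det (r • (A : SpaceTime →ₗ[ℝ] SpaceTime))
      = r ^ 3 * LinearMap.det (A : SpaceTime →ₗ[ℝ] SpaceTime) := by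
    rw [LinearMap.det_smul, hfr]
  have h1 := Measure.map_linearMap_addHaar_eq_smul_addHaar (volume : Measure SpaceTime)
    (f := r • (A : SpaceTime →ₗ[ℝ] SpaceTime)) (by rw [hd]; positivity)
  have hm : Measurable fun p : SpaceTime => r • A p :=
    (A.continuous.const_smul r).measurable
  have h2 : blow q₀ A r = (fun y => q₀ + y) ∘ fun p => r • A p := rfl
  rw [h2, ← Measure.map_map (measurable_const_add q₀) hm]
  have h3 : (volume : Measure SpaceTime).map (fun p => r • A p) = _ := h1
  rw [h3, Measure.map_smul, map_add_left_eq_self, hd, abs_inv, abs_mul, abs_of_pos (pow_pos hr 3),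
    mul_comm]

theorem volume_preimage_blow (q₀ : SpaceTime) (A : SpaceTime ≃L[ℝ] SpaceTime) {r : ℝ} (hr : 0 < r)
    {N : Set SpaceTime} (hN : volume N = 0) : volume (blow q₀ A r ⁻¹' N) = 0 := by
  obtain ⟨c, -, h⟩ := exists_map_blow A
  rw [← (measurableEmbedding_blow q₀ A hr.ne').map_apply, h q₀ r hr, Measure.smul_apply, hN,
    smul_zero]

theorem integral_blow {A : SpaceTime ≃L[ℝ] SpaceTime} {c : ℝ} (hc : 0 < c) {q₀ : SpaceTime} {r : ℝ}
    (hr : 0 < r) (h : (volume : Measure SpaceTime).map (blow q₀ A r)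
      = ENNReal.ofReal (c * r ^ 3)⁻¹ • volume) (F : SpaceTime → ℝ) :
    ∫ p, F (blow q₀ A r p) = (c * r ^ 3)⁻¹ * ∫ q, F q := by
  rw [← (measurableEmbedding_blow q₀ A hr.ne').integral_map, h, integral_smul_measure,
    ENNReal.toReal_ofReal (by positivity), smul_eq_mul]

/-- The cylinder `(-1, 1)² × (0, 1)`. -/
def unitCyl : Set SpaceTime := (Ioo (-1) 1 ×ˢ Ioo (-1) 1) ×ˢ Ioo 0 1

theorem measurableSet_unitCyl : MeasurableSet unitCyl :=
  ((isOpen_Ioo.prod isOpen_Ioo).prod isOpen_Ioo).measurableSet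

theorem volume_unitCyl_lt_top : volume unitCyl < ⊤ := by
  refine lt_of_le_of_lt (measure_mono (t := (Icc (-1) 1 ×ˢ Icc (-1) 1) ×ˢ Icc 0 1) ?_)
    ((isCompact_Icc.prod isCompact_Icc).prod isCompact_Icc).measure_lt_top
  exact Set.prod_mono (Set.prod_mono Ioo_subset_Icc_self Ioo_subset_Icc_self) Ioo_subset_Icc_self

/-- The part of the unit cylinder that the dilation sends into `R`. -/
def blowSet (q₀ : SpaceTime) (A : SpaceTime ≃L[ℝ] SpaceTime) (R : Set SpaceTime) (r : ℝ) :
    Set SpaceTime := {p | p ∈ unitCyl ∧ blow q₀ A r p ∈ R}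

theorem measurableSet_blowSet (q₀ : SpaceTime) (A : SpaceTime ≃L[ℝ] SpaceTime) {R : Set SpaceTime}
    (hR : IsOpen R) (r : ℝ) : MeasurableSet (blowSet q₀ A R r) :=
  measurableSet_unitCyl.inter (hR.preimage (continuous_blow q₀ A r)).measurableSet

theorem blowSet_subset (q₀ : SpaceTime) (A : SpaceTime ≃L[ℝ] SpaceTime) (R : Set SpaceTime) (r : ℝ) :
    blowSet q₀ A R r ⊆ unitCyl := fun _ h => h.1

/-- The mean of `|F - ℓ|` over the part in `R` of the dilated cylinders, written in the variables of
the unit cylinder, tends to zero. The cylinders shrink to `q₀` and lie at later times, so that `q₀`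
may be a point at time `0`. -/
def HasMeanLimit (q₀ : SpaceTime) (A : SpaceTime ≃L[ℝ] SpaceTime) (R : Set SpaceTime)
    (F : SpaceTime → ℝ) (ℓ : ℝ) : Prop :=
  Tendsto (fun r : ℝ => ∫ p in blowSet q₀ A R r, |F (blow q₀ A r p) - ℓ|) (𝓝[>] 0) (𝓝 0)

/-- The dilated cylinders shrink to `q₀`. -/
theorem eventually_blow (q₀ : SpaceTime) (A : SpaceTime ≃L[ℝ] SpaceTime) {U : Set SpaceTime}
    (hU : U ∈ 𝓝 q₀) : ∀ᶠ r : ℝ in 𝓝[>] 0, ∀ p ∈ unitCyl, blow q₀ A r p ∈ U := by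
  have hK : IsCompact ((Icc (-1) 1 ×ˢ Icc (-1) 1) ×ˢ Icc 0 1 : Set SpaceTime) :=
    (isCompact_Icc.prod isCompact_Icc).prod isCompact_Icc
  obtain ⟨M, hM⟩ := (hK.image A.continuous).isBounded.exists_norm_le
  obtain ⟨ε, hε, hεU⟩ := Metric.mem_nhds_iff.1 hU
  have hev : ∀ᶠ r : ℝ in 𝓝[>] 0, r * M < ε := by
    have : Tendsto (fun r : ℝ => r * M) (𝓝[>] 0) (𝓝 (0 * M)) :=
      (tendsto_id.mul_const M).mono_left nhdsWithin_le_nhds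
    exact this.eventually_lt_const (by simpa using hε)
  filter_upwards [hev, self_mem_nhdsWithin] with r hr hr0 p hp
  refine hεU ?_
  rw [mem_ball_iff_norm, blow, add_sub_cancel_left, norm_smul, Real.norm_of_nonneg (le_of_lt hr0)]
  refine lt_of_le_of_lt (mul_le_mul_of_nonneg_left (hM _ ⟨p, ?_, rfl⟩) (le_of_lt hr0)) hr
  exact Set.prod_mono (Set.prod_mono Ioo_subset_Icc_self Ioo_subset_Icc_self) Ioo_subset_Icc_self hp

/-- A limit along `R` is a mean limit. -/
theorem hasMeanLimit_of_tendsto {q₀ : SpaceTime} (A : SpaceTime ≃L[ℝ] SpaceTime) {R : Set SpaceTime}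
    (hR : IsOpen R) {F F' : SpaceTime → ℝ} {ℓ : ℝ} (hF : ∀ᵐ q ∂(volume.restrict R), F q = F' q)
    (h : Tendsto F' (𝓝[R] q₀) (𝓝 ℓ)) : HasMeanLimit q₀ A R F ℓ := by
  rw [HasMeanLimit, Metric.tendsto_nhds]
  intro ε hε
  have hv : 0 ≤ volume.real unitCyl := measureReal_nonneg
  set δ := ε / (2 * (volume.real unitCyl + 1)) with hδ
  have hδ0 : 0 < δ := by positivity
  have h1 : ∀ᶠ q in 𝓝 q₀, q ∈ R → |F' q - ℓ| < δ := by
    have := (Metric.tendsto_nhds.1 h) δ hδ0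
    rw [eventually_nhdsWithin_iff] at this
    exact this
  filter_upwards [eventually_blow q₀ A h1, self_mem_nhdsWithin] with r hr hr0
  have hae : ∀ᵐ p ∂(volume.restrict (blowSet q₀ A R r)), ‖|F (blow q₀ A r p) - ℓ|‖ ≤ δ := by
    rw [ae_restrict_iff' (measurableSet_blowSet q₀ A hR r)]
    rw [ae_restrict_iff' hR.measurableSet] at hF
    have h2 : ∀ᵐ p : SpaceTime, blow q₀ A r p ∈ R → F (blow q₀ A r p) = F' (blow q₀ A r p) :=
      ae_iff.2 (volume_preimage_blow q₀ A hr0 (ae_iff.1 hF))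
    filter_upwards [h2] with p hp hpR
    rw [norm_abs_eq_norm, Real.norm_eq_abs, hp hpR.2]
    exact (hr p hpR.1 hpR.2).le
  have hfin : volume (blowSet q₀ A R r) < ⊤ :=
    (measure_mono (blowSet_subset q₀ A R r)).trans_lt volume_unitCyl_lt_top
  have h3 := norm_setIntegral_le_of_norm_le_const_ae hfin hae
  rw [dist_zero_right]
  refine h3.trans_lt ?_
  have h4 : volume.real (blowSet q₀ A R r) ≤ volume.real unitCyl :=
    measureReal_mono (blowSet_subset q₀ A R r) volume_unitCyl_lt_top.ne
  calc δ * volume.real (blowSet q₀ A R r) ≤ δ * (volume.real unitCyl + 1) := by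
        gcongr; linarith
    _ = ε / 2 := by rw [hδ]; field_simp
    _ < ε := half_lt_self hε

/-- The frames in which the sheet is blown up: `τ` spans the first axis and `iτ` the second one,
and time is multiplied by `κ`. -/
def frame {τ : ℂ} (hτ : τ ≠ 0) {κ : ℝ} (hκ : 0 < κ) : SpaceTime ≃L[ℝ] SpaceTime :=
  LinearEquiv.toContinuousLinearEquiv
    { toFun := fun p => (cx.symm (cx p.1 * τ), κ * p.2)
      invFun := fun q => (cx.symm (cx q.1 / τ), q.2 / κ)
      map_add' := fun p q => by simp [add_mul, mul_add]
      map_smul' := fun a p => by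
        refine Prod.ext ?_ ?_
        · simp only [Prod.smul_fst, map_smul, smul_mul_assoc, RingHom.id_apply]
        · simp only [Prod.smul_snd, smul_eq_mul, RingHom.id_apply]; ring
      left_inv := fun p => by simp [hτ, hκ.ne']
      right_inv := fun q => by
        refine Prod.ext ?_ ?_
        · simp [hτ]
        · simp only; field_simp }

theorem frame_apply {τ : ℂ} (hτ : τ ≠ 0) {κ : ℝ} (hκ : 0 < κ) (p : SpaceTime) :
    frame hτ hκ p = (cx.symm (cx p.1 * τ), κ * p.2) := rfl

theorem eventually_blow_mem_slab {q₀ : SpaceTime} {T : ℝ} (hq₀ : q₀.2 ∈ Ico 0 T) {τ : ℂ}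
    (hτ : τ ≠ 0) {κ : ℝ} (hκ : 0 < κ) :
    ∀ᶠ r : ℝ in 𝓝[>] 0, ∀ p : SpaceTime, p.2 ∈ Icc 0 1 →
      (blow q₀ (frame hτ hκ) r p).2 ∈ Ico 0 T ∧ (0 < p.2 → 0 < (blow q₀ (frame hτ hκ) r p).2) := by
  have h1 : ∀ᶠ r : ℝ in 𝓝[>] 0, r * κ < T - q₀.2 := by
    have : Tendsto (fun r : ℝ => r * κ) (𝓝[>] 0) (𝓝 (0 * κ)) :=
      (tendsto_id.mul_const κ).mono_left nhdsWithin_le_nhds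
    exact this.eventually_lt_const (by simpa using hq₀.2)
  filter_upwards [h1, self_mem_nhdsWithin] with r hr hr0 p hp
  have hr0 : 0 < r := hr0
  have e : (blow q₀ (frame hτ hκ) r p).2 = q₀.2 + r * κ * p.2 := by
    simp [blow, frame_apply, mul_assoc]
  have h2 : 0 < r * κ := mul_pos hr0 hκ
  rw [e]
  refine ⟨⟨by nlinarith [hp.1, hq₀.1], by nlinarith [hp.2]⟩, fun h => ?_⟩
  nlinarith [hq₀.1, mul_pos h2 h]

theorem eventually_integrableOn_blow {q₀ : SpaceTime} {T : ℝ} (hq₀ : q₀.2 ∈ Ico 0 T) {τ : ℂ}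
    (hτ : τ ≠ 0) {κ : ℝ} (hκ : 0 < κ) {F : SpaceTime → ℝ} (hF : LocallyIntegrableOn F (slab₀ T)) :
    ∀ᶠ r : ℝ in 𝓝[>] 0, IntegrableOn (fun p => F (blow q₀ (frame hτ hκ) r p)) unitCyl := by
  filter_upwards [eventually_blow_mem_slab hq₀ hτ hκ, self_mem_nhdsWithin] with r hr hr0
  have hr0 : 0 < r := hr0
  set A := frame hτ hκ
  set K : Set SpaceTime := (Icc (-1) 1 ×ˢ Icc (-1) 1) ×ˢ Icc 0 1
  have hK : IsCompact K := (isCompact_Icc.prod isCompact_Icc).prod isCompact_Icc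
  have h1 : IntegrableOn F (blow q₀ A r '' K) := by
    refine hF.integrableOn_compact_subset ?_ (hK.image (continuous_blow q₀ A r))
    rintro _ ⟨p, hp, rfl⟩
    exact ⟨mem_univ _, (hr p hp.2).1⟩
  obtain ⟨c, hc, hmap⟩ := exists_map_blow A
  have h2 : IntegrableOn F (blow q₀ A r '' K) ((volume : Measure SpaceTime).map (blow q₀ A r)) := by
    rw [hmap q₀ r hr0, IntegrableOn, Measure.restrict_smul]
    exact Integrable.smul_measure h1 ENNReal.ofReal_ne_top
  rw [(measurableEmbedding_blow q₀ A hr0.ne').integrableOn_map_iff] at h2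
  refine h2.mono_set fun p hp => ⟨p, ?_, rfl⟩
  exact Set.prod_mono (Set.prod_mono Ioo_subset_Icc_self Ioo_subset_Icc_self) Ioo_subset_Icc_self hp

/-- Pairing with a dilated test function, in the limit, sees only the mean limits. -/
theorem Sides.tendsto_pairing {G : Geometry} {T : ℝ} {S : Sheet G T} {Ω : Bool → ℝ → Set Plane}
    (hΩ : Sides S Ω) {q₀ : SpaceTime} (hq₀ : q₀.2 ∈ Ico 0 T) {τ : ℂ} (hτ : τ ≠ 0)
    {κ : ℝ} (hκ : 0 < κ) {c : ℝ} (hc : 0 < c) (hmap : ∀ (q₀ : SpaceTime) (r : ℝ),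
    0 < r → (volume : Measure SpaceTime).map (blow q₀ (frame hτ hκ) r)
      = ENNReal.ofReal (c * r ^ 3)⁻¹ • volume) {F : SpaceTime → ℝ}
    (hF : LocallyIntegrableOn F (slab₀ T)) {ℓ : Bool → ℝ}
    (hℓ : ∀ b, HasMeanLimit q₀ (frame hτ hκ) (openRegion T (Ω b)) F (ℓ b))
    {ψ : SpaceTime → ℝ} (hψ : Continuous ψ) (hψc : HasCompactSupport ψ)
    (hψ0 : ∀ p, p ∉ unitCyl → ψ p = 0) :
    Tendsto (fun r : ℝ => (c * r ^ 3)⁻¹ * (∫ q in slab T, F q * ψ (unblow q₀ (frame hτ hκ) r q))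
      - (ℓ true * (∫ p in blowSet q₀ (frame hτ hκ) (openRegion T (Ω true)) r, ψ p)
        + ℓ false * ∫ p in blowSet q₀ (frame hτ hκ) (openRegion T (Ω false)) r, ψ p))
      (𝓝[>] 0) (𝓝 0) := by
  set A := frame hτ hκ
  set D : Bool → ℝ → Set SpaceTime := fun b => blowSet q₀ A (openRegion T (Ω b)) with hD
  obtain ⟨M, hM⟩ := hψc.exists_bound_of_continuous hψ
  have hM0 : 0 ≤ M := (norm_nonneg _).trans (hM 0)
  have hlim : Tendsto (fun r : ℝ => M * (∫ p in D true r, |F (blow q₀ A r p) - ℓ true|)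
      + M * ∫ p in D false r, |F (blow q₀ A r p) - ℓ false|) (𝓝[>] 0) (𝓝 0) := by
    simpa using ((hℓ true).const_mul M).add ((hℓ false).const_mul M)
  refine squeeze_zero_norm' ?_ hlim
  filter_upwards [eventually_blow_mem_slab hq₀ hτ hκ, eventually_integrableOn_blow hq₀ hτ hκ hF,
    self_mem_nhdsWithin] with r hr hFi hr0
  have hr0 : 0 < r := hr0
  have hDm : ∀ b, MeasurableSet (D b r) := fun b =>
    measurableSet_blowSet q₀ A (hΩ.isOpen_openRegion b) r
  have hDs : ∀ b, D b r ⊆ unitCyl := fun b => blowSet_subset q₀ A _ r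
  have hψi : IntegrableOn ψ unitCyl := (hψ.integrable_of_hasCompactSupport hψc).integrableOn
  have hFψ : IntegrableOn (fun p => F (blow q₀ A r p) * ψ p) unitCyl :=
    hFi.mul_bdd hψ.aestronglyMeasurable (Eventually.of_forall hM)
  have hslab : ∀ p ∈ unitCyl, blow q₀ A r p ∈ slab T := fun p hp =>
    ⟨mem_univ _, (hr p (Ioo_subset_Icc_self hp.2)).2 hp.2.1, (hr p (Ioo_subset_Icc_self hp.2)).1.2⟩
  have e1 : ∫ q in slab T, F q * ψ (unblow q₀ A r q) = ∫ q, F q * ψ (unblow q₀ A r q) := by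
    refine setIntegral_eq_integral_of_forall_compl_eq_zero fun q hq => ?_
    rw [hψ0 _ fun h => hq ?_, mul_zero]
    have := hslab _ h
    rwa [blow_unblow q₀ A hr0.ne'] at this
  have e2 : (c * r ^ 3)⁻¹ * ∫ q, F q * ψ (unblow q₀ A r q)
      = ∫ p in unitCyl, F (blow q₀ A r p) * ψ p := by
    rw [← integral_blow hc hr0 (hmap q₀ r hr0) fun q => F q * ψ (unblow q₀ A r q)]
    simp only [unblow_blow q₀ A hr0.ne']
    refine (setIntegral_eq_integral_of_forall_compl_eq_zero fun p hp => ?_).symm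
    rw [hψ0 p hp, mul_zero]
  have hdisj : Disjoint (D true r) (D false r) := disjoint_left.2 fun p hp hp' =>
    disjoint_left.1 hΩ.disjoint_openRegion hp.2 hp'.2
  have hsets : unitCyl =ᵐ[volume] (D true r ∪ D false r : Set SpaceTime) := by
    refine ae_eq_set.2 ⟨measure_mono_null ?_ (volume_preimage_blow q₀ A hr0 hΩ.volume_slab_diff), ?_⟩
    · rintro p ⟨hp, hn⟩
      refine ⟨hslab p hp, fun h => hn ?_⟩
      exact h.imp (fun h => ⟨hp, h⟩) (fun h => ⟨hp, h⟩)
    · rw [sdiff_eq_empty.2 (union_subset (hDs true) (hDs false)), measure_empty]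
  have e3 : ∫ p in unitCyl, F (blow q₀ A r p) * ψ p = (∫ p in D true r, F (blow q₀ A r p) * ψ p)
      + ∫ p in D false r, F (blow q₀ A r p) * ψ p := by
    rw [setIntegral_congr_set hsets, setIntegral_union hdisj (hDm false)
      (hFψ.mono_set (hDs true)) (hFψ.mono_set (hDs false))]
  have e4 : ∀ b, (∫ p in D b r, F (blow q₀ A r p) * ψ p) - ℓ b * ∫ p in D b r, ψ p
      = ∫ p in D b r, (F (blow q₀ A r p) - ℓ b) * ψ p := fun b => by
    rw [← integral_const_mul, ← integral_sub (hFψ.mono_set (hDs b))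
      ((hψi.mono_set (hDs b)).const_mul _)]
    simp only [sub_mul]
  have e5 : ∀ b, ‖∫ p in D b r, (F (blow q₀ A r p) - ℓ b) * ψ p‖
      ≤ M * ∫ p in D b r, |F (blow q₀ A r p) - ℓ b| := fun b => by
    have hcst : IntegrableOn (fun _ : SpaceTime => ℓ b) unitCyl :=
      integrableOn_const volume_unitCyl_lt_top.ne
    rw [← integral_const_mul]
    refine norm_integral_le_of_norm_le
      ((((hFi.sub hcst).mono_set (hDs b)).abs).const_mul M) (Eventually.of_forall fun p => ?_)
    rw [norm_mul, mul_comm, Real.norm_eq_abs (_ - _)]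
    exact mul_le_mul_of_nonneg_right (hM p) (abs_nonneg _)
  rw [e1, e2, e3]
  have e6 := e4 true
  have e7 := e4 false
  calc ‖_‖ = ‖(∫ p in D true r, (F (blow q₀ A r p) - ℓ true) * ψ p)
        + ∫ p in D false r, (F (blow q₀ A r p) - ℓ false) * ψ p‖ := by
        congr 1
        rw [← e6, ← e7]
        ring
    _ ≤ _ := (norm_add_le _ _).trans (add_le_add (e5 true) (e5 false))

/-! ### The test functions of the blow-up -/

/-- The spatial profile of the test functions of the blow-up. It equals `1` on `[-1/2, 1/2]`, where the
dilated interface lies. -/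
def spaceBump : ContDiffBump (0 : ℝ) := ⟨1 / 2, 3 / 4, by norm_num, by norm_num⟩

/-- The temporal profile of the test functions of the blow-up; it vanishes for `t ≤ 0`. -/
def timeBump : ContDiffBump (1 / 2 : ℝ) := ⟨1 / 8, 1 / 4, by norm_num, by norm_num⟩

/-- The test function of the blow-up, in the unit cylinder. -/
def cylBump (p : SpaceTime) : ℝ := spaceBump p.1.1 * spaceBump p.1.2 * timeBump p.2

theorem contDiff_cylBump : ContDiff ℝ ∞ cylBump := by
  refine ContDiff.mul (ContDiff.mul ?_ ?_) ?_
  · exact spaceBump.contDiff.comp (contDiff_fst.comp contDiff_fst)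
  · exact spaceBump.contDiff.comp (contDiff_snd.comp contDiff_fst)
  · exact timeBump.contDiff.comp contDiff_snd

theorem support_cylBump_subset : Function.support cylBump ⊆
    (Metric.closedBall 0 (3 / 4) ×ˢ Metric.closedBall 0 (3 / 4)) ×ˢ
      Metric.closedBall (1 / 2) (1 / 4) := by
  intro p hp
  have h1 : spaceBump p.1.1 ≠ 0 := fun h => hp (by simp [cylBump, h])
  have h2 : spaceBump p.1.2 ≠ 0 := fun h => hp (by simp [cylBump, h])
  have h3 : timeBump p.2 ≠ 0 := fun h => hp (by simp [cylBump, h])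
  have e1 : p.1.1 ∈ Function.support spaceBump := h1
  have e2 : p.1.2 ∈ Function.support spaceBump := h2
  have e3 : p.2 ∈ Function.support timeBump := h3
  rw [ContDiffBump.support_eq] at e1 e2 e3
  exact ⟨⟨Metric.ball_subset_closedBall e1, Metric.ball_subset_closedBall e2⟩,
    Metric.ball_subset_closedBall e3⟩

theorem isCompact_cylBump : IsCompact ((Metric.closedBall 0 (3 / 4) ×ˢ Metric.closedBall 0 (3 / 4)) ×ˢ
      Metric.closedBall (1 / 2) (1 / 4) : Set SpaceTime) :=
  ((isCompact_closedBall _ _).prod (isCompact_closedBall _ _)).prod (isCompact_closedBall _ _)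

theorem hasCompactSupport_cylBump : HasCompactSupport cylBump :=
  HasCompactSupport.of_support_subset_isCompact isCompact_cylBump support_cylBump_subset

theorem tsupport_cylBump_subset : tsupport cylBump ⊆ unitCyl := by
  refine (closure_minimal support_cylBump_subset isCompact_cylBump.isClosed).trans ?_
  simp only [Real.closedBall_eq_Icc]
  refine Set.prod_mono (Set.prod_mono ?_ ?_) ?_ <;>
  · intro x hx
    constructor <;> norm_num at hx ⊢ <;> linarith [hx.1, hx.2]

theorem deriv_spaceBump_eq_zero {v : ℝ} (hv : ¬|v| < 1) : deriv spaceBump v = 0 := by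
  by_contra h
  have h1 : v ∈ tsupport spaceBump := support_deriv_subset (f := spaceBump) h
  rw [ContDiffBump.tsupport_eq, mem_closedBall_zero_iff, Real.norm_eq_abs] at h1
  have h2 : spaceBump.rOut = 3 / 4 := rfl
  rw [h2] at h1
  exact hv (h1.trans_lt (by norm_num))

theorem fderiv_cylBump (p : SpaceTime) : fderiv ℝ cylBump p ((0, 1), 0)
    = spaceBump p.1.1 * deriv spaceBump p.1.2 * timeBump p.2 := by
  have hd : Differentiable ℝ cylBump := contDiff_cylBump.differentiable (by simp)
  have h1 : HasDerivAt (fun s : ℝ => p + s • (((0, 1), 0) : SpaceTime)) ((0, 1), 0) 0 := by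
    simpa using ((hasDerivAt_id (0 : ℝ)).smul_const (((0, 1), 0) : SpaceTime)).const_add p
  have h2 := (hd (p + (0 : ℝ) • (((0, 1), 0) : SpaceTime))).hasFDerivAt.comp_hasDerivAt (0 : ℝ) h1
  rw [zero_smul, add_zero] at h2
  have h3 : HasDerivAt (fun s : ℝ => p.1.2 + s) 1 0 := (hasDerivAt_id (0 : ℝ)).const_add p.1.2
  have h4 : HasDerivAt spaceBump (deriv spaceBump p.1.2) (p.1.2 + 0) := by
    rw [add_zero]
    exact ((spaceBump.contDiff (n := 1)).differentiable one_ne_zero _).hasDerivAt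
  have h5 := (((h4.comp (0 : ℝ) h3).const_mul (spaceBump p.1.1)).mul_const (timeBump p.2))
  rw [mul_one] at h5
  refine h2.unique (h5.congr_of_eventuallyEq (Eventually.of_forall fun s => ?_))
  simp [cylBump]

theorem integral_side_deriv_spaceBump (b : Bool) {h : ℝ} (hh : |h| < 1 / 2) :
    ∫ v, {v : ℝ | 0 < sg b * (v - h)}.indicator (deriv spaceBump) v = -sg b := by
  have hc : HasCompactSupport spaceBump := spaceBump.hasCompactSupport
  have hd : ContDiff ℝ 1 spaceBump := spaceBump.contDiff
  have hone : spaceBump h = 1 := by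
    refine spaceBump.one_of_mem_closedBall ?_
    rw [mem_closedBall_zero_iff, Real.norm_eq_abs]
    exact hh.le
  cases b
  · have : {v : ℝ | 0 < sg false * (v - h)} = Iio h := by
      ext v; simp [sg]
    rw [this, integral_indicator measurableSet_Iio, ← integral_Iic_eq_integral_Iio,
      hc.integral_Iic_deriv_eq hd, hone]
    simp [sg]
  · have : {v : ℝ | 0 < sg true * (v - h)} = Ioi h := by
      ext v; simp [sg]
    rw [this, integral_indicator measurableSet_Ioi, hc.integral_Ioi_deriv_eq hd, hone]
    simp [sg]

/-- The flux of the test function through a graph does not depend on the graph, which may be rough in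
time, as long as its height is less than `1 / 2`: there the profile is constant. -/
theorem integral_fderiv_cylBump {b : Bool} {D : Set SpaceTime} (hDm : MeasurableSet D)
    (hD : ∀ u s : ℝ, |u| < 1 → s ∈ Ioo (0 : ℝ) 1 → ∃ h : ℝ, |h| < 1 / 2 ∧ ∀ v : ℝ, |v| < 1 →
      (((u, v), s) ∈ D ↔ 0 < sg b * (v - h))) :
    ∫ p in D, fderiv ℝ cylBump p ((0, 1), 0)
      = -sg b * ((∫ u, spaceBump u) * ∫ s, timeBump s) := by
  have hcont : Continuous fun p => fderiv ℝ cylBump p ((0, 1), 0) :=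
    (contDiff_cylBump.continuous_fderiv (by simp)).clm_apply continuous_const
  have hcs : HasCompactSupport fun p => fderiv ℝ cylBump p ((0, 1), 0) :=
    hasCompactSupport_cylBump.fderiv_apply (𝕜 := ℝ) _
  have hi : Integrable (D.indicator fun p => fderiv ℝ cylBump p ((0, 1), 0)) :=
    (hcont.integrable_of_hasCompactSupport hcs).indicator hDm
  rw [← integral_indicator hDm]
  rw [Measure.volume_eq_prod] at hi ⊢
  rw [integral_prod_symm _ hi]
  have hslice : ∀ᵐ s : ℝ, Integrable fun x : Plane =>
      D.indicator (fun p => fderiv ℝ cylBump p ((0, 1), 0)) (x, s) := hi.prod_left_ae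
  have key : ∀ᵐ s : ℝ, ∫ x : Plane, D.indicator (fun p => fderiv ℝ cylBump p ((0, 1), 0)) (x, s)
      = timeBump s * (-sg b * ∫ u, spaceBump u) := by
    filter_upwards [hslice] with s hs
    rw [Measure.volume_eq_prod] at hs ⊢
    rw [integral_prod _ hs, ← integral_const_mul, ← integral_const_mul]
    refine integral_congr_ae (Eventually.of_forall fun u => ?_)
    simp only
    by_cases hus : |u| < 1 ∧ s ∈ Ioo (0 : ℝ) 1
    · obtain ⟨h, hh, hv⟩ := hD u s hus.1 hus.2
      rw [show timeBump s * (-sg b * spaceBump u)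
        = (spaceBump u * timeBump s) * -sg b by ring, ← integral_side_deriv_spaceBump b hh,
        ← integral_const_mul]
      refine integral_congr_ae (Eventually.of_forall fun v => ?_)
      simp only [indicator, fderiv_cylBump, mem_ofPred_eq]
      by_cases hv1 : |v| < 1
      · simp only [hv v hv1]
        split_ifs <;> ring
      · rw [deriv_spaceBump_eq_zero hv1]
        split_ifs <;> simp
    · have h0 : spaceBump u * timeBump s = 0 := by
        by_contra hne
        have e1 : u ∈ Function.support spaceBump := left_ne_zero_of_mul hne
        have e3 : s ∈ Function.support timeBump := right_ne_zero_of_mul hne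
        rw [ContDiffBump.support_eq, Real.ball_eq_Ioo] at e1 e3
        have r1 : spaceBump.rOut = 3 / 4 := rfl
        have r2 : timeBump.rOut = 1 / 4 := rfl
        rw [r1] at e1
        rw [r2] at e3
        refine hus ⟨abs_lt.2 ⟨by linarith [e1.1], by linarith [e1.2]⟩,
          by linarith [e3.1], by linarith [e3.2]⟩
      rw [show timeBump s * (-sg b * spaceBump u)
        = (spaceBump u * timeBump s) * -sg b by ring, h0, zero_mul]
      refine (integral_congr_ae (g := fun _ => (0 : ℝ)) ?_).trans (integral_zero _ _)
      refine (Eventually.of_forall fun v => ?_)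
      simp only [indicator, fderiv_cylBump]
      split_ifs
      · rw [mul_right_comm, h0, zero_mul]
      · rfl
  rw [integral_congr_ae key, integral_mul_const]
  ring

/-! ### The jump of the pressure -/

theorem isTest_blow {q₀ : SpaceTime} {A : SpaceTime ≃L[ℝ] SpaceTime} {r T : ℝ} (hr : r ≠ 0)
    (h : ∀ p ∈ unitCyl, (blow q₀ A r p).2 < T) : IsTest T fun q => cylBump (unblow q₀ A r q) := by
  refine ⟨?_, ?_, ?_⟩
  · have h1 : ContDiff ℝ ∞ fun q : SpaceTime => r⁻¹ • (q - q₀) :=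
      (contDiff_id.sub contDiff_const).const_smul r⁻¹
    exact contDiff_cylBump.comp (A.symm.contDiff.comp h1)
  · exact hasCompactSupport_cylBump.comp_homeomorph (blowHomeo q₀ A hr).symm
  · intro q hq
    have h1 := tsupport_cylBump_subset (tsupport_comp_subset_preimage cylBump
      (continuous_unblow q₀ A r) hq)
    have h2 := h _ h1
    rwa [blow_unblow q₀ A hr] at h2

theorem fderiv_cylBump_unblow (q₀ : SpaceTime) (A : SpaceTime ≃L[ℝ] SpaceTime) (r : ℝ)
    (q e : SpaceTime) : fderiv ℝ (fun q => cylBump (unblow q₀ A r q)) q e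
      = r⁻¹ * fderiv ℝ cylBump (unblow q₀ A r q) (A.symm e) := by
  have hd : Differentiable ℝ cylBump := contDiff_cylBump.differentiable (by simp)
  have h1 : HasFDerivAt (unblow q₀ A r) ((A.symm : SpaceTime →L[ℝ] SpaceTime).comp
      (r⁻¹ • ContinuousLinearMap.id ℝ SpaceTime)) q :=
    (A.symm : SpaceTime →L[ℝ] SpaceTime).hasFDerivAt.comp q
      (((hasFDerivAt_id q).sub_const q₀).const_smul r⁻¹)
  have h2 : HasFDerivAt (fun q => cylBump (unblow q₀ A r q)) _ q := (hd _).hasFDerivAt.comp q h1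
  rw [h2.fderiv]
  simp

namespace Sheet

variable {G : Geometry} {T : ℝ} (S : Sheet G T) {Ω : Bool → ℝ → Set Plane}

set_option maxHeartbeats 1000000 in
/-- The pressure does not jump. Test functions concentrate at a point of the interface: since the
densities differ, the balances of mass and volume show that no mass crosses the interface, and then
the balance of momentum leaves only the jump of the pressure. -/
theorem pressure_eq (hΩ : Sides S Ω) (α₀ : ℝ) {t₀ : ℝ} (ht₀ : t₀ ∈ Ico 0 T)
    {g : ℝ} {ρ : SpaceTime → ℝ} {v : SpaceTime → Plane} {p : SpaceTime → ℝ} {ρ₀ : Plane → ℝ}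
    {v₀ : Plane → Plane} (hsol : IsWeakSolution g T ρ v p ρ₀ v₀) {ρc : Bool → ℝ}
    (hne : ρc true ≠ ρc false) (hρ : ∀ b, ∀ q ∈ openRegion T (Ω b), ρ q = ρc b)
    (hvel : ∀ᵐ q ∂(volume.restrict (slab T)), cvel v q = S.vel (cx q.1) q.2) {P : Bool → ℝ}
    (hp : ∀ b, ∀ κ : ℝ, ∀ hκ : 0 < κ, HasMeanLimit (cx.symm (S.z α₀ t₀), t₀)
      (frame (S.regular t₀ ht₀ α₀) hκ) (openRegion T (Ω b)) p (P b)) : P true = P false := by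
  set x₀ := S.z α₀ t₀ with hx₀
  set τ := S.zα α₀ t₀ with hτdef
  have hτ : τ ≠ 0 := S.regular t₀ ht₀ α₀
  obtain ⟨κ, hκ, r₀, hr₀, hchart⟩ := S.exists_chart hΩ α₀ ht₀
  set q₀ : SpaceTime := (cx.symm x₀, t₀) with hq₀
  set A := frame hτ hκ with hA
  obtain ⟨c, hc, hmap⟩ := exists_map_blow A
  choose L hL using fun b => S.exists_limit_vel hΩ α₀ ht₀ b
  have hL' : ∀ b, Tendsto (fun q : SpaceTime => S.vel (cx q.1) q.2) (𝓝[openRegion T (Ω b)] q₀)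
      (𝓝 (L b)) := fun b => (hL b).mono_left (nhdsWithin_mono _ fun q hq =>
        ⟨⟨hq.1.1.le, hq.1.2⟩, hq.2⟩)
  -- mean limits of functions of the density and of the velocity
  have hml : ∀ Φ : ℝ → ℂ → ℝ, (∀ r, Continuous (Φ r)) → ∀ b, HasMeanLimit q₀ A (openRegion T (Ω b))
      (fun q => Φ (ρ q) (cvel v q)) (Φ (ρc b) (L b)) := fun Φ hΦ b => by
    refine hasMeanLimit_of_tendsto A (hΩ.isOpen_openRegion b)
      (F' := fun q => Φ (ρc b) (S.vel (cx q.1) q.2)) ?_ (((hΦ _).tendsto _).comp (hL' b))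
    filter_upwards [ae_restrict_of_ae_restrict_of_subset (Sides.openRegion_subset b) hvel,
      ae_restrict_mem (hΩ.isOpen_openRegion b).measurableSet] with q hq hqb
    rw [hq, hρ b q hqb]
  have hv1 : ∀ q, (v q).1 = (cvel v q).re := fun q => by simp [cvel]
  have hv2 : ∀ q, (v q).2 = -(cvel v q).im := fun q => by simp [cvel]
  -- `ψ e` is the derivative of the profile along the direction `e`; `J` is the pairing with a
  -- dilated profile, and `Y b` the integral of a profile over the dilated fluid on the side `b`
  set ψ : SpaceTime → SpaceTime → ℝ := fun e p => fderiv ℝ cylBump p (A.symm e) with hψ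
  have hψc : ∀ e, Continuous (ψ e) := fun e =>
    (contDiff_cylBump.continuous_fderiv (by simp)).clm_apply continuous_const
  have hψs : ∀ e, HasCompactSupport (ψ e) := fun e =>
    hasCompactSupport_cylBump.fderiv_apply (𝕜 := ℝ) _
  have hψt : ∀ e p, p ∉ tsupport cylBump → ψ e p = 0 := fun e p h => by
    simp only [hψ]; rw [fderiv_eq_zero_of_notMem_tsupport h]; rfl
  have hφt : ∀ p, p ∉ tsupport cylBump → cylBump p = 0 := fun p h => image_eq_zero_of_notMem_tsupport h
  set J : (SpaceTime → ℝ) → (SpaceTime → ℝ) → ℝ → ℝ := fun F ψ r =>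
    (c * r ^ 3)⁻¹ * ∫ q in slab T, F q * ψ (unblow q₀ A r q) with hJ
  set Y : Bool → (SpaceTime → ℝ) → ℝ → ℝ := fun b ψ r =>
    ∫ p in blowSet q₀ A (openRegion T (Ω b)) r, ψ p with hY
  have pair : ∀ {F : SpaceTime → ℝ} {ℓ : Bool → ℝ}, LocallyIntegrableOn F (slab₀ T) →
      (∀ b, HasMeanLimit q₀ A (openRegion T (Ω b)) F (ℓ b)) → ∀ e,
      Tendsto (fun r => J F (ψ e) r - (ℓ true * Y true (ψ e) r + ℓ false * Y false (ψ e) r))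
        (𝓝[>] 0) (𝓝 0) := fun hF hℓ e =>
    hΩ.tendsto_pairing ht₀ hτ hκ hc hmap hF hℓ (hψc e) (hψs e)
      fun p hp => hψt e p fun h => hp (tsupport_cylBump_subset h)
  -- local integrability and mean limits of the coefficients
  have i1 : LocallyIntegrableOn (fun q => (v q).1) (slab₀ T) := fun q hq =>
    (hsol.int_v q hq).imp fun s hs => ⟨hs.1, Integrable.fst hs.2⟩
  have i2 : LocallyIntegrableOn (fun q => (v q).2) (slab₀ T) := fun q hq =>
    (hsol.int_v q hq).imp fun s hs => ⟨hs.1, Integrable.snd hs.2⟩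
  have ir1 : LocallyIntegrableOn (fun q => ρ q * (v q).1) (slab₀ T) := fun q hq =>
    (hsol.int_ρv q hq).imp fun s hs => ⟨hs.1,
      show Integrable (fun q => (ρ q • v q).1) (volume.restrict s) from Integrable.fst hs.2⟩
  have ir2 : LocallyIntegrableOn (fun q => ρ q * (v q).2) (slab₀ T) := fun q hq =>
    (hsol.int_ρv q hq).imp fun s hs => ⟨hs.1,
      show Integrable (fun q => (ρ q • v q).2) (volume.restrict s) from Integrable.snd hs.2⟩
  have ione : LocallyIntegrableOn (fun _ : SpaceTime => (1 : ℝ)) (slab₀ T) :=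
    (locallyIntegrable_const 1).locallyIntegrableOn _
  set a : Bool → ℝ := fun b => (L b).re with ha
  set d : Bool → ℝ := fun b => -(L b).im with hd
  have m1 : ∀ b, HasMeanLimit q₀ A (openRegion T (Ω b)) (fun q => (v q).1) (a b) := by
    simp only [hv1]; exact hml (fun _ w => w.re) fun _ => by fun_prop
  have m2 : ∀ b, HasMeanLimit q₀ A (openRegion T (Ω b)) (fun q => (v q).2) (d b) := by
    simp only [hv2]; exact hml (fun _ w => -w.im) fun _ => by fun_prop
  have mr : ∀ b, HasMeanLimit q₀ A (openRegion T (Ω b)) ρ (ρc b) :=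
    hml (fun r _ => r) fun _ => by fun_prop
  have mone : ∀ b, HasMeanLimit q₀ A (openRegion T (Ω b)) (fun _ => (1 : ℝ)) 1 :=
    hml (fun _ _ => 1) fun _ => by fun_prop
  have mr1 : ∀ b, HasMeanLimit q₀ A (openRegion T (Ω b)) (fun q => ρ q * (v q).1) (ρc b * a b) := by
    simp only [hv1]; exact hml (fun r w => r * w.re) fun _ => by fun_prop
  have mr2 : ∀ b, HasMeanLimit q₀ A (openRegion T (Ω b)) (fun q => ρ q * (v q).2) (ρc b * d b) := by
    simp only [hv2]; exact hml (fun r w => r * -w.im) fun _ => by fun_prop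
  have mr11 : ∀ b, HasMeanLimit q₀ A (openRegion T (Ω b)) (fun q => ρ q * ((v q).1 * (v q).1))
      (ρc b * (a b * a b)) := by
    simp only [hv1]; exact hml (fun r w => r * (w.re * w.re)) fun _ => by fun_prop
  have mr12 : ∀ b, HasMeanLimit q₀ A (openRegion T (Ω b)) (fun q => ρ q * ((v q).1 * (v q).2))
      (ρc b * (a b * d b)) := by
    simp only [hv1, hv2]; exact hml (fun r w => r * (w.re * -w.im)) fun _ => by fun_prop
  have mr22 : ∀ b, HasMeanLimit q₀ A (openRegion T (Ω b)) (fun q => ρ q * ((v q).2 * (v q).2))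
      (ρc b * (d b * d b)) := by
    simp only [hv2]; exact hml (fun r w => r * (-w.im * -w.im)) fun _ => by fun_prop
  -- the equations of mass, volume and momentum, and `∫ ∂_e ζ = 0`, for the dilated test function
  set e₀ : SpaceTime := ((0, 0), 1)
  set e₁ : SpaceTime := ((1, 0), 0)
  set e₂ : SpaceTime := ((0, 1), 0)
  have hsmall := eventually_blow_mem_slab (q₀ := q₀) ht₀ hτ hκ
  have heqs : ∀ᶠ r : ℝ in 𝓝[>] 0,
      J ρ (ψ e₀) r + J (fun q => ρ q * (v q).1) (ψ e₁) r + J (fun q => ρ q * (v q).2) (ψ e₂) r = 0 ∧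
      J (fun q => (v q).1) (ψ e₁) r + J (fun q => (v q).2) (ψ e₂) r = 0 ∧
      J (fun q => ρ q * (v q).1) (ψ e₀) r + J (fun q => ρ q * ((v q).1 * (v q).1)) (ψ e₁) r
        + J (fun q => ρ q * ((v q).1 * (v q).2)) (ψ e₂) r + J p (ψ e₁) r = 0 ∧
      J (fun q => ρ q * (v q).2) (ψ e₀) r + J (fun q => ρ q * ((v q).1 * (v q).2)) (ψ e₁) r
        + J (fun q => ρ q * ((v q).2 * (v q).2)) (ψ e₂) r + J p (ψ e₂) r
        - g * (r * J ρ cylBump r) = 0 ∧ ∀ e, J (fun _ => 1) (ψ e) r = 0 := by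
    filter_upwards [hsmall, self_mem_nhdsWithin] with r hr hr0
    have hr0 : 0 < r := hr0
    have hcyl : ∀ p ∈ unitCyl, (0 : ℝ) < (blow q₀ A r p).2 ∧ (blow q₀ A r p).2 < T := fun p hp =>
      ⟨(hr p (Ioo_subset_Icc_self hp.2)).2 hp.2.1, (hr p (Ioo_subset_Icc_self hp.2)).1.2⟩
    set ζ : SpaceTime → ℝ := fun q => cylBump (unblow q₀ A r q) with hζ
    have hζt : IsTest T ζ := isTest_blow hr0.ne' fun p hp => (hcyl p hp).2
    have hζ0 : ∀ q : SpaceTime, ¬(0 < q.2 ∧ q.2 < T) → unblow q₀ A r q ∉ unitCyl := fun q hq h => by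
      have := hcyl _ h
      rw [blow_unblow q₀ A hr0.ne'] at this
      exact hq this
    have hinit : ∀ x : Plane, ζ (x, 0) = 0 := fun x =>
      hφt _ fun h => hζ0 (x, 0) (fun h => lt_irrefl _ h.1) (tsupport_cylBump_subset h)
    have hd1 : ∀ q, d₁ ζ q = r⁻¹ * ψ e₁ (unblow q₀ A r q) := fun q =>
      fderiv_cylBump_unblow q₀ A r q e₁
    have hd2 : ∀ q, d₂ ζ q = r⁻¹ * ψ e₂ (unblow q₀ A r q) := fun q =>
      fderiv_cylBump_unblow q₀ A r q e₂
    have hdt : ∀ q, dt ζ q = r⁻¹ * ψ e₀ (unblow q₀ A r q) := fun q =>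
      fderiv_cylBump_unblow q₀ A r q e₀
    have hzero : IsTest T fun _ => (0 : ℝ) :=
      ⟨contDiff_const, HasCompactSupport.zero, by simp [tsupport]⟩
    have hd0 : ∀ q, d₁ (fun _ => (0 : ℝ)) q = 0 ∧ d₂ (fun _ => (0 : ℝ)) q = 0 ∧
      dt (fun _ => (0 : ℝ)) q = 0 := fun q => by simp [d₁, d₂, dt]
    have hK : IsCompact (blow q₀ A r '' tsupport cylBump) :=
      IsCompact.image hasCompactSupport_cylBump (continuous_blow q₀ A r)
    have hint : ∀ {F χ : SpaceTime → ℝ}, LocallyIntegrableOn F (slab₀ T) → Continuous χ →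
        (∀ p, p ∉ tsupport cylBump → χ p = 0) →
        IntegrableOn (fun q => F q * χ (unblow q₀ A r q)) (slab T) := fun hF hχ hχ0 => by
      refine integrableOn_slab_mul hF (hχ.comp (continuous_unblow q₀ A r)) hK ?_ fun q hq =>
        hχ0 _ fun h => hq ⟨_, h, blow_unblow q₀ A hr0.ne' q⟩
      rintro _ ⟨p, hp, rfl⟩
      exact (hcyl p (tsupport_cylBump_subset hp)).2
    have hi : ∀ {F : SpaceTime → ℝ}, LocallyIntegrableOn F (slab₀ T) → ∀ e,
        IntegrableOn (fun q => F q * ψ e (unblow q₀ A r q)) (slab T) := fun hF e =>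
      hint hF (hψc e) (hψt e)
    have hadd : ∀ {f₁ f₂ : SpaceTime → ℝ}, IntegrableOn f₁ (slab T) → IntegrableOn f₂ (slab T) →
        IntegrableOn (fun q => f₁ q + f₂ q) (slab T) := fun h1 h2 => h1.add h2
    have hfac : ∀ {I : ℝ}, r⁻¹ * I = 0 → (c * r ^ 3)⁻¹ * I = 0 := fun h => by
      rw [(mul_eq_zero.1 h).resolve_left (inv_ne_zero hr0.ne'), mul_zero]
    refine ⟨?_, ?_, ?_, ?_, fun e => ?_⟩
    · have h := hsol.mass ζ hζt
      simp only [hinit, mul_zero, integral_zero, add_zero, hd1, hd2, hdt] at h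
      simp only [hJ, ← mul_add]
      rw [← integral_add (hi hsol.int_ρ e₀) (hi ir1 e₁), ← integral_add
        (hadd (hi hsol.int_ρ e₀) (hi ir1 e₁)) (hi ir2 e₂)]
      refine hfac ?_
      rw [← h, ← integral_const_mul]
      congr 1; ext q; ring
    · have h := hsol.div_free ζ hζt
      simp only [hd1, hd2] at h
      simp only [hJ, ← mul_add]
      rw [← integral_add (hi i1 e₁) (hi i2 e₂)]
      refine hfac ?_
      rw [← h, ← integral_const_mul]
      congr 1; ext q; ring
    · have h := hsol.momentum ζ (fun _ => 0) hζt hzero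
      simp only [hinit, mul_zero, add_zero, integral_zero, (hd0 _).1, (hd0 _).2.1, (hd0 _).2.2,
        sub_zero, hd1, hd2, hdt] at h
      simp only [hJ, ← mul_add]
      rw [← integral_add (hi ir1 e₀) (hi hsol.int_ρvv₁₁ e₁), ← integral_add
        (hadd (hi ir1 e₀) (hi hsol.int_ρvv₁₁ e₁)) (hi hsol.int_ρvv₁₂ e₂), ← integral_add
        (hadd (hadd (hi ir1 e₀) (hi hsol.int_ρvv₁₁ e₁)) (hi hsol.int_ρvv₁₂ e₂)) (hi hsol.int_p e₁)]
      refine hfac ?_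
      rw [← h, ← integral_const_mul]
      congr 1; ext q; ring
    · have h := hsol.momentum (fun _ => 0) ζ hzero hζt
      simp only [hinit, mul_zero, add_zero, zero_add, integral_zero, (hd0 _).1, (hd0 _).2.1,
        (hd0 _).2.2, hd1, hd2, hdt] at h
      have hiφ := (hint hsol.int_ρ contDiff_cylBump.continuous hφt).const_mul (g * r)
      have hJφ : g * (r * J ρ cylBump r) = (c * r ^ 3)⁻¹ *
          ∫ q in slab T, g * r * (ρ q * cylBump (unblow q₀ A r q)) := by
        rw [integral_const_mul]; simp only [hJ]; ring
      rw [hJφ]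
      simp only [hJ, ← mul_add, ← mul_sub]
      rw [← integral_add (hi ir2 e₀) (hi hsol.int_ρvv₁₂ e₁), ← integral_add
        (hadd (hi ir2 e₀) (hi hsol.int_ρvv₁₂ e₁)) (hi hsol.int_ρvv₂₂ e₂), ← integral_add
        (hadd (hadd (hi ir2 e₀) (hi hsol.int_ρvv₁₂ e₁)) (hi hsol.int_ρvv₂₂ e₂)) (hi hsol.int_p e₂),
        ← integral_sub (hadd (hadd (hadd (hi ir2 e₀) (hi hsol.int_ρvv₁₂ e₁)) (hi hsol.int_ρvv₂₂ e₂))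
        (hi hsol.int_p e₂)) hiφ]
      refine hfac ?_
      rw [← h, ← integral_const_mul]
      congr 1; ext q
      simp only [hζ]
      field_simp
      ring
    · have h1 := integral_mul_fderiv (μ := (volume : Measure SpaceTime)) (f := fun _ => (1 : ℝ))
        (f' := fun _ => 0) (v := e) (hζt.smooth.of_le (by simp)) hζt.compact continuousOn_const
        continuousOn_const fun q _ => hasDerivAt_const _ _
      simp only [zero_mul, integral_zero, neg_zero] at h1
      simp only [hJ]
      refine hfac ?_
      rw [← integral_const_mul, ← h1]
      rw [setIntegral_eq_integral_of_forall_compl_eq_zero]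
      · congr 1; ext q
        rw [fderiv_cylBump_unblow q₀ A r q e]; simp only [hψ]; ring
      · intro q hq
        rw [hψt e _ fun h => hζ0 q (fun h => hq ⟨mem_univ _, h⟩) (tsupport_cylBump_subset h)]
        simp
  -- in the limit the equations relate the fluxes `Y b (ψ e)`; `m b` is the flux of volume through
  -- the boundary of the moving region on the side `b`
  have Y0 : ∀ e, Tendsto (fun r => Y true (ψ e) r + Y false (ψ e) r) (𝓝[>] 0) (𝓝 0) := fun e => by
    have h := (pair ione mone e).neg
    rw [neg_zero] at h
    refine h.congr' ?_
    filter_upwards [heqs] with r hr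
    rw [hr.2.2.2.2 e]; ring
  set m : Bool → ℝ → ℝ := fun b r => Y b (ψ e₀) r + a b * Y b (ψ e₁) r + d b * Y b (ψ e₂) r with hm
  have hmass : Tendsto (fun r => ρc true * m true r + ρc false * m false r) (𝓝[>] 0) (𝓝 0) := by
    have h := ((pair hsol.int_ρ mr e₀).add ((pair ir1 mr1 e₁).add (pair ir2 mr2 e₂))).neg
    simp only [add_zero, neg_zero] at h
    refine h.congr' ?_
    filter_upwards [heqs] with r hr
    simp only [hm]
    linear_combination -hr.1
  have hvol : Tendsto (fun r => m true r + m false r) (𝓝[>] 0) (𝓝 0) := by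
    have h := ((pair i1 m1 e₁).add (pair i2 m2 e₂)).neg.add (Y0 e₀)
    simp only [add_zero, neg_zero] at h
    refine h.congr' ?_
    filter_upwards [heqs] with r hr
    simp only [hm]
    linear_combination -hr.2.1
  -- `ρ₁ m₁ + ρ₂ m₂ → 0` and `m₁ + m₂ → 0` with `ρ₁ ≠ ρ₂`: no mass crosses the interface
  have hmt : Tendsto (m true) (𝓝[>] 0) (𝓝 0) := by
    have h := (hmass.sub (hvol.const_mul (ρc false))).const_mul (ρc true - ρc false)⁻¹
    simp only [mul_zero, sub_zero] at h
    refine h.congr fun r => ?_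
    have : ρc true - ρc false ≠ 0 := sub_ne_zero.2 hne
    field_simp
    ring
  have hmf : Tendsto (m false) (𝓝[>] 0) (𝓝 0) := by
    have h := hvol.sub hmt
    rw [sub_zero] at h
    exact h.congr fun r => by ring
  have hYb : ∀ b, Tendsto (fun r => r * Y b cylBump r) (𝓝[>] 0) (𝓝 0) := fun b => by
    have hi : Integrable cylBump :=
      contDiff_cylBump.continuous.integrable_of_hasCompactSupport hasCompactSupport_cylBump
    have h0 : Tendsto (fun r : ℝ => |r| * ∫ p, ‖cylBump p‖) (𝓝[>] 0) (𝓝 0) := by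
      have : Tendsto (fun r : ℝ => |r| * ∫ p, ‖cylBump p‖) (𝓝 0) (𝓝 (|0| * ∫ p, ‖cylBump p‖)) :=
        (continuous_abs.tendsto 0).mul_const _
      rw [abs_zero, zero_mul] at this
      exact this.mono_left nhdsWithin_le_nhds
    refine squeeze_zero_norm (fun r => ?_) h0
    rw [norm_mul, Real.norm_eq_abs r]
    refine mul_le_mul_of_nonneg_left ?_ (abs_nonneg r)
    refine (norm_integral_le_integral_norm _).trans ?_
    exact setIntegral_le_integral hi.norm (Eventually.of_forall fun p => norm_nonneg _)
  have hgrav : Tendsto (fun r => g * (r * J ρ cylBump r)) (𝓝[>] 0) (𝓝 0) := by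
    have h1 : Tendsto (fun r : ℝ => r) (𝓝[>] 0) (𝓝 0) := tendsto_id.mono_left nhdsWithin_le_nhds
    have h2 := (h1.mul (hΩ.tendsto_pairing (q₀ := q₀) ht₀ hτ hκ hc hmap hsol.int_ρ mr
      contDiff_cylBump.continuous hasCompactSupport_cylBump
      fun p hp => hφt p fun h => hp (tsupport_cylBump_subset h))).add
      (((hYb true).const_mul (ρc true)).add ((hYb false).const_mul (ρc false)))
    have h3 := h2.const_mul g
    simp only [mul_zero, add_zero] at h3
    refine h3.congr fun r => ?_
    simp only [hJ, hY]
    ring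
  have hmom1 : Tendsto (fun r => (P true - P false) * Y true (ψ e₁) r) (𝓝[>] 0) (𝓝 0) := by
    have h := (((pair ir1 mr1 e₀).add ((pair hsol.int_ρvv₁₁ mr11 e₁).add
      ((pair hsol.int_ρvv₁₂ mr12 e₂).add (pair hsol.int_p (fun b => hp b κ hκ) e₁)))).neg.sub
      (((hmt.const_mul (ρc true * a true)).add (hmf.const_mul (ρc false * a false))))).sub
      ((Y0 e₁).const_mul (P false))
    simp only [mul_zero, add_zero, neg_zero, sub_zero] at h
    refine h.congr' ?_
    filter_upwards [heqs] with r hr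
    simp only [hm]
    linear_combination -hr.2.2.1
  have hmom2 : Tendsto (fun r => (P true - P false) * Y true (ψ e₂) r) (𝓝[>] 0) (𝓝 0) := by
    have h := ((((pair ir2 mr2 e₀).add ((pair hsol.int_ρvv₁₂ mr12 e₁).add
      ((pair hsol.int_ρvv₂₂ mr22 e₂).add (pair hsol.int_p (fun b => hp b κ hκ) e₂)))).neg.sub
      (((hmt.const_mul (ρc true * d true)).add (hmf.const_mul (ρc false * d false))))).sub
      ((Y0 e₂).const_mul (P false))).add hgrav
    simp only [mul_zero, add_zero, neg_zero, sub_zero] at h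
    refine h.congr' ?_
    filter_upwards [heqs] with r hr
    simp only [hm]
    linear_combination -hr.2.2.2.1
  -- momentum leaves `[p] Y (ψ e) → 0` for spatial `e`, and the flux along the normal at the point does
  -- not vanish, whatever graph the interface is in the dilated square
  set n : SpaceTime := A ((0, 1), 0) with hn
  have hnn : n = n.1.1 • e₁ + n.1.2 • e₂ := by
    have h0 : n.2 = 0 := by simp [hn, hA, frame_apply]
    refine Prod.ext (Prod.ext ?_ ?_) ?_ <;> simp [e₁, e₂, h0]
  have hYn : ∀ r, Y true (ψ n) r = n.1.1 * Y true (ψ e₁) r + n.1.2 * Y true (ψ e₂) r := fun r => by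
    have hi : ∀ e, Integrable (ψ e) := fun e => (hψc e).integrable_of_hasCompactSupport (hψs e)
    simp only [hY]
    rw [← integral_const_mul, ← integral_const_mul, ← integral_add
      ((hi e₁).integrableOn.const_mul _) ((hi e₂).integrableOn.const_mul _)]
    congr 1; ext p
    simp only [hψ]
    conv_lhs => rw [hnn]
    simp only [map_add, map_smul, smul_eq_mul]
  have hflux : ∀ᶠ r : ℝ in 𝓝[>] 0, Y true (ψ n) r
      = -sg true * ((∫ u, spaceBump u) * ∫ s, timeBump s) := by
    have hr₀' : ∀ᶠ r : ℝ in 𝓝[>] 0, r < r₀ :=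
      mem_nhdsWithin_of_mem_nhds (Iio_mem_nhds hr₀)
    filter_upwards [hsmall, hr₀', self_mem_nhdsWithin] with r hr hrr hr0
    have hr0 : 0 < r := hr0
    have h1 : ∀ p, ψ n p = fderiv ℝ cylBump p ((0, 1), 0) := fun p => by
      simp only [hψ, hn, ContinuousLinearEquiv.symm_apply_apply]
    simp only [hY, h1]
    refine integral_fderiv_cylBump
      (measurableSet_blowSet q₀ A (hΩ.isOpen_openRegion true) r) fun u s hu hs => ?_
    have ht := hr ((u, 0), s) (Ioo_subset_Icc_self hs)
    have htv : ∀ v : ℝ, (blow q₀ (frame hτ hκ) r ((u, v), s)).2 = t₀ + r * (κ * s) := fun v => by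
      simp [blow, frame_apply, hq₀]
    have hxv : ∀ v : ℝ, (blow q₀ (frame hτ hκ) r ((u, v), s)).1
        = cx.symm (x₀ + ((r * u : ℝ) + (r * v : ℝ) * Complex.I) * τ) := fun v => by
      apply cx.injective
      simp [blow, frame_apply, hq₀, cx_mk]
      ring
    rw [htv] at ht
    have hab : |t₀ + r * (κ * s) - t₀| < κ * r := by
      rw [add_sub_cancel_left, abs_of_pos (by have := hs.1; positivity)]
      have : 0 < κ * r := by positivity
      nlinarith [hs.2]
    obtain ⟨α, h, -, hh, -, hside⟩ := (hchart r hr0 hrr _ ht.1 hab).1 (r * u) (by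
      rw [abs_mul, abs_of_pos hr0]; nlinarith)
    refine ⟨h / r, ?_, fun v hv => ?_⟩
    · rw [abs_div, abs_of_pos hr0, div_lt_iff₀ hr0]; linarith
    · have h2 := hside (r * v) (by rw [abs_mul, abs_of_pos hr0]; nlinarith) true
      have h3 : ((u, v), s) ∈ unitCyl := ⟨⟨abs_lt.1 hu, abs_lt.1 hv⟩, hs⟩
      have h4 : ((u, v), s) ∈ blowSet q₀ A (openRegion T (Ω true)) r ↔
          cx.symm (x₀ + ((r * u : ℝ) + (r * v : ℝ) * Complex.I) * τ) ∈ Ω true (t₀ + r * (κ * s)) := by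
        rw [← hxv v, ← htv v]
        refine ⟨fun h => h.2.2, fun h => ⟨h3, ?_, h⟩⟩
        show (blow q₀ (frame hτ hκ) r ((u, v), s)).2 ∈ Ioo 0 T
        rw [htv]
        exact ⟨ht.2 hs.1, ht.1.2⟩
      rw [h4, h2]
      have h5 : sg true * (r * v - h) = r * (sg true * (v - h / r)) := by field_simp
      rw [h5, mul_pos_iff_of_pos_left hr0]
  have hfin : Tendsto (fun r => (P true - P false) * Y true (ψ n) r) (𝓝[>] 0) (𝓝 0) := by
    have h := (hmom1.const_mul n.1.1).add (hmom2.const_mul n.1.2)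
    simp only [mul_zero, add_zero] at h
    exact h.congr fun r => by rw [hYn]; ring
  have hconst : (P true - P false) * (-sg true * ((∫ u, spaceBump u) * ∫ s, timeBump s)) = 0 := by
    refine tendsto_nhds_unique (tendsto_const_nhds.congr' ?_) hfin
    filter_upwards [hflux] with r hr
    rw [hr]
  have hpos : 0 < (∫ u, spaceBump u) * ∫ s, timeBump s :=
    mul_pos spaceBump.integral_pos timeBump.integral_pos
  have := (mul_eq_zero.1 hconst).resolve_right
    (mul_ne_zero (neg_ne_zero.2 (sg_ne_zero true)) hpos.ne')
  linarith

end Sheet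

/-! ### Local representations of the pressure -/

/-- Near the points of `N`, in the fluid on the side `b`, the pressure is the sum of `-Q`, which is
continuous up to the sheet, and of the function `κ` of time. -/
structure PressureChart {G : Geometry} {T : ℝ} (S : Sheet G T) (Ω : Bool → ℝ → Set Plane)
    (p : SpaceTime → ℝ) (b : Bool) (N : Set SpaceTime) (Q : SpaceTime → ℝ) (κ : ℝ → ℝ) : Prop where
  isOpen : IsOpen N
  cont : ∀ q ∈ N, q ∈ fluidRegion T (Ω b) → ContinuousWithinAt Q (slab₀ T) q
  lim : ∀ α t, t ∈ Ico 0 T → (cx.symm (S.z α t), t) ∈ N →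
    ∃ L, Tendsto Q (𝓝[fluidRegion T (Ω b)] (cx.symm (S.z α t), t)) (𝓝 L)
  int : Integrable κ
  ae : ∀ᵐ q ∂(volume.restrict (N ∩ openRegion T (Ω b))), p q + Q q = κ q.2

theorem openRegion_subset_fluidRegion (T : ℝ) (O : ℝ → Set Plane) :
    openRegion T O ⊆ fluidRegion T O := fun _ h => ⟨⟨h.1.1.le, h.1.2⟩, h.2⟩

theorem fluidRegion_subset_slab₀ (T : ℝ) (O : ℝ → Set Plane) : fluidRegion T O ⊆ slab₀ T :=
  fun _ h => ⟨mem_univ _, h.1⟩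

namespace Sheet

variable {G : Geometry} {T : ℝ} (S : Sheet G T) {Ω : Bool → ℝ → Set Plane}

theorem continuousWithinAt_bern {c : ℝ} {σ₀ : ℂ} (g r : ℝ) {q : SpaceTime} (hq : q ∈ slab₀ T)
    (hoff : S.Off q.2 (cx q.1)) (h : S.Branch c σ₀ q) :
    ContinuousWithinAt (S.bern c σ₀ g r) (slab₀ T) q := by
  have h1 := S.continuousWithinAt_accPot hq hoff h
  have h2 := S.continuousWithinAt_vel hq hoff
  have h3 : ContinuousWithinAt (fun q : SpaceTime => q.1.2) (slab₀ T) q := by fun_prop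
  have re : ∀ {F : SpaceTime → ℂ}, ContinuousWithinAt F (slab₀ T) q →
      ContinuousWithinAt (fun q => (F q).re) (slab₀ T) q := fun h =>
    Complex.continuous_re.continuousAt.comp_continuousWithinAt h
  have im : ∀ {F : SpaceTime → ℂ}, ContinuousWithinAt F (slab₀ T) q →
      ContinuousWithinAt (fun q => (F q).im) (slab₀ T) q := fun h =>
    Complex.continuous_im.continuousAt.comp_continuousWithinAt h
  exact continuousWithinAt_const.mul (((re h1).add ((((re h2).pow 2).add ((im h2).pow 2)).div_const
    2)).add (continuousWithinAt_const.mul h3))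

theorem exists_limit_bern (hΩ : Sides S Ω) {c α₀ : ℝ} (hα₀ : α₀ ∈ Ioo c (c + 2 * Real.pi))
    {σ₀ : ℂ} {t₀ : ℝ} (ht₀ : t₀ ∈ Ico 0 T) (g r : ℝ)
    (h : S.Branch c σ₀ (cx.symm (S.z α₀ t₀), t₀)) (b : Bool) :
    ∃ L : ℝ, Tendsto (S.bern c σ₀ g r)
      (𝓝[fluidRegion T (Ω b)] (cx.symm (S.z α₀ t₀), t₀)) (𝓝 L) := by
  obtain ⟨L₁, h1⟩ := S.exists_limit_accPot hΩ hα₀ ht₀ h b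
  obtain ⟨L₂, h2⟩ := S.exists_limit_vel hΩ α₀ ht₀ b
  have h3 : Tendsto (fun q : SpaceTime => q.1.2)
      (𝓝[fluidRegion T (Ω b)] (cx.symm (S.z α₀ t₀), t₀)) (𝓝 (S.z α₀ t₀).im) :=
    ((continuous_snd.comp continuous_fst).tendsto
      (((cx.symm (S.z α₀ t₀), t₀) : SpaceTime))).mono_left nhdsWithin_le_nhds
  have re : ∀ {F : SpaceTime → ℂ} {l : Filter SpaceTime} {L : ℂ}, Tendsto F l (𝓝 L) →
      Tendsto (fun q => (F q).re) l (𝓝 L.re) := fun h => (Complex.continuous_re.tendsto _).comp h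
  have im : ∀ {F : SpaceTime → ℂ} {l : Filter SpaceTime} {L : ℂ}, Tendsto F l (𝓝 L) →
      Tendsto (fun q => (F q).im) l (𝓝 L.im) := fun h => (Complex.continuous_im.tendsto _).comp h
  exact ⟨_, (((re h1).add ((((re h2).pow 2).add ((im h2).pow 2)).div_const 2)).add
    (h3.const_mul g)).const_mul r⟩

/-- A function of time that is known on an open set of times may be extended by zero. -/
theorem integrable_indicator_of_time {κ : ℝ → ℝ} {I : Set ℝ} (hI : IsOpen I)
    (hκ : IntegrableOn κ I) {N : Set SpaceTime} {h : SpaceTime → ℝ}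
    (hN : ∀ q ∈ N, q.2 ∈ I) (hNm : MeasurableSet N)
    (hae : ∀ᵐ q ∂(volume.restrict N), h q = κ q.2) :
    Integrable (I.indicator κ) ∧ ∀ᵐ q ∂(volume.restrict N), h q = I.indicator κ q.2 := by
  refine ⟨hκ.integrable_indicator hI.measurableSet, ?_⟩
  filter_upwards [hae, ae_restrict_mem hNm] with q hq hqN
  rw [hq, indicator_of_mem (hN q hqN)]

/-- A point inside a fluid has a pressure chart, which does not meet the sheet. -/
theorem exists_pressureChart_interior (hΩ : Sides S Ω) {b : Bool} {g r : ℝ} {ρ : SpaceTime → ℝ}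
    {v : SpaceTime → Plane} {p : SpaceTime → ℝ} {ρ₀ : Plane → ℝ}
    {v₀ : Plane → Plane} (hsol : IsWeakSolution g T ρ v p ρ₀ v₀)
    (hρ : ∀ q ∈ openRegion T (Ω b), ρ q = r)
    (hvel : ∀ᵐ q ∂(volume.restrict (slab T)), cvel v q = S.vel (cx q.1) q.2)
    {q₀ : SpaceTime} (hq₀ : q₀ ∈ openRegion T (Ω b)) :
    ∃ N Q κ, q₀ ∈ N ∧ PressureChart S Ω p b N Q κ := by
  have hT0 : q₀.2 ∈ Ico 0 T := ⟨hq₀.1.1.le, hq₀.1.2⟩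
  have hs0 : q₀ ∈ slab₀ T := ⟨mem_univ _, hT0⟩
  set σ₀ := sig G (cx q₀.1 - S.z 0 q₀.2) with hσ
  have hσ₀ : σ₀ ≠ 0 := hΩ.off hT0 hq₀.2 0
  have hb0 : S.Branch 0 σ₀ q₀ := by
    rw [Branch, div_self hσ₀]; exact Complex.one_mem_slitPlane
  have hev : ∀ᶠ q in 𝓝 q₀, S.Branch 0 σ₀ q ∧ q ∈ openRegion T (Ω b) := by
    have h1 := S.eventually_branch hs0 hb0
    rw [eventually_nhdsWithin_iff] at h1
    filter_upwards [h1, (hΩ.isOpen_openRegion b).mem_nhds hq₀] with q hq hq'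
    exact ⟨hq ⟨mem_univ _, hq'.1.1.le, hq'.1.2⟩, hq'⟩
  obtain ⟨ε, hε, hεO⟩ := Metric.nhds_basis_closedBall.mem_iff.1 hev
  set N : Set SpaceTime := Metric.ball q₀.1 ε ×ˢ Metric.ball q₀.2 ε with hN
  have hNc : N ⊆ Metric.closedBall q₀ ε := by
    rw [hN, ball_prod_same]; exact Metric.ball_subset_closedBall
  have hNo : IsOpen N := Metric.isOpen_ball.prod Metric.isOpen_ball
  have hoff : ∀ q ∈ Metric.closedBall q₀ ε, q ∈ slab₀ T ∧ S.Off q.2 (cx q.1) := fun q hq =>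
    have h := hεO hq
    ⟨⟨mem_univ _, h.2.1.1.le, h.2.1.2⟩, hΩ.off ⟨h.2.1.1.le, h.2.1.2⟩ h.2.2⟩
  set Q := S.bern 0 σ₀ g r with hQ
  have hQc : ∀ q ∈ Metric.closedBall q₀ ε, ContinuousWithinAt Q (slab₀ T) q := fun q hq =>
    S.continuousWithinAt_bern g r (hoff q hq).1 (hoff q hq).2 (hεO hq).1
  have hQi : IntegrableOn Q (Metric.closedBall q₀ ε) :=
    ContinuousOn.integrableOn_compact (isCompact_closedBall _ _) fun q hq =>
      (hQc q hq).mono fun q hq => (hoff q hq).1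
  have hpi : IntegrableOn p (Metric.closedBall q₀ ε) :=
    hsol.int_p.integrableOn_compact_subset (fun q hq => (hoff q hq).1) (isCompact_closedBall _ _)
  obtain ⟨κ, hκ, hae⟩ := exists_time_function (h := fun q => p q + Q q) hε
    (Metric.isOpen_ball (x := q₀.2) (ε := ε))
    ((show IntegrableOn (fun q => p q + Q q) _ from hpi.add hQi).mono_set hNc)
    fun ζ h1 h2 h3 => S.weak_gradient hΩ (O := N) (fun q hq => (hεO (hNc hq)).2) hσ₀
      (fun q hq => (hεO (hNc hq)).1) hsol hρ hvel h1 h2 h3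
  obtain ⟨k1, k2⟩ := integrable_indicator_of_time Metric.isOpen_ball hκ (fun q hq => hq.2)
    hNo.measurableSet hae
  refine ⟨N, Q, _, ⟨Metric.mem_ball_self hε, Metric.mem_ball_self hε⟩, hNo,
    fun q hq _ => hQc q (hNc hq), fun α t ht hN => ?_, k1,
    ae_restrict_of_ae_restrict_of_subset inter_subset_left k2⟩
  have h1 := (S.off_iff ht _).1 (hoff _ (hNc hN)).2 α
  simp at h1

/-- At a point of the other fluid the chart is trivial. -/
theorem exists_pressureChart_other (hΩ : Sides S Ω) (p : SpaceTime → ℝ) (b : Bool)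
    {q₀ : SpaceTime} (hq₀ : q₀ ∈ openRegion T (Ω !b)) :
    ∃ N Q κ, q₀ ∈ N ∧ PressureChart S Ω p b N Q κ := by
  refine ⟨openRegion T (Ω !b), fun _ => 0, fun _ => 0, hq₀, hΩ.isOpen_openRegion _,
    fun _ _ _ => continuousWithinAt_const, fun _ _ _ _ => ⟨0, tendsto_const_nhds⟩,
    integrable_zero _ _ _, ?_⟩
  have : openRegion T (Ω !b) ∩ openRegion T (Ω b) = ∅ := by
    refine eq_empty_of_forall_notMem fun q hq => ?_
    exact hΩ.not_mem_of_mem ⟨hq.2.1.1.le, hq.2.1.2⟩ hq.2.2 hq.1.2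
  rw [this, Measure.restrict_empty]
  exact ae_zero.symm ▸ eventually_bot

set_option maxHeartbeats 1000000 in
/-- A point of the sheet has a pressure chart, even at time `0`. It comes with a point `x₁` of the
plane that stays in the fluid during the time of the chart, and at which the function of time can be
read off. -/
theorem exists_pressureChart_boundary (hΩ : Sides S Ω) (b : Bool) {g r : ℝ} {ρ : SpaceTime → ℝ}
    {v : SpaceTime → Plane} {p : SpaceTime → ℝ} {ρ₀ : Plane → ℝ}
    {v₀ : Plane → Plane} (hsol : IsWeakSolution g T ρ v p ρ₀ v₀)
    (hρ : ∀ q ∈ openRegion T (Ω b), ρ q = r)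
    (hvel : ∀ᵐ q ∂(volume.restrict (slab T)), cvel v q = S.vel (cx q.1) q.2)
    (α₀ : ℝ) {t₀ : ℝ} (ht₀ : t₀ ∈ Ico 0 T) :
    ∃ N Q κ, (cx.symm (S.z α₀ t₀), t₀) ∈ N ∧ PressureChart S Ω p b N Q κ ∧
      ∃ x₁, ∀ q ∈ N, q.2 ∈ Ico 0 T → (x₁, q.2) ∈ N ∧ x₁ ∈ Ω b q.2 := by
  obtain ⟨κ₀, hκ₀, r₀, hr₀, hchart⟩ := S.exists_chart hΩ α₀ ht₀
  set x₀ := S.z α₀ t₀ with hx₀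
  set τ := S.zα α₀ t₀ with hτdef
  have hτ : τ ≠ 0 := S.regular t₀ ht₀ α₀
  have hτn : 0 < ‖τ‖ := norm_pos_iff.2 hτ
  set q₀ : SpaceTime := (cx.symm x₀, t₀) with hq₀
  have hs0 : q₀ ∈ slab₀ T := ⟨mem_univ _, ht₀⟩
  set c := α₀ - Real.pi with hc
  set σ₀ := sig G (x₀ - S.z c t₀) with hσ
  have hσ₀ : σ₀ ≠ 0 := by
    refine S.sig_z_sub_ne ht₀ (by rw [hc]; linarith [Real.pi_pos]) ?_
    rw [hc, sub_sub_cancel, abs_of_pos Real.pi_pos]; linarith [Real.pi_pos]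
  have hb0 : S.Branch c σ₀ q₀ := by
    have : cx q₀.1 = x₀ := by simp [hq₀]
    rw [Branch, this, div_self hσ₀]; exact Complex.one_mem_slitPlane
  have hev := S.eventually_branch hs0 hb0
  rw [eventually_nhdsWithin_iff, Metric.eventually_nhds_iff] at hev
  obtain ⟨ε, hε, hbr⟩ := hev
  -- `s` is small enough for the chart of the interface and for the branch of the logarithm
  obtain ⟨s, hs, hs1, hs2, hs3, hs4, hs5⟩ : ∃ s > 0, s < r₀ ∧ 2 * s < Real.pi ∧ 2 * s * ‖τ‖ < ε ∧
      κ₀ * s < ε ∧ κ₀ * s < T - t₀ := by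
    have h1 : ∀ k : ℝ, Tendsto (fun s : ℝ => k * s) (𝓝[>] 0) (𝓝 0) := fun k => by
      have : Tendsto (fun s : ℝ => k * s) (𝓝 0) (𝓝 (k * 0)) := tendsto_id.const_mul k
      rw [mul_zero] at this
      exact this.mono_left nhdsWithin_le_nhds
    have h2 := (h1 (2 * ‖τ‖)).eventually_lt_const hε
    have h3 := (h1 κ₀).eventually_lt_const hε
    have h4 := (h1 κ₀).eventually_lt_const (sub_pos.2 ht₀.2)
    have h5 := (h1 2).eventually_lt_const Real.pi_pos
    have h6 := (h1 1).eventually_lt_const hr₀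
    obtain ⟨s, a2, a3, a4, a5, a6, a7⟩ :=
      (h2.and (h3.and (h4.and (h5.and (h6.and self_mem_nhdsWithin))))).exists
    exact ⟨s, a7, by simpa using a6, a5, by linarith, a3, a4⟩
  have hchart' := hchart s hs hs1
  set N : Set SpaceTime := {q | q.1 ∈ box x₀ τ s ∧ |q.2 - t₀| < κ₀ * s / 2} with hN
  have hκs : 0 < κ₀ * s := mul_pos hκ₀ hs
  have hNo : IsOpen N := ((isOpen_box x₀ τ s).preimage continuous_fst).inter
    (isOpen_lt ((continuous_snd.sub continuous_const).abs) continuous_const)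
  -- coordinates in the frame of the tangent and the normal
  have hframe : ∀ x ∈ box x₀ τ s, ∃ u y : ℝ, |u| < s ∧ |y| < s ∧
      u = ((cx x - x₀) / τ).re ∧ y = ((cx x - x₀) / τ).im ∧
      x = cx.symm (x₀ + (u + y * Complex.I) * τ) := fun x hx =>
    ⟨_, _, hx.1, hx.2, rfl, rfl, by
      apply cx.injective
      rw [Complex.re_add_im, div_mul_cancel₀ _ hτ]; simp⟩
  have hNbr : ∀ q : SpaceTime, q.1 ∈ box x₀ τ s → |q.2 - t₀| < κ₀ * s → q.2 ∈ Ico 0 T →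
      S.Branch c σ₀ q := fun q hq1 hq2 hqT => by
    refine hbr ?_ ⟨mem_univ _, hqT⟩
    rw [Prod.dist_eq]
    exact max_lt ((dist_lt_of_mem_box hτ hq1).trans hs3) (lt_trans hq2 hs4)
  have hlt : ∀ {t : ℝ}, |t - t₀| < κ₀ * s / 2 → |t - t₀| < κ₀ * s := fun h => by linarith
  -- the part of the square on the side `b` of the strip that may contain the sheet
  set V : Set Plane := {x | x ∈ box x₀ τ s ∧ s / 2 < sg b * ((cx x - x₀) / τ).im} with hV
  have hVo : IsOpen V := by
    have h1 : Continuous fun x : Plane => sg b * ((cx x - x₀) / τ).im :=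
      continuous_const.mul (Complex.continuous_im.comp
        ((cx.continuous.sub continuous_const).div_const τ))
    exact (isOpen_box x₀ τ s).inter (isOpen_lt continuous_const h1)
  have hVΩ : ∀ x ∈ V, ∀ t ∈ Ico 0 T, |t - t₀| < κ₀ * s → x ∈ Ω b t := by
    intro x hx t ht htt
    obtain ⟨u, y, hu, hy, -, hy', hxe⟩ := hframe x hx.1
    obtain ⟨α, h, -, hh, -, hside⟩ := (hchart' t ht htt).1 u hu
    rw [hxe]
    refine (hside y hy b).2 ?_
    have h1 : s / 2 < sg b * y := by rw [hy']; exact hx.2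
    have h2 : sg b * h ≤ |h| := by
      refine (le_abs_self _).trans ?_
      rw [abs_mul, abs_sg, one_mul]
    rw [mul_sub]
    linarith
  set x₁ : Plane := cx.symm (x₀ + ((sg b * (3 / 4 * s) : ℝ) * Complex.I) * τ) with hx₁
  have hx₁V : x₁ ∈ V := by
    have e : (cx x₁ - x₀) / τ = (sg b * (3 / 4 * s) : ℝ) * Complex.I := by
      simp [hx₁, hτ]
    refine ⟨⟨?_, ?_⟩, ?_⟩
    · rw [e]; simpa using hs
    · rw [e]
      have : ((sg b * (3 / 4 * s) : ℝ) * Complex.I).im = sg b * (3 / 4 * s) := by simp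
      rw [this, abs_mul, abs_sg, abs_of_pos (by positivity)]; linarith
    · rw [e]
      have : ((sg b * (3 / 4 * s) : ℝ) * Complex.I).im = sg b * (3 / 4 * s) := by simp
      rw [this, ← mul_assoc, sg_mul_self]; linarith
  obtain ⟨R, hR, hRV⟩ := Metric.nhds_basis_closedBall.mem_iff.1 (hVo.mem_nhds hx₁V)
  set Q := S.bern c σ₀ g r with hQ
  set O := N ∩ openRegion T (Ω b) with hO
  have hOo : IsOpen O := hNo.inter (hΩ.isOpen_openRegion b)
  set I : Set ℝ := {t | |t - t₀| < κ₀ * s / 2} ∩ Ioo 0 T with hI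
  have hIo : IsOpen I :=
    (isOpen_lt ((continuous_id.sub continuous_const).abs) continuous_const).inter isOpen_Ioo
  have hOI : ∀ q ∈ O, q.2 ∈ I := fun q hq => ⟨hq.1.2, hq.2.1⟩
  have hQc : ∀ q : SpaceTime, q.1 ∈ box x₀ τ s → |q.2 - t₀| < κ₀ * s →
      q ∈ fluidRegion T (Ω b) → ContinuousWithinAt Q (slab₀ T) q := fun q h1 h2 h3 =>
    S.continuousWithinAt_bern g r ⟨mem_univ _, h3.1⟩ (hΩ.off h3.1 h3.2) (hNbr q h1 h2 h3.1)
  have hw : ∀ ζ : SpaceTime → ℝ, ContDiff ℝ ∞ ζ → HasCompactSupport ζ → tsupport ζ ⊆ O →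
      (∫ q, (p q + Q q) * d₁ ζ q = 0) ∧ ∫ q, (p q + Q q) * d₂ ζ q = 0 := fun ζ h1 h2 h3 =>
    S.weak_gradient hΩ (O := O) inter_subset_right hσ₀
      (fun q hq => hNbr q hq.1.1 (hlt hq.1.2) ⟨hq.2.1.1.le, hq.2.1.2⟩) hsol hρ hvel h1 h2 h3
  have hBO : Metric.ball x₁ R ×ˢ I ⊆ O := fun q hq => by
    have h1 := hRV (Metric.ball_subset_closedBall hq.1)
    exact ⟨⟨h1.1, hq.2.1⟩, hq.2.2, hVΩ _ h1 _ ⟨hq.2.2.1.le, hq.2.2.2⟩ (hlt hq.2.1)⟩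
  -- `p + Q` is integrable up to time `0`, so that `κ` is integrable
  set K : Set SpaceTime := Metric.closedBall x₁ R ×ˢ
    (Icc (t₀ - κ₀ * s / 2) (t₀ + κ₀ * s / 2) ∩ Ici 0) with hK
  have hKc : IsCompact K := (isCompact_closedBall _ _).prod (isCompact_Icc.inter_right isClosed_Ici)
  have hKt : ∀ q ∈ K, q.2 ∈ Ico 0 T ∧ |q.2 - t₀| < κ₀ * s := fun q hq =>
    ⟨⟨hq.2.2, by linarith [hq.2.1.2]⟩, by
      rw [abs_lt]; constructor <;> linarith [hq.2.1.1, hq.2.1.2]⟩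
  have hKs : K ⊆ slab₀ T := fun q hq => ⟨mem_univ _, (hKt q hq).1⟩
  have hQK : IntegrableOn Q K := ContinuousOn.integrableOn_compact hKc fun q hq =>
    (hQc q (hRV hq.1).1 (hKt q hq).2
      ⟨(hKt q hq).1, hVΩ _ (hRV hq.1) _ (hKt q hq).1 (hKt q hq).2⟩).mono hKs
  have hpK : IntegrableOn p K := hsol.int_p.integrableOn_compact_subset hKs hKc
  have hBK : Metric.ball x₁ R ×ˢ I ⊆ K := fun q hq => by
    have h1 := abs_lt.1 (show |q.2 - t₀| < κ₀ * s / 2 from hq.2.1)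
    exact ⟨Metric.ball_subset_closedBall hq.1, ⟨by linarith [h1.1], by linarith [h1.2]⟩,
      hq.2.2.1.le⟩
  obtain ⟨κ, hκ, hae⟩ := exists_time_function (h := fun q => p q + Q q) hR hIo
    ((show IntegrableOn (fun q => p q + Q q) K from hpK.add hQK).mono_set hBK)
    fun ζ h1 h2 h3 => hw ζ h1 h2 (h3.trans hBO)
  have hloc : LocallyIntegrableOn (fun q => p q + Q q) O := by
    have h1 : LocallyIntegrableOn p O := hsol.int_p.mono_set fun q hq =>
      ⟨mem_univ _, hq.2.1.1.le, hq.2.1.2⟩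
    have h2 : LocallyIntegrableOn Q O := ContinuousOn.locallyIntegrableOn (fun q hq =>
      (hQc q hq.1.1 (hlt hq.1.2) (openRegion_subset_fluidRegion T _ hq.2)).mono fun q hq =>
        ⟨mem_univ _, hq.2.1.1.le, hq.2.1.2⟩) hOo.measurableSet
    exact h1.add h2
  have hae' := ae_eq_time_function hOo hloc hw hR hIo hBO hOI (fun t ht => by
    have h1 := (hchart' t ⟨ht.2.1.le, ht.2.2⟩ (hlt ht.1)).2 b
    convert h1 using 1
    ext x
    exact ⟨fun h => ⟨h.1.1, h.2.2⟩, fun h => ⟨⟨h.1, ht.1⟩, ht.2, h.2⟩⟩) hae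
  obtain ⟨k1, k2⟩ := integrable_indicator_of_time hIo hκ hOI hOo.measurableSet hae'
  refine ⟨N, Q, _, ⟨⟨?_, ?_⟩, ?_⟩, ⟨hNo, fun q hq hqf => hQc q hq.1 (hlt hq.2) hqf,
    fun α t ht hαN => ?_, k1, k2⟩, x₁, fun q hq hqT => ⟨⟨hx₁V.1, hq.2⟩, hVΩ x₁ hx₁V _ hqT (hlt hq.2)⟩⟩
  · simpa [hq₀] using hs
  · simpa [hq₀] using hs
  · simpa [hq₀] using hκs
  · -- a point of the sheet in the chart has a parameter close to `α₀`
    have hαN2 : |t - t₀| < κ₀ * s := hlt hαN.2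
    obtain ⟨u, y, hu, hy, -, -, hxe⟩ := hframe _ hαN.1
    obtain ⟨β, h, hβ, hh, hzβ, hside⟩ := (hchart' t ht hαN2).1 u hu
    change cx.symm (S.z α t) = _ at hxe
    have hoff : ¬S.Off t (cx (cx.symm (S.z α t))) := fun ho => by
      have := (S.off_iff ht _).1 ho α
      simp at this
    rw [← hΩ.mem_or ht, hxe, hside y hy true, hside y hy false] at hoff
    have hyh : y = h := by
      simp only [sg, not_or, not_lt] at hoff
      norm_num at hoff
      linarith [hoff.1, hoff.2]
    have hz : S.z α t = S.z β t := by
      rw [hzβ, ← hyh]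
      have := congrArg cx hxe
      simpa using this
    rw [hz]
    have hβ' := abs_lt.1 hβ
    refine S.exists_limit_bern hΩ ⟨by linarith [hβ'.1], by linarith [hβ'.2]⟩ ht g r ?_ b
    rw [← hz]
    exact hNbr _ hαN.1 hαN2 ht

end Sheet

/-! ### Mean limits of the pressure -/

/-- Functions that agree almost everywhere on an open set of space-time and are continuous in space
agree on almost all time slices. -/
theorem ae_forall_slice_eq {U : Set SpaceTime} (hU : IsOpen U) {f₁ f₂ : SpaceTime → ℝ}
    (h : ∀ᵐ q ∂(volume.restrict U), f₁ q = f₂ q)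
    (h₁ : ∀ t, ContinuousOn (fun x => f₁ (x, t)) {x | (x, t) ∈ U})
    (h₂ : ∀ t, ContinuousOn (fun x => f₂ (x, t)) {x | (x, t) ∈ U}) :
    ∀ᵐ t : ℝ, ∀ x, (x, t) ∈ U → f₁ (x, t) = f₂ (x, t) := by
  rw [ae_restrict_iff' hU.measurableSet, Measure.volume_eq_prod] at h
  have h' : ∀ᵐ t : ℝ, ∀ᵐ x : Plane, (x, t) ∈ U → f₁ (x, t) = f₂ (x, t) :=
    Measure.ae_ae_of_ae_prod (Measure.measurePreserving_swap.quasiMeasurePreserving.ae h)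
  filter_upwards [h'] with t ht x hx
  have hUt : IsOpen {x | (x, t) ∈ U} := hU.preimage (continuous_id.prodMk continuous_const)
  exact Measure.eqOn_open_of_ae_eq (μ := volume) ((ae_restrict_iff' hUt.measurableSet).2 ht) hUt
    (h₁ t) (h₂ t) hx

/-- Mean limits are local. -/
theorem hasMeanLimit_of_inter {q₀ : SpaceTime} {A : SpaceTime ≃L[ℝ] SpaceTime}
    {N R : Set SpaceTime} (hN : N ∈ 𝓝 q₀) {F : SpaceTime → ℝ} {ℓ : ℝ}
    (h : HasMeanLimit q₀ A (N ∩ R) F ℓ) : HasMeanLimit q₀ A R F ℓ := by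
  refine Tendsto.congr' ?_ h
  filter_upwards [eventually_blow q₀ A hN] with r hr
  have : blowSet q₀ A (N ∩ R) r = blowSet q₀ A R r := by
    ext p
    exact ⟨fun h => ⟨h.1, h.2.2⟩, fun h => ⟨h.1, hr p h.1, h.2⟩⟩
  rw [this]

/-- `t` is a right-sided Lebesgue point of `κ`, with the chosen value `κ t`. -/
def IsRightLebesgue (κ : ℝ → ℝ) (t : ℝ) : Prop :=
  Tendsto (fun δ : ℝ => ∫ s in Ioo (0 : ℝ) 1, |κ (t + δ * s) - κ t|) (𝓝[>] 0) (𝓝 0)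

theorem ae_isRightLebesgue {κ : ℝ → ℝ} (hκ : Integrable κ) : ∀ᵐ t : ℝ, IsRightLebesgue κ t := by
  filter_upwards [IsUnifLocDoublingMeasure.ae_tendsto_average_norm_sub (volume : Measure ℝ)
    hκ.locallyIntegrable 1] with t ht
  have hδ : Tendsto (fun δ : ℝ => δ / 2) (𝓝[>] 0) (𝓝[>] 0) := by
    refine tendsto_nhdsWithin_of_tendsto_nhds_of_eventually_within _ ?_ ?_
    · have : Tendsto (fun δ : ℝ => δ / 2) (𝓝 0) (𝓝 (0 / 2)) := tendsto_id.div_const 2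
      rw [zero_div] at this
      exact this.mono_left nhdsWithin_le_nhds
    · filter_upwards [self_mem_nhdsWithin] with δ hδ
      exact half_pos (show 0 < δ from hδ)
  have h := ht (fun δ : ℝ => t + δ / 2) (fun δ => δ / 2) hδ (by
    filter_upwards [self_mem_nhdsWithin] with δ hδ
    have hδ : 0 < δ := hδ
    rw [one_mul, Metric.mem_closedBall, Real.dist_eq, sub_add_cancel_left, abs_neg,
      abs_of_pos (half_pos hδ)])
  refine h.congr' ?_
  filter_upwards [self_mem_nhdsWithin] with δ hδ
  have hδ : 0 < δ := hδ
  rw [← integral_Ioc_eq_integral_Ioo, ← intervalIntegral.integral_of_le zero_le_one,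
    intervalIntegral.integral_comp_add_mul (fun y => |κ y - κ t|) hδ.ne' t, mul_zero, add_zero, mul_one,
    intervalIntegral.integral_of_le (by linarith), ← integral_Icc_eq_integral_Ioc, setAverage_eq,
    Real.closedBall_eq_Icc, Real.volume_real_Icc_of_le (by linarith)]
  have e1 : t + δ / 2 - δ / 2 = t := by ring
  have e2 : t + δ / 2 + δ / 2 = t + δ := by ring
  rw [e1, e2, add_sub_cancel_left]
  rfl

/-- At a Lebesgue point of `κ`, the sum of `κ` and of a function with a limit has a mean limit. -/
theorem hasMeanLimit_of_isRightLebesgue {q₀ : SpaceTime} {τ : ℂ} (hτ : τ ≠ 0) {k : ℝ} (hk : 0 < k)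
    {R : Set SpaceTime} (hR : IsOpen R) {F Q : SpaceTime → ℝ} {κ : ℝ → ℝ} (hκi : Integrable κ)
    (hκ : IsRightLebesgue κ q₀.2) {ℓ : ℝ} (hQ : Tendsto Q (𝓝[R] q₀) (𝓝 ℓ))
    (hF : ∀ᵐ q ∂(volume.restrict R), F q + Q q = κ q.2) :
    HasMeanLimit q₀ (frame hτ hk) R F (κ q₀.2 - ℓ) := by
  set A := frame hτ hk
  rw [HasMeanLimit, Metric.tendsto_nhds]
  intro ε hε
  have hv : 0 ≤ volume.real unitCyl := measureReal_nonneg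
  set δ := ε / (2 * (volume.real unitCyl + 1)) with hδ
  have hδ0 : 0 < δ := by positivity
  have h1 : ∀ᶠ q in 𝓝 q₀, q ∈ R → |Q q - ℓ| < δ := by
    have := (Metric.tendsto_nhds.1 hQ) δ hδ0
    rw [eventually_nhdsWithin_iff] at this
    exact this
  -- the mean of `|κ - κ(t₀)|` over a cylinder is a one-dimensional mean
  set B : Set Plane := Ioo (-1) 1 ×ˢ Ioo (-1) 1 with hB
  have hscale : Tendsto (fun r : ℝ => r * k) (𝓝[>] 0) (𝓝[>] 0) := by
    refine tendsto_nhdsWithin_of_tendsto_nhds_of_eventually_within _ ?_ ?_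
    · have : Tendsto (fun r : ℝ => r * k) (𝓝 0) (𝓝 (0 * k)) := tendsto_id.mul_const k
      rw [zero_mul] at this
      exact this.mono_left nhdsWithin_le_nhds
    · filter_upwards [self_mem_nhdsWithin] with r hr
      exact mul_pos hr hk
  have h2 : Tendsto (fun r : ℝ => volume.real B *
      ∫ s in Ioo (0 : ℝ) 1, |κ (q₀.2 + r * k * s) - κ q₀.2|) (𝓝[>] 0) (𝓝 0) := by
    simpa using (hκ.comp hscale).const_mul (volume.real B)
  have h3 := h2.eventually_lt_const (half_pos hε)
  filter_upwards [eventually_blow q₀ A h1, h3, self_mem_nhdsWithin] with r hr hr3 hr0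
  have hr0 : 0 < r := hr0
  set D := blowSet q₀ A R r with hD
  have hDm : MeasurableSet D := measurableSet_blowSet q₀ A hR r
  have htime : ∀ p, (blow q₀ A r p).2 = q₀.2 + r * k * p.2 := fun p => by
    simp [blow, A, frame_apply, mul_assoc]
  set f : ℝ → ℝ := fun s => |κ (q₀.2 + r * k * s) - κ q₀.2| with hf
  have hfi : IntegrableOn f (Ioo 0 1) := by
    have h4 : Integrable fun s : ℝ => κ (q₀.2 + r * k * s) :=
      (hκi.comp_add_left q₀.2).comp_mul_left' (mul_pos hr0 hk).ne'
    exact (h4.integrableOn.sub (integrableOn_const measure_Ioo_lt_top.ne)).abs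
  have hcyl : (volume : Measure SpaceTime).restrict unitCyl
      = (volume.restrict B).prod (volume.restrict (Ioo (0 : ℝ) 1)) := by
    rw [Measure.prod_restrict]; rfl
  have hBfin : volume B ≠ ⊤ := by
    refine (lt_of_le_of_lt (measure_mono (t := Icc (-1) 1 ×ˢ Icc (-1) 1) ?_)
      (isCompact_Icc.prod isCompact_Icc).measure_lt_top).ne
    exact Set.prod_mono Ioo_subset_Icc_self Ioo_subset_Icc_self
  have hfi' : IntegrableOn (fun p : SpaceTime => f p.2) unitCyl := by
    have : IsFiniteMeasure (volume.restrict B) := ⟨by simpa using hBfin.lt_top⟩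
    rw [IntegrableOn, hcyl]
    exact Integrable.comp_snd hfi _
  have hfint : ∫ p in unitCyl, f p.2 = volume.real B * ∫ s in Ioo (0 : ℝ) 1, f s := by
    have := integral_prod_mul (μ := volume.restrict B) (ν := volume.restrict (Ioo (0 : ℝ) 1))
      (fun _ => (1 : ℝ)) f
    rw [← hcyl] at this
    simpa using this
  have hae : ∀ᵐ p ∂(volume.restrict D), ‖|F (blow q₀ A r p) - (κ q₀.2 - ℓ)|‖ ≤ f p.2 + δ := by
    rw [ae_restrict_iff' hDm]
    rw [ae_restrict_iff' hR.measurableSet] at hF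
    have h4 : ∀ᵐ p : SpaceTime, blow q₀ A r p ∈ R →
        F (blow q₀ A r p) + Q (blow q₀ A r p) = κ (blow q₀ A r p).2 :=
      ae_iff.2 (volume_preimage_blow q₀ A hr0 (ae_iff.1 hF))
    filter_upwards [h4] with p hp hpR
    have h5 := hp hpR.2
    have h6 := hr p hpR.1 hpR.2
    rw [htime] at h5
    have e : F (blow q₀ A r p) - (κ q₀.2 - ℓ)
        = (κ (q₀.2 + r * k * p.2) - κ q₀.2) - (Q (blow q₀ A r p) - ℓ) := by linarith
    rw [norm_abs_eq_norm, e]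
    exact (norm_sub_le _ _).trans (add_le_add le_rfl h6.le)
  have hci : IntegrableOn (fun _ : SpaceTime => δ) unitCyl :=
    integrableOn_const volume_unitCyl_lt_top.ne
  have hbi : IntegrableOn (fun p : SpaceTime => f p.2 + δ) unitCyl := hfi'.add hci
  rw [dist_zero_right]
  calc ‖∫ p in D, |F (blow q₀ A r p) - (κ q₀.2 - ℓ)|‖
      ≤ ∫ p in D, (f p.2 + δ) :=
        norm_integral_le_of_norm_le (hbi.mono_set (blowSet_subset q₀ A R r)) hae
    _ ≤ ∫ p in unitCyl, (f p.2 + δ) := by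
        refine setIntegral_mono_set hbi (Eventually.of_forall fun p => ?_)
          (blowSet_subset q₀ A R r).eventuallyLE
        exact add_nonneg (abs_nonneg _) hδ0.le
    _ = volume.real B * (∫ s in Ioo (0 : ℝ) 1, f s) + volume.real unitCyl * δ := by
        rw [integral_add hfi' hci, hfint, setIntegral_const, smul_eq_mul]
    _ < ε / 2 + (volume.real unitCyl + 1) * δ := by
        refine add_lt_add hr3 ?_
        nlinarith
    _ = ε := by rw [hδ]; field_simp; ring

/-! ### Limits of the pressure at the interface -/

namespace Sheet

variable {G : Geometry} {T : ℝ} (S : Sheet G T) {Ω : Bool → ℝ → Set Plane}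

/-- Convergence inside a fluid at a fixed time is convergence inside its space-time region. -/
theorem tendsto_slice (O : ℝ → Set Plane) {t : ℝ} (ht : t ∈ Ico 0 T) (x : Plane) :
    Tendsto (fun x : Plane => ((x, t) : SpaceTime)) (𝓝[O t] x) (𝓝[fluidRegion T O] (x, t)) := by
  refine tendsto_nhdsWithin_of_tendsto_nhds_of_eventually_within _ ?_ ?_
  · exact ((continuous_id.prodMk continuous_const).tendsto x).mono_left nhdsWithin_le_nhds
  · filter_upwards [self_mem_nhdsWithin] with y hy using ⟨ht, hy⟩

variable {S} in
/-- A point of a fluid remains in it for some time; this connects time `0` with positive times. -/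
theorem _root_.TwoFluid.Sides.tendsto_later (hΩ : Sides S Ω) {b : Bool} {q : SpaceTime}
    (hq : q ∈ fluidRegion T (Ω b)) :
    Tendsto (fun s : ℝ => ((q.1, s) : SpaceTime)) (𝓝[>] q.2) (𝓝[fluidRegion T (Ω b)] q) := by
  have h1 : Tendsto (fun s : ℝ => ((q.1, s) : SpaceTime)) (𝓝[>] q.2) (𝓝 q) :=
    ((continuous_const.prodMk continuous_id).tendsto q.2).mono_left nhdsWithin_le_nhds
  have h2 : ∀ᶠ s in 𝓝[>] q.2, s ∈ Ico 0 T := by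
    filter_upwards [Ioo_mem_nhdsGT hq.1.2] with s hs
    exact ⟨hq.1.1.trans hs.1.le, hs.2⟩
  have h3 : Tendsto (fun s : ℝ => ((q.1, s) : SpaceTime)) (𝓝[>] q.2) (𝓝[slab₀ T] q) :=
    tendsto_nhdsWithin_of_tendsto_nhds_of_eventually_within _ h1
      (h2.mono fun s hs => ⟨mem_univ _, hs⟩)
  exact tendsto_nhdsWithin_of_tendsto_nhds_of_eventually_within _ h1
    (h3.eventually (hΩ.eventually_mem hq))

/-- If the pressure is continuous inside a fluid, then it has limits at the interface. -/
theorem exists_limit_pressure (hΩ : Sides S Ω) {p : SpaceTime → ℝ} {b : Bool} {N : Set SpaceTime}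
    {Q : SpaceTime → ℝ} {κ : ℝ → ℝ} (hc : PressureChart S Ω p b N Q κ) {x₁ : Plane}
    (hx₁ : ∀ q ∈ N, q.2 ∈ Ico 0 T → (x₁, q.2) ∈ N ∧ x₁ ∈ Ω b q.2)
    (hp : ContinuousOn p (fluidRegion T (Ω b))) {α t : ℝ} (ht : t ∈ Ico 0 T)
    (hN : (cx.symm (S.z α t), t) ∈ N) :
    ∃ P, Tendsto p (𝓝[fluidRegion T (Ω b)] (cx.symm (S.z α t), t)) (𝓝 P) := by
  set R := fluidRegion T (Ω b) with hR
  set h : SpaceTime → ℝ := fun q => p q + Q q with hh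
  have hcont : ∀ q ∈ N, q ∈ R → ContinuousWithinAt h R q := fun q hq hqR =>
    (hp q hqR).add ((hc.cont q hq hqR).mono (fluidRegion_subset_slab₀ T _))
  have hUo : IsOpen (N ∩ openRegion T (Ω b)) := hc.isOpen.inter (hΩ.isOpen_openRegion b)
  have hUR : N ∩ openRegion T (Ω b) ⊆ R := fun q hq => openRegion_subset_fluidRegion T _ hq.2
  have hae := ae_forall_slice_eq hUo (f₁ := h) (f₂ := fun q => κ q.2) hc.ae
    (fun t x hx => ((hcont (x, t) hx.1 (hUR hx)).mono hUR).comp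
      (t := N ∩ openRegion T (Ω b)) (f := fun x : Plane => ((x, t) : SpaceTime))
      (by fun_prop) fun y hy => hy)
    fun t => continuousOn_const (c := κ t)
  have hdense := Measure.dense_of_ae hae
  -- `h` depends on time only: it agrees with `κ` at a dense set of times, and it is continuous
  have hkey : ∀ q ∈ N, q ∈ R → h q = h (x₁, q.2) := by
    intro q hq hqR
    obtain ⟨h1, h2⟩ := hx₁ q hq hqR.1
    have hqR' : (x₁, q.2) ∈ R := ⟨hqR.1, h2⟩
    have l1 := hΩ.tendsto_later hqR
    have l2 := hΩ.tendsto_later hqR'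
    refine tendsto_nhds_unique_of_frequently_eq ((hcont q hq hqR).tendsto.comp l1)
      ((hcont _ h1 hqR').tendsto.comp l2) ?_
    have hfr : ∃ᶠ s in 𝓝[>] q.2, ∀ x, (x, s) ∈ N ∩ openRegion T (Ω b) → h (x, s) = κ s := by
      rw [frequently_iff]
      intro V hV
      obtain ⟨u, hu, huV⟩ := (mem_nhdsGT_iff_exists_Ioo_subset).1 hV
      obtain ⟨s, hs, hs'⟩ := hdense.exists_between hu
      exact ⟨s, huV hs', hs⟩
    have hmem : ∀ {q : SpaceTime}, q ∈ N → q ∈ R →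
        ∀ᶠ s in 𝓝[>] q.2, (q.1, s) ∈ N ∩ openRegion T (Ω b) := by
      intro q hq hqR
      have l := hΩ.tendsto_later hqR
      filter_upwards [l.eventually (mem_nhdsWithin_of_mem_nhds (hc.isOpen.mem_nhds hq)),
        l.eventually self_mem_nhdsWithin, self_mem_nhdsWithin] with s a1 a2 a3
      exact ⟨a1, ⟨hqR.1.1.trans_lt a3, a2.1.2⟩, a2.2⟩
    refine (hfr.and_eventually ((hmem hq hqR).and (hmem (q := (x₁, q.2)) h1 hqR'))).mono fun s hs => ?_
    exact (hs.1 _ hs.2.1).trans (hs.1 _ hs.2.2).symm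
  obtain ⟨L, hL⟩ := hc.lim α t ht hN
  obtain ⟨h1, h2⟩ := hx₁ _ hN ht
  have l1 : Tendsto (fun q : SpaceTime => ((x₁, q.2) : SpaceTime))
      (𝓝[R] (cx.symm (S.z α t), t)) (𝓝[R] (x₁, t)) := by
    refine tendsto_nhdsWithin_of_tendsto_nhds_of_eventually_within _ ?_ ?_
    · exact ((continuous_const.prodMk continuous_snd).tendsto
        ((cx.symm (S.z α t), t) : SpaceTime)).mono_left nhdsWithin_le_nhds
    · filter_upwards [self_mem_nhdsWithin, mem_nhdsWithin_of_mem_nhds (hc.isOpen.mem_nhds hN)]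
        with q hq hqN
      exact ⟨hq.1, (hx₁ q hqN hq.1).2⟩
  refine ⟨h (x₁, t) - L, (((hcont _ h1 ⟨ht, h2⟩).tendsto.comp l1).sub hL).congr' ?_⟩
  filter_upwards [self_mem_nhdsWithin, mem_nhdsWithin_of_mem_nhds (hc.isOpen.mem_nhds hN)]
    with q hq hqN
  simp only [Function.comp_apply]
  rw [← hkey q hqN hq]
  simp [hh]

variable {g : ℝ} {ρ : SpaceTime → ℝ} {v : SpaceTime → Plane} {p : SpaceTime → ℝ} {ρ₀ : Plane → ℝ}
  {v₀ : Plane → Plane} {ρc : Bool → ℝ}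

/-- The pressure is continuous across the interface if it is continuous inside each fluid. -/
theorem exists_common_limit (hΩ : Sides S Ω) (hsol : IsWeakSolution g T ρ v p ρ₀ v₀)
    (hne : ρc true ≠ ρc false) (hρ : ∀ b, ∀ q ∈ openRegion T (Ω b), ρ q = ρc b)
    (hvel : ∀ᵐ q ∂(volume.restrict (slab T)), cvel v q = S.vel (cx q.1) q.2)
    (hp : ∀ b, ContinuousOn p (fluidRegion T (Ω b))) (α : ℝ) {t : ℝ} (ht : t ∈ Ico 0 T) :
    ∃ P, ∀ b, Tendsto p (𝓝[fluidRegion T (Ω b)] (cx.symm (S.z α t), t)) (𝓝 P) := by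
  have h : ∀ b, ∃ P, Tendsto p (𝓝[fluidRegion T (Ω b)] (cx.symm (S.z α t), t)) (𝓝 P) := fun b => by
    obtain ⟨N, Q, κ, hN, hc, x₁, hx₁⟩ :=
      S.exists_pressureChart_boundary hΩ b hsol (hρ b) hvel α ht
    exact S.exists_limit_pressure hΩ hc hx₁ (hp b) ht hN
  choose P hP using h
  have heq : P true = P false := S.pressure_eq hΩ α ht hsol hne hρ hvel fun b κ hκ =>
    hasMeanLimit_of_tendsto _ (hΩ.isOpen_openRegion b) (Eventually.of_forall fun q => rfl)
      ((hP b).mono_left (nhdsWithin_mono _ (openRegion_subset_fluidRegion T _)))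
  refine ⟨P true, fun b => ?_⟩
  cases b
  · rw [heq]; exact hP false
  · exact hP true

/-- Pressure charts for the side `b` cover the open slab. -/
theorem exists_pressureChart (hΩ : Sides S Ω) (hsol : IsWeakSolution g T ρ v p ρ₀ v₀)
    (hρ : ∀ b, ∀ q ∈ openRegion T (Ω b), ρ q = ρc b)
    (hvel : ∀ᵐ q ∂(volume.restrict (slab T)), cvel v q = S.vel (cx q.1) q.2) (b : Bool)
    (q : SpaceTime) (hq : q ∈ slab T) : ∃ N Q κ, q ∈ N ∧ PressureChart S Ω p b N Q κ := by
  have hT : q.2 ∈ Ico 0 T := ⟨hq.2.1.le, hq.2.2⟩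
  by_cases h1 : q.1 ∈ Ω b q.2
  · exact S.exists_pressureChart_interior hΩ hsol (hρ b) hvel ⟨hq.2, h1⟩
  by_cases h2 : q.1 ∈ Ω (!b) q.2
  · exact S.exists_pressureChart_other hΩ p b ⟨hq.2, h2⟩
  have h3 : ¬S.Off q.2 (cx q.1) := by
    rw [← hΩ.mem_or hT]
    cases b
    · exact fun h => h.elim h2 h1
    · exact fun h => h.elim h1 h2
  rw [S.off_iff hT] at h3
  push Not at h3
  obtain ⟨α, hα⟩ := h3
  obtain ⟨N, Q, κ, hN, hc, -⟩ := S.exists_pressureChart_boundary hΩ b hsol (hρ b) hvel α hT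
  refine ⟨N, Q, κ, ?_, hc⟩
  rw [← hα] at hN
  simpa using hN

open scoped Classical in
/-- A version of the pressure that is continuous inside each fluid and across the interface. The
functions of time in countably many charts are compatible at almost all times, and almost all times
are Lebesgue points of all of them; at the exceptional times the version is zero. -/
theorem exists_version (hΩ : Sides S Ω) (hsol : IsWeakSolution g T ρ v p ρ₀ v₀)
    (hne : ρc true ≠ ρc false) (hρ : ∀ b, ∀ q ∈ openRegion T (Ω b), ρ q = ρc b)
    (hvel : ∀ᵐ q ∂(volume.restrict (slab T)), cvel v q = S.vel (cx q.1) q.2) :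
    ∃ q : SpaceTime → ℝ, q =ᵐ[volume.restrict (slab T)] p ∧ ∀ t ∈ Ioo 0 T,
      (∀ b, ContinuousOn (fun x => q (x, t)) (Ω b t)) ∧
      ∀ α, ∃ P, ∀ b, Tendsto (fun x => q (x, t)) (𝓝[Ω b t] (cx.symm (S.z α t))) (𝓝 P) := by
  have hch := S.exists_pressureChart hΩ hsol hρ hvel
  choose! N Q κ hmem hchart using hch
  have hcov : ∀ b, ∃ s ⊆ slab T, s.Countable ∧ slab T ⊆ ⋃ i ∈ s, N b i := fun b =>
    TopologicalSpace.countable_cover_nhdsWithin fun i hi =>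
      mem_nhdsWithin_of_mem_nhds ((hchart b i hi).isOpen.mem_nhds (hmem b i hi))
  choose s hs hsc hscov using hcov
  have hidx : ∀ b, ∀ q ∈ slab T, ∃ i ∈ s b, q ∈ N b i := fun b q hq => by
    simpa using hscov b hq
  choose! idx hidxs hidxN using hidx
  have hU : ∀ b, ∀ i ∈ s b, IsOpen (N b i ∩ openRegion T (Ω b)) := fun b i hi =>
    (hchart b i (hs b hi)).isOpen.inter (hΩ.isOpen_openRegion b)
  have hQ : ∀ b, ∀ i ∈ s b, ContinuousOn (Q b i) (N b i ∩ openRegion T (Ω b)) := fun b i hi q hq =>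
    ((hchart b i (hs b hi)).cont q hq.1 (openRegion_subset_fluidRegion T _ hq.2)).mono fun q hq =>
      fluidRegion_subset_slab₀ T _ (openRegion_subset_fluidRegion T _ hq.2)
  -- at a good time the charts fit together, and the functions of time have a mean limit
  set good : ℝ → Prop := fun t => ∀ b, (∀ i ∈ s b, ∀ j ∈ s b, ∀ x,
      (x, t) ∈ (N b i ∩ openRegion T (Ω b)) ∩ (N b j ∩ openRegion T (Ω b)) →
      Q b i (x, t) - Q b j (x, t) = κ b i t - κ b j t) ∧ ∀ i ∈ s b, IsRightLebesgue (κ b i) t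
    with hgood
  have hgoodae : ∀ᵐ t : ℝ, good t := by
    rw [ae_all_iff]
    intro b
    refine Eventually.and ((ae_ball_iff (hsc b)).2 fun i hi => (ae_ball_iff (hsc b)).2 fun j hj => ?_)
      ((ae_ball_iff (hsc b)).2 fun i hi => ae_isRightLebesgue (hchart b i (hs b hi)).int)
    have hsl : ∀ {F : SpaceTime → ℝ} {U V : Set SpaceTime}, ContinuousOn F U → V ⊆ U → ∀ t : ℝ,
        ContinuousOn (fun x : Plane => F (x, t)) {x | (x, t) ∈ V} := fun hF hV t =>
      hF.comp (f := fun x : Plane => ((x, t) : SpaceTime)) (by fun_prop) fun x hx => hV hx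
    refine ae_forall_slice_eq ((hU b i hi).inter (hU b j hj)) (f₁ := fun q => Q b i q - Q b j q)
      (f₂ := fun q => κ b i q.2 - κ b j q.2) ?_
      (fun t => (hsl (hQ b i hi) inter_subset_left t).sub (hsl (hQ b j hj) inter_subset_right t))
      fun t => continuousOn_const (c := κ b i t - κ b j t)
    filter_upwards [ae_restrict_of_ae_restrict_of_subset inter_subset_left (hchart b i (hs b hi)).ae,
      ae_restrict_of_ae_restrict_of_subset inter_subset_right (hchart b j (hs b hj)).ae] with q h1 h2
    linarith
  set val : Bool → SpaceTime → ℝ := fun b q => κ b (idx b q) q.2 - Q b (idx b q) q with hval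
  set q' : SpaceTime → ℝ := fun q =>
    if good q.2 then if q.1 ∈ Ω true q.2 then val true q else val false q else 0 with hq'
  have hrep : ∀ b, ∀ q ∈ openRegion T (Ω b), good q.2 → ∀ i ∈ s b, q ∈ N b i →
      q' q = κ b i q.2 - Q b i q := by
    intro b q hq hg i hi hqi
    have hqs : q ∈ slab T := Sides.openRegion_subset b hq
    have h1 : q' q = val b q := by
      simp only [hq', if_pos hg]
      cases b
      · have : q.1 ∉ Ω true q.2 := hΩ.not_mem_of_mem ⟨hq.1.1.le, hq.1.2⟩ hq.2
        rw [if_neg this]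
      · rw [if_pos hq.2]
    have h2 := (hg b).1 i hi (idx b q) (hidxs b q hqs) q.1 ⟨⟨hqi, hq⟩, hidxN b q hqs, hq⟩
    rw [h1]
    simp only [hval]
    change Q b i q - Q b (idx b q) q = _ at h2
    linarith
  refine ⟨q', ?_, fun t ht => ?_⟩
  · have h1 : ∀ᵐ q : SpaceTime, ∀ b, ∀ i ∈ s b, q ∈ N b i ∩ openRegion T (Ω b) →
        p q + Q b i q = κ b i q.2 := by
      rw [ae_all_iff]
      exact fun b => (ae_ball_iff (hsc b)).2 fun i hi =>
        (ae_restrict_iff' (hU b i hi).measurableSet).1 (hchart b i (hs b hi)).ae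
    have h2 : ∀ᵐ q : SpaceTime, good q.2 := by
      rw [Measure.volume_eq_prod]
      exact Measure.quasiMeasurePreserving_snd.ae hgoodae
    filter_upwards [ae_restrict_of_ae h1, ae_restrict_of_ae h2, hΩ.ae_mem] with q a1 a2 a3
    have key : ∀ b, q ∈ openRegion T (Ω b) → q' q = p q := fun b hb => by
      have hqs : q ∈ slab T := Sides.openRegion_subset b hb
      rw [hrep b q hb a2 _ (hidxs b q hqs) (hidxN b q hqs),
        ← a1 b _ (hidxs b q hqs) ⟨hidxN b q hqs, hb⟩, add_sub_cancel_right]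
    exact a3.elim (key true) (key false)
  by_cases hg : good t
  swap
  · have h0 : ∀ x, q' (x, t) = 0 := fun x => by simp only [hq', if_neg hg]
    simp only [h0]
    exact ⟨fun b => continuousOn_const, fun α => ⟨0, fun b => tendsto_const_nhds⟩⟩
  have hT : t ∈ Ico 0 T := ⟨ht.1.le, ht.2⟩
  have hloc : ∀ b x, ∀ᶠ y in 𝓝[Ω b t] x, q' (y, t)
      = κ b (idx b (x, t)) t - Q b (idx b (x, t)) (y, t) := fun b x => by
    have hxs : ((x, t) : SpaceTime) ∈ slab T := ⟨mem_univ _, ht⟩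
    have hi := hidxs b _ hxs
    have hN : N b (idx b (x, t)) ∈ 𝓝 ((x, t) : SpaceTime) :=
      (hchart b _ (hs b hi)).isOpen.mem_nhds (hidxN b _ hxs)
    filter_upwards [(tendsto_slice (Ω b) hT x).eventually (mem_nhdsWithin_of_mem_nhds hN),
      self_mem_nhdsWithin] with y hy1 hy2
    exact hrep b (y, t) ⟨ht, hy2⟩ hg _ hi hy1
  refine ⟨fun b x hx => ?_, fun α => ?_⟩
  · have hxs : ((x, t) : SpaceTime) ∈ slab T := ⟨mem_univ _, ht⟩
    have h1 := hloc b x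
    refine Tendsto.congr' (EventuallyEq.symm h1) ?_
    simp only [h1.self_of_nhdsWithin hx]
    have h2 := (hchart b _ (hs b (hidxs b _ hxs))).cont _ (hidxN b _ hxs) ⟨hT, hx⟩
    exact tendsto_const_nhds.sub (((h2.mono (fluidRegion_subset_slab₀ T _)).tendsto).comp
      (tendsto_slice (Ω b) hT x))
  · set x₀ := cx.symm (S.z α t)
    have hxs : ((x₀, t) : SpaceTime) ∈ slab T := ⟨mem_univ _, ht⟩
    have hc := fun b => hchart b _ (hs b (hidxs b _ hxs))
    choose L hL using fun b => (hc b).lim α t hT (hidxN b _ hxs)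
    have hlim : ∀ b, Tendsto (fun x => q' (x, t)) (𝓝[Ω b t] x₀)
        (𝓝 (κ b (idx b (x₀, t)) t - L b)) := fun b =>
      Tendsto.congr' (EventuallyEq.symm (hloc b x₀))
        (tendsto_const_nhds.sub ((hL b).comp (tendsto_slice (Ω b) hT x₀)))
    have heq := S.pressure_eq hΩ α hT hsol hne hρ hvel
      (P := fun b => κ b (idx b (x₀, t)) t - L b) fun b k hk =>
        hasMeanLimit_of_inter ((hc b).isOpen.mem_nhds (hidxN b _ hxs))
          (hasMeanLimit_of_isRightLebesgue (q₀ := (x₀, t)) _ hk (hU b _ (hidxs b _ hxs)) (hc b).int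
            ((hg b).2 _ (hidxs b _ hxs)) ((hL b).mono_left (nhdsWithin_mono _ fun q hq =>
              openRegion_subset_fluidRegion T _ hq.2)) (hc b).ae)
    refine ⟨κ true (idx true (x₀, t)) t - L true, fun b => ?_⟩
    cases b
    · exact heq ▸ hlim false
    · exact hlim true

end Sheet

end

end TwoFluid

theorem proposition2p1
    (G : Geometry) (g T : ℝ) (hT : 0 < T)
    -- the interface, the two fluid domains and the amplitude of the vorticity
    (z : ℝ → ℝ → Plane) (Ω₁ Ω₂ : ℝ → Set Plane) (ϖ : ℝ → ℝ → ℝ)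
    (hz : IsC1Ck 3 T z) (hΩ : IsInterface G T z Ω₁ Ω₂)
    (hϖ : IsC1Ck 2 T ϖ) (hϖ_per : ∀ t ∈ Ico 0 T, ∀ α, ϖ (α + 2 * Real.pi) t = ϖ α t)
    -- the weak solution
    (ρ : SpaceTime → ℝ) (v : SpaceTime → Plane) (p : SpaceTime → ℝ)
    (ρ₀ : Plane → ℝ) (v₀ : Plane → Plane)
    (hsol : IsWeakSolution g T ρ v p ρ₀ v₀)
    -- the density takes two different constant values
    (ρ₁ ρ₂ : ℝ) (hne : ρ₁ ≠ ρ₂)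
    (hρ₁ : ∀ t ∈ Ico 0 T, ∀ x ∈ Ω₁ t, ρ (x, t) = ρ₁)
    (hρ₂ : ∀ t ∈ Ico 0 T, ∀ x ∈ Ω₂ t, ρ (x, t) = ρ₂)
    -- the vorticity is concentrated on the interface
    (hcurl : HasSheetVorticity G T z ϖ v) (hfar : FarField T v G) :
    -- a version of the pressure that is continuous inside each fluid is continuous across `z`
    (∃ q : SpaceTime → ℝ, q =ᵐ[volume.restrict (slab T)] p ∧
      ∀ t ∈ Ioo 0 T,
        ContinuousOn (fun x => q (x, t)) (Ω₁ t) ∧ ContinuousOn (fun x => q (x, t)) (Ω₂ t) ∧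
        ∀ α, PressuresAgree z q α t) ∧
    -- and if `p` itself is continuous inside each fluid, no other version is needed
    (ContinuousOn p (fluidRegion T Ω₁) → ContinuousOn p (fluidRegion T Ω₂) →
      ∀ t ∈ Ico 0 T, ∀ α, PressuresAgree z p α t) := by
  obtain ⟨S, hSz, hSτ, hSw, hS⟩ := exists_sheet hz hΩ hϖ hϖ_per
  have hpt : ∀ α t, cx.symm (S.z α t) = z α t := fun α t => by simp [hSz]
  have hvel := S.ae_cvel_eq hS hsol.int_v hsol.div_free
    (fun χ hχ => by simpa only [hSw, hpt] using hcurl χ hχ) hfar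
  have hρ : ∀ b : Bool, ∀ q ∈ openRegion T ((fun b : Bool => if b then Ω₁ else Ω₂) b),
      ρ q = (fun b : Bool => if b then ρ₁ else ρ₂) b := by
    rintro (_ | _) q hq
    · exact hρ₂ q.2 ⟨hq.1.1.le, hq.1.2⟩ q.1 hq.2
    · exact hρ₁ q.2 ⟨hq.1.1.le, hq.1.2⟩ q.1 hq.2
  have hne' : (fun b : Bool => if b then ρ₁ else ρ₂) true
      ≠ (fun b : Bool => if b then ρ₁ else ρ₂) false := by simpa using hne
  -- the normal lines enter the two fluids
  have hline₁ : ∀ t ∈ Ico 0 T, ∀ α, Tendsto (fun s : ℝ => z α t + s • normal z α t) (𝓝[>] 0)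
      (𝓝[Ω₁ t] (z α t)) := fun t ht α => by
    refine tendsto_nhdsWithin_of_tendsto_nhds_of_eventually_within _ ?_ (hΩ.side₁ t ht α)
    have : Tendsto (fun s : ℝ => z α t + s • normal z α t) (𝓝 0)
        (𝓝 (z α t + (0 : ℝ) • normal z α t)) := Continuous.tendsto (by fun_prop) 0
    rw [zero_smul, add_zero] at this
    exact this.mono_left nhdsWithin_le_nhds
  have hline₂ : ∀ t ∈ Ico 0 T, ∀ α, Tendsto (fun s : ℝ => z α t - s • normal z α t) (𝓝[>] 0)
      (𝓝[Ω₂ t] (z α t)) := fun t ht α => by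
    refine tendsto_nhdsWithin_of_tendsto_nhds_of_eventually_within _ ?_ (hΩ.side₂ t ht α)
    have : Tendsto (fun s : ℝ => z α t - s • normal z α t) (𝓝 0)
        (𝓝 (z α t - (0 : ℝ) • normal z α t)) := Continuous.tendsto (by fun_prop) 0
    rw [zero_smul, sub_zero] at this
    exact this.mono_left nhdsWithin_le_nhds
  refine ⟨?_, fun hp₁ hp₂ t ht α => ?_⟩
  · obtain ⟨q, hqp, hq⟩ := S.exists_version hS hsol hne' hρ hvel
    refine ⟨q, hqp, fun t ht => ⟨(hq t ht).1 true, (hq t ht).1 false, fun α => ?_⟩⟩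
    have hT' : t ∈ Ico 0 T := ⟨ht.1.le, ht.2⟩
    obtain ⟨P, hP⟩ := (hq t ht).2 α
    rw [hpt] at hP
    exact ⟨P, P, (hP true).comp (hline₁ t hT' α), (hP false).comp (hline₂ t hT' α), rfl⟩
  · have hp : ∀ b : Bool, ContinuousOn p (fluidRegion T ((fun b : Bool => if b then Ω₁ else Ω₂) b)) := by
      rintro (_ | _)
      · exact hp₂
      · exact hp₁
    obtain ⟨P, hP⟩ := S.exists_common_limit hS hsol hne' hρ hvel hp α ht
    rw [hpt] at hP
    exact ⟨P, P, ((hP true).comp (Sheet.tendsto_slice Ω₁ ht _)).comp (hline₁ t ht α),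
      ((hP false).comp (Sheet.tendsto_slice Ω₂ ht _)).comp (hline₂ t ht α), rfl⟩
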